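/- **Conventions.** A *straight graph* is an oriented graph $G$ with an ordering $v_1<\dots<v_n$ of its vertices and a map $f$ on $\{1,\dots,n\}$ with $i\le f(i)$ and $f(i)\le f(i+1)$ such that $v_iv_j$ is a directed edge if and only if $i<j\le f(i)$. A graph is a *proper interval graph* (PIG) if it has a straight orientation. A set $W$ of vertices is a *2-dom* (total 2-dominating set) if every vertex has at least two neighbours in $W$ (in the underlying graph), and a *minimum 2-dom* if moreover $|W|$ is minimum. The *blocks* of $W$ are its inclusion-maximal connected subsets. Throughout, $n$ and $m$ are the numbers of vertices and edges and every vertex has at least two neighbours (otherwise there is no 2-dom). Running times count elementary steps of a random access machine with addition, subtraction and comparison on words of $O(\log n)$ bits; $O(m)$ means at most $c(m+1)$, with $c$ an absolute constant, and similarly for $O(n)$. **The digraph $R(G)$.** Identify $v_i$ with $i$, and suppose that $\{1,2,3\}$ and $\{n-2,n-1,n\}$ are connected components of $G$ that are triangles. Let $d^+(i)=f(i)-i$. A connected set $w_1<\dots<w_j$ with $j\ge 3$ is *expansive*, and *represented* by the edge $w_1w_2$, if * $w_j=f(w_{j-2})$ and $w_i=f^{i-2}(w_1)$ for $4\le i\le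 j-2$; * $w_3=f(w_1)$ if $j\ne 4$, and $w_3=\min\{f(w_1),w_4-1\}$ if $j=4$; * $w_{j-1}=w_j-1$ if $j\ge 5$. Given such a set, let $u=f(f(w_{j-1})+1)$ and $z=f(f(w_j)+1)$. The edge $xy$ is the *$j$-extension* of $w_1w_2$ if $xy$ represents some expansive set, $f(w_j)<x$, and $(x,y)$ equals $$\begin{cases}(u-2,u-1)&\text{if }u=z,\ d^+(u-1)=1,\\ (u-1,u)&\text{if }(u=z,\ d^+(u-1)>1)\text{ or }(u\ne z,\ d^+(u)=1),\\ (u,z-1)&\text{if }u\neq z,\ f(u)=z,\ d^+(u)>1,\\ (u,z)&\text{otherwise.}\end{cases}$$ The *width* of the edge $vw$ is the least $\kappa\ge1$ with $d^+(f^\kappa(v))\ge2$, or $\infty$ if there is none. The weighted digraph $R(G)$, in which parallel edges of different weights are allowed, has two vertices $\underline e,\overline e$ for each edge $e$ of $G$, and a further vertex $t$, the sink; its source is $\underline{s}$ for $s=(1,2)$. Its edges are: * *regular* edges of weight $j$ from $\underline e$ to $\underline g$ and to $\overline g$, for $j\in\{3,4\}$ and $g$ the $j$-extension of $e$; * *regular*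 edges of weight $\kappa+4$ from $\overline e$ to $\underline g$ and to $\overline g$, if $e$ has finite width $\kappa$ and $g$ is the $(\kappa+4)$-extension of $e$; * a *compact* edge of weight $\kappa$ from $\overline e$ to $\overline g$, if $e=vw$ has finite width $\kappa$ and $w\ne f(v)$, where $g=(z,z+1)$ and $z=f^\kappa(v)$; * a regular edge of weight $3$ from $\underline e$ to $t$, for $e=(n-2,n-1)$. A source–sink path $P$ *encodes* $W$ if, when $P$ is cut after each regular edge into pieces $P_1,\dots,P_k$, the blocks of $W$ are $B_1<\dots<B_k$, where $B_h$ is the expansive set represented by the edge $e$ for which $P_h$ starts in $\underline e$ or $\overline e$, and $|B_h|$ is the weight of $P_h$. **Theorem.** (1) There is an algorithm which, given a straight graph $G$ in the form of $n$ and the vector $f(1),\dots,f(n)$, computes a minimum 2-dom of $G$ in $O(m)$ time. It inserts a triangle before and a triangle after the vertices of $G$, as new connected components, in $O(n)$ time, which gives a straight graph $G'$ on $n'=n+6$ vertices; for $G'$, the digraph $R(G')$ is acyclic. It then runs the following steps. * Step 0, in $O(n)$ time, computes for each vertex $i$ of $G'$ the pair $(\kappa,f^\kappa(i))$ if the edges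 leaving $i$ have width $\kappa<\infty$ (the width is determined by $i$, also if no edge leaves $i$), and the pair $(n'+1,i)$ otherwise. * Step 1, in $O(m)$ time, builds $R(G')$ with adjacency lists. * Step 2, in $O(m)$ time, finds a source–sink path $P$ of minimum weight in $R(G')$. * Step 3, in $O(n)$ time, outputs the set $W'$ that $P$ encodes. Deleting the two added triangles from $W'$, in $O(n)$ time, leaves a minimum 2-dom of $G$. (2) There is an algorithm that, given a proper interval graph by adjacency lists (in any order), computes a minimum 2-dom of it in linear time $O(n+m)$. -/

import Mathlib

namespace StraightDom

/-! ### Random access machine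

A machine state consists of registers and of arrays, all holding natural numbers.  A program is a
finite text, so it uses finitely many of them.  The arithmetic is addition and truncated
subtraction, the tests are `<` and `=`. -/

/-- A state of the machine. -/
structure RamState where
  reg : ℕ → ℕ
  arr : ℕ → ℕ → ℕ

/-- Arithmetic expressions; `load a e` reads cell `e` of array `a`. -/
inductive RamExpr where
  | const (k : ℕ) : RamExpr
  | reg (r : ℕ) : RamExpr
  | load (a : ℕ) (e : RamExpr) : RamExpr
  | add (e₁ e₂ : RamExpr) : RamExpr
  | sub (e₁ e₂ : RamExpr) : RamExpr

/-- The value of an expression. -/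
def RamExpr.eval (s : RamState) : RamExpr → ℕ
  | .const k => k
  | .reg r => s.reg r
  | .load a e => s.arr a (e.eval s)
  | .add e₁ e₂ => e₁.eval s + e₂.eval s
  | .sub e₁ e₂ => e₁.eval s - e₂.eval s

/-- The number of elementary operations needed to evaluate an expression. -/
def RamExpr.cost : RamExpr → ℕ
  | .const _ => 1
  | .reg _ => 1
  | .load _ e => e.cost + 1
  | .add e₁ e₂ => e₁.cost + e₂.cost + 1
  | .sub e₁ e₂ => e₁.cost + e₂.cost + 1

/-- Tests. -/
inductive RamTest where
  | lt (e₁ e₂ : RamExpr) : RamTest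
  | eq (e₁ e₂ : RamExpr) : RamTest

/-- When a test succeeds. -/
def RamTest.Holds (s : RamState) : RamTest → Prop
  | .lt e₁ e₂ => e₁.eval s < e₂.eval s
  | .eq e₁ e₂ => e₁.eval s = e₂.eval s

/-- The number of elementary operations needed to evaluate a test. -/
def RamTest.cost : RamTest → ℕ
  | .lt e₁ e₂ => e₁.cost + e₂.cost + 1
  | .eq e₁ e₂ => e₁.cost + e₂.cost + 1

/-- Programs. -/
inductive RamProg where
  | skip : RamProg
  | assign (r : ℕ) (e : RamExpr) : RamProg
  | store (a : ℕ) (i e : RamExpr) : RamProg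
  | seq (p q : RamProg) : RamProg
  | ite (b : RamTest) (p q : RamProg) : RamProg
  | while (b : RamTest) (p : RamProg) : RamProg

/-- Write a register. -/
def RamState.setReg (s : RamState) (r x : ℕ) : RamState :=
  { s with reg := Function.update s.reg r x }

/-- Write an array cell. -/
def RamState.setArr (s : RamState) (a i x : ℕ) : RamState :=
  { s with arr := Function.update s.arr a (Function.update (s.arr a) i x) }

/-- `Exec B p s t s'`: started in state `s`, the program `p` halts in state `s'` after exactly `t`
elementary steps, and no value that it stores, nor an address that it writes to, exceeds `B`.
(Inside an expression of a fixed program values can exceed `B` by a constant factor only, so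
that words of `O(log B)` bits suffice.) -/
inductive Exec (B : ℕ) : RamProg → RamState → ℕ → RamState → Prop
  | skip (s : RamState) : Exec B .skip s 1 s
  | assign (s : RamState) (r : ℕ) (e : RamExpr) (he : e.eval s ≤ B) :
      Exec B (.assign r e) s (e.cost + 1) (s.setReg r (e.eval s))
  | store (s : RamState) (a : ℕ) (i e : RamExpr) (hi : i.eval s ≤ B) (he : e.eval s ≤ B) :
      Exec B (.store a i e) s (i.cost + e.cost + 1) (s.setArr a (i.eval s) (e.eval s))
  | seq {p q : RamProg} {s s' s'' : RamState} {t t' : ℕ}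
      (hp : Exec B p s t s') (hq : Exec B q s' t' s'') : Exec B (.seq p q) s (t + t') s''
  | ite_true {b : RamTest} {p q : RamProg} {s s' : RamState} {t : ℕ}
      (hb : b.Holds s) (hp : Exec B p s t s') : Exec B (.ite b p q) s (b.cost + 1 + t) s'
  | ite_false {b : RamTest} {p q : RamProg} {s s' : RamState} {t : ℕ}
      (hb : ¬ b.Holds s) (hq : Exec B q s t s') : Exec B (.ite b p q) s (b.cost + 1 + t) s'
  | while_true {b : RamTest} {p : RamProg} {s s' s'' : RamState} {t t' : ℕ}
      (hb : b.Holds s) (hp : Exec B p s t s') (hw : Exec B (.while b p) s' t' s'') :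
      Exec B (.while b p) s (b.cost + 1 + t + t') s''
  | while_false {b : RamTest} {p : RamProg} {s : RamState} (hb : ¬ b.Holds s) :
      Exec B (.while b p) s (b.cost + 1) s

/-! ### Total domination, straight graphs, proper interval graphs -/

/-- `W` is a total `k`-dominating set: every vertex has at least `k` neighbours in `W`. -/
def IsTotalDominating {V : Type*} (k : ℕ) (G : SimpleGraph V) (W : Set V) : Prop :=
  ∀ x, (k : ℕ∞) ≤ (G.neighborSet x ∩ W).encard

/-- A total `k`-dominating set of minimum cardinality. -/
def IsMinTotalDominating {V : Type*} (k : ℕ) (G : SimpleGraph V) (W : Set V) : Prop :=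
  IsTotalDominating k G W ∧ ∀ W', IsTotalDominating k G W' → W.encard ≤ W'.encard

/-- The number of directed edges of a digraph. -/
noncomputable def numArcs {V : Type*} (G : Digraph V) : ℕ :=
  {e : V × V | G.Adj e.1 e.2}.ncard

/-- The enumeration `v` of the vertices and the map `f` (acting on positions in the enumeration)
witness that `G` is a straight graph. -/
structure IsStraightOrder {V : Type*} (G : Digraph V) {n : ℕ} (v : Fin n ≃ V)
    (f : Fin n → Fin n) : Prop where
  le_apply : ∀ i, i ≤ f i
  mono : Monotone f
  adj_iff : ∀ i j, G.Adj (v i) (v j) ↔ i < j ∧ j ≤ f i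

/-- Straight graphs: the oriented graphs that have a straight ordering. -/
def IsStraight {V : Type*} (G : Digraph V) : Prop :=
  (∀ x y, G.Adj x y → ¬ G.Adj y x) ∧
    ∃ (n : ℕ) (v : Fin n ≃ V) (f : Fin n → Fin n), IsStraightOrder G v f

/-- Proper interval graphs: the graphs that have a straight orientation. -/
def IsProperInterval {V : Type*} (H : SimpleGraph V) : Prop :=
  ∃ G : Digraph V, G.toSimpleGraphInclusive = H ∧ IsStraight G

/-! ### The digraph `R`

From here on a straight graph is given by its number `n` of vertices, which are the numbers
`1, …, n` in their order, and by a map `F` on them such that `i` and `j`, for `i < j`, are adjacent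
exactly when `j ≤ F i`. -/

/-- The map `f` on positions, moved from `0, …, n - 1` to `1, …, n`, and `0` elsewhere. -/
def frHat {n : ℕ} (f : Fin n → Fin n) (i : ℕ) : ℕ :=
  if h : 1 ≤ i ∧ i ≤ n then (f ⟨i - 1, by omega⟩ : ℕ) + 1 else 0

/-- The straight graph on `1, …, n + 6` with a triangle `{1, 2, 3}` added before the vertices of
the given graph (which move by `3`) and a triangle `{n + 4, n + 5, n + 6}` added after them. -/
def padFr (n : ℕ) (F : ℕ → ℕ) (i : ℕ) : ℕ :=
  if i ≤ 3 then 3 else if i ≤ n + 3 then F (i - 3) + 3 else n + 6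

/-- `ij` is a directed edge. -/
def IsArc (n : ℕ) (F : ℕ → ℕ) (i j : ℕ) : Prop :=
  1 ≤ i ∧ i < j ∧ j ≤ n ∧ j ≤ F i

/-- The underlying undirected graph (numbers outside of `1, …, n` are isolated). -/
def underlying (n : ℕ) (F : ℕ → ℕ) : SimpleGraph ℕ :=
  SimpleGraph.fromRel (IsArc n F)

/-- The out-degree of `i`. -/
def outDeg (F : ℕ → ℕ) (i : ℕ) : ℕ := F i - i

/-- The edges that leave `v` have width `κ` (a finite number). -/
def IsWidth (F : ℕ → ℕ) (v κ : ℕ) : Prop :=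
  1 ≤ κ ∧ 2 ≤ outDeg F (F^[κ] v) ∧ ∀ k, 1 ≤ k → k < κ → outDeg F (F^[k] v) < 2

/-- `w 1 < ⋯ < w j` is an expansive connected set. -/
structure IsExpansive (n : ℕ) (F : ℕ → ℕ) (j : ℕ) (w : ℕ → ℕ) : Prop where
  three_le : 3 ≤ j
  mem : ∀ i, 1 ≤ i → i ≤ j → 1 ≤ w i ∧ w i ≤ n
  strictMono : StrictMonoOn w (Set.Icc 1 j)
  connected : ((underlying n F).induce (w '' Set.Icc 1 j)).Connected
  third : j ≠ 4 → w 3 = F (w 1)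
  third_of_four : j = 4 → w 3 = min (F (w 1)) (w 4 - 1)
  middle : ∀ i, 4 ≤ i → i + 2 ≤ j → w i = F^[i - 2] (w 1)
  last : w j = F (w (j - 2))
  penultimate : 5 ≤ j → w (j - 1) = w j - 1

/-- The first two vertices of the expansive set that extends an expansive set with last two
vertices `p < q`. -/
def extPair (F : ℕ → ℕ) (p q : ℕ) : ℕ × ℕ :=
  let u := F (F p + 1)
  let z := F (F q + 1)
  if u = z ∧ outDeg F (u - 1) = 1 then (u - 2, u - 1)
  else if (u = z ∧ 1 < outDeg F (u - 1)) ∨ (u ≠ z ∧ outDeg F u = 1) then (u - 1, u)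
  else if u ≠ z ∧ F u = z ∧ 1 < outDeg F u then (u, z - 1)
  else (u, z)

/-- `xy` is the `j`-extension of `vw`: the expansive set `s` with `j` vertices that `vw`
represents exists, `xy` represents some expansive set `s'`, and `s'` extends `s`; in particular
`s'` lies after `s` and no edge joins them. -/
def IsExtension (n : ℕ) (F : ℕ → ℕ) (j v w x y : ℕ) : Prop :=
  ∃ s : ℕ → ℕ, IsExpansive n F j s ∧ s 1 = v ∧ s 2 = w ∧
    ∃ (j' : ℕ) (s' : ℕ → ℕ), IsExpansive n F j' s' ∧ s' 1 = x ∧ s' 2 = y ∧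
      F (s j) < x ∧ (x, y) = extPair F (s (j - 1)) (s j)

/-- The possible vertices of `R`: the two copies of `vw` (the lower copy has `big = false`, the
upper copy has `big = true`), and the sink. -/
inductive RVertex where
  | node (v w : ℕ) (big : Bool) : RVertex
  | sink : RVertex

/-- Weighted directed edges of `R`; parallel edges of different weights are allowed. -/
structure REdge where
  src : RVertex
  tgt : RVertex
  weight : ℕ
  compact : Bool

/-- The vertices of `R`. -/
inductive IsRVertex (n : ℕ) (F : ℕ → ℕ) : RVertex → Prop
  | node {v w : ℕ} (big : Bool) (h : IsArc n F v w) : IsRVertex n F (.node v w big)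
  | sink : IsRVertex n F .sink

/-- The edges of `R`; those with `compact = false` are the regular ones. -/
inductive IsREdge (n : ℕ) (F : ℕ → ℕ) : REdge → Prop
  | small {v w x y j : ℕ} (big : Bool) (hj : j = 3 ∨ j = 4) (h : IsExtension n F j v w x y) :
      IsREdge n F ⟨.node v w false, .node x y big, j, false⟩
  | large {v w x y κ : ℕ} (big : Bool) (hκ : IsWidth F v κ)
      (h : IsExtension n F (κ + 4) v w x y) :
      IsREdge n F ⟨.node v w true, .node x y big, κ + 4, false⟩
  | compact {v w κ : ℕ} (h : IsArc n F v w) (hw : F v ≠ w) (hκ : IsWidth F v κ) :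
      IsREdge n F ⟨.node v w true, .node (F^[κ] v) (F^[κ] v + 1) true, κ, true⟩
  | last : IsREdge n F ⟨.node (n - 2) (n - 1) false, .sink, 3, false⟩

/-- `P` is the list of the edges of a path of `R` from the first vertex to the second. -/
inductive IsRPath (n : ℕ) (F : ℕ → ℕ) : RVertex → RVertex → List REdge → Prop
  | nil (a : RVertex) : IsRPath n F a a []
  | cons {e : REdge} {b : RVertex} {P : List REdge} (he : IsREdge n F e)
      (hP : IsRPath n F e.tgt b P) : IsRPath n F e.src b (e :: P)

/-- `R` has no directed cycle. -/
def RAcyclic (n : ℕ) (F : ℕ → ℕ) : Prop :=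
  ∀ a P, IsRPath n F a a P → P = []

/-- The weight of a path. -/
def pathWeight (P : List REdge) : ℕ := (P.map REdge.weight).sum

/-- `P` is a path of minimum weight from the source of `R` to its sink. -/
def IsShortestRPath (n : ℕ) (F : ℕ → ℕ) (P : List REdge) : Prop :=
  IsRPath n F (.node 1 2 false) .sink P ∧
    ∀ Q, IsRPath n F (.node 1 2 false) .sink Q → pathWeight P ≤ pathWeight Q

/-- `DecodesTo n F P Bs`: when the path `P` is cut after each of its regular edges, into pieces
`P₁, …, P_k`, the list `Bs` consists of the expansive sets `B₁, …, B_k` such that `B_h` has as many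
vertices as the weight of `P_h` and is represented by the edge `vw` that `P_h` starts from. -/
inductive DecodesTo (n : ℕ) (F : ℕ → ℕ) : List REdge → List (Set ℕ) → Prop
  | nil : DecodesTo n F [] []
  | cons {C : List REdge} {r : REdge} {P : List REdge} {Bs : List (Set ℕ)} {v w : ℕ}
      {big : Bool} {s : ℕ → ℕ}
      (hC : ∀ e ∈ C, e.compact = true) (hr : r.compact = false)
      (hsrc : (C ++ [r]).head?.map REdge.src = some (.node v w big))
      (hs : IsExpansive n F (pathWeight (C ++ [r])) s) (h₁ : s 1 = v) (h₂ : s 2 = w)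
      (hP : DecodesTo n F P Bs) :
      DecodesTo n F ((C ++ [r]) ++ P) (s '' Set.Icc 1 (pathWeight (C ++ [r])) :: Bs)

/-- `B` is a block of `W`: a connected subset that is maximal by inclusion. -/
def IsBlock {V : Type*} (G : SimpleGraph V) (W B : Set V) : Prop :=
  B ⊆ W ∧ (G.induce B).Connected ∧
    ∀ B', B ⊆ B' → B' ⊆ W → (G.induce B').Connected → B' = B

/-- The path `P` encodes the set `W`: the sets `B₁ < ⋯ < B_k` that `P` decodes to are the blocks
of `W`, and `W` is their union. -/
def Encodes (n : ℕ) (F : ℕ → ℕ) (P : List REdge) (W : Set ℕ) : Prop :=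
  ∃ Bs : List (Set ℕ), DecodesTo n F P Bs ∧
    Bs.Pairwise (fun A B => ∀ a ∈ A, ∀ b ∈ B, a < b) ∧
    (∀ B, IsBlock (underlying n F) W B ↔ B ∈ Bs) ∧
    W = {x | ∃ B ∈ Bs, x ∈ B}

/-! ### How the objects are stored in memory -/

/-- The input: register `0` holds `n`, array `0` holds `F 1, …, F n`, all else is `0`. -/
def inputState (n : ℕ) (F : ℕ → ℕ) : RamState where
  reg := fun r => if r = 0 then n else 0
  arr := fun a i => if a = 0 ∧ 1 ≤ i ∧ i ≤ n then F i else 0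

/-- Register `0` and array `0` hold the straight graph. -/
def HoldsGraph (σ : RamState) (n : ℕ) (F : ℕ → ℕ) : Prop :=
  σ.reg 0 = n ∧ ∀ i, 1 ≤ i → i ≤ n → σ.arr 0 i = F i

/-- Arrays `1` and `2` hold the width map: `(κ, F^κ i)` if the edges that leave `i` have width
`κ < ∞`, and `(n + 1, i)` otherwise. -/
def HoldsWidth (σ : RamState) (n : ℕ) (F : ℕ → ℕ) : Prop :=
  ∀ i, 1 ≤ i → i ≤ n →
    (∀ κ, IsWidth F i κ → σ.arr 1 i = κ ∧ σ.arr 2 i = F^[κ] i) ∧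
    ((¬ ∃ κ, IsWidth F i κ) → σ.arr 1 i = n + 1 ∧ σ.arr 2 i = i)

/-- The vertex of `R` with index `k`: the sink has index `σ.reg 1`, and the other vertices have
smaller indices and are stored as triples in the arrays `3, 4, 5`. -/
def vertexAt (σ : RamState) (k : ℕ) : RVertex :=
  if k = σ.reg 1 then .sink else .node (σ.arr 3 k) (σ.arr 4 k) (decide (σ.arr 5 k = 1))

/-- The edge of `R` stored at position `e` of the list of the edges that leave the vertex with
index `k`: array `7` holds the index of the end vertex, array `8` the weight, and array `9` a
flag that is `1` for compact edges. -/
def edgeAt (σ : RamState) (k e : ℕ) : REdge :=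
  ⟨vertexAt σ k, vertexAt σ (σ.arr 7 e), σ.arr 8 e, decide (σ.arr 9 e = 1)⟩

/-- The memory holds `R` with adjacency lists; array `6` holds where the list of each vertex
begins, and every vertex and every edge is stored exactly once. -/
def HoldsR (σ : RamState) (n : ℕ) (F : ℕ → ℕ) : Prop :=
  Set.BijOn (vertexAt σ) (Set.Iic (σ.reg 1)) {x | IsRVertex n F x} ∧
  ∀ k, k ≤ σ.reg 1 →
    (∀ e, σ.arr 6 k ≤ e → e < σ.arr 6 (k + 1) → σ.arr 7 e ≤ σ.reg 1) ∧
    Set.BijOn (edgeAt σ k) (Set.Ico (σ.arr 6 k) (σ.arr 6 (k + 1)))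
      {e | IsREdge n F e ∧ e.src = vertexAt σ k}

/-- The memory holds the path `P`: register `2` holds the number of its edges, and the arrays
`10, …, 14` hold the vertex that each edge leaves (as a triple), its weight, and its flag. -/
def HoldsPath (σ : RamState) (P : List REdge) : Prop :=
  σ.reg 2 = P.length ∧ ∀ (k : ℕ) (h : k < P.length),
    P[k].src = .node (σ.arr 10 k) (σ.arr 11 k) (decide (σ.arr 12 k = 1)) ∧
    P[k].weight = σ.arr 13 k ∧ P[k].compact = decide (σ.arr 14 k = 1)

/-- The memory holds the set `W` as a list without repetitions: register `r` holds its length and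
array `a` its entries. -/
def HoldsSet (σ : RamState) (r a : ℕ) (W : Set ℕ) : Prop :=
  Set.BijOn (σ.arr a) (Set.Iio (σ.reg r)) W

/-- The memory holds the graph `H` on `0, …, n - 1` with adjacency lists, and nothing else:
register `0` holds `n`, array `0` holds where the list of each vertex begins (and, in cell `n`,
where the last one ends), and array `1` holds the lists one after the other, the entries of each
list being in any order. -/
structure HoldsAdjacencyLists (σ : RamState) {n : ℕ} (H : SimpleGraph (Fin n)) : Prop where
  reg_zero : σ.reg 0 = n
  reg_ne_zero : ∀ r, r ≠ 0 → σ.reg r = 0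
  start_zero : σ.arr 0 0 = 0
  start_le : ∀ x : Fin n, σ.arr 0 x ≤ σ.arr 0 ((x : ℕ) + 1)
  list : ∀ x : Fin n, Set.BijOn (σ.arr 1) (Set.Ico (σ.arr 0 x) (σ.arr 0 ((x : ℕ) + 1)))
    {k | ∃ y : Fin n, H.Adj x y ∧ k = (y : ℕ)}
  arr_zero : ∀ i, n < i → σ.arr 0 i = 0
  arr_one : ∀ i, σ.arr 0 n ≤ i → σ.arr 1 i = 0
  arr_ge : ∀ a i, 2 ≤ a → σ.arr a i = 0

end StraightDom

/-!
The vertices of the padded graph are the numbers `1, …, N`, and `F` sends a vertex to its last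
neighbour; `F` is monotone, so that every neighbourhood is an interval.

*Total domination as a shortest path problem.* Among the total `2`-dominating sets of minimum
size, take one for which the sum of its elements is as large as possible (`Opt`). No vertex of it
can be replaced by a later one (`Opt.no_exchange`), and none can be removed (`Opt.no_removal`).
Applied to the vertices of a block, this forces them to be as far to the right as possible, which
is what expansive sets are about (`Opt.block`), and it forces the first two vertices of a block to
be the ones that are prescribed by the last two vertices of the preceding block
(`Opt.eq_extPair`). Hence the set is a sequence of expansive sets, each of which extends the
preceding one (`Opt.chain`). Since compact edges cut a large expansive set at the iterates of its
first vertex that have at least two out-neighbours, such a sequence is the same as a path from the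
source to the sink (`Chain.exists_path`). Conversely, every such path encodes a total
`2`-dominating set whose size is the weight of the path (`IsRPath.dom`), because the extension of
an expansive set starts early enough for the vertices between the two sets. So paths of minimum
weight encode minimum sets (`IsShortestRPath.min`). The weight of an edge of `R` is at most the
distance between its ends (`IsREdge.weight_le`), so `R` is acyclic; the edges of `G` in
lexicographic order give a topological order of `R`, and each vertex of `R` has at most five
outgoing edges, so shortest paths are found in linear time by going through `R` backwards.

*Programs.* A triple `Tri B p s T Q` says that the program `p`, started in the state `s`, stops
after at most `T` steps in a state with `Q`, and uses no number larger than `B`. For loops, the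
time bound is a potential that depends on the state (`Tri.while_frame`), which is how the total
cost of nested loops over adjacency lists is accounted for. The programs of the six stages are
combined in `IsStraightOrder.run`.

*Proper interval graphs.* By assumption there is an order of the vertices in which every vertex
between two adjacent vertices is adjacent to both (`Umbrella`); it is not known to the program. In
each component, a vertex of least degree among those farthest from the root of a breadth-first
search has the same closed neighbourhood as the end of the component on its side of the root
(`Layered.leftEnd`); up to reversal of the order, it is the left end. The distances from this end
determine which vertices come no later than the last neighbour of a vertex `x`, without reference to the
order: those that are not farther from the end than `x`, and the neighbours of `x`
(`LeftEnd.dist_le_or_adj_iff`). Their number, plus the number of vertices in the components that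
were treated before, is `g x`. Then `2 * g x` minus the degree of `x` is, up to a constant, `g x`
plus the number of vertices before the first neighbour of `x`. Both are monotone in the hidden
order, and vertices with the same key have the same closed neighbourhood, so that sorting by these
keys gives a straight order for which `g` is the map to the last neighbour (`Sorted.straight`).
The algorithm for straight graphs then applies (`intervalProg_spec`).
-/

namespace StraightDom

/-! ### Reasoning about programs -/

instance (k : ℕ) : OfNat RamExpr k := ⟨.const k⟩
instance : Add RamExpr := ⟨.add⟩
instance : Sub RamExpr := ⟨.sub⟩

/-- Read a register. -/
abbrev R (r : ℕ) : RamExpr := .reg r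

/-- Read an array cell. -/
abbrev A (a : ℕ) (e : RamExpr) : RamExpr := .load a e

@[simp] theorem eval_ofNat (s : RamState) (k : ℕ) :
    (no_index (OfNat.ofNat k : RamExpr)).eval s = OfNat.ofNat k := rfl
@[simp] theorem eval_reg (s : RamState) (r : ℕ) : (RamExpr.reg r).eval s = s.reg r := rfl
@[simp] theorem eval_load (s : RamState) (a : ℕ) (e : RamExpr) :
    (RamExpr.load a e).eval s = s.arr a (e.eval s) := rfl
@[simp] theorem eval_add (s : RamState) (e₁ e₂ : RamExpr) :
    (e₁ + e₂).eval s = e₁.eval s + e₂.eval s := rfl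
@[simp] theorem eval_sub (s : RamState) (e₁ e₂ : RamExpr) :
    (e₁ - e₂).eval s = e₁.eval s - e₂.eval s := rfl
@[simp] theorem holds_lt (s : RamState) (e₁ e₂ : RamExpr) :
    (RamTest.lt e₁ e₂).Holds s ↔ e₁.eval s < e₂.eval s := Iff.rfl
@[simp] theorem holds_eq (s : RamState) (e₁ e₂ : RamExpr) :
    (RamTest.eq e₁ e₂).Holds s ↔ e₁.eval s = e₂.eval s := Iff.rfl

@[simp] theorem setReg_reg (s : RamState) (r x r' : ℕ) :
    (s.setReg r x).reg r' = if r' = r then x else s.reg r' := by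
  simp [RamState.setReg, Function.update_apply]
@[simp] theorem setReg_arr (s : RamState) (r x : ℕ) : (s.setReg r x).arr = s.arr := rfl
@[simp] theorem setArr_reg (s : RamState) (a i x : ℕ) : (s.setArr a i x).reg = s.reg := rfl
@[simp] theorem setArr_arr (s : RamState) (a i x a' j : ℕ) :
    (s.setArr a i x).arr a' j = if a' = a ∧ j = i then x else s.arr a' j := by
  by_cases h : a' = a
  · subst h; simp [RamState.setArr, Function.update_apply]
  · simp [RamState.setArr, h]

infixr:60 " ;; " => RamProg.seq

/-- The program does not write to the register `r`. -/
def RamProg.noReg (r : ℕ) : RamProg → Bool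
  | .skip => true
  | .assign r' _ => r' != r
  | .store _ _ _ => true
  | .seq p q => p.noReg r && q.noReg r
  | .ite _ p q => p.noReg r && q.noReg r
  | .while _ p => p.noReg r

/-- The program does not write to the array `a`. -/
def RamProg.noArr (a : ℕ) : RamProg → Bool
  | .skip => true
  | .assign _ _ => true
  | .store a' _ _ => a' != a
  | .seq p q => p.noArr a && q.noArr a
  | .ite _ p q => p.noArr a && q.noArr a
  | .while _ p => p.noArr a

theorem Exec.reg_eq {B : ℕ} {p : RamProg} {s s' : RamState} {t : ℕ} (h : Exec B p s t s') {r : ℕ}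
    (hr : p.noReg r = true) : s'.reg r = s.reg r := by
  induction h with
  | skip => rfl
  | assign s r' e he =>
    have : r ≠ r' := by rintro rfl; simp [RamProg.noReg] at hr
    simp [this]
  | store => rfl
  | seq _ _ ih₁ ih₂ =>
    simp only [RamProg.noReg, Bool.and_eq_true] at hr
    rw [ih₂ hr.2, ih₁ hr.1]
  | ite_true _ _ ih =>
    simp only [RamProg.noReg, Bool.and_eq_true] at hr
    exact ih hr.1
  | ite_false _ _ ih =>
    simp only [RamProg.noReg, Bool.and_eq_true] at hr
    exact ih hr.2
  | while_true _ _ _ ih₁ ih₂ => rw [ih₂ hr, ih₁ hr]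
  | while_false => rfl

theorem Exec.arr_eq {B : ℕ} {p : RamProg} {s s' : RamState} {t : ℕ} (h : Exec B p s t s') {a : ℕ}
    (ha : p.noArr a = true) : s'.arr a = s.arr a := by
  induction h with
  | skip => rfl
  | assign => rfl
  | store s a' i e hi he =>
    have : a ≠ a' := by rintro rfl; simp [RamProg.noArr] at ha
    simp [RamState.setArr, this]
  | seq _ _ ih₁ ih₂ =>
    simp only [RamProg.noArr, Bool.and_eq_true] at ha
    rw [ih₂ ha.2, ih₁ ha.1]
  | ite_true _ _ ih =>
    simp only [RamProg.noArr, Bool.and_eq_true] at ha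
    exact ih ha.1
  | ite_false _ _ ih =>
    simp only [RamProg.noArr, Bool.and_eq_true] at ha
    exact ih ha.2
  | while_true _ _ _ ih₁ ih₂ => rw [ih₂ ha, ih₁ ha]
  | while_false => rfl

/-- Started in `s`, the program halts after at most `T` steps in a state that satisfies `Q`. -/
def Tri (B : ℕ) (p : RamProg) (s : RamState) (T : ℕ) (Q : RamState → Prop) : Prop :=
  ∃ t s', Exec B p s t s' ∧ t ≤ T ∧ Q s'

theorem Tri.mono {B : ℕ} {p : RamProg} {s : RamState} {T T' : ℕ} {Q Q' : RamState → Prop}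
    (h : Tri B p s T Q) (hT : T ≤ T') (hQ : ∀ s', Q s' → Q' s') : Tri B p s T' Q' := by
  obtain ⟨t, s', h₁, h₂, h₃⟩ := h
  exact ⟨t, s', h₁, h₂.trans hT, hQ _ h₃⟩

theorem Tri.seq {B : ℕ} {p q : RamProg} {s : RamState} {T T₁ : ℕ} {P Q : RamState → Prop}
    (hp : Tri B p s T₁ P) (hq : ∀ s', P s' → Tri B q s' (T - T₁) Q) (hT : T₁ ≤ T) :
    Tri B (p ;; q) s T Q := by
  obtain ⟨t, s', h₁, h₂, h₃⟩ := hp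
  obtain ⟨t', s'', h₄, h₅, h₆⟩ := hq s' h₃
  exact ⟨t + t', s'', .seq h₁ h₄, by omega, h₆⟩

/-- Everything that the program cannot change is the same before and after it. -/
def Frame (p : RamProg) (s s' : RamState) : Prop :=
  (∀ r, p.noReg r = true → s'.reg r = s.reg r) ∧ ∀ a, p.noArr a = true → s'.arr a = s.arr a

theorem Tri.frame {B : ℕ} {p : RamProg} {s : RamState} {T : ℕ} {Q : RamState → Prop}
    (h : Tri B p s T Q) : Tri B p s T (fun s' => Q s' ∧ Frame p s s') := by
  obtain ⟨t, s', h₁, h₂, h₃⟩ := h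
  exact ⟨t, s', h₁, h₂, h₃, fun _ => h₁.reg_eq, fun _ => h₁.arr_eq⟩

theorem Frame.reg {p : RamProg} {s s' : RamState} (h : Frame p s s') (r : ℕ)
    (hr : p.noReg r = true := by rfl) : s'.reg r = s.reg r := h.1 r hr

theorem Frame.arr {p : RamProg} {s s' : RamState} (h : Frame p s s') (a : ℕ)
    (ha : p.noArr a = true := by rfl) : s'.arr a = s.arr a := h.2 a ha

/-- The rule for loops.  The potential `Φ` pays for the iterations, which may differ in cost. -/
theorem Tri.while {B : ℕ} {b : RamTest} {p : RamProg} {Q : RamState → Prop}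
    (I : RamState → Prop) (Φ : RamState → ℕ)
    (hbody : ∀ s, I s → b.Holds s →
      ∃ T, Tri B p s T (fun s' => I s' ∧ b.cost + 1 + T + Φ s' ≤ Φ s))
    (hexit : ∀ s, I s → ¬ b.Holds s → b.cost + 1 ≤ Φ s ∧ Q s) (s : RamState) (hs : I s) :
    Tri B (.while b p) s (Φ s) Q := by
  induction hn : Φ s using Nat.strong_induction_on generalizing s with
  | _ n ih =>
    subst hn
    by_cases hb : b.Holds s
    · obtain ⟨T, t, s', h₁, h₂, h₃, h₄⟩ := hbody s hs hb
      obtain ⟨t', s'', h₅, h₆, h₇⟩ := ih (Φ s') (by omega) s' h₃ rfl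
      exact ⟨_, s'', .while_true hb h₁ h₅, by omega, h₇⟩
    · exact ⟨_, s, .while_false hb, (hexit s hs hb).1, (hexit s hs hb).2⟩

/-- The weakest precondition of a program without loops. -/
def RamProg.wp (B : ℕ) : RamProg → (RamState → Prop) → RamState → Prop
  | .skip, Q, s => Q s
  | .assign r e, Q, s => e.eval s ≤ B ∧ Q (s.setReg r (e.eval s))
  | .store a i e, Q, s => (i.eval s ≤ B ∧ e.eval s ≤ B) ∧ Q (s.setArr a (i.eval s) (e.eval s))
  | .seq p q, Q, s => p.wp B (q.wp B Q) s
  | .ite b p q, Q, s => (b.Holds s → p.wp B Q s) ∧ (¬ b.Holds s → q.wp B Q s)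
  | .while _ _, _, _ => False

/-- A bound on the number of steps of a program without loops. -/
def RamProg.maxCost : RamProg → ℕ
  | .skip => 1
  | .assign _ e => e.cost + 1
  | .store _ i e => i.cost + e.cost + 1
  | .seq p q => p.maxCost + q.maxCost
  | .ite b p q => b.cost + 1 + max p.maxCost q.maxCost
  | .while _ _ => 0

theorem Tri.of_wp {B : ℕ} {p : RamProg} {s : RamState} {Q : RamState → Prop}
    (h : p.wp B Q s) : Tri B p s p.maxCost Q := by
  induction p generalizing s Q with
  | skip => exact ⟨_, _, .skip s, le_rfl, h⟩
  | assign r e => exact ⟨_, _, .assign s r e h.1, le_rfl, h.2⟩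
  | store a i e => exact ⟨_, _, .store s a i e h.1.1 h.1.2, le_rfl, h.2⟩
  | seq p q ihp ihq =>
    refine Tri.seq (ihp h) (fun s' h' => ?_) (Nat.le_add_right _ _)
    exact (ihq h').mono (by simp [RamProg.maxCost]) fun _ => id
  | ite b p q ihp ihq =>
    by_cases hb : b.Holds s
    · obtain ⟨t, s', h₁, h₂, h₃⟩ := ihp (h.1 hb)
      exact ⟨_, s', .ite_true hb h₁, by simp [RamProg.maxCost]; omega, h₃⟩
    · obtain ⟨t, s', h₁, h₂, h₃⟩ := ihq (h.2 hb)
      exact ⟨_, s', .ite_false hb h₁, by simp [RamProg.maxCost]; omega, h₃⟩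
  | _ => exact h.elim

/-- A program without loops, run within a larger time bound. -/
theorem Tri.wp {B : ℕ} {p : RamProg} {s : RamState} {Q : RamState → Prop} {T : ℕ}
    (h : p.wp B Q s) (hT : p.maxCost ≤ T) : Tri B p s T Q :=
  (Tri.of_wp h).mono hT fun _ => id

theorem Tri.skip {B : ℕ} {s : RamState} {Q : RamState → Prop} {T : ℕ} (h : Q s) (hT : 1 ≤ T) :
    Tri B .skip s T Q :=
  ⟨1, s, .skip s, hT, h⟩

theorem Tri.assign {B : ℕ} {q : RamProg} {s : RamState} {Q : RamState → Prop} {T T' r : ℕ}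
    {e : RamExpr} (he : e.eval s ≤ B) (h : Tri B q (s.setReg r (e.eval s)) T Q)
    (hT : e.cost + 1 + T ≤ T') : Tri B (.assign r e ;; q) s T' Q := by
  obtain ⟨t, s', h₁, h₂, h₃⟩ := h
  exact ⟨_, s', .seq (.assign s r e he) h₁, by omega, h₃⟩

theorem Tri.store {B : ℕ} {q : RamProg} {s : RamState} {Q : RamState → Prop} {T T' a : ℕ}
    {i e : RamExpr} (hi : i.eval s ≤ B) (he : e.eval s ≤ B)
    (h : Tri B q (s.setArr a (i.eval s) (e.eval s)) T Q)
    (hT : i.cost + e.cost + 1 + T ≤ T') : Tri B (.store a i e ;; q) s T' Q := by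
  obtain ⟨t, s', h₁, h₂, h₃⟩ := h
  exact ⟨_, s', .seq (.store s a i e hi he) h₁, by omega, h₃⟩

theorem Tri.ite {B : ℕ} {b : RamTest} {p q : RamProg} {s : RamState} {Q : RamState → Prop}
    {T T' : ℕ} (hp : b.Holds s → Tri B p s T Q) (hq : ¬ b.Holds s → Tri B q s T Q)
    (hT : b.cost + 1 + T ≤ T') : Tri B (.ite b p q) s T' Q := by
  by_cases hb : b.Holds s
  · obtain ⟨t, s', h₁, h₂, h₃⟩ := hp hb
    exact ⟨_, s', .ite_true hb h₁, by omega, h₃⟩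
  · obtain ⟨t, s', h₁, h₂, h₃⟩ := hq hb
    exact ⟨_, s', .ite_false hb h₁, by omega, h₃⟩

/-! ### Exchange arguments for total domination -/

/-- A straight graph on `1, …, N` whose first and last three vertices are components. -/
structure PadGraph (N : ℕ) (F : ℕ → ℕ) : Prop where
  six_le : 6 ≤ N
  le_map : ∀ i, i ≤ N → i ≤ F i
  map_le : ∀ i, F i ≤ N
  mono : Monotone F
  first : ∀ i, i ≤ 3 → F i = 3
  last : ∀ i, N < i + 3 → F i = N
  gap : F (N - 3) = N - 3

/-- Adjacency, for numbers between `1` and `N`. -/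
def Nbr (F : ℕ → ℕ) (p a : ℕ) : Prop := (p < a ∧ a ≤ F p) ∨ (a < p ∧ p ≤ F a)

/-- `p` has two neighbours in the set that are different from `r`. -/
def TwoNbrs (F : ℕ → ℕ) (W : Finset ℕ) (r p : ℕ) : Prop :=
  ∃ a ∈ W, ∃ b ∈ W, a ≠ r ∧ b ≠ r ∧ a < b ∧ Nbr F p a ∧ Nbr F p b

/-- Total `2`-dominating sets of the graph on `1, …, N`. -/
structure Dom (N : ℕ) (F : ℕ → ℕ) (W : Finset ℕ) : Prop where
  sub : ∀ a ∈ W, 1 ≤ a ∧ a ≤ N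
  two : ∀ p, 1 ≤ p → p ≤ N → ∃ a ∈ W, ∃ b ∈ W, a < b ∧ Nbr F p a ∧ Nbr F p b

/-- A minimum total `2`-dominating set whose vertices lie as far to the right as possible. -/
structure Opt (N : ℕ) (F : ℕ → ℕ) (W : Finset ℕ) : Prop where
  dom : Dom N F W
  card_le : ∀ W', Dom N F W' → W.card ≤ W'.card
  sum_le : ∀ W', Dom N F W' → W'.card = W.card → ∑ a ∈ W', a ≤ ∑ a ∈ W, a

theorem exists_opt {N : ℕ} {F : ℕ → ℕ} {W₀ : Finset ℕ} (h₀ : Dom N F W₀) :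
    ∃ W, Opt N F W := by
  classical
  let S := (Finset.Icc 1 N).powerset.filter (Dom N F)
  have mem : ∀ W, W ∈ S ↔ Dom N F W := fun W => by
    simp only [S, Finset.mem_filter, Finset.mem_powerset, and_iff_right_iff_imp]
    exact fun h a ha => Finset.mem_Icc.2 (h.sub a ha)
  obtain ⟨W₁, h₁, hmin⟩ := S.exists_min_image Finset.card ⟨W₀, (mem _).2 h₀⟩
  obtain ⟨W, hW, hmax⟩ := (S.filter fun W => W.card = W₁.card).exists_max_image
    (fun W => ∑ a ∈ W, a) ⟨W₁, by simp [h₁]⟩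
  rw [Finset.mem_filter, mem] at hW
  refine ⟨W, hW.1, fun W' h => hW.2 ▸ hmin W' ((mem _).2 h), fun W' h h' => hmax W' ?_⟩
  rw [Finset.mem_filter, mem]
  exact ⟨h, h'.trans hW.2⟩

namespace Opt

variable {N : ℕ} {F : ℕ → ℕ} {W : Finset ℕ}

/-- No vertex of an optimal set can be replaced by a later one. -/
theorem no_exchange (h : Opt N F W) {r r' : ℕ} (hr : r ∈ W) (hlt : r < r') (hN : r' ≤ N)
    (H : ∀ p, 1 ≤ p → p ≤ N → Nbr F p r → TwoNbrs F W r p ∨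
      (∃ a ∈ W, a ≠ r ∧ a ≠ r' ∧ Nbr F p a ∧ Nbr F p r') ∨ (r' ∉ W ∧ Nbr F p r')) : False := by
  classical
  have hdom : Dom N F (insert r' (W.erase r)) := by
    refine ⟨fun a ha => ?_, fun p h1 hp => ?_⟩
    · rcases Finset.mem_insert.1 ha with rfl | ha
      · exact ⟨by omega, hN⟩
      · exact h.dom.sub a (Finset.mem_of_mem_erase ha)
    have mem : ∀ a ∈ W, a ≠ r → a ∈ insert r' (W.erase r) := fun a ha hne =>
      Finset.mem_insert_of_mem (Finset.mem_erase.2 ⟨hne, ha⟩)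
    have new : ∀ a ∈ W, a ≠ r → a ≠ r' → Nbr F p a → Nbr F p r' →
        ∃ a ∈ insert r' (W.erase r), ∃ b ∈ insert r' (W.erase r),
          a < b ∧ Nbr F p a ∧ Nbr F p b := by
      intro a ha h1 h2 h3 h4
      rcases lt_or_gt_of_ne h2 with h2 | h2
      · exact ⟨a, mem a ha h1, r', Finset.mem_insert_self _ _, h2, h3, h4⟩
      · exact ⟨r', Finset.mem_insert_self _ _, a, mem a ha h1, h2, h4, h3⟩
    by_cases hpr : Nbr F p r
    · rcases H p h1 hp hpr with ⟨a, ha, b, hb, h2, h3, h4, h5, h6⟩ | ⟨a, ha, h2, h3, h4, h5⟩ |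
        ⟨h2, h3⟩
      · exact ⟨a, mem a ha h2, b, mem b hb h3, h4, h5, h6⟩
      · exact new a ha h2 h3 h4 h5
      · obtain ⟨a, ha, b, hb, h4, h5, h6⟩ := h.dom.two p h1 hp
        by_cases har : a = r
        · exact new b hb (by omega) (fun e => h2 (e ▸ hb)) h6 h3
        · exact new a ha har (fun e => h2 (e ▸ ha)) h5 h3
    · obtain ⟨a, ha, b, hb, h4, h5, h6⟩ := h.dom.two p h1 hp
      exact ⟨a, mem a ha (fun e => hpr (e ▸ h5)), b, mem b hb (fun e => hpr (e ▸ h6)), h4, h5, h6⟩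
  have hcard := h.card_le _ hdom
  have he : (W.erase r).card + 1 = W.card := Finset.card_erase_add_one hr
  by_cases hmem : r' ∈ W.erase r
  · rw [Finset.insert_eq_of_mem hmem] at hcard
    omega
  · have hc : (insert r' (W.erase r)).card = W.card := by
      rw [Finset.card_insert_of_notMem hmem, he]
    have hs := h.sum_le _ hdom hc
    rw [Finset.sum_insert hmem, ← Finset.add_sum_erase W (fun a => a) hr] at hs
    omega

/-- No vertex of an optimal set can be removed. -/
theorem no_removal (h : Opt N F W) {r : ℕ} (hr : r ∈ W)
    (H : ∀ p, 1 ≤ p → p ≤ N → Nbr F p r → TwoNbrs F W r p) : False := by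
  classical
  have hdom : Dom N F (W.erase r) := by
    refine ⟨fun a ha => h.dom.sub a (Finset.mem_of_mem_erase ha), fun p h1 hp => ?_⟩
    by_cases hpr : Nbr F p r
    · obtain ⟨a, ha, b, hb, h2, h3, h4, h5, h6⟩ := H p h1 hp hpr
      exact ⟨a, Finset.mem_erase.2 ⟨h2, ha⟩, b, Finset.mem_erase.2 ⟨h3, hb⟩, h4, h5, h6⟩
    · obtain ⟨a, ha, b, hb, h4, h5, h6⟩ := h.dom.two p h1 hp
      exact ⟨a, Finset.mem_erase.2 ⟨fun e => hpr (e ▸ h5), ha⟩, b,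
        Finset.mem_erase.2 ⟨fun e => hpr (e ▸ h6), hb⟩, h4, h5, h6⟩
  have hcard := h.card_le _ hdom
  have he : (W.erase r).card + 1 = W.card := Finset.card_erase_add_one hr
  omega

/-- The last vertex `e` of a block is the last neighbour of the vertex `c` two places before it. -/
theorem last_eq (h : Opt N F W) (G : PadGraph N F) {c d e : ℕ} (hc : c ∈ W) (hd : d ∈ W)
    (he : e ∈ W) (hcd : c < d) (hde : d < e) (hec : e ≤ F c)
    (hend : ∀ y ∈ W, e < y → F e < y) : e = F c := by
  by_contra hne
  have hFN := G.map_le c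
  refine h.no_exchange he (r' := F c) (by omega) hFN fun p h1 hp hpe => ?_
  have m1 := @G.mono p c
  have m2 := @G.mono c p
  have m3 := @G.mono p e
  have m4 := @G.mono e p
  have m5 := @G.mono p d
  have m6 := @G.mono d p
  have m7 := @G.mono c d
  have m8 := @G.mono c e
  have m9 := @G.mono e (F c)
  have hnot : F c ∉ W := fun hF => by have := hend _ hF; omega
  unfold Nbr at hpe
  by_cases p1 : p < c
  · exact .inl ⟨c, hc, d, hd, by omega, by omega, hcd, by unfold Nbr; omega, by unfold Nbr; omega⟩
  by_cases p2 : p = d ∨ p = F c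
  · by_cases p3 : p = d
    · exact .inr (.inl ⟨c, hc, by omega, by omega, by unfold Nbr; omega, by unfold Nbr; omega⟩)
    · exact .inl ⟨c, hc, d, hd, by omega, by omega, hcd, by unfold Nbr; omega,
        by unfold Nbr; omega⟩
  · exact .inr (.inr ⟨hnot, by unfold Nbr; omega⟩)

/-- In a block with at least five vertices, the last two are consecutive. -/
theorem penultimate_eq (h : Opt N F W) (G : PadGraph N F) {a b c d e : ℕ} (ha : a ∈ W)
    (hb : b ∈ W) (hc : c ∈ W) (hd : d ∈ W) (he : e ∈ W) (hab : a < b) (hbc : b < c) (hcd : c < d)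
    (hde : d < e) (hba : b ≤ F a) (hcb : c ≤ F b) (hec : e ≤ F c)
    (hcons : ∀ y ∈ W, d < y → e ≤ y) : d = e - 1 := by
  by_contra hne
  have := h.dom.sub e he
  refine h.no_exchange hd (r' := e - 1) (by omega) (by omega) fun p h1 hp hpd => ?_
  have hnot : e - 1 ∉ W := fun hF => by have := hcons _ hF; omega
  have m1 := @G.mono p b
  have m2 := @G.mono b p
  have m3 := @G.mono p c
  have m4 := @G.mono c p
  have m5 := @G.mono c (e - 1)
  have m6 := @G.mono d (e - 1)
  have m7 := @G.mono a b
  unfold Nbr at hpd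
  by_cases p1 : p < b
  · exact .inl ⟨b, hb, c, hc, by omega, by omega, hbc, by unfold Nbr; omega, by unfold Nbr; omega⟩
  by_cases p2 : p = b
  · exact .inl ⟨a, ha, c, hc, by omega, by omega, by omega, by unfold Nbr; omega,
      by unfold Nbr; omega⟩
  by_cases p3 : p < c
  · exact .inl ⟨b, hb, c, hc, by omega, by omega, hbc, by unfold Nbr; omega, by unfold Nbr; omega⟩
  by_cases p4 : p = c
  · exact .inl ⟨b, hb, e, he, by omega, by omega, by omega, by unfold Nbr; omega,
      by unfold Nbr; omega⟩
  by_cases p5 : p < e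
  · exact .inl ⟨c, hc, e, he, by omega, by omega, by omega, by unfold Nbr; omega,
      by unfold Nbr; omega⟩
  · exact .inr (.inr ⟨hnot, by unfold Nbr; omega⟩)

/-- In a block with four vertices, the third one is as far to the right as possible. -/
theorem third_of_four_eq (h : Opt N F W) (G : PadGraph N F) {a b c d : ℕ} (ha : a ∈ W)
    (hb : b ∈ W) (hc : c ∈ W) (hd : d ∈ W) (hab : a < b) (hbc : b < c) (hcd : c < d)
    (hca : c ≤ F a) (hdb : d ≤ F b) (hcons : ∀ y ∈ W, c < y → d ≤ y) :
    c = min (F a) (d - 1) := by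
  by_contra hne
  obtain ⟨r, hr⟩ : ∃ r, r = min (F a) (d - 1) := ⟨_, rfl⟩
  have := h.dom.sub d hd
  refine h.no_exchange hc (r' := r) (by omega) (by omega) fun p h1 hp hpc => ?_
  have hnot : r ∉ W := fun hF => by have := hcons _ hF; omega
  have m1 := @G.mono p a
  have m2 := @G.mono a p
  have m3 := @G.mono p b
  have m4 := @G.mono b p
  have m5 := @G.mono b r
  have m6 := @G.mono c r
  have m7 := @G.mono a b
  unfold Nbr at hpc
  by_cases p1 : p < a
  · exact .inl ⟨a, ha, b, hb, by omega, by omega, hab, by unfold Nbr; omega, by unfold Nbr; omega⟩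
  by_cases p2 : p = a
  · exact .inr (.inl ⟨b, hb, by omega, by omega, by unfold Nbr; omega, by unfold Nbr; omega⟩)
  by_cases p3 : p < r
  · exact .inr (.inl ⟨a, ha, by omega, by omega, by unfold Nbr; omega, by unfold Nbr; omega⟩)
  by_cases p4 : p = r
  · exact .inl ⟨a, ha, d, hd, by omega, by omega, by omega, by unfold Nbr; omega,
      by unfold Nbr; omega⟩
  · exact .inr (.inr ⟨hnot, by unfold Nbr; omega⟩)

/-- In a block of five or more vertices, each of the vertices from the third to the third but last
is as far to the right as possible.  Here `r` is the vertex in question, `a` the vertex that limits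
it, and `n₁`, `n₂` are the next vertices.  The exchange of `r` for `F a` can leave `n₂` with one
neighbour only, if `n₂` ends the block and `F a = n₁`; then `r` is exchanged for `F n₂`, or `n₂` is
removed. -/
theorem middle_eq (h : Opt N F W) (G : PadGraph N F) {a o r n₁ n₂ : ℕ} (ha : a ∈ W)
    (ho : o ∈ W) (hr : r ∈ W) (h₁ : n₁ ∈ W) (h₂ : n₂ ∈ W) (har : a < r) (hrn : r < n₁)
    (hnn : n₁ < n₂) (hra : r ≤ F a) (hnr : n₁ ≤ F r) (hnn' : n₂ ≤ F n₁) (hor : o < r)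
    (hao : Nbr F a o)
    (hlow : ∀ p, 1 ≤ p → p < a → r ≤ F p → TwoNbrs F W r p)
    (hc₁ : ∀ y ∈ W, r < y → n₁ ≤ y) (hc₂ : ∀ y ∈ W, n₁ < y → n₂ ≤ y)
    (hend : (∃ n₃ ∈ W, n₂ < n₃ ∧ n₃ ≤ F n₂) ∨ (n₁ = n₂ - 1 ∧ n₂ = F r)) : r = F a := by
  by_contra hne
  have b1 := h.dom.sub n₂ h₂
  have bA := G.map_le a
  have bL := G.le_map n₂ b1.2
  have bN := G.map_le n₂
  have k1 := @G.mono a r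
  have k2 := @G.mono r n₁
  have k3 := @G.mono n₁ n₂
  have k4 := @G.mono r (F a)
  have hlow' : ∀ p, 1 ≤ p → p < a → Nbr F p r → TwoNbrs F W r p := fun p h1 hp hpr =>
    hlow p h1 hp (by unfold Nbr at hpr; omega)
  unfold Nbr at hao
  by_cases hcase : F a = n₁ ∧ n₁ = n₂ - 1 ∧ n₂ = F r
  · by_cases hF : n₂ < F n₂
    · refine h.no_exchange hr (r' := F n₂) (by omega) bN fun p h1 hp hpr => ?_
      have m1 := @G.mono p a
      have m2 := @G.mono a p
      by_cases p1 : p < a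
      · exact .inl (hlow' p h1 p1 hpr)
      unfold Nbr at hpr
      by_cases p2 : p = a
      · exact .inl ⟨o, ho, n₁, h₁, by omega, by omega, by omega, by unfold Nbr; subst p2; omega,
          by unfold Nbr; subst p2; omega⟩
      by_cases p3 : p < n₁
      · exact .inl ⟨a, ha, n₁, h₁, by omega, by omega, by omega, by unfold Nbr; omega,
          by unfold Nbr; omega⟩
      by_cases p4 : p = n₁
      · exact .inl ⟨a, ha, n₂, h₂, by omega, by omega, by omega, by unfold Nbr; omega,
          by unfold Nbr; subst p4; omega⟩
      · have : p = n₂ := by omega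
        exact .inr (.inl ⟨n₁, h₁, by omega, by omega, by unfold Nbr; omega,
          by unfold Nbr; subst this; omega⟩)
    · refine h.no_removal h₂ fun p h1 hp hpr => ?_
      have m1 := @G.mono p a
      have m2 := @G.mono p r
      have m3 := @G.mono r p
      unfold Nbr at hpr
      by_cases p1 : p < r
      · exact ⟨r, hr, n₁, h₁, by omega, by omega, by omega, by unfold Nbr; omega,
          by unfold Nbr; omega⟩
      by_cases p2 : p = r
      · exact ⟨a, ha, n₁, h₁, by omega, by omega, by omega, by unfold Nbr; omega,
          by unfold Nbr; subst p2; omega⟩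
      by_cases p3 : p = n₁
      · exact ⟨a, ha, r, hr, by omega, by omega, by omega, by unfold Nbr; omega,
          by unfold Nbr; omega⟩
      · exact ⟨r, hr, n₁, h₁, by omega, by omega, by omega, by unfold Nbr; omega,
          by unfold Nbr; omega⟩
  · refine h.no_exchange hr (r' := F a) (by omega) bA fun p h1 hp hpr => ?_
    have m1 := @G.mono p a
    have m2 := @G.mono a p
    have m3 := @G.mono p r
    have m4 := @G.mono r p
    have m5 := @G.mono p n₁
    have m6 := @G.mono n₁ p
    by_cases p1 : p < a
    · exact .inl (hlow' p h1 p1 hpr)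
    unfold Nbr at hpr
    by_cases p2 : p = a
    · exact .inr (.inl ⟨o, ho, by omega, by omega, by unfold Nbr; subst p2; omega,
        by unfold Nbr; subst p2; omega⟩)
    by_cases p3 : p < F a
    · exact .inr (.inl ⟨a, ha, by omega, by omega, by unfold Nbr; omega, by unfold Nbr; omega⟩)
    by_cases p4 : p = F a
    · by_cases p5 : F a = n₁
      · exact .inl ⟨a, ha, n₂, h₂, by omega, by omega, by omega, by unfold Nbr; omega,
          by unfold Nbr; rw [p4.trans p5]; omega⟩
      · exact .inl ⟨a, ha, n₁, h₁, by omega, by omega, by omega, by unfold Nbr; omega,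
          by unfold Nbr; omega⟩
    by_cases hmem : F a ∈ W
    · have q1 := hc₁ _ hmem (by omega)
      have q2 := hc₂ _ hmem
      by_cases p5 : p = n₂
      · obtain ⟨n₃, h₃, q3, q4⟩ := hend.resolve_right (by omega)
        exact .inl ⟨n₁, h₁, n₃, h₃, by omega, by omega, by omega, by unfold Nbr; omega,
          by unfold Nbr; subst p5; omega⟩
      · exact .inl ⟨n₁, h₁, n₂, h₂, by omega, by omega, by omega, by unfold Nbr; omega,
          by unfold Nbr; omega⟩
    · exact .inr (.inr ⟨hmem, by unfold Nbr; omega⟩)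

/-- The second vertex of a block, given the first one `x`, the third one `c`, and the last two
vertices `p₀ < q₀` of the preceding block. -/
theorem second_eq (h : Opt N F W) (G : PadGraph N F) {p₀ q₀ x y c : ℕ} (hp₀ : p₀ ∈ W)
    (hq₀ : q₀ ∈ W) (hx : x ∈ W) (hy : y ∈ W) (hc : c ∈ W) (hpq : p₀ < q₀) (hqx : F q₀ < x)
    (hxy : x < y) (hyc : y < c) (hcx : c ≤ F x) (hqp : q₀ ≤ F p₀) (hxu : x ≤ F (F p₀ + 1))
    (hyz : y ≤ F (F q₀ + 1)) (hcons : ∀ a ∈ W, y < a → c ≤ a)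
    (hc' : c = F x ∨ (c = F y - 1 ∧ F y ∈ W)) : y = min (F (F q₀ + 1)) (F x - 1) := by
  have b1 := h.dom.sub c hc
  have bp := h.dom.sub p₀ hp₀
  have bL := G.le_map y (by omega)
  have bq := h.dom.sub q₀ hq₀
  have bL' := G.le_map q₀ bq.2
  have k0 := @G.mono p₀ q₀ (by omega)
  have bN := G.map_le x
  have k1 := @G.mono x y
  have k2 := @G.mono (F q₀ + 1) x
  have k3 := @G.mono y c
  by_contra hne
  obtain ⟨r, hrdef⟩ : ∃ r, r = min (F (F q₀ + 1)) (F x - 1) := ⟨_, rfl⟩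
  by_cases hlt : r < c
  · refine h.no_exchange hy (r' := r) (by omega) (by omega) fun p h1 hp hpr => ?_
    have hnot : r ∉ W := fun hF => by have := hcons _ hF; omega
    have m1 := @G.mono p x
    have m2 := @G.mono x p
    have m3 := @G.mono p y
    have m4 := @G.mono y p
    have m5 := @G.mono p q₀
    have m6 := @G.mono p p₀
    have m7 := @G.mono (F p₀ + 1) p
    have m8 := @G.mono (F q₀ + 1) p
    have m9 := @G.mono y r
    unfold Nbr at hpr
    by_cases p1 : p ≤ F p₀
    · exact .inl ⟨p₀, hp₀, q₀, hq₀, by omega, by omega, by omega, by unfold Nbr; omega,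
        by unfold Nbr; omega⟩
    by_cases p2 : p ≤ F q₀
    · exact .inl ⟨q₀, hq₀, x, hx, by omega, by omega, by omega, by unfold Nbr; omega,
        by unfold Nbr; omega⟩
    by_cases p3 : p < x
    · exact .inr (.inl ⟨x, hx, by omega, by omega, by unfold Nbr; omega, by unfold Nbr; omega⟩)
    by_cases p4 : p = x
    · exact .inr (.inl ⟨c, hc, by omega, by omega, by unfold Nbr; subst p4; omega,
        by unfold Nbr; subst p4; omega⟩)
    by_cases p5 : p < r
    · exact .inr (.inl ⟨x, hx, by omega, by omega, by unfold Nbr; omega, by unfold Nbr; omega⟩)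
    by_cases p6 : p = r
    · exact .inl ⟨x, hx, c, hc, by omega, by omega, by omega, by unfold Nbr; omega,
        by unfold Nbr; omega⟩
    · exact .inr (.inr ⟨hnot, by unfold Nbr; omega⟩)
  · obtain ⟨hc1, hd⟩ := hc'.resolve_left (by omega)
    refine h.no_removal hy fun p h1 hp hpr => ?_
    have m1 := @G.mono p x
    have m2 := @G.mono x p
    have m3 := @G.mono p y
    have m4 := @G.mono y p
    have m5 := @G.mono p q₀
    have m6 := @G.mono p p₀
    have m7 := @G.mono (F p₀ + 1) p
    have m8 := @G.mono (F q₀ + 1) p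
    unfold Nbr at hpr
    by_cases p1 : p ≤ F p₀
    · exact ⟨p₀, hp₀, q₀, hq₀, by omega, by omega, by omega, by unfold Nbr; omega,
        by unfold Nbr; omega⟩
    by_cases p2 : p ≤ F q₀
    · exact ⟨q₀, hq₀, x, hx, by omega, by omega, by omega, by unfold Nbr; omega,
        by unfold Nbr; omega⟩
    by_cases p3 : p < x
    · exact ⟨x, hx, c, hc, by omega, by omega, by omega, by unfold Nbr; omega,
        by unfold Nbr; omega⟩
    by_cases p4 : p = x
    · exact ⟨c, hc, F y, hd, by omega, by omega, by omega, by unfold Nbr; subst p4; omega,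
        by unfold Nbr; subst p4; omega⟩
    by_cases p5 : p = c
    · exact ⟨x, hx, F y, hd, by omega, by omega, by omega, by unfold Nbr; omega,
        by unfold Nbr; omega⟩
    · exact ⟨x, hx, c, hc, by omega, by omega, by omega, by unfold Nbr; omega,
        by unfold Nbr; omega⟩

/-- The first vertex of a block, given the second one `y`, the third one `c`, and the last two
vertices `p₀ < q₀` of the preceding block. -/
theorem first_eq (h : Opt N F W) (G : PadGraph N F) {p₀ q₀ x y c : ℕ} (hp₀ : p₀ ∈ W)
    (hq₀ : q₀ ∈ W) (hx : x ∈ W) (hy : y ∈ W) (hc : c ∈ W) (hpq : p₀ < q₀) (hqx : F q₀ < x)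
    (hxy : x < y) (hyc : y < c) (hcx : c ≤ F x) (hqp : q₀ ≤ F p₀) (hxu : x ≤ F (F p₀ + 1))
    (hyz : y ≤ F (F q₀ + 1)) (hcons : ∀ a ∈ W, x < a → y ≤ a) :
    x = min (F (F p₀ + 1)) (y - 1) := by
  have b1 := h.dom.sub c hc
  have bp := h.dom.sub p₀ hp₀
  have bq := h.dom.sub q₀ hq₀
  have bL' := G.le_map q₀ bq.2
  have k0 := @G.mono p₀ q₀ (by omega)
  have bN := G.map_le x
  have k1 := @G.mono x y
  by_contra hne
  obtain ⟨r, hrdef⟩ : ∃ r, r = min (F (F p₀ + 1)) (y - 1) := ⟨_, rfl⟩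
  refine h.no_exchange hx (r' := r) (by omega) (by omega) fun p h1 hp hpr => ?_
  have hnot : r ∉ W := fun hF => by have := hcons _ hF; omega
  have m1 := @G.mono p x
  have m2 := @G.mono x p
  have m5 := @G.mono p q₀
  have m6 := @G.mono p p₀
  have m7 := @G.mono (F p₀ + 1) p
  have m8 := @G.mono (F q₀ + 1) p
  have m9 := @G.mono x r
  unfold Nbr at hpr
  by_cases p1 : p ≤ F p₀
  · exact .inl ⟨p₀, hp₀, q₀, hq₀, by omega, by omega, by omega, by unfold Nbr; omega,
      by unfold Nbr; omega⟩
  by_cases p2 : p ≤ F q₀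
  · exact .inr (.inl ⟨q₀, hq₀, by omega, by omega, by unfold Nbr; omega, by unfold Nbr; omega⟩)
  by_cases p3 : p < r
  · by_cases p4 : p < x
    · exact .inr (.inl ⟨y, hy, by omega, by omega, by unfold Nbr; omega, by unfold Nbr; omega⟩)
    · exact .inr (.inl ⟨y, hy, by omega, by omega, by unfold Nbr; omega, by unfold Nbr; omega⟩)
  by_cases p6 : p = r
  · exact .inl ⟨y, hy, c, hc, by omega, by omega, by omega, by unfold Nbr; omega,
      by unfold Nbr; omega⟩
  · exact .inr (.inr ⟨hnot, by unfold Nbr; omega⟩)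

/-- A block that starts with `x, x + 1, x + 2` and does not reach beyond `x + 2` from `x` can be
moved to the right. -/
theorem no_tight_start (h : Opt N F W) (G : PadGraph N F) {p₀ q₀ x : ℕ} (hp₀ : p₀ ∈ W)
    (hq₀ : q₀ ∈ W) (hx : x ∈ W) (hy : x + 1 ∈ W) (hc : x + 2 ∈ W) (hpq : p₀ < q₀)
    (hqx : F q₀ < x) (hqp : q₀ ≤ F p₀) (hxu : x + 1 ≤ F (F p₀ + 1)) (hyz : x + 2 ≤ F (F q₀ + 1))
    (hFx : F x = x + 2) (hFy : x + 2 < F (x + 1)) : False := by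
  have bp := h.dom.sub q₀ hq₀
  have bL := G.le_map q₀ bp.2
  have k0 := @G.mono p₀ q₀ (by omega)
  have k1 := @G.mono (x + 1) (x + 2)
  refine h.no_exchange hx (r' := F (x + 1)) (by omega) (G.map_le _) fun p h1 hp hpr => ?_
  have m1 := @G.mono p x
  have m2 := @G.mono x p
  have m5 := @G.mono p q₀
  have m6 := @G.mono p p₀
  have m7 := @G.mono (F p₀ + 1) p
  have m8 := @G.mono (F q₀ + 1) p
  unfold Nbr at hpr
  by_cases p1 : p ≤ F p₀
  · exact .inl ⟨p₀, hp₀, q₀, hq₀, by omega, by omega, by omega, by unfold Nbr; omega,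
      by unfold Nbr; omega⟩
  by_cases p2 : p ≤ F q₀
  · exact .inl ⟨q₀, hq₀, x + 1, hy, by omega, by omega, by omega, by unfold Nbr; omega,
      by unfold Nbr; omega⟩
  by_cases p3 : p ≤ x
  · exact .inl ⟨x + 1, hy, x + 2, hc, by omega, by omega, by omega, by unfold Nbr; omega,
      by unfold Nbr; omega⟩
  by_cases p4 : p = x + 1
  · subst p4
    exact .inr (.inl ⟨x + 2, hc, by omega, by omega, by unfold Nbr; omega, by unfold Nbr; omega⟩)
  · obtain rfl : p = x + 2 := by omega
    exact .inr (.inl ⟨x + 1, hy, by omega, by omega, by unfold Nbr; omega, by unfold Nbr; omega⟩)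

/-- In an optimal set, the first two vertices of a block are determined by the last two vertices
of the preceding block. -/
theorem eq_extPair (h : Opt N F W) (G : PadGraph N F) {p₀ q₀ x y c : ℕ} (hp₀ : p₀ ∈ W)
    (hq₀ : q₀ ∈ W) (hx : x ∈ W) (hy : y ∈ W) (hc : c ∈ W) (hpq : p₀ < q₀) (hqx : F q₀ < x)
    (hxy : x < y) (hyc : y < c) (hcx : c ≤ F x) (hqp : q₀ ≤ F p₀) (hxu : x ≤ F (F p₀ + 1))
    (hyz : y ≤ F (F q₀ + 1)) (hcons₁ : ∀ a ∈ W, x < a → y ≤ a) (hcons₂ : ∀ a ∈ W, y < a → c ≤ a)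
    (hc' : c = F x ∨ (c = F y - 1 ∧ F y ∈ W)) : (x, y) = extPair F p₀ q₀ := by
  have hY := h.second_eq G hp₀ hq₀ hx hy hc hpq hqx hxy hyc hcx hqp hxu hyz hcons₂ hc'
  have hX := h.first_eq G hp₀ hq₀ hx hy hc hpq hqx hxy hyc hcx hqp hxu hyz hcons₁
  have hT : y = x + 1 → c = x + 2 → x + 1 ≤ F (F p₀ + 1) → x + 2 ≤ F (F q₀ + 1) →
      F x = x + 2 → ¬ x + 2 < F y := by
    rintro rfl rfl h1 h2 h3
    exact h.no_tight_start G hp₀ hq₀ hx hy hc hpq hqx hqp h1 h2 h3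
  have k1 := @G.mono (F q₀ + 1) x (by omega)
  have k2 := @G.mono p₀ q₀ (by omega)
  have k3 := @G.mono (F p₀ + 1) (F q₀ + 1) (by omega)
  have bx := h.dom.sub x hx
  obtain ⟨u, hu⟩ : ∃ u, u = F (F p₀ + 1) := ⟨_, rfl⟩
  obtain ⟨z, hz⟩ : ∃ z, z = F (F q₀ + 1) := ⟨_, rfl⟩
  rw [← hu] at hX hxu hT k3
  rw [← hz] at hY hyz hT k1 k3
  have e1 : F x ≤ F u := G.mono hxu
  have e2 : x ≤ u - 1 → F x ≤ F (u - 1) := fun e => G.mono e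
  unfold extPair
  simp only [outDeg, ← hu, ← hz]
  clear hc' hcons₁ hcons₂ hp₀ hq₀ hx hy hc hpq hqp hqx k2 hu hz
  split_ifs with c1 c2 c3
  · obtain ⟨rfl, c1⟩ := c1
    have := e2 (by omega)
    have hy : y = u - 1 := by omega
    simp only [Prod.mk.injEq]
    omega
  · rcases c2 with ⟨rfl, c2⟩ | ⟨c2, c4⟩
    · have := e2 (by omega)
      have hy : y = u := by
        by_contra hne
        have hy : y = u - 1 := by omega
        rw [hy] at hT
        exact hT (by omega) (by omega) (by omega) (by omega) (by omega) (by omega)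
      simp only [Prod.mk.injEq]
      omega
    · have hy : y = u := by omega
      simp only [Prod.mk.injEq]
      omega
  · obtain ⟨c3, c4, c5⟩ := c3
    simp only [Prod.mk.injEq]
    omega
  · have hne : u ≠ z := by
      rintro rfl
      have := e2 (by omega)
      omega
    have hy : y = z := by
      by_contra hne'
      have hxu' : x = u → F x = F u := fun e => e ▸ rfl
      have hy : y = u := by omega
      rw [hy] at hT
      exact hT (by omega) (by omega) (by omega) (by omega) (by omega) (by omega)
    simp only [Prod.mk.injEq]
    omega

end Opt

/-! ### Expansive sets in arithmetical terms -/

/-- The expansive set with `j` vertices that is represented by `vw` exists. -/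
structure ExpOK (F : ℕ → ℕ) (j v w : ℕ) : Prop where
  pos : 1 ≤ v
  lt : v < w
  lt_map : w < F v
  size : j = 3 ∨ (j = 4 ∧ w + 1 < F w) ∨ (5 ≤ j ∧ 2 ≤ outDeg F (F^[j - 4] v))

/-- The last two vertices of the expansive set with `j` vertices that is represented by `vw`. -/
def penLast (F : ℕ → ℕ) (j v w : ℕ) : ℕ × ℕ :=
  if j = 3 then (w, F v)
  else if j = 4 then (min (F v) (F w - 1), F w)
  else (F^[j - 3] v - 1, F^[j - 3] v)

/-- `xy` is the `j`-extension of `vw`, in arithmetical terms. -/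
structure Ext (F : ℕ → ℕ) (j v w x y : ℕ) : Prop where
  ok : ExpOK F j v w
  lt : x < y
  lt_map : y < F x
  far : F (penLast F j v w).2 < x
  eq : (x, y) = extPair F (penLast F j v w).1 (penLast F j v w).2

/-- `vw` starts a sequence of expansive sets, each extending the preceding one, that ends with the
last triangle and has `k` vertices altogether. -/
inductive Chain (N : ℕ) (F : ℕ → ℕ) : ℕ → ℕ → ℕ → Prop
  | last : Chain N F (N - 2) (N - 1) 3
  | step {j v w x y k : ℕ} (h : Ext F j v w x y) (hc : Chain N F x y k) : Chain N F v w (j + k)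

/-! ### Optimal sets consist of expansive sets -/

/-- `w 0 < w 1 < ⋯` are the elements of `W`. -/
structure Enumerates (W : Finset ℕ) (w : ℕ → ℕ) : Prop where
  mem : ∀ i, i < W.card → w i ∈ W
  lt : ∀ i j, i < j → j < W.card → w i < w j
  surj : ∀ a ∈ W, ∃ i, i < W.card ∧ w i = a

theorem exists_enumerates (W : Finset ℕ) : ∃ w, Enumerates W w := by
  let e := W.orderEmbOfFin rfl
  refine ⟨fun i => if h : i < W.card then e ⟨i, h⟩ else 0, fun i h => ?_, fun i j h hj => ?_,
    fun a ha => ?_⟩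
  · simp only [h, dif_pos]
    exact W.orderEmbOfFin_mem rfl _
  · simp only [hj, h.trans hj, dif_pos]
    exact e.strictMono h
  · have : a ∈ Set.range e := by rw [Finset.range_orderEmbOfFin]; exact ha
    obtain ⟨i, hi⟩ := this
    exact ⟨i, i.2, by simp [hi]⟩

namespace Enumerates

variable {W : Finset ℕ} {w : ℕ → ℕ}

theorem le (h : Enumerates W w) {i j : ℕ} (hij : i ≤ j) (hj : j < W.card) : w i ≤ w j := by
  rcases hij.eq_or_lt with rfl | hij
  · exact le_rfl
  · exact (h.lt i j hij hj).le

theorem lt_iff (h : Enumerates W w) {i j : ℕ} (hi : i < W.card) (hj : j < W.card) :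
    w i < w j ↔ i < j := by
  refine ⟨fun hw => ?_, fun hij => h.lt i j hij hj⟩
  by_contra hij
  have := h.le (not_lt.1 hij) hi
  omega

/-- No element of `W` lies between two consecutive ones. -/
theorem next (h : Enumerates W w) {i a : ℕ} (hi : i < W.card) (ha : a ∈ W) (hlt : w i < a) :
    i + 1 < W.card ∧ w (i + 1) ≤ a := by
  obtain ⟨k, hk, rfl⟩ := h.surj a ha
  have := (h.lt_iff hi hk).1 hlt
  exact ⟨by omega, h.le this hk⟩

end Enumerates

namespace Opt

variable {N : ℕ} {F : ℕ → ℕ} {W : Finset ℕ} {w : ℕ → ℕ}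

/-- The block of an optimal set that starts with `w a` is expansive. -/
theorem block (h : Opt N F W) (G : PadGraph N F) (e : Enumerates W w) {a : ℕ} (ha : a < W.card)
    (hstart : ∀ q ∈ W, q < w a → F q < w a) :
    ∃ b, b < W.card ∧ a + 2 ≤ b ∧ (b + 1 = W.card ∨ F (w b) < w (b + 1)) ∧
      (∀ i, a ≤ i → i < b → w (i + 1) ≤ F (w i)) ∧
      ExpOK F (b - a + 1) (w a) (w (a + 1)) ∧
      penLast F (b - a + 1) (w a) (w (a + 1)) = (w (b - 1), w b) ∧
      w (a + 2) ≤ F (w a) ∧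
      (w (a + 2) = F (w a) ∨ (w (a + 2) = F (w (a + 1)) - 1 ∧ F (w (a + 1)) ∈ W)) := by
  classical
  have mono := G.mono
  have sub := h.dom.sub
  have hstart2 : a + 2 < W.card ∧ w (a + 2) ≤ F (w a) := by
    have hwa := sub _ (e.mem a ha)
    obtain ⟨x, hx, y, hy, hxy, h1, h2⟩ := h.dom.two (w a) hwa.1 hwa.2
    have low : ∀ q ∈ W, Nbr F (w a) q → w a < q ∧ q ≤ F (w a) := fun q hq hn => by
      rcases hn with hn | hn
      · exact hn
      · have := hstart q hq hn.1
        omega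
    have n1 := e.next ha hx (low x hx h1).1
    have n2 := e.next n1.1 hy (by omega)
    exact ⟨n2.1, n2.2.trans (low y hy h2).2⟩
  have hex : ∃ b, a ≤ b ∧ b < W.card ∧ (b + 1 = W.card ∨ F (w b) < w (b + 1)) :=
    ⟨W.card - 1, by omega, by omega, .inl (by omega)⟩
  obtain ⟨b, ⟨hab, hbK, hend⟩, hmin⟩ : ∃ b, (a ≤ b ∧ b < W.card ∧
      (b + 1 = W.card ∨ F (w b) < w (b + 1))) ∧ ∀ i, a ≤ i → i < b → w (i + 1) ≤ F (w i) := by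
    refine ⟨Nat.find hex, Nat.find_spec hex, fun i h1 h2 => ?_⟩
    have h3 := Nat.find_min hex h2
    have h4 := (Nat.find_spec hex).2.1
    by_contra h5
    exact h3 ⟨h1, by omega, .inr (by omega)⟩
  have hb2 : a + 2 ≤ b := by
    by_contra hlt
    have h1 := e.lt a (a + 1) (by omega) (by omega)
    have h2 := e.lt (a + 1) (a + 2) (by omega) (by omega)
    have h3 := mono h1.le
    obtain rfl | rfl : b = a ∨ b = a + 1 := by omega
    · rcases hend with hend | hend
      · omega
      · omega
    · rcases hend with hend | hend
      · omega
      · have : w (a + 1 + 1) = w (a + 2) := rfl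
        omega
  have hup : ∀ y ∈ W, w b < y → F (w b) < y := fun y hy hlt => by
    have := e.next hbK hy hlt
    rcases hend with hend | hend
    · omega
    · omega
  have hL : ∀ i, i < W.card → w i ≤ F (w i) := fun i hi => G.le_map _ (sub _ (e.mem i hi)).2
  have hbF : w b ≤ F (w (b - 2)) := by
    have hwb := sub _ (e.mem b hbK)
    obtain ⟨x, hx, y, hy, hxy, h1, h2⟩ := h.dom.two (w b) hwb.1 hwb.2
    have low : ∀ q ∈ W, Nbr F (w b) q → q < w b ∧ w b ≤ F q := fun q hq hn => by
      rcases hn with hn | hn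
      · have := hup q hq hn.1
        omega
      · exact hn
    obtain ⟨i, hi, rfl⟩ := e.surj x hx
    obtain ⟨k, hk, rfl⟩ := e.surj y hy
    have h3 := (e.lt_iff hi hk).1 hxy
    have h4 := (e.lt_iff hk hbK).1 (low _ hy h2).1
    exact (low _ hx h1).2.trans (mono (e.le (by omega) (by omega)))
  have lt' : ∀ i, i < b → w i < w (i + 1) := fun i hi => e.lt i (i + 1) (by omega) (by omega)
  have mem' : ∀ i, i ≤ b → w i ∈ W := fun i hi => e.mem i (by omega)
  have cons : ∀ i, i < b → ∀ y ∈ W, w i < y → w (i + 1) ≤ y := fun i hi y hy hlt =>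
    (e.next (by omega) hy hlt).2
  have hlast : w b = F (w (b - 2)) := by
    obtain ⟨c, rfl⟩ : ∃ c, b = c + 2 := ⟨b - 2, by omega⟩
    exact h.last_eq G (mem' c (by omega)) (mem' (c + 1) (by omega)) (mem' _ le_rfl)
      (lt' c (by omega)) (lt' (c + 1) (by omega)) hbF hup
  have hpos := (sub _ (mem' a (by omega))).1
  have l1 := lt' a (by omega)
  have l2 : w (a + 1) < w (a + 2) := lt' (a + 1) (by omega)
  have hlt3 : w (a + 1) < F (w a) := by
    have := hstart2.2
    omega
  refine ⟨b, hbK, hb2, hend, hmin, ?_⟩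
  rcases (by omega : b = a + 2 ∨ b = a + 3 ∨ a + 4 ≤ b) with rfl | rfl | hb4
  · have hlast' : w (a + 2) = F (w a) := hlast
    have hj : a + 2 - a + 1 = 3 := by omega
    rw [hj]
    refine ⟨⟨hpos, l1, hlt3, .inl rfl⟩, ?_, hstart2.2, .inl hlast'⟩
    simp [penLast, hlast']
  · have hlast' : w (a + 3) = F (w (a + 1)) := hlast
    have hj : a + 3 - a + 1 = 4 := by omega
    have l3 : w (a + 2) < w (a + 3) := lt' (a + 2) (by omega)
    have hthird := h.third_of_four_eq G (mem' a (by omega)) (mem' (a + 1) (by omega))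
      (mem' (a + 2) (by omega)) (mem' (a + 3) (by omega)) l1 l2 l3 hstart2.2 hbF
      (cons (a + 2) (by omega))
    rw [hj]
    refine ⟨⟨hpos, l1, hlt3, .inr (.inl ⟨rfl, ?_⟩)⟩, ?_, hstart2.2, ?_⟩
    · have : w (a + 2 + 1) = w (a + 3) := rfl
      omega
    · have : w (a + 3 - 1) = w (a + 2) := rfl
      simp only [penLast]
      rw [this, hthird, hlast']
      simp
    · rcases le_or_gt (F (w a)) (w (a + 3) - 1) with h1 | h1
      · left; omega
      · right
        refine ⟨by omega, ?_⟩
        rw [← hlast']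
        exact mem' _ le_rfl
  · have hpen : w (b - 1) = w b - 1 := by
      obtain ⟨c, rfl⟩ : ∃ c, b = c + 4 := ⟨b - 4, by omega⟩
      exact h.penultimate_eq G (mem' c (by omega)) (mem' (c + 1) (by omega))
        (mem' (c + 2) (by omega)) (mem' (c + 3) (by omega)) (mem' (c + 4) (by omega))
        (lt' c (by omega)) (lt' (c + 1) (by omega)) (lt' (c + 2) (by omega))
        (lt' (c + 3) (by omega)) (hmin c (by omega) (by omega))
        (hmin (c + 1) (by omega) (by omega)) hbF (cons (c + 3) (by omega))
    have hends : ∀ i, i + 2 ≤ b → a ≤ i → (∃ n₃ ∈ W, w (i + 2) < n₃ ∧ n₃ ≤ F (w (i + 2))) ∨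
        (w (i + 1) = w (i + 2) - 1 ∧ w (i + 2) = F (w i)) := by
      intro i hi hai
      rcases hi.eq_or_lt with rfl | hi
      · exact .inr ⟨hpen, hlast⟩
      · exact .inl ⟨w (i + 2 + 1), mem' _ (by omega), lt' _ (by omega), hmin _ (by omega) hi⟩
    have hthird : w (a + 2) = F (w a) := by
      refine h.middle_eq G (n₁ := w (a + 3)) (n₂ := w (a + 4)) (mem' a (by omega))
        (mem' (a + 1) (by omega)) (mem' _ (by omega)) (mem' _ (by omega)) (mem' _ (by omega))
        (by omega) (lt' (a + 2) (by omega)) (lt' (a + 3) (by omega)) hstart2.2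
        (hmin (a + 2) (by omega) (by omega)) (hmin (a + 3) (by omega) (by omega)) l2
        (.inl ⟨l1, hlt3.le⟩) (fun p h1 h2 h3 => ?_) (cons (a + 2) (by omega))
        (cons (a + 3) (by omega)) (hends (a + 2) (by omega) (by omega))
      exact ⟨w a, mem' a (by omega), w (a + 1), mem' _ (by omega), by omega, by omega, l1,
        .inl ⟨h2, by omega⟩, .inl ⟨by omega, by omega⟩⟩
    have hmid : ∀ i, a + 3 ≤ i → i + 2 ≤ b → w i = F (w (i - 1)) := by
      intro i hi hib
      obtain ⟨c, rfl⟩ : ∃ c, i = c + 3 := ⟨i - 3, by omega⟩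
      have c0 := lt' c (by omega)
      have c1 := lt' (c + 1) (by omega)
      have c2 := lt' (c + 2) (by omega)
      have f0 := hmin c (by omega) (by omega)
      have f1 := hmin (c + 1) (by omega) (by omega)
      change w (c + 3) = F (w (c + 2))
      refine h.middle_eq G (n₁ := w (c + 4)) (n₂ := w (c + 5)) (mem' (c + 2) (by omega))
        (mem' (c + 1) (by omega)) (mem' _ (by omega)) (mem' _ (by omega)) (mem' _ (by omega))
        c2 (lt' (c + 3) (by omega)) (lt' (c + 4) (by omega))
        (hmin (c + 2) (by omega) (by omega)) (hmin (c + 3) (by omega) (by omega))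
        (hmin (c + 4) (by omega) (by omega)) (c1.trans c2)
        (.inr ⟨c1, f1⟩) (fun p h1 h2 h3 => ?_) (cons (c + 3) (by omega))
        (cons (c + 4) (by omega)) (hends (c + 3) (by omega) (by omega))
      have g0 : w (c + 1 + 1) = w (c + 2) := rfl
      have g1 : w (c + 2 + 1) = w (c + 3) := rfl
      have m1 := @mono p (w (c + 1))
      have m2 := @mono (w (c + 1)) p
      by_cases p1 : p < w (c + 1)
      · exact ⟨w (c + 1), mem' _ (by omega), w (c + 2), mem' _ (by omega), by omega, by omega, c1,
          .inl ⟨p1, by omega⟩, .inl ⟨by omega, by omega⟩⟩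
      by_cases p2 : p = w (c + 1)
      · subst p2
        exact ⟨w c, mem' _ (by omega), w (c + 2), mem' _ (by omega), by omega, by omega, by omega,
          .inr ⟨c0, f0⟩, .inl ⟨by omega, f1⟩⟩
      · exact ⟨w (c + 1), mem' _ (by omega), w (c + 2), mem' _ (by omega), by omega, by omega, c1,
          .inr ⟨by omega, by omega⟩, .inl ⟨by omega, by omega⟩⟩
    have hiter : ∀ k, a + 2 + k + 2 ≤ b → w (a + 2 + k) = F^[k + 1] (w a) := by
      intro k
      induction k with
      | zero => intro _; simpa using hthird
      | succ k ih =>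
        intro hk
        rw [Function.iterate_succ_apply', ← ih (by omega)]
        exact hmid (a + 2 + (k + 1)) (by omega) (by omega)
    have h1 : w (b - 2) = F^[b - a + 1 - 4] (w a) := by
      have := hiter (b - a - 4) (by omega)
      rwa [show a + 2 + (b - a - 4) = b - 2 by omega,
        show b - a - 4 + 1 = b - a + 1 - 4 by omega] at this
    have h2 : w b = F^[b - a + 1 - 3] (w a) := by
      rw [show b - a + 1 - 3 = (b - a + 1 - 4) + 1 by omega, Function.iterate_succ_apply', ← h1,
        hlast]
    refine ⟨⟨hpos, l1, hlt3, .inr (.inr ⟨by omega, ?_⟩)⟩, ?_, hstart2.2, .inl hthird⟩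
    · rw [← h1, outDeg, ← hlast]
      have q1 := lt' (b - 2) (by omega)
      have q2 := lt' (b - 1) (by omega)
      rw [show b - 2 + 1 = b - 1 by omega] at q1
      rw [show b - 1 + 1 = b by omega] at q2
      omega
    · rw [penLast, if_neg (by omega), if_neg (by omega), ← h2, hpen]

/-- The first two vertices of the first triangle and the last triangle lie in every optimal set, which
is why the paths of `R` start in `(1, 2)` and end with an edge of weight `3`. -/
theorem ends_mem (h : Opt N F W) (G : PadGraph N F) :
    1 ∈ W ∧ 2 ∈ W ∧ N - 2 ∈ W ∧ N - 1 ∈ W ∧ N ∈ W := by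
  have h6 := G.six_le
  have f1 := G.first 1 (by omega)
  have f2 := G.first 2 (by omega)
  have f3 := G.first 3 (by omega)
  have g := G.gap
  have hlow : ∀ a, 1 ≤ a → a ≤ N → N - 3 < F a → N - 3 < a := fun a h1 h2 h3 => by
    by_contra h4
    have := @G.mono a (N - 3) (by omega)
    omega
  have hF := G.map_le
  refine ⟨?_, ?_, ?_, ?_, ?_⟩
  · obtain ⟨a, ha, b, hb, hab, h1, h2⟩ := h.dom.two 2 (by omega) (by omega)
    have := h.dom.sub a ha
    unfold Nbr at h1 h2
    obtain rfl : a = 1 := by omega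
    exact ha
  · obtain ⟨a, ha, b, hb, hab, h1, h2⟩ := h.dom.two 1 (by omega) (by omega)
    have := h.dom.sub a ha
    unfold Nbr at h1 h2
    obtain rfl : a = 2 := by omega
    exact ha
  · obtain ⟨a, ha, b, hb, hab, h1, h2⟩ := h.dom.two N (by omega) (by omega)
    have q1 := h.dom.sub a ha
    have q2 := h.dom.sub b hb
    have := hlow a q1.1 q1.2
    unfold Nbr at h1 h2
    obtain rfl : a = N - 2 := by omega
    exact ha
  · obtain ⟨a, ha, b, hb, hab, h1, h2⟩ := h.dom.two N (by omega) (by omega)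
    have q1 := h.dom.sub a ha
    have q2 := h.dom.sub b hb
    have := hlow a q1.1 q1.2
    unfold Nbr at h1 h2
    obtain rfl : b = N - 1 := by omega
    exact hb
  · obtain ⟨a, ha, b, hb, hab, h1, h2⟩ := h.dom.two (N - 1) (by omega) (by omega)
    have q1 := h.dom.sub a ha
    have q2 := h.dom.sub b hb
    have := hlow a q1.1 q1.2
    have := hlow b q2.1 q2.2
    unfold Nbr at h1 h2
    obtain rfl : b = N := by omega
    exact hb

/-- The part of an optimal set from the start `w a` of a block on is a sequence of expansive sets. -/
theorem chain_from (h : Opt N F W) (G : PadGraph N F) (e : Enumerates W w) (k : ℕ) :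
    ∀ a, a + k = W.card → a < W.card → (∀ q ∈ W, q < w a → F q < w a) →
      Chain N F (w a) (w (a + 1)) k := by
  induction k using Nat.strong_induction_on with
  | _ k ih =>
    intro a hak ha hstart
    obtain ⟨b, hbK, hab, hend, hconn, hok, hpl, -, -⟩ := h.block G e ha hstart
    have mono := G.mono
    have sub := h.dom.sub
    by_cases hb : b + 1 = W.card
    · obtain ⟨-, -, m2, m1, m0⟩ := h.ends_mem G
      have h6 := G.six_le
      obtain ⟨i₀, hi₀, e₀⟩ := e.surj _ m0
      obtain ⟨i₁, hi₁, e₁⟩ := e.surj _ m1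
      obtain ⟨i₂, hi₂, e₂⟩ := e.surj _ m2
      have t1 := (e.lt_iff hi₂ hi₁).1 (by omega)
      have t2 := (e.lt_iff hi₁ hi₀).1 (by omega)
      have s0 := (sub _ (e.mem b hbK)).2
      have s1 := e.lt (b - 1) b (by omega) hbK
      have s2 := e.lt (b - 2) (b - 1) (by omega) (by omega)
      have u0 := e.le (show i₀ ≤ b by omega) hbK
      have u1 := e.le (show i₁ ≤ b - 1 by omega) (by omega)
      have u2 := e.le (show i₂ ≤ b - 2 by omega) (by omega)
      obtain rfl : b = a + 2 := by
        by_contra hne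
        have s3 := e.lt (b - 3) (b - 2) (by omega) (by omega)
        have s4 := hconn (b - 3) (by omega) (by omega)
        rw [show b - 3 + 1 = b - 2 by omega] at s4
        have := @mono (w (b - 3)) (N - 3) (by omega)
        have := G.gap
        omega
      have q2 : w a = N - 2 := by
        have : w (a + 2 - 2) = w a := rfl
        omega
      have q1 : w (a + 1) = N - 1 := by
        have : w (a + 2 - 1) = w (a + 1) := rfl
        omega
      rw [q1, q2, show k = 3 by omega]
      exact .last
    · have hend' := hend.resolve_left hb
      have hb1 : b + 1 < W.card := by omega
      have hs1 : ∀ q ∈ W, q < w (b + 1) → F q < w (b + 1) := by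
        intro q hq hlt
        have : q ≤ w b := by
          by_contra hq'
          have := (e.next hbK hq (by omega)).2
          omega
        exact (mono this).trans_lt hend'
      obtain ⟨b', hbK', hab', -, -, hok', -, hc, hc'⟩ := h.block G e hb1 hs1
      have ihc := ih (k - (b - a + 1)) (by omega) (b + 1) (by omega) hb1 hs1
      have l1 := e.lt (b - 1) b (by omega) hbK
      have l2 := e.lt (b + 1) (b + 2) (by omega) (by omega)
      have l3 := e.lt (b + 2) (b + 3) (by omega) (by omega)
      have mp := e.mem (b - 1) (by omega)
      have mq := e.mem b hbK
      have mx := e.mem (b + 1) hb1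
      have sq := sub _ mq
      have sx := sub _ mx
      have hcn := hconn (b - 1) (by omega) (by omega)
      rw [show b - 1 + 1 = b by omega] at hcn
      have hcq := G.le_map _ sq.2
      have k1 := mono l1.le
      have hxu : w (b + 1) ≤ F (F (w (b - 1)) + 1) := by
        obtain ⟨x, hx, y, hy, hxy, h1, h2⟩ := h.dom.two (F (w (b - 1)) + 1) (by omega) (by omega)
        have hx' : w (b - 1) < x := by
          by_contra hle
          have := @mono x (w (b - 1)) (by omega)
          unfold Nbr at h1
          omega
        have n1 := (e.next (by omega) hx hx').2
        rw [show b - 1 + 1 = b by omega] at n1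
        have n2 := (e.next hbK hy (by omega)).2
        have := @mono y (w (b - 1))
        unfold Nbr at h2
        omega
      have hyz : w (b + 2) ≤ F (F (w b) + 1) := by
        obtain ⟨x, hx, y, hy, hxy, h1, h2⟩ := h.dom.two (F (w b) + 1) (by omega) (by omega)
        have hx' : w b < x := by
          by_contra hle
          have := @mono x (w b) (by omega)
          unfold Nbr at h1
          omega
        have n1 := (e.next hbK hx hx').2
        have n2 := (e.next hb1 hy (by omega)).2
        rw [show b + 1 + 1 = b + 2 by omega] at n2
        unfold Nbr at h2
        omega
      have hext := h.eq_extPair G (c := w (b + 3)) mp mq mx (e.mem (b + 2) (by omega))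
        (e.mem (b + 3) (by omega)) l1 hend' l2 l3 hc hcn hxu hyz
        (fun a ha hlt => (e.next hb1 ha hlt).2) (fun a ha hlt => (e.next (by omega) ha hlt).2) hc'
      have hE : Ext F (b - a + 1) (w a) (w (a + 1)) (w (b + 1)) (w (b + 2)) := by
        refine ⟨hok, hok'.lt, hok'.lt_map, ?_, ?_⟩
        · rw [hpl]; exact hend'
        · rw [hpl]; exact hext
      have := Chain.step hE ihc
      rwa [show b - a + 1 + (k - (b - a + 1)) = k by omega] at this

/-- An optimal set is a sequence of expansive sets, each of which extends the preceding one. -/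
theorem chain (h : Opt N F W) (G : PadGraph N F) : Chain N F 1 2 W.card := by
  obtain ⟨w, e⟩ := exists_enumerates W
  obtain ⟨m1, m2, -⟩ := h.ends_mem G
  obtain ⟨i, hi, ei⟩ := e.surj _ m1
  obtain ⟨i', hi', ei'⟩ := e.surj _ m2
  have hw0 : w 0 = 1 := by
    have := e.le (Nat.zero_le i) hi
    have := h.dom.sub _ (e.mem 0 (by omega))
    omega
  have h01 := (e.lt_iff (by omega : 0 < W.card) hi').1 (by omega)
  have hw1 : w 1 = 2 := by
    have := e.le h01 hi'
    have := e.lt 0 1 (by omega) (by omega)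
    simp only [Nat.succ_eq_add_one, zero_add] at *
    omega
  have := h.chain_from G e W.card 0 (by omega) (by omega) fun q hq hlt => by
    have := h.dom.sub q hq
    omega
  rwa [hw0, zero_add, hw1] at this

end Opt

/-! ### The vertices of expansive sets -/

/-- The list `F v, F² v, …, F^k v`. -/
def iterList (F : ℕ → ℕ) (v k : ℕ) : List ℕ := (List.range k).map fun i => F^[i + 1] v

/-- The expansive set with `j ≥ 5` vertices that starts with `v`, without its first two vertices. -/
def tailList (F : ℕ → ℕ) (v j : ℕ) : List ℕ :=
  iterList F v (j - 4) ++ [F^[j - 3] v - 1, F^[j - 3] v]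

/-- The expansive set with `j` vertices that is represented by `vw`. -/
def expList (F : ℕ → ℕ) (v w j : ℕ) : List ℕ :=
  if j = 3 then [v, w, F v]
  else if j = 4 then [v, w, min (F v) (F w - 1), F w]
  else v :: w :: tailList F v j

@[simp] theorem length_iterList (F : ℕ → ℕ) (v k : ℕ) : (iterList F v k).length = k := by
  simp [iterList]

theorem iterList_add (F : ℕ → ℕ) (v k l : ℕ) :
    iterList F v (k + l) = iterList F v k ++ iterList F (F^[k] v) l := by
  simp only [iterList, List.range_add, List.map_append, List.map_map]
  congr 1
  apply List.map_congr_left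
  intro i _
  rw [Function.comp, ← Function.iterate_add_apply, show k + i + 1 = i + 1 + k by omega]

theorem mem_iterList {F : ℕ → ℕ} {v k a : ℕ} :
    a ∈ iterList F v k ↔ ∃ i, 1 ≤ i ∧ i ≤ k ∧ F^[i] v = a := by
  simp only [iterList, List.mem_map, List.mem_range]
  constructor
  · rintro ⟨i, hi, rfl⟩
    exact ⟨i + 1, by omega, by omega, rfl⟩
  · rintro ⟨i, h1, h2, rfl⟩
    exact ⟨i - 1, by omega, by rw [Nat.sub_add_cancel h1]⟩

theorem length_tailList {F : ℕ → ℕ} {v j : ℕ} (hj : 4 ≤ j) : (tailList F v j).length = j - 2 := by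
  simp [tailList]
  omega

section

variable {N : ℕ} {F : ℕ → ℕ}

theorem PadGraph.iterate_le (G : PadGraph N F) {v : ℕ} (hv : v ≤ N) (i : ℕ) : F^[i] v ≤ N := by
  cases i with
  | zero => exact hv
  | succ i => rw [Function.iterate_succ_apply']; exact G.map_le _

/-- Up to a vertex of positive out-degree the iterates of `F` increase strictly. -/
theorem PadGraph.iterate_lt (G : PadGraph N F) {v m : ℕ} (hv : v ≤ N)
    (hm : 1 ≤ outDeg F (F^[m] v)) {i : ℕ} (hi : i ≤ m) : F^[i] v < F^[i + 1] v := by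
  by_contra h
  rw [Function.iterate_succ_apply'] at h
  have h1 := G.le_map _ (G.iterate_le hv i)
  have h2 : F (F^[i] v) = F^[i] v := by omega
  have h3 : ∀ k, F^[k] (F^[i] v) = F^[i] v := fun k => Function.iterate_fixed h2 k
  have h4 : F^[m] v = F^[i] v := by
    rw [← h3 (m - i), ← Function.iterate_add_apply, Nat.sub_add_cancel hi]
  rw [h4, outDeg, h2] at hm
  omega

theorem PadGraph.iterate_lt_of_lt (G : PadGraph N F) {v m : ℕ} (hv : v ≤ N)
    (hm : 1 ≤ outDeg F (F^[m] v)) {i k : ℕ} (hik : i < k) (hk : k ≤ m + 1) :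
    F^[i] v < F^[k] v := by
  induction k with
  | zero => omega
  | succ k ih =>
    have := G.iterate_lt hv hm (i := k) (by omega)
    rcases (by omega : i = k ∨ i < k) with rfl | h
    · exact this
    · exact (ih h (by omega)).trans this

theorem ExpOK.three_le {j v w : ℕ} (h : ExpOK F j v w) : 3 ≤ j := by
  rcases h.size with h | h | h <;> omega

theorem ExpOK.le (G : PadGraph N F) {j v w : ℕ} (h : ExpOK F j v w) : v ≤ N ∧ w ≤ N := by
  have h1 := h.lt
  have h2 := h.lt_map
  have h3 := G.map_le v
  omega

theorem ExpOK.length_expList {j v w : ℕ} (h : ExpOK F j v w) : (expList F v w j).length = j := by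
  unfold expList
  split_ifs with h1 h2
  · simp [h1]
  · simp [h2]
  · have := h.three_le
    rw [List.length_cons, List.length_cons, length_tailList (by omega)]
    omega

/-- `L` lists the vertices of a connected set in increasing order; it starts with `v, w`, ends with
`q`, and contains two neighbours of every vertex between `v` and `F p`, where `p` is the last vertex
but one. -/
structure GoodList (N : ℕ) (F : ℕ → ℕ) (v w p q : ℕ) (L : List ℕ) : Prop where
  head : ∃ T, L = v :: w :: T
  chain : L.IsChain fun a b => a < b ∧ b ≤ F a
  mem_last : q ∈ L
  pen_lt : p < q
  last_le : q ≤ F p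
  le_last : ∀ a ∈ L, a ≤ q
  two : ∀ x, v ≤ x → x ≤ F p → ∃ a ∈ L, ∃ b ∈ L, a < b ∧ Nbr F x a ∧ Nbr F x b

theorem isChain_iterList {v k : ℕ} (h : ∀ i, i < k → F^[i] v < F^[i + 1] v) :
    (v :: iterList F v k).IsChain fun a b => a < b ∧ b ≤ F a := by
  induction k with
  | zero => simp [iterList]
  | succ k ih =>
    rw [iterList_add, ← List.cons_append, List.isChain_append]
    refine ⟨ih fun i hi => h i (by omega), by simp [iterList], ?_⟩
    have hlast : (v :: iterList F v k).getLast? = some (F^[k] v) := by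
      cases k with
      | zero => simp [iterList]
      | succ k =>
        rw [iterList_add, ← List.cons_append, List.getLast?_append]
        simp only [iterList, List.range_one, List.map_cons, List.map_nil,
          List.getLast?_singleton, Option.some_or, Function.iterate_succ_apply',
          Function.iterate_zero, id_eq]
    intro x hx y hy
    rw [hlast] at hx
    simp only [Option.mem_def, Option.some.injEq] at hx
    subst hx
    simp only [iterList, List.range_one, List.map_cons, List.map_nil, List.head?_cons,
      Option.mem_def, Option.some.injEq] at hy
    subst hy
    have := h k (by omega)
    rw [Function.iterate_succ_apply'] at this
    simpa using this

theorem ExpOK.goodList_large (G : PadGraph N F) {m v w : ℕ} (hpos : 1 ≤ v) (hlt : v < w)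
    (hw : w < F v) (hm : 1 ≤ m) (hd : 2 ≤ outDeg F (F^[m] v)) :
    GoodList N F v w (F^[m + 1] v - 1) (F^[m + 1] v)
      (v :: w :: (iterList F v m ++ [F^[m + 1] v - 1, F^[m + 1] v])) := by
  have mono := G.mono
  have hvN : v ≤ N := by have := G.map_le v; omega
  have hlts : ∀ i, i ≤ m → F^[i] v < F^[i + 1] v := fun i hi => G.iterate_lt hvN (by omega) hi
  have hF : ∀ i, F^[i + 1] v = F (F^[i] v) := fun i => Function.iterate_succ_apply' F i v
  have hlast : F^[m] v + 2 ≤ F^[m + 1] v := by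
    rw [hF]
    unfold outDeg at hd
    omega
  obtain ⟨q, hq⟩ : ∃ q, q = F^[m + 1] v := ⟨_, rfl⟩
  rw [← hq] at hlast ⊢
  obtain ⟨c, hc⟩ : ∃ c, c = F^[m] v := ⟨_, rfl⟩
  have hqc : q = F c := by rw [hq, hc, hF]
  rw [← hc] at hlast
  have hqN := G.map_le c
  have hqF := G.le_map q (by omega)
  have mv : v ∈ v :: w :: (iterList F v m ++ [q - 1, q]) := by simp
  have mw : w ∈ v :: w :: (iterList F v m ++ [q - 1, q]) := by simp
  have mp : q - 1 ∈ v :: w :: (iterList F v m ++ [q - 1, q]) := by simp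
  have mq : q ∈ v :: w :: (iterList F v m ++ [q - 1, q]) := by simp
  have mi : ∀ i, i ≤ m → F^[i] v ∈ v :: w :: (iterList F v m ++ [q - 1, q]) := by
    intro i hi
    rcases Nat.eq_zero_or_pos i with rfl | h0
    · simp
    · refine List.mem_cons_of_mem _ (List.mem_cons_of_mem _ (List.mem_append_left _ ?_))
      exact mem_iterList.2 ⟨i, h0, hi, rfl⟩
  have mc := hc ▸ mi m le_rfl
  have hcpq := @mono c (q - 1) (by omega)
  have hup : ∀ i, i ≤ m → F^[i] v ≤ c := fun i hi => by
    rcases hi.eq_or_lt with rfl | hi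
    · rw [hc]
    · rw [hc]
      exact (G.iterate_lt_of_lt (m := m) (k := m) hvN (by omega) hi (by omega)).le
  have hFv : F v ≤ c := hup 1 hm
  refine ⟨⟨_, rfl⟩, ?_, mq, by omega, by omega, ?_, ?_⟩
  · have h1 := isChain_iterList (F := F) (v := v) (k := m) fun i hi => hlts i hi.le
    have hlast? : (iterList F v m).getLast? = some c := by
      obtain ⟨k, rfl⟩ : ∃ k, m = k + 1 := ⟨m - 1, by omega⟩
      rw [iterList_add, hc]
      simp [iterList, ← Function.iterate_succ_apply']
    have hhead? : (iterList F v m).head? = some (F v) := by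
      obtain ⟨k, rfl⟩ : ∃ k, m = 1 + k := ⟨m - 1, by omega⟩
      rw [iterList_add]
      simp [iterList]
    have h2 : (iterList F v m ++ [q - 1, q]).IsChain fun a b => a < b ∧ b ≤ F a := by
      rw [List.isChain_append]
      refine ⟨List.IsChain.tail h1, ?_, ?_⟩
      · simp only [List.isChain_cons_cons, List.isChain_singleton, and_true]
        omega
      · intro x hx y hy
        rw [hlast?] at hx
        simp only [Option.mem_def, Option.some.injEq, List.head?_cons] at hx hy
        subst hx hy
        omega
    have hwF := @mono v w hlt.le
    rw [List.isChain_cons_cons, List.isChain_cons]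
    refine ⟨⟨hlt, hw.le⟩, ?_, h2⟩
    intro y hy
    rw [List.head?_append, hhead?] at hy
    simp only [Option.some_or, Option.mem_def, Option.some.injEq] at hy
    subst hy
    omega
  · intro a ha
    simp only [List.mem_cons, List.mem_append, List.not_mem_nil, or_false] at ha
    rcases ha with rfl | rfl | ha | rfl | rfl
    · have := hup 0 (by omega)
      simp only [Function.iterate_zero, id_eq] at this
      omega
    · omega
    · obtain ⟨i, h1, h2, rfl⟩ := mem_iterList.1 ha
      have := hup i h2
      omega
    · omega
    · exact le_rfl
  · have low : ∀ k, 1 ≤ k → k ≤ m → ∀ x, v ≤ x → x < F^[k] v →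
        ∃ a ∈ v :: w :: (iterList F v m ++ [q - 1, q]),
        ∃ b ∈ v :: w :: (iterList F v m ++ [q - 1, q]), a < b ∧ Nbr F x a ∧ Nbr F x b := by
      intro k h1
      induction k, h1 using Nat.le_induction with
      | base =>
        intro _ x hx hx'
        have hx' : x < F v := hx'
        have mF := mi 1 hm
        simp only [Function.iterate_one] at mF
        have := @mono v x hx
        rcases hx.eq_or_lt with rfl | hx
        · exact ⟨w, mw, F v, mF, hw, .inl ⟨hlt, hw.le⟩, .inl ⟨by omega, le_rfl⟩⟩
        · exact ⟨v, mv, F v, mF, by omega, .inr ⟨hx, hx'.le⟩, .inl ⟨hx', this⟩⟩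
      | succ k h1 ih =>
        intro hk x hx hx'
        have e1 := hlts k (by omega)
        have e2 := hlts (k - 1) (by omega)
        have e3 := hF k
        have e4 := hF (k - 1)
        rw [Nat.sub_add_cancel h1] at e2 e4
        rcases lt_trichotomy x (F^[k] v) with h | h | h
        · exact ih (by omega) x hx h
        · exact ⟨_, mi (k - 1) (by omega), _, mi (k + 1) hk, by omega,
            .inr ⟨by omega, by omega⟩, .inl ⟨by omega, by rw [h]; omega⟩⟩
        · have := @mono (F^[k] v) x h.le
          exact ⟨_, mi k (by omega), _, mi (k + 1) hk, e1, .inr ⟨h, by omega⟩,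
            .inl ⟨hx', by omega⟩⟩
    intro x hx hx'
    rcases lt_or_ge x c with h | h
    · exact low m hm le_rfl x hx (hc ▸ h)
    have hmc := @mono c x h
    rcases h.eq_or_lt with h | h
    · have e2 := hlts (m - 1) (by omega)
      have e4 := hF (m - 1)
      rw [Nat.sub_add_cancel hm, ← hc] at e2 e4
      exact ⟨_, mi (m - 1) (by omega), q, mq, by omega, .inr ⟨by omega, by omega⟩,
        .inl ⟨by omega, by omega⟩⟩
    by_cases h3 : x < q
    · exact ⟨c, mc, q, mq, by omega, .inr ⟨h, by omega⟩, .inl ⟨h3, by omega⟩⟩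
    by_cases h4 : x = q
    · exact ⟨c, mc, q - 1, mp, by omega, .inr ⟨h, by omega⟩, .inr ⟨by omega, by omega⟩⟩
    · have := @mono (q - 1) q (by omega)
      exact ⟨q - 1, mp, q, mq, by omega, .inr ⟨by omega, hx'⟩, .inr ⟨by omega, by omega⟩⟩

/-- An expansive set contains two neighbours of every vertex from its first one up to the last
neighbour of its last vertex but one. -/
theorem ExpOK.goodList (G : PadGraph N F) {j v w : ℕ} (h : ExpOK F j v w) :
    GoodList N F v w (penLast F j v w).1 (penLast F j v w).2 (expList F v w j) := by
  obtain ⟨hpos, hlt, hw, hsize⟩ := h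
  have mono := G.mono
  have m1 := @mono v w hlt.le
  have m2 := @mono w (F v) hw.le
  have hvN := G.map_le v
  have hwN := G.map_le w
  have hFv := G.le_map _ hvN
  have hFw := G.le_map _ hwN
  rcases hsize with rfl | ⟨rfl, h4⟩ | ⟨h5, hd⟩
  · simp only [penLast, expList, if_pos]
    refine ⟨⟨_, rfl⟩, by simp; omega, by simp, hw, by omega, by simp; omega,
      fun x h1 h2 => ?_⟩
    have e1 := @mono v x h1
    by_cases c1 : x = v
    · exact ⟨w, by simp, F v, by simp, hw, .inl (by omega), .inl (by subst c1; omega)⟩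
    by_cases c2 : x < F v
    · by_cases c3 : x ≤ w
      · exact ⟨v, by simp, F v, by simp, by omega, .inr (by omega), .inl (by omega)⟩
      · exact ⟨v, by simp, w, by simp, by omega, .inr (by omega), .inr (by omega)⟩
    by_cases c3 : x = F v
    · exact ⟨v, by simp, w, by simp, by omega, .inr (by omega), .inr (by omega)⟩
    · exact ⟨w, by simp, F v, by simp, by omega, .inr (by omega), .inr (by omega)⟩
  · simp only [penLast, expList]
    simp only [show ¬ (4 = 3) by omega, if_false, if_true]
    obtain ⟨c, hc⟩ : ∃ c, c = min (F v) (F w - 1) := ⟨_, rfl⟩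
    rw [← hc]
    have e2 := @mono w c (by omega)
    have e3 := @mono c (F w) (by omega)
    refine ⟨⟨_, rfl⟩, by simp; omega, by simp, by omega, by omega, by simp; omega,
      fun x h1 h2 => ?_⟩
    have e1 := @mono v x h1
    by_cases c1 : x = v
    · exact ⟨w, by simp, c, by simp, by omega, .inl (by omega), .inl (by omega)⟩
    by_cases c2 : x ≤ w
    · exact ⟨v, by simp, c, by simp, by omega, .inr (by omega), .inl (by omega)⟩
    by_cases c3 : x ≤ c
    · exact ⟨v, by simp, w, by simp, by omega, .inr (by omega), .inr (by omega)⟩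
    by_cases c4 : x ≤ F w
    · exact ⟨w, by simp, c, by simp, by omega, .inr (by omega), .inr (by omega)⟩
    · exact ⟨c, by simp, F w, by simp, by omega, .inr (by omega), .inr (by omega)⟩
  · have := ExpOK.goodList_large G hpos hlt hw (m := j - 4) (by omega) hd
    rw [show j - 4 + 1 = j - 3 by omega] at this
    simp only [penLast, expList, if_neg (show ¬ j = 3 by omega), if_neg (show ¬ j = 4 by omega),
      tailList]
    exact this

/-- A set whose elements, in increasing order, are linked by edges is connected. -/
theorem connected_of_chain {n : ℕ} {L : List ℕ} (hne : L ≠ [])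
    (hc : L.IsChain fun a b => a < b ∧ b ≤ F a) (hL : ∀ a ∈ L, 1 ≤ a ∧ a ≤ n) :
    ((underlying n F).induce {a | a ∈ L}).Connected := by
  rw [SimpleGraph.connected_iff_exists_forall_reachable]
  have key : ∀ i, (hi : i < L.length) →
      ((underlying n F).induce {a | a ∈ L}).Reachable
        ⟨L[0]'(by omega), List.getElem_mem _⟩ ⟨L[i], List.getElem_mem _⟩ := by
    intro i
    induction i with
    | zero => exact fun _ => SimpleGraph.Reachable.refl _
    | succ i ih =>
      intro hi
      refine (ih (by omega)).trans (SimpleGraph.Adj.reachable ?_)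
      have h := List.isChain_iff_getElem.1 hc i hi
      have h1 := hL _ (List.getElem_mem (show i < L.length by omega))
      have h2 := hL _ (List.getElem_mem hi)
      simp only [underlying, SimpleGraph.comap_adj, SimpleGraph.fromRel_adj,
        Function.Embedding.subtype_apply]
      exact ⟨by omega, .inl ⟨h1.1, h.1, h2.2, h.2⟩⟩
  refine ⟨⟨L[0]'(List.length_pos_of_ne_nil hne), List.getElem_mem _⟩, fun ⟨a, ha⟩ => ?_⟩
  obtain ⟨i, hi, rfl⟩ := List.getElem_of_mem ha
  exact key i hi

theorem GoodList.pairwise {v w p q : ℕ} {L : List ℕ} (h : GoodList N F v w p q L) :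
    L.Pairwise (· < ·) := by
  have : L.IsChain (· < ·) := h.chain.imp fun _ _ h => h.1
  exact List.isChain_iff_pairwise.1 this

theorem GoodList.first_le {v w p q : ℕ} {L : List ℕ} (h : GoodList N F v w p q L) :
    ∀ a ∈ L, v ≤ a := by
  obtain ⟨T, rfl⟩ := h.head
  have := h.pairwise
  rw [List.pairwise_cons] at this
  intro a ha
  rcases List.mem_cons.1 ha with rfl | ha
  · exact le_rfl
  · exact (this.1 a ha).le

theorem ExpOK.last_le (G : PadGraph N F) {j v w : ℕ} (h : ExpOK F j v w) :
    (penLast F j v w).2 ≤ N :=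
  (h.goodList G).last_le.trans (G.map_le _)

/-! ### Extensions in arithmetical terms -/

/-- The `i`-th vertex of an expansive set, counted from `1`. -/
def expSeq (F : ℕ → ℕ) (v w j i : ℕ) : ℕ := (expList F v w j).getD (i - 1) 0

theorem ExpOK.image_expSeq {j v w : ℕ} (h : ExpOK F j v w) :
    expSeq F v w j '' Set.Icc 1 j = {a | a ∈ expList F v w j} := by
  have hl := h.length_expList
  ext a
  simp only [Set.mem_image, Set.mem_Icc, Set.mem_ofPred_eq, expSeq]
  constructor
  · rintro ⟨i, hi, rfl⟩
    rw [List.getD_eq_getElem _ _ (by omega)]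
    exact List.getElem_mem _
  · intro ha
    obtain ⟨i, hi, rfl⟩ := List.getElem_of_mem ha
    refine ⟨i + 1, by omega, ?_⟩
    rw [Nat.add_sub_cancel, List.getD_eq_getElem _ _ hi]

theorem ExpOK.isExpansive (G : PadGraph N F) {j v w : ℕ} (h : ExpOK F j v w) :
    IsExpansive N F j (expSeq F v w j) := by
  have hl := h.length_expList
  have hg := h.goodList G
  have hN := h.last_le G
  have hget : ∀ i, 1 ≤ i → i ≤ j → ∃ hi : i - 1 < (expList F v w j).length,
      expSeq F v w j i = (expList F v w j)[i - 1] := fun i h1 h2 =>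
    ⟨by omega, List.getD_eq_getElem _ _ (by omega)⟩
  have hlarge : 5 ≤ j → ∀ i, 3 ≤ i → i + 2 ≤ j → expSeq F v w j i = F^[i - 2] v := by
    intro h5 i h1 h2
    unfold expSeq expList
    rw [if_neg (by omega), if_neg (by omega)]
    obtain ⟨k, rfl⟩ : ∃ k, i = k + 3 := ⟨i - 3, by omega⟩
    simp only [List.getD_cons_succ, tailList, show k + 3 - 1 = k + 1 + 1 by omega]
    rw [List.getD_append _ _ _ _ (by simp; omega), List.getD_eq_getElem _ _ (by simp; omega)]
    simp [iterList]
  have hpen : 5 ≤ j → expSeq F v w j (j - 1) = F^[j - 3] v - 1 := by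
    intro h5
    unfold expSeq expList
    rw [if_neg (by omega), if_neg (by omega)]
    obtain ⟨k, rfl⟩ : ∃ k, j = k + 4 := ⟨j - 4, by omega⟩
    simp only [List.getD_cons_succ, tailList, show k + 4 - 1 - 1 = k + 1 + 1 by omega]
    rw [List.getD_append_right _ _ _ _ (by simp)]
    simp
  have hlast : 5 ≤ j → expSeq F v w j j = F^[j - 3] v := by
    intro h5
    unfold expSeq expList
    rw [if_neg (by omega), if_neg (by omega)]
    obtain ⟨k, rfl⟩ : ∃ k, j = k + 4 := ⟨j - 4, by omega⟩
    simp only [List.getD_cons_succ, tailList, show k + 4 - 1 = k + 1 + 1 + 1 by omega]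
    rw [List.getD_append_right _ _ _ _ (by simp)]
    simp
  have h1 : expSeq F v w j 1 = v := by unfold expSeq expList; split_ifs <;> simp
  refine ⟨h.three_le, fun i hi hij => ?_, ?_, ?_, fun hj => ?_, ?_, fun i h4 h5 => ?_, ?_, ?_⟩
  · obtain ⟨h2, h3⟩ := hget i hi hij
    rw [h3]
    have := hg.first_le _ (List.getElem_mem h2)
    have := hg.le_last _ (List.getElem_mem h2)
    have := h.pos
    omega
  · intro a ha b hb hab
    obtain ⟨h2, h3⟩ := hget a ha.1 ha.2
    obtain ⟨h4, h5⟩ := hget b hb.1 hb.2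
    rw [h3, h5]
    exact List.pairwise_iff_getElem.1 hg.pairwise _ _ h2 h4 (by have := ha.1; omega)
  · rw [h.image_expSeq]
    refine connected_of_chain ?_ hg.chain fun a ha => ?_
    · obtain ⟨T, hT⟩ := hg.head
      rw [hT]
      simp
    · have := hg.first_le a ha
      have := hg.le_last a ha
      have := h.pos
      omega
  · rcases (by have := h.three_le; omega : j = 3 ∨ 5 ≤ j) with rfl | h5
    · simp [expSeq, expList]
    · rcases h5.eq_or_lt with rfl | h6
      · rw [hlarge le_rfl 3 le_rfl le_rfl, h1]
        rfl
      · rw [hlarge h5 3 le_rfl (by omega), h1]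
        rfl
  · rintro rfl
    simp [expSeq, expList]
  · rw [hlarge (by omega) i (by omega) h5, h1]
  · rcases (by have := h.three_le; omega : j = 3 ∨ j = 4 ∨ 5 ≤ j) with rfl | rfl | h5
    · simp [expSeq, expList]
    · simp [expSeq, expList]
    · rw [hlast h5, hlarge h5 (j - 2) (by omega) (by omega), ← Function.iterate_succ_apply' F]
      congr 1
      omega
  · intro h5
    rw [hpen h5, hlast h5]

theorem expSeq_one (F : ℕ → ℕ) (v w j : ℕ) : expSeq F v w j 1 = v := by
  unfold expSeq expList; split_ifs <;> simp

theorem expSeq_two (F : ℕ → ℕ) (v w j : ℕ) : expSeq F v w j 2 = w := by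
  unfold expSeq expList; split_ifs <;> simp

theorem IsExpansive.expOK {j : ℕ} {s : ℕ → ℕ} (h : IsExpansive N F j s) :
    ExpOK F j (s 1) (s 2) ∧ penLast F j (s 1) (s 2) = (s (j - 1), s j) := by
  have h3 := h.three_le
  have lt : ∀ i k, 1 ≤ i → i < k → k ≤ j → s i < s k := fun i k h1 h2 h3 =>
    h.strictMono ⟨h1, by omega⟩ ⟨by omega, h3⟩ h2
  have l1 := lt 1 2 le_rfl (by omega) (by omega)
  have l2 := lt 2 3 (by omega) (by omega) h3
  have pos := (h.mem 1 le_rfl (by omega)).1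
  rcases (by omega : j = 3 ∨ j = 4 ∨ 5 ≤ j) with rfl | rfl | h5
  · have := h.third (by omega)
    exact ⟨⟨pos, l1, by omega, .inl rfl⟩, by simp [penLast, this]⟩
  · have h4 := h.third_of_four rfl
    have hl : s 4 = F (s 2) := h.last
    have l3 := lt 3 4 (by omega) (by omega) le_rfl
    refine ⟨⟨pos, l1, by omega, .inr (.inl ⟨rfl, by omega⟩)⟩, ?_⟩
    simp [penLast, h4, hl]
  · have ht := h.third (by omega)
    have hm : s (j - 2) = F^[j - 4] (s 1) := by
      rcases h5.eq_or_lt with rfl | h6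
      · exact ht
      · exact h.middle (j - 2) (by omega) (by omega)
    have hl : s j = F^[j - 3] (s 1) := by
      rw [h.last, hm, ← Function.iterate_succ_apply' F]
      congr 1
      omega
    have l3 := lt (j - 2) (j - 1) (by omega) (by omega) (by omega)
    have l4 := lt (j - 1) j (by omega) (by omega) (by omega)
    refine ⟨⟨pos, l1, by omega, .inr (.inr ⟨h5, ?_⟩)⟩, ?_⟩
    · rw [← hm, outDeg, ← h.last]
      omega
    · rw [penLast, if_neg (by omega), if_neg (by omega), ← hl, h.penultimate h5]

theorem isExtension_iff (G : PadGraph N F) {j v w x y : ℕ} :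
    IsExtension N F j v w x y ↔ Ext F j v w x y := by
  constructor
  · rintro ⟨s, hs, rfl, rfl, j', s', hs', rfl, rfl, hfar, heq⟩
    obtain ⟨h1, h2⟩ := hs.expOK
    obtain ⟨h3, -⟩ := hs'.expOK
    exact ⟨h1, h3.lt, h3.lt_map, by rw [h2]; exact hfar, by rw [h2]; exact heq⟩
  · intro h
    have h1 := h.ok.isExpansive G
    have hx : ExpOK F 3 x y :=
      ⟨by have := h.far; omega, h.lt, h.lt_map, .inl rfl⟩
    have h2 := h1.expOK.2
    rw [expSeq_one, expSeq_two] at h2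
    refine ⟨_, h1, expSeq_one .., expSeq_two .., 3, _, hx.isExpansive G, expSeq_one ..,
      expSeq_two .., ?_, ?_⟩
    · have := h.far
      rwa [h2] at this
    · have := h.eq
      rwa [h2] at this

end

/-! ### Paths of `R` and the sets that they encode -/

section

variable {N : ℕ} {F : ℕ → ℕ}

theorem isRPath_nil_iff {a b : RVertex} : IsRPath N F a b [] ↔ a = b := by
  constructor
  · intro h
    cases h
    rfl
  · rintro rfl
    exact .nil a

theorem isRPath_cons_iff {a b : RVertex} {e : REdge} {P : List REdge} :
    IsRPath N F a b (e :: P) ↔ e.src = a ∧ IsREdge N F e ∧ IsRPath N F e.tgt b P := by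
  constructor
  · intro h
    cases h with
    | cons he hP => exact ⟨rfl, he, hP⟩
  · rintro ⟨rfl, he, hP⟩
    exact .cons he hP

theorem IsRPath.append {a b c : RVertex} {P Q : List REdge} (h : IsRPath N F a b P)
    (h' : IsRPath N F b c Q) : IsRPath N F a c (P ++ Q) := by
  induction h with
  | nil => exact h'
  | cons he _ ih => exact .cons he (ih h')

@[simp] theorem pathWeight_nil : pathWeight [] = 0 := rfl

@[simp] theorem pathWeight_cons (e : REdge) (P : List REdge) :
    pathWeight (e :: P) = e.weight + pathWeight P := by
  simp [pathWeight]

@[simp] theorem pathWeight_append (P Q : List REdge) :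
    pathWeight (P ++ Q) = pathWeight P + pathWeight Q := by
  simp [pathWeight]

/-- The first coordinate of a vertex of `R`; the sink lies beyond all others. -/
def rpos (N : ℕ) : RVertex → ℕ
  | .node v _ _ => v
  | .sink => N + 1

theorem PadGraph.add_le_iterate (G : PadGraph N F) {v m : ℕ} (hv : v ≤ N)
    (hm : 1 ≤ outDeg F (F^[m] v)) {i : ℕ} (hi : i ≤ m + 1) : v + i ≤ F^[i] v := by
  induction i with
  | zero => simp
  | succ i ih =>
    have := G.iterate_lt hv hm (i := i) (by omega)
    have := ih (by omega)
    omega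

theorem ExpOK.add_le_last (G : PadGraph N F) {j v w : ℕ} (h : ExpOK F j v w) :
    v + j ≤ (penLast F j v w).2 + 1 := by
  have hvN := (h.le G).1
  have h1 := h.lt
  have h2 := h.lt_map
  rcases h.size with rfl | ⟨rfl, h4⟩ | ⟨h5, hd⟩
  · simp only [penLast, if_pos]
    omega
  · simp only [penLast, if_neg (show ¬ (4 = 3) by omega), if_true]
    omega
  · simp only [penLast, if_neg (show ¬ j = 3 by omega), if_neg (show ¬ j = 4 by omega)]
    obtain ⟨k, rfl⟩ : ∃ k, j = k + 5 := ⟨j - 5, by omega⟩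
    simp only [show k + 5 - 4 = k + 1 by omega, show k + 5 - 3 = k + 1 + 1 by omega] at hd ⊢
    rw [Function.iterate_succ_apply] at hd
    have h6 := G.add_le_iterate (v := F v) (m := k) (i := k) (G.map_le v) (by omega) (by omega)
    rw [Function.iterate_succ_apply', Function.iterate_succ_apply]
    unfold outDeg at hd
    omega

theorem Ext.add_le (G : PadGraph N F) {j v w x y : ℕ} (h : Ext F j v w x y) : v + j ≤ x := by
  have h1 := h.ok.add_le_last G
  have h2 := h.far
  have h3 := G.le_map _ (h.ok.last_le G)
  omega

theorem IsArc.le {v w : ℕ} (h : IsArc N F v w) : 1 ≤ v ∧ v < w ∧ w ≤ N ∧ w ≤ F v := h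

/-- The weight of an edge of `R` is at most the distance of its ends. -/
theorem IsREdge.weight_le (G : PadGraph N F) {e : REdge} (h : IsREdge N F e) :
    1 ≤ e.weight ∧ rpos N e.src + e.weight ≤ rpos N e.tgt := by
  have h6 := G.six_le
  cases h with
  | small big hj h =>
    have := ((isExtension_iff G).1 h).add_le G
    exact ⟨by simp only; omega, this⟩
  | large big hκ h =>
    have := ((isExtension_iff G).1 h).add_le G
    exact ⟨by simp only; omega, this⟩
  | @compact v w κ h hw hκ =>
    have := h.le
    have := G.add_le_iterate (v := v) (m := κ) (i := κ) (by omega) (by have := hκ.2.1; omega)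
      (by omega)
    exact ⟨hκ.1, this⟩
  | last => exact ⟨by simp only; omega, by simp only [rpos]; omega⟩

theorem IsRPath.weight_le (G : PadGraph N F) {a b : RVertex} {P : List REdge}
    (h : IsRPath N F a b P) : P.length ≤ pathWeight P ∧ rpos N a + pathWeight P ≤ rpos N b := by
  induction h with
  | nil => simp
  | cons he _ ih =>
    have := he.weight_le G
    simp only [pathWeight_cons, List.length_cons]
    omega

theorem PadGraph.rAcyclic (G : PadGraph N F) : RAcyclic N F := by
  intro a P h
  have := h.weight_le G
  exact List.eq_nil_of_length_eq_zero (by omega)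

/-! ### From sequences of expansive sets to paths -/

theorem penLast_add {v w w' κ j : ℕ} (hj : 5 ≤ j) :
    penLast F (κ + j) v w = penLast F j (F^[κ] v) w' := by
  rw [penLast, if_neg (by omega), if_neg (by omega), penLast, if_neg (by omega), if_neg (by omega),
    ← Function.iterate_add_apply, show j - 3 + κ = κ + j - 3 by omega]

/-- A large expansive set corresponds to a sequence of compact edges, one for each `F^[i] v` with
`1 ≤ i < j - 4` that has at least two out-neighbours, followed by a regular edge. -/
theorem Ext.exists_path (G : PadGraph N F) {x y : ℕ} (big : Bool) (j : ℕ) : ∀ v w, 5 ≤ j →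
    Ext F j v w x y →
    ∃ P, IsRPath N F (.node v w true) (.node x y big) P ∧ pathWeight P = j := by
  induction j using Nat.strong_induction_on with
  | _ j ih =>
    intro v w h5 h
    have hd : 2 ≤ outDeg F (F^[j - 4] v) := by
      rcases h.ok.size with h | h | h
      · omega
      · omega
      · exact h.2
    obtain ⟨κ, hκ⟩ : ∃ κ, IsWidth F v κ := by
      have hex : ∃ κ, 1 ≤ κ ∧ 2 ≤ outDeg F (F^[κ] v) := ⟨j - 4, by omega, hd⟩
      classical
      refine ⟨Nat.find hex, (Nat.find_spec hex).1, (Nat.find_spec hex).2, fun k h1 h2 => ?_⟩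
      have := Nat.find_min hex h2
      omega
    have hle : κ ≤ j - 4 := by
      by_contra hlt
      have := hκ.2.2 (j - 4) (by omega) (by omega)
      omega
    have hκ1 := hκ.1
    rcases hle.eq_or_lt with rfl | hlt
    · have hj : j - 4 + 4 = j := by omega
      have := IsREdge.large big hκ (by rw [hj]; exact (isExtension_iff G).2 h)
      exact ⟨_, .cons this (.nil _), by simp [hj]⟩
    · have hwN := h.ok.le G
      have hlm := h.ok.lt_map
      have hc : IsREdge N F _ := IsREdge.compact (v := v) (w := w) (κ := κ)
        ⟨h.ok.pos, h.ok.lt, hwN.2, hlm.le⟩ (by omega) hκ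
      have hz := hκ.2.1
      have hz1 := G.add_le_iterate (v := v) (i := κ) hwN.1 (by omega : 1 ≤ outDeg F (F^[κ] v))
        (by omega)
      obtain ⟨i, rfl⟩ : ∃ i, j = κ + i := ⟨j - κ, by omega⟩
      have hext : Ext F i (F^[κ] v) (F^[κ] v + 1) x y := by
        have hp := penLast_add (F := F) (v := v) (w := w) (w' := F^[κ] v + 1) (κ := κ) (j := i)
          (by omega)
        refine ⟨⟨?_, by omega, by unfold outDeg at hz; omega, .inr (.inr ⟨by omega, ?_⟩)⟩, h.lt,
          h.lt_map, ?_, ?_⟩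
        · have := h.ok.pos
          omega
        · rw [← Function.iterate_add_apply, show i - 4 + κ = κ + i - 4 by omega]
          exact hd
        · rw [← hp]; exact h.far
        · rw [← hp]; exact h.eq
      obtain ⟨P, hP, hw⟩ := ih i (by omega) _ _ (by omega) hext
      exact ⟨_, .cons hc hP, by simp [hw]⟩

/-- Small expansive sets correspond to edges that leave lower vertices, large ones to paths that leave
upper vertices. -/
theorem Chain.exists_path (G : PadGraph N F) {v w k : ℕ} (h : Chain N F v w k) :
    ∃ b P, IsRPath N F (.node v w b) .sink P ∧ pathWeight P = k := by
  induction h with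
  | last => exact ⟨false, _, .cons .last (.nil _), rfl⟩
  | @step j v w x y k h hc ih =>
    obtain ⟨b, P, hP, hk⟩ := ih
    by_cases hj : 5 ≤ j
    · obtain ⟨Q, hQ, hj⟩ := h.exists_path G b j v w hj
      exact ⟨true, Q ++ P, hQ.append hP, by simp [hj, hk]⟩
    · have h3 := h.ok.three_le
      exact ⟨false, _, .cons (.small b (by omega) ((isExtension_iff G).2 h)) hP, by simp [hk]⟩

theorem Chain.exists_path_source (G : PadGraph N F) {k : ℕ} (h : Chain N F 1 2 k) :
    ∃ P, IsRPath N F (.node 1 2 false) .sink P ∧ pathWeight P = k := by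
  obtain ⟨b, P, hP, hk⟩ := h.exists_path G
  cases b with
  | false => exact ⟨P, hP, hk⟩
  | true =>
    exfalso
    have h1 := G.first 1 (by omega)
    have h3 := G.first 3 (by omega)
    have hit : ∀ i, 1 ≤ i → outDeg F (F^[i] 1) = 0 := by
      intro i hi
      obtain ⟨i, rfl⟩ : ∃ k, i = k + 1 := ⟨i - 1, by omega⟩
      rw [Function.iterate_succ_apply, h1, Function.iterate_fixed h3, outDeg, h3]
    cases P with
    | nil => cases isRPath_nil_iff.1 hP
    | cons e P =>
      obtain ⟨hs, he, -⟩ := isRPath_cons_iff.1 hP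
      cases he with
      | small => simp at hs
      | large big hκ h =>
        simp only [RVertex.node.injEq] at hs
        obtain ⟨rfl, -⟩ := hs
        have := hit _ hκ.1
        have := hκ.2.1
        omega
      | compact h hw hκ =>
        simp only [RVertex.node.injEq] at hs
        obtain ⟨rfl, -⟩ := hs
        have := hit _ hκ.1
        have := hκ.2.1
        omega
      | last => simp at hs

/-! ### From paths to sets -/

/-- The vertices that the edge `e` of a path contributes to the encoded set.  The flag `fresh` tells
that the preceding edge is regular, so that `e` starts a new block. -/
def edgeOut (F : ℕ → ℕ) (fresh : Bool) (e : REdge) : List ℕ :=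
  match e.src with
  | .sink => []
  | .node v w false => expList F v w e.weight
  | .node v w true => (if fresh then [v, w] else []) ++
      (if e.compact then iterList F v e.weight else tailList F v e.weight)

/-- The set that a path encodes, in increasing order. -/
def pathOut (F : ℕ → ℕ) : Bool → List REdge → List ℕ
  | _, [] => []
  | fresh, e :: P => edgeOut F fresh e ++ pathOut F (!e.compact) P

/-- A path that starts in an upper vertex consists of compact edges, a regular edge, and a path
that starts where the extension starts. -/
theorem IsRPath.split_upper (G : PadGraph N F) (P : List REdge) : ∀ v w,
    IsRPath N F (.node v w true) .sink P →
    ∃ C r P' j x y b, P = C ++ [r] ++ P' ∧ (∀ e ∈ C, e.compact = true) ∧ r.compact = false ∧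
      (C ++ [r]).head?.map REdge.src = some (.node v w true) ∧ pathWeight (C ++ [r]) = j ∧
      5 ≤ j ∧ Ext F j v w x y ∧ IsRPath N F (.node x y b) .sink P' ∧
      pathOut F false P = tailList F v j ++ pathOut F true P' := by
  induction P with
  | nil => intro v w h; cases isRPath_nil_iff.1 h
  | cons e P ih =>
    intro v w h
    obtain ⟨hs, he, hP⟩ := isRPath_cons_iff.1 h
    cases he with
    | small => simp at hs
    | last => simp at hs
    | @large v w x y κ big hκ hx =>
      simp only [RVertex.node.injEq, and_true] at hs
      obtain ⟨rfl, rfl⟩ := hs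
      refine ⟨[], _, P, κ + 4, x, y, big, rfl, by simp, rfl, rfl, by simp, ?_,
        (isExtension_iff G).1 hx, hP, by simp [pathOut, edgeOut]⟩
      have := hκ.1
      omega
    | @compact v w κ hx hw hκ =>
      simp only [RVertex.node.injEq, and_true] at hs
      obtain ⟨rfl, rfl⟩ := hs
      obtain ⟨C, r, P', j, x, y, b, rfl, hC, hr, -, hj, h5, hext, hP', hout⟩ := ih _ _ hP
      have ha := hx.le
      have hp := penLast_add (F := F) (v := v) (w := w) (w' := F^[κ] v + 1) (κ := κ) (j := j) h5
      have hd : 2 ≤ outDeg F (F^[j - 4] (F^[κ] v)) := by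
        rcases hext.ok.size with h | h | h
        · omega
        · omega
        · exact h.2
      refine ⟨_ :: C, r, P', κ + j, x, y, b, rfl, by simpa using hC, hr, rfl, ?_, by omega, ?_,
        hP', ?_⟩
      · simp only [List.cons_append, pathWeight_cons, hj]
      · refine ⟨⟨ha.1, ha.2.1, by omega, .inr (.inr ⟨by omega, ?_⟩)⟩, hext.lt, hext.lt_map, ?_, ?_⟩
        · rwa [← Function.iterate_add_apply, show j - 4 + κ = κ + j - 4 by omega] at hd
        · rw [hp]; exact hext.far
        · rw [hp]; exact hext.eq
      · simp only [List.append_assoc, List.cons_append, List.nil_append] at hout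
        simp only [List.cons_append, pathOut, edgeOut, Bool.false_eq_true, if_false, if_true,
          List.nil_append, Bool.not_true, hout, List.append_assoc]
        rw [← List.append_assoc]
        congr 1
        rw [tailList, tailList, show κ + j - 4 = κ + (j - 4) by omega, iterList_add,
          ← Function.iterate_add_apply, show j - 3 + κ = κ + j - 3 by omega, List.append_assoc]

/-- A path to the sink is a single edge, or starts with a piece that stands for an expansive set
that is extended by the rest of the path. -/
theorem IsRPath.split (G : PadGraph N F) {P : List REdge} {v w : ℕ} {b : Bool}
    (h : IsRPath N F (.node v w b) .sink P) :
    (v = N - 2 ∧ w = N - 1 ∧ P = [⟨.node (N - 2) (N - 1) false, .sink, 3, false⟩]) ∨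
    ∃ C r P' j x y b', P = C ++ [r] ++ P' ∧ (∀ e ∈ C, e.compact = true) ∧ r.compact = false ∧
      (C ++ [r]).head?.map REdge.src = some (.node v w b) ∧ pathWeight (C ++ [r]) = j ∧
      Ext F j v w x y ∧ IsRPath N F (.node x y b') .sink P' ∧
      pathOut F true P = expList F v w j ++ pathOut F true P' := by
  cases P with
  | nil => cases isRPath_nil_iff.1 h
  | cons e P =>
    obtain ⟨hs, he, hP⟩ := isRPath_cons_iff.1 h
    cases b with
    | true =>
      right
      obtain ⟨C, r, P', j, x, y, b', h1, h2, h3, h4, h5, h6, h7, h8, h9⟩ :=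
        IsRPath.split_upper G _ v w h
      refine ⟨C, r, P', j, x, y, b', h1, h2, h3, h4, h5, h7, h8, ?_⟩
      have : ∀ fresh, edgeOut F fresh e = (if fresh then [v, w] else []) ++
          (if e.compact then iterList F v e.weight else tailList F v e.weight) := by
        intro fresh
        simp only [edgeOut, hs]
      rw [pathOut, this] at h9 ⊢
      have hE : expList F v w j = v :: w :: tailList F v j := by
        unfold expList
        rw [if_neg (by omega), if_neg (by omega)]
      simp only [Bool.false_eq_true, if_false, List.nil_append] at h9
      simp only [if_true, List.cons_append, List.nil_append, hE, h9]
    | false =>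
      cases he with
      | large => simp at hs
      | compact => simp at hs
      | last =>
        left
        simp only [RVertex.node.injEq, and_true] at hs
        refine ⟨hs.1.symm, hs.2.symm, ?_⟩
        cases P with
        | nil => rfl
        | cons e P =>
          obtain ⟨hs, he, -⟩ := isRPath_cons_iff.1 hP
          cases he <;> simp at hs
      | @small v w x y j big hj hx =>
        simp only [RVertex.node.injEq, and_true] at hs
        obtain ⟨rfl, rfl⟩ := hs
        right
        exact ⟨[], _, P, j, x, y, big, rfl, by simp, rfl, rfl, by simp, (isExtension_iff G).1 hx,
          hP, by simp [pathOut, edgeOut]⟩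

/-- `P` starts in a vertex of `R` that comes from the edge `vw` and leads to the sink, and it encodes
a set with blocks `Bs` that contains two neighbours of every vertex from `v` on.  In this form the
statement can be proved by induction on the number of blocks. -/
structure Decoded (N : ℕ) (F : ℕ → ℕ) (P : List REdge) (v w : ℕ) (Bs : List (Set ℕ)) : Prop where
  decodes : DecodesTo N F P Bs
  mem_iff : ∀ x, x ∈ pathOut F true P ↔ ∃ B ∈ Bs, x ∈ B
  connected : ∀ B ∈ Bs, ((underlying N F).induce B).Connected
  far : Bs.Pairwise fun A B => ∀ a ∈ A, ∀ b ∈ B, F a < b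
  length : (pathOut F true P).length = pathWeight P
  pairwise : (pathOut F true P).Pairwise (· < ·)
  bounds : ∀ a ∈ pathOut F true P, v ≤ a ∧ a ≤ N
  first_mem : v ∈ pathOut F true P
  second_mem : w ∈ pathOut F true P
  two : ∀ p, v ≤ p → p ≤ N →
    ∃ a ∈ pathOut F true P, ∃ b ∈ pathOut F true P, a < b ∧ Nbr F p a ∧ Nbr F p b

theorem extPair_le (p q : ℕ) :
    (extPair F p q).1 ≤ F (F p + 1) ∧ (extPair F p q).2 ≤ F (F q + 1) ∨
      F (F q + 1) < F (F p + 1) := by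
  by_cases h : F (F q + 1) < F (F p + 1)
  · exact .inr h
  · left
    unfold extPair
    simp only
    split_ifs <;> simp only <;> omega

/-- Every path to the sink encodes a set that is total `2`-dominating from its first vertex on: the
vertices between two blocks have their neighbours in the last two vertices of the first block and the
first two vertices of the second one, as the extension is chosen within reach. -/
theorem IsRPath.decoded (G : PadGraph N F) (n : ℕ) : ∀ (P : List REdge) (v w : ℕ) (b : Bool),
    P.length ≤ n → IsRPath N F (.node v w b) .sink P → ∃ Bs, Decoded N F P v w Bs := by
  have h6 := G.six_le
  induction n with
  | zero =>
    intro P v w b hn h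
    rw [List.eq_nil_of_length_eq_zero (Nat.le_zero.1 hn)] at h
    cases isRPath_nil_iff.1 h
  | succ n ih =>
    intro P v w b hn h
    rcases h.split G with ⟨rfl, rfl, rfl⟩ |
      ⟨C, r, P', j, x, y, b', rfl, hC, hr, hsrc, hj, hext, hP', hout⟩
    · have hlast := G.last (N - 2) (by omega)
      have hok : ExpOK F 3 (N - 2) (N - 1) := ⟨by omega, by omega, by omega, .inl rfl⟩
      have hg := hok.goodList G
      have hout : pathOut F true [⟨.node (N - 2) (N - 1) false, .sink, 3, false⟩] =
          expList F (N - 2) (N - 1) 3 := by simp [pathOut, edgeOut]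
      have him := hok.image_expSeq
      refine ⟨[expSeq F (N - 2) (N - 1) 3 '' Set.Icc 1 3], ?_⟩
      have hex := hok.isExpansive G
      refine ⟨?_, ?_, ?_, by simp, ?_, ?_, ?_, ?_, ?_, ?_⟩
      · exact DecodesTo.cons (C := []) (P := []) (Bs := []) (v := N - 2) (w := N - 1) (big := false)
          (by simp) rfl rfl hex
          (expSeq_one ..) (expSeq_two ..) .nil
      · intro x
        rw [hout]
        simp [him]
      · simp only [List.mem_singleton, forall_eq]
        exact hex.connected
      · rw [hout, hok.length_expList]
        rfl
      · rw [hout]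
        exact hg.pairwise
      · intro a ha
        rw [hout] at ha
        exact ⟨hg.first_le a ha, (hg.le_last a ha).trans (hok.last_le G)⟩
      · simp [hout, expList]
      · simp [hout, expList]
      · intro p h1 h2
        rw [hout]
        refine hg.two p h1 ?_
        simp only [penLast, if_pos]
        have := G.last (N - 1) (by omega)
        omega
    · have hok := hext.ok
      have hg := hok.goodList G
      have him := hok.image_expSeq
      have hlen : P'.length ≤ n := by
        simp only [List.length_append, List.length_singleton] at hn
        omega
      obtain ⟨Bs, D⟩ := ih P' x y b' hlen hP'
      have hlN := hok.last_le G
      have hFl := G.le_map _ hlN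
      have hfar := hext.far
      refine ⟨expSeq F v w j '' Set.Icc 1 j :: Bs, ?_, ?_, ?_, ?_, ?_, ?_, ?_, ?_, ?_, ?_⟩
      · have hex := hok.isExpansive G
        rw [← hj] at hex ⊢
        exact DecodesTo.cons hC hr hsrc hex (expSeq_one ..) (expSeq_two ..) D.decodes
      · intro a
        rw [hout, List.mem_append, D.mem_iff]
        simp [him]
      · intro B hB
        rcases List.mem_cons.1 hB with rfl | hB
        · exact (hok.isExpansive G).connected
        · exact D.connected B hB
      · refine List.pairwise_cons.2 ⟨fun B hB a ha b hb => ?_, D.far⟩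
        rw [him] at ha
        have h1 := G.mono (hg.le_last a ha)
        have h2 := (D.bounds b ((D.mem_iff b).2 ⟨B, hB, hb⟩)).1
        omega
      · rw [hout, List.length_append, hok.length_expList, D.length, pathWeight_append, hj]
      · rw [hout, List.pairwise_append]
        refine ⟨hg.pairwise, D.pairwise, fun a ha b hb => ?_⟩
        have h1 := hg.le_last a ha
        have h2 := (D.bounds b hb).1
        omega
      · intro a ha
        rw [hout, List.mem_append] at ha
        rcases ha with ha | ha
        · exact ⟨hg.first_le a ha, (hg.le_last a ha).trans hlN⟩
        · have := hg.le_last v (by obtain ⟨T, hT⟩ := hg.head; simp [hT])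
          have := D.bounds a ha
          omega
      · obtain ⟨T, hT⟩ := hg.head
        rw [hout, hT]
        simp
      · obtain ⟨T, hT⟩ := hg.head
        rw [hout, hT]
        simp
      · intro p h1 h2
        rw [hout]
        have lift : ∀ a, a ∈ expList F v w j → a ∈ expList F v w j ++ pathOut F true P' :=
          fun a ha => List.mem_append_left _ ha
        have lift' : ∀ a, a ∈ pathOut F true P' → a ∈ expList F v w j ++ pathOut F true P' :=
          fun a ha => List.mem_append_right _ ha
        obtain ⟨p₀, hp₀⟩ : ∃ p₀, p₀ = (penLast F j v w).1 := ⟨_, rfl⟩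
        obtain ⟨q₀, hq₀⟩ : ∃ q₀, q₀ = (penLast F j v w).2 := ⟨_, rfl⟩
        have hpl := hg.pen_lt
        have hll := hg.last_le
        have hmq := hg.mem_last
        have htw := hg.two p h1
        have heq := hext.eq
        rw [← hp₀] at hpl hll htw heq
        rw [← hq₀] at hpl hll hmq heq hfar
        have e1 : x = (extPair F p₀ q₀).1 := by rw [← heq]
        have e2 : y = (extPair F p₀ q₀).2 := by rw [← heq]
        have k1 := @G.mono p₀ q₀ hpl.le
        have k2 := @G.mono (F p₀ + 1) (F q₀ + 1) (by omega)
        have hle := (extPair_le (F := F) p₀ q₀).resolve_right (by omega)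
        rw [← e1, ← e2] at hle
        have hxy := hext.lt
        by_cases c1 : p ≤ F p₀
        · obtain ⟨a, ha, b, hb, hn⟩ := htw c1
          exact ⟨a, lift a ha, b, lift b hb, hn⟩
        have m1 := @G.mono (F p₀ + 1) p (by omega)
        by_cases c2 : p ≤ F q₀
        · exact ⟨q₀, lift _ hmq, x, lift' _ D.first_mem, by omega, .inr ⟨by omega, c2⟩,
            .inl ⟨by omega, by omega⟩⟩
        have m2 := @G.mono (F q₀ + 1) p (by omega)
        by_cases c3 : p < x
        · exact ⟨x, lift' _ D.first_mem, y, lift' _ D.second_mem, hxy, .inl ⟨c3, by omega⟩,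
            .inl ⟨by omega, by omega⟩⟩
        · obtain ⟨a, ha, b, hb, hn⟩ := D.two p (by omega) h2
          exact ⟨a, lift' a ha, b, lift' b hb, hn⟩

/-- If a set is the union of connected sets without edges between them, then these sets are its
blocks. -/
theorem isBlock_iff {V : Type*} {H : SimpleGraph V} {Bs : Set (Set V)} {W B : Set V}
    (hconn : ∀ B ∈ Bs, (H.induce B).Connected)
    (hsep : ∀ A ∈ Bs, ∀ B ∈ Bs, A ≠ B → ∀ a ∈ A, ∀ b ∈ B, ¬ H.Adj a b)
    (hW : ∀ x, x ∈ W ↔ ∃ B ∈ Bs, x ∈ B) : IsBlock H W B ↔ B ∈ Bs := by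
  have key : ∀ B', B' ⊆ W → (H.induce B').Connected → ∀ A ∈ Bs, ∀ a, a ∈ A → a ∈ B' →
      B' ⊆ A := by
    intro B' hB' hc A hA a ha haB b hb
    have hr := hc.preconnected ⟨a, haB⟩ ⟨b, hb⟩
    rw [SimpleGraph.reachable_iff_reflTransGen] at hr
    have : ∀ y : B', Relation.ReflTransGen (H.induce B').Adj ⟨a, haB⟩ y → y.1 ∈ A := by
      intro y hy
      induction hy with
      | refl => exact ha
      | @tail y z _ hyz ih =>
        obtain ⟨A', hA', hz⟩ := (hW z.1).1 (hB' z.2)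
        by_contra hne
        exact hsep A hA A' hA' (fun e => hne (e ▸ hz)) _ ih _ hz hyz
    exact this _ hr
  have sub : ∀ A ∈ Bs, A ⊆ W := fun A hA a ha => (hW a).2 ⟨A, hA, ha⟩
  constructor
  · rintro ⟨h1, h2, h3⟩
    obtain ⟨⟨a, ha⟩⟩ := h2.nonempty
    obtain ⟨A, hA, haA⟩ := (hW a).1 (h1 ha)
    have := h3 A (key B h1 h2 A hA a haA ha) (sub A hA) (hconn A hA)
    exact this ▸ hA
  · intro hB
    refine ⟨sub B hB, hconn B hB, fun B' h1 h2 h3 => ?_⟩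
    obtain ⟨⟨a, ha⟩⟩ := (hconn B hB).nonempty
    exact (key B' h2 h3 B hB a ha (h1 ha)).antisymm h1

theorem Decoded.encodes (G : PadGraph N F) {P : List REdge} {v w : ℕ} {Bs : List (Set ℕ)}
    (D : Decoded N F P v w Bs) : Encodes N F P {x | x ∈ pathOut F true P} := by
  have hsub : ∀ B ∈ Bs, ∀ b ∈ B, b ≤ N ∧ b ≤ F b := fun B hB b hb => by
    have := (D.bounds b ((D.mem_iff b).2 ⟨B, hB, hb⟩)).2
    exact ⟨this, G.le_map b this⟩
  refine ⟨Bs, D.decodes, ?_, fun B => isBlock_iff (Bs := {B | B ∈ Bs}) D.connected ?_ D.mem_iff, ?_⟩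
  · refine D.far.imp_of_mem fun {A B} hA hB h a ha b hb => ?_
    have := (hsub A hA a ha).2
    have := h a ha b hb
    omega
  · intro A hA B hB hne a ha b hb hadj
    have ha' := hsub A hA a ha
    have hb' := hsub B hB b hb
    obtain ⟨i, hi, rfl⟩ := List.getElem_of_mem hA
    obtain ⟨k, hk, rfl⟩ := List.getElem_of_mem hB
    simp only [underlying, SimpleGraph.fromRel_adj, IsArc] at hadj
    rcases lt_or_gt_of_ne (fun e : i = k => hne (by subst e; rfl)) with hik | hik
    · have := List.pairwise_iff_getElem.1 D.far i k hi hk hik a ha b hb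
      omega
    · have := List.pairwise_iff_getElem.1 D.far k i hk hi hik b hb a ha
      omega
  · ext x
    exact D.mem_iff x

/-- Paths from the source to the sink stand for total `2`-dominating sets. -/
theorem IsRPath.dom (G : PadGraph N F) {P : List REdge} {w : ℕ} {b : Bool}
    (h : IsRPath N F (.node 1 w b) .sink P) : Dom N F (pathOut F true P).toFinset ∧
      (pathOut F true P).toFinset.card = pathWeight P ∧ (pathOut F true P).Pairwise (· < ·) ∧
      Encodes N F P {x | x ∈ pathOut F true P} := by
  obtain ⟨Bs, D⟩ := IsRPath.decoded G _ P _ _ _ le_rfl h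
  refine ⟨⟨fun a ha => D.bounds a (List.mem_toFinset.1 ha), fun p h1 h2 => ?_⟩, ?_, D.pairwise,
    D.encodes G⟩
  · simpa only [List.mem_toFinset] using D.two p h1 h2
  · rw [List.toFinset_card_of_nodup (D.pairwise.imp fun h => h.ne), D.length]

/-- A path of minimum weight stands for a minimum total `2`-dominating set. -/
theorem IsShortestRPath.min (G : PadGraph N F) {P : List REdge} (h : IsShortestRPath N F P)
    {W : Finset ℕ} (hW : Dom N F W) : pathWeight P ≤ W.card := by
  obtain ⟨W', hW'⟩ := exists_opt hW
  obtain ⟨Q, hQ, hk⟩ := (hW'.chain G).exists_path_source G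
  exact (h.2 Q hQ).trans (hk ▸ hW'.card_le W hW)

theorem Dom.exists_path (G : PadGraph N F) {W : Finset ℕ} (hW : Dom N F W) :
    ∃ P, IsRPath N F (.node 1 2 false) .sink P := by
  obtain ⟨W', hW'⟩ := exists_opt hW
  obtain ⟨Q, hQ, -⟩ := (hW'.chain G).exists_path_source G
  exact ⟨Q, hQ⟩

end

/-! ### Straight graphs and numbers -/

section

variable {V : Type*} {G : Digraph V} {n : ℕ} {v : Fin n ≃ V} {f : Fin n → Fin n}

theorem frHat_succ (f : Fin n → Fin n) (i : Fin n) : frHat f (i + 1) = f i + 1 := by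
  unfold frHat
  rw [dif_pos ⟨by omega, i.2⟩]
  simp

theorem padFr_add_four (f : Fin n → Fin n) (i : Fin n) : padFr n (frHat f) (i + 4) = f i + 4 := by
  unfold padFr
  rw [if_neg (by omega), if_pos (by omega), show (i : ℕ) + 4 - 3 = i + 1 by omega, frHat_succ]

theorem padFr_cases (f : Fin n → Fin n) (i : ℕ) : (i ≤ 3 ∧ padFr n (frHat f) i = 3) ∨
    (∃ k : Fin n, i = k + 4 ∧ padFr n (frHat f) i = f k + 4) ∨
    (n + 3 < i ∧ padFr n (frHat f) i = n + 6) := by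
  by_cases h1 : i ≤ 3
  · exact .inl ⟨h1, by simp [padFr, h1]⟩
  by_cases h2 : i ≤ n + 3
  · refine .inr (.inl ⟨⟨i - 4, by omega⟩, by simp; omega, ?_⟩)
    rw [← padFr_add_four]
    congr 1
    simp only
    omega
  · exact .inr (.inr ⟨by omega, by simp [padFr, h1, h2]⟩)

theorem IsStraightOrder.padGraph (h : IsStraightOrder G v f) :
    PadGraph (n + 6) (padFr n (frHat f)) := by
  refine ⟨by omega, fun i hi => ?_, fun i => ?_, fun i j hij => ?_, fun i hi => ?_,
    fun i hi => ?_, ?_⟩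
  · rcases padFr_cases f i with ⟨h1, h2⟩ | ⟨k, rfl, h2⟩ | ⟨h1, h2⟩
    · omega
    · have : (k : ℕ) ≤ f k := h.le_apply k
      omega
    · omega
  · rcases padFr_cases f i with ⟨h1, h2⟩ | ⟨k, rfl, h2⟩ | ⟨h1, h2⟩
    · omega
    · omega
    · omega
  · rcases padFr_cases f i with ⟨h1, h2⟩ | ⟨k, rfl, h2⟩ | ⟨h1, h2⟩ <;>
    rcases padFr_cases f j with ⟨h3, h4⟩ | ⟨l, rfl, h4⟩ | ⟨h3, h4⟩
    · omega
    · omega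
    · omega
    · omega
    · have : (f k : ℕ) ≤ f l := h.mono (show (k : ℕ) ≤ l by omega)
      omega
    · omega
    · omega
    · omega
    · omega
  · simp [padFr, hi]
  · unfold padFr
    split_ifs <;> omega
  · rcases padFr_cases f (n + 6 - 3) with ⟨h1, h2⟩ | ⟨k, h1, h2⟩ | ⟨h1, h2⟩
    · omega
    · have : (k : ℕ) ≤ f k := h.le_apply k
      omega
    · omega

theorem IsStraightOrder.adj_iff_nbr (h : IsStraightOrder G v f) (i j : Fin n) :
    G.toSimpleGraphInclusive.Adj (v i) (v j) ↔ Nbr (padFr n (frHat f)) (i + 4) (j + 4) := by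
  simp only [Digraph.toSimpleGraphInclusive, SimpleGraph.fromRel_adj, h.adj_iff, Nbr,
    padFr_add_four, ne_eq, EmbeddingLike.apply_eq_iff_eq, Fin.lt_def, Fin.le_def, Fin.ext_iff]
  omega

theorem two_le_encard_iff {α : Type*} {s : Set α} :
    (2 : ℕ∞) ≤ s.encard ↔ ∃ a b, a ∈ s ∧ b ∈ s ∧ a ≠ b := by
  rw [← Set.one_lt_encard_iff, ← one_add_one_eq_two]
  exact ENat.add_one_le_iff (by simp)

/-- Each neighbour of one of the inner numbers is an inner number. -/
theorem nbr_inner {i : Fin n} {a : ℕ}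
    (ha : Nbr (padFr n (frHat f)) (i + 4) a) : ∃ j : Fin n, a = j + 4 := by
  unfold Nbr at ha
  rw [padFr_add_four] at ha
  rcases padFr_cases f a with ⟨h1, h2⟩ | ⟨k, rfl, h2⟩ | ⟨h1, h2⟩
  · omega
  · exact ⟨k, rfl⟩
  · omega

/-- The total `2`-dominating sets of the graph with two triangles added are the total
`2`-dominating sets of the given graph, with the triangles added. -/
theorem IsStraightOrder.dom_iff (h : IsStraightOrder G v f) (W : Set V) (W' : Finset ℕ)
    (hW : (W' : Set ℕ) =
      {1, 2, 3} ∪ {k | ∃ i : Fin n, v i ∈ W ∧ k = (i : ℕ) + 4} ∪ {n + 4, n + 5, n + 6}) :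
    Dom (n + 6) (padFr n (frHat f)) W' ↔ IsTotalDominating 2 G.toSimpleGraphInclusive W := by
  have mem : ∀ k, k ∈ W' ↔ (k = 1 ∨ k = 2 ∨ k = 3) ∨ (∃ i : Fin n, v i ∈ W ∧ k = (i : ℕ) + 4) ∨
      (k = n + 4 ∨ k = n + 5 ∨ k = n + 6) := fun k => by
    rw [← Finset.mem_coe, hW]
    simp only [Set.mem_union, Set.mem_insert_iff, Set.mem_singleton_iff, Set.mem_ofPred_eq,
      or_assoc]
  have mem' : ∀ i : Fin n, (i : ℕ) + 4 ∈ W' ↔ v i ∈ W := fun i => by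
    rw [mem]
    constructor
    · rintro (h1 | ⟨j, h1, h2⟩ | h1)
      · omega
      · obtain rfl : i = j := Fin.ext (by omega)
        exact h1
      · omega
    · exact fun h1 => .inr (.inl ⟨i, h1, rfl⟩)
  have G' := h.padGraph
  constructor
  · intro hD x
    obtain ⟨i, rfl⟩ := v.surjective x
    obtain ⟨a, ha, b, hb, hab, h1, h2⟩ := hD.two (i + 4) (by omega) (by omega)
    obtain ⟨j, rfl⟩ := nbr_inner h1
    obtain ⟨k, rfl⟩ := nbr_inner h2
    refine two_le_encard_iff.2 ⟨v j, v k, ⟨(h.adj_iff_nbr i j).2 h1, (mem' j).1 ha⟩,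
      ⟨(h.adj_iff_nbr i k).2 h2, (mem' k).1 hb⟩, fun e => ?_⟩
    have := v.injective e
    subst this
    omega
  · intro hT
    refine ⟨fun a ha => ?_, fun p h1 h2 => ?_⟩
    · rcases (mem a).1 ha with h1 | ⟨j, -, h2⟩ | h1 <;> omega
    · have hf := G'.first
      have hl := G'.last
      rcases padFr_cases f p with ⟨h3, h4⟩ | ⟨i, rfl, h3⟩ | ⟨h3, h4⟩
      · have m1 : 1 ∈ W' := (mem 1).2 (by simp)
        have m2 : 2 ∈ W' := (mem 2).2 (by simp)
        have m3 : 3 ∈ W' := (mem 3).2 (by simp)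
        have f1 := hf 1 (by omega)
        have f2 := hf 2 (by omega)
        rcases (by omega : p = 1 ∨ p = 2 ∨ p = 3) with rfl | rfl | rfl
        · exact ⟨2, m2, 3, m3, by omega, .inl (by omega), .inl (by omega)⟩
        · exact ⟨1, m1, 3, m3, by omega, .inr (by omega), .inl (by omega)⟩
        · exact ⟨1, m1, 2, m2, by omega, .inr (by omega), .inr (by omega)⟩
      · obtain ⟨x, y, hx, hy, hne⟩ := two_le_encard_iff.1 (hT (v i))
        obtain ⟨j, rfl⟩ := v.surjective x
        obtain ⟨k, rfl⟩ := v.surjective y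
        have n1 := (h.adj_iff_nbr i j).1 hx.1
        have n2 := (h.adj_iff_nbr i k).1 hy.1
        have hjk : (j : ℕ) ≠ k := fun e => hne (congrArg v (Fin.ext e))
        rcases lt_or_gt_of_ne hjk with hjk | hjk
        · exact ⟨_, (mem' j).2 hx.2, _, (mem' k).2 hy.2, by omega, n1, n2⟩
        · exact ⟨_, (mem' k).2 hy.2, _, (mem' j).2 hx.2, by omega, n2, n1⟩
      · have m1 : n + 4 ∈ W' := (mem _).2 (by simp)
        have m2 : n + 5 ∈ W' := (mem _).2 (by simp)
        have m3 : n + 6 ∈ W' := (mem _).2 (by simp)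
        have f1 := hl (n + 4) (by omega)
        have f2 := hl (n + 5) (by omega)
        rcases (by omega : p = n + 4 ∨ p = n + 5 ∨ p = n + 6) with rfl | rfl | rfl
        · exact ⟨_, m2, _, m3, by omega, .inl (by omega), .inl (by omega)⟩
        · exact ⟨_, m1, _, m3, by omega, .inr (by omega), .inl (by omega)⟩
        · exact ⟨_, m1, _, m2, by omega, .inr (by omega), .inr (by omega)⟩

/-- The set `W` with the two triangles added. -/
noncomputable def padSet (v : Fin n ≃ V) (W : Set V) : Finset ℕ := by
  classical
  exact ({1, 2, 3} ∪ ((Finset.univ.filter fun i : Fin n => v i ∈ W) : Finset (Fin n)).map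
    (⟨fun i => (i : ℕ) + 4, fun _ _ hij => Fin.ext (by simpa using hij)⟩ : Fin n ↪ ℕ)) ∪
    {n + 4, n + 5, n + 6}

theorem coe_padSet (v : Fin n ≃ V) (W : Set V) : (padSet v W : Set ℕ) =
    {1, 2, 3} ∪ {k | ∃ i : Fin n, v i ∈ W ∧ k = (i : ℕ) + 4} ∪ {n + 4, n + 5, n + 6} := by
  ext k
  simp only [padSet, Finset.coe_union, Finset.coe_insert, Finset.coe_singleton, Finset.coe_map,
    Finset.coe_filter, Finset.mem_univ, true_and, Set.mem_union,
    Set.mem_image, Set.mem_ofPred_eq, eq_comm]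
  rfl

theorem card_padSet (v : Fin n ≃ V) (W : Set V) : ((padSet v W).card : ℕ∞) = W.encard + 6 := by
  classical
  have h1 : W.encard = ((Finset.univ.filter fun i : Fin n => v i ∈ W).card : ℕ∞) := by
    have : W = v '' ((Finset.univ.filter fun i : Fin n => v i ∈ W : Finset (Fin n)) : Set (Fin n))
        := by
      ext x
      obtain ⟨i, rfl⟩ := v.surjective x
      simp
    rw [this, v.injective.encard_image, Set.encard_coe_eq_coe_finsetCard]
    simp
  rw [h1, padSet, Finset.card_union_of_disjoint, Finset.card_union_of_disjoint, Finset.card_map]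
  · have h2 : ({n + 4, n + 5, n + 6} : Finset ℕ).card = 3 := by
      rw [Finset.card_insert_of_notMem (by simp), Finset.card_insert_of_notMem (by simp),
        Finset.card_singleton]
    rw [h2]
    norm_cast
    simp
    omega
  · rw [Finset.disjoint_left]
    intro a ha hb
    simp only [Finset.mem_insert, Finset.mem_singleton, Finset.mem_map] at ha hb
    obtain ⟨i, -, hi⟩ := hb
    have hi : (i : ℕ) + 4 = a := hi
    omega
  · rw [Finset.disjoint_left]
    intro a ha hb
    simp only [Finset.mem_union, Finset.mem_insert, Finset.mem_singleton, Finset.mem_map]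
      at ha hb
    rcases ha with ha | ⟨i, -, hi⟩
    · omega
    · have hi : (i : ℕ) + 4 = a := hi
      omega

/-- A minimum total `2`-dominating set of the padded graph, without the triangles. -/
theorem IsStraightOrder.min (h : IsStraightOrder G v f) {W' : Finset ℕ}
    (hD : Dom (n + 6) (padFr n (frHat f)) W')
    (hmin : ∀ W'', Dom (n + 6) (padFr n (frHat f)) W'' → W'.card ≤ W''.card) :
    (W' : Set ℕ) = {1, 2, 3} ∪ {k | ∃ i : Fin n, v i ∈ {x | (v.symm x : ℕ) + 4 ∈ W'} ∧
      k = (i : ℕ) + 4} ∪ {n + 4, n + 5, n + 6} ∧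
      IsMinTotalDominating 2 G.toSimpleGraphInclusive {x | (v.symm x : ℕ) + 4 ∈ W'} := by
  have heq : (W' : Set ℕ) = {1, 2, 3} ∪ {k | ∃ i : Fin n, v i ∈ {x | (v.symm x : ℕ) + 4 ∈ W'} ∧
      k = (i : ℕ) + 4} ∪ {n + 4, n + 5, n + 6} := by
    have hf := h.padGraph.first
    have hl := h.padGraph.last
    have hg := h.padGraph.gap
    have hlow : ∀ a, n + 3 < padFr n (frHat f) a → n + 3 < a := fun a h1 => by
      by_contra h4
      have := h.padGraph.mono (show a ≤ n + 6 - 3 by omega)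
      omega
    have t1 := hD.two 1 (by omega) (by omega)
    have t2 := hD.two 2 (by omega) (by omega)
    have t3 := hD.two (n + 6) (by omega) (by omega)
    have t4 := hD.two (n + 5) (by omega) (by omega)
    have f1 := hf 1 (by omega)
    have f2 := hf 2 (by omega)
    have f3 := hl (n + 5) (by omega)
    have f4 := hl (n + 6) (by omega)
    have mem : ∀ p a, Nbr (padFr n (frHat f)) p a → (p < a ∧ a ≤ padFr n (frHat f) p) ∨
      (a < p ∧ p ≤ padFr n (frHat f) a) := fun _ _ h => h
    obtain ⟨a, ha, b, hb, hab, h1, h2⟩ := t1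
    obtain ⟨c, hc, d, hd, hcd, h3, h4⟩ := t2
    obtain ⟨a', ha', b', hb', hab', h1', h2'⟩ := t3
    obtain ⟨c', hc', d', hd', hcd', h3', h4'⟩ := t4
    have sa := hD.sub a ha
    have sc := hD.sub c hc
    have la := hlow a'
    have lb := hlow b'
    have lc := hlow c'
    have ld := hlow d'
    unfold Nbr at h1 h2 h3 h4 h1' h2' h3' h4'
    obtain rfl : a = 2 := by omega
    obtain rfl : b = 3 := by omega
    obtain rfl : c = 1 := by omega
    obtain rfl : a' = n + 4 := by omega
    obtain rfl : b' = n + 5 := by omega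
    obtain rfl : d' = n + 6 := by omega
    ext k
    simp only [Finset.mem_coe, Set.mem_ofPred_eq, Equiv.symm_apply_apply, Set.mem_union,
      Set.mem_insert_iff, Set.mem_singleton_iff]
    constructor
    · intro hk
      have := hD.sub k hk
      by_cases c1 : k ≤ 3
      · exact .inl (.inl (by omega))
      by_cases c2 : n + 4 ≤ k
      · exact .inr (by omega)
      · refine .inl (.inr ⟨⟨k - 4, by omega⟩, ?_, ?_⟩)
        · simpa [Nat.sub_add_cancel (by omega : 4 ≤ k)] using hk
        · simp only
          omega
    · rintro (((rfl | rfl | rfl) | ⟨i, h1, rfl⟩) | rfl | rfl | rfl) <;> assumption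
  refine ⟨heq, (h.dom_iff _ _ heq).1 hD, fun W'' hW'' => ?_⟩
  have h1 := hmin _ ((h.dom_iff W'' _ (coe_padSet v W'')).2 hW'')
  have h2 : padSet v {x | (v.symm x : ℕ) + 4 ∈ W'} = W' := by
    rw [← Finset.coe_inj, coe_padSet, ← heq]
  have h3 : ((padSet v {x | (v.symm x : ℕ) + 4 ∈ W'}).card : ℕ∞) ≤ (padSet v W'').card := by
    rw [h2]
    exact_mod_cast h1
  rw [card_padSet, card_padSet] at h3
  exact (ENat.add_le_add_iff_right (by simp)).1 h3

/-! ### Counting edges -/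

theorem IsStraightOrder.numArcs_eq (h : IsStraightOrder G v f) :
    numArcs G = ∑ i : Fin n, ((f i : ℕ) - i) := by
  classical
  have : {e : V × V | G.Adj e.1 e.2} =
      (fun e : (_ : Fin n) × Fin n => (v e.1, v e.2)) ''
        ((Finset.univ.sigma fun i => Finset.Ioc i (f i) : Finset _) : Set _) := by
    ext ⟨x, y⟩
    obtain ⟨i, rfl⟩ := v.surjective x
    obtain ⟨j, rfl⟩ := v.surjective y
    simp [h.adj_iff]
  rw [numArcs, this, Set.ncard_image_of_injective, Set.ncard_coe_finset, Finset.card_sigma]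
  · simp
  · rintro ⟨i, j⟩ ⟨k, l⟩ hh
    simpa using hh

theorem IsStraightOrder.ncard_edgeSet (h : IsStraightOrder G v f) :
    G.toSimpleGraphInclusive.edgeSet.ncard = numArcs G := by
  have hanti : ∀ x y, G.Adj x y → ¬ G.Adj y x := by
    intro x y
    obtain ⟨i, rfl⟩ := v.surjective x
    obtain ⟨j, rfl⟩ := v.surjective y
    rw [h.adj_iff, h.adj_iff]
    exact fun h1 h2 => lt_asymm h1.1 h2.1
  have : G.toSimpleGraphInclusive.edgeSet =
      (fun e : V × V => s(e.1, e.2)) '' {e : V × V | G.Adj e.1 e.2} := by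
    ext e
    induction e using Sym2.inductionOn with
    | hf x y =>
      simp only [SimpleGraph.mem_edgeSet, Digraph.toSimpleGraphInclusive, SimpleGraph.fromRel_adj,
        Set.mem_image, Set.mem_ofPred_eq, Prod.exists, Sym2.eq_iff]
      constructor
      · rintro ⟨-, h1 | h1⟩
        · exact ⟨x, y, h1, .inl ⟨rfl, rfl⟩⟩
        · exact ⟨y, x, h1, .inr ⟨rfl, rfl⟩⟩
      · rintro ⟨a, b, h1, ⟨rfl, rfl⟩ | ⟨rfl, rfl⟩⟩
        · exact ⟨fun e => by subst e; exact hanti _ _ h1 h1, .inl h1⟩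
        · exact ⟨fun e => by subst e; exact hanti _ _ h1 h1, .inr h1⟩
  rw [this, Set.InjOn.ncard_image, numArcs]
  rintro ⟨a, b⟩ h1 ⟨c, d⟩ h2 hh
  simp only [Sym2.eq_iff] at hh
  rcases hh with ⟨rfl, rfl⟩ | ⟨rfl, rfl⟩
  · rfl
  · exact (hanti _ _ h1 h2).elim

/-- Twice the number of edges is the sum of the degrees. -/
theorem sum_ncard_neighborSet {n : ℕ} (H : SimpleGraph (Fin n)) :
    ∑ x, (H.neighborSet x).ncard = 2 * H.edgeSet.ncard := by
  classical
  have h1 := H.sum_degrees_eq_twice_card_edges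
  rw [← SimpleGraph.coe_edgeFinset, Set.ncard_coe_finset, ← h1]
  refine Finset.sum_congr rfl fun x _ => ?_
  rw [← SimpleGraph.card_neighborSet_eq_degree, Set.ncard_eq_toFinset_card', Set.toFinset_card]

/-- If all vertices have two neighbours, then there are at least as many edges as vertices. -/
theorem IsStraightOrder.le_numArcs (h : IsStraightOrder G v f)
    (hdeg : ∀ x, 2 ≤ (G.toSimpleGraphInclusive.neighborSet x).encard) : n ≤ numArcs G := by
  classical
  have : Fintype V := Fintype.ofEquiv _ v
  have hcard : Fintype.card V = n := by rw [← Fintype.card_congr v, Fintype.card_fin]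
  have h1 := G.toSimpleGraphInclusive.sum_degrees_eq_twice_card_edges
  have h2 : G.toSimpleGraphInclusive.edgeFinset.card = numArcs G := by
    rw [← h.ncard_edgeSet, ← SimpleGraph.coe_edgeFinset, Set.ncard_coe_finset]
  have h3 : ∑ _x : V, 2 ≤ ∑ x, G.toSimpleGraphInclusive.degree x := by
    refine Finset.sum_le_sum fun x _ => ?_
    have := hdeg x
    rw [← SimpleGraph.card_neighborSet_eq_degree, ← Set.toFinset_card]
    rw [Set.encard_eq_coe_toFinset_card] at this
    exact_mod_cast this
  rw [Finset.sum_const, Finset.card_univ, hcard, h1, h2, smul_eq_mul] at h3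
  omega

end

/-! ### Inserting the two triangles -/

/-- Register `0` and array `0` hold the graph, including the values at `0` and `N + 1`. -/
def Holds (N : ℕ) (F : ℕ → ℕ) (s : RamState) : Prop :=
  s.reg 0 = N ∧ ∀ i, i ≤ N + 1 → s.arr 0 i = F i

/-- Move the map `F` by three positions and add the two triangles. -/
def insertionProg : RamProg :=
  .assign 5 (R 0) ;;
  .while (.lt 0 (R 5)) (.store 0 (R 5 + 3) (A 0 (R 5) + 3) ;; .assign 5 (R 5 - 1)) ;;
  .store 0 0 3 ;; .store 0 1 3 ;; .store 0 2 3 ;; .store 0 3 3 ;;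
  .store 0 (R 0 + 4) (R 0 + 6) ;; .store 0 (R 0 + 5) (R 0 + 6) ;;
  .store 0 (R 0 + 6) (R 0 + 6) ;; .store 0 (R 0 + 7) (R 0 + 6) ;;
  .assign 0 (R 0 + 6)

theorem insertionProg_spec {n B : ℕ} {f : Fin n → Fin n} {s : RamState} (hB : n + 7 ≤ B)
    (h0 : s.reg 0 = n) (hf : ∀ i, 1 ≤ i → i ≤ n → s.arr 0 i = frHat f i) :
    Tri B insertionProg s (100 * (n + 1)) (Holds (n + 6) (padFr n (frHat f))) := by
  refine Tri.seq (T₁ := 10) (P := fun s' => s' = s.setReg 5 n) (Tri.wp ?_ (by decide)) ?_ (by omega)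
  · simp only [RamProg.wp, eval_reg, h0]
    exact ⟨by omega, trivial⟩
  rintro _ rfl
  let I : RamState → Prop := fun s' => s'.reg 0 = n ∧ s'.reg 5 ≤ n ∧
    (∀ i, 1 ≤ i → i ≤ s'.reg 5 → s'.arr 0 i = frHat f i) ∧
    (∀ i, s'.reg 5 < i → i ≤ n → s'.arr 0 (i + 3) = frHat f i + 3)
  refine Tri.seq (T₁ := 20 * n + 10) (P := fun s' => I s' ∧ s'.reg 5 = 0) ?_ ?_ (by omega)
  · have hs : I (s.setReg 5 n) := by
      refine ⟨by simpa using h0, by simp, fun i h1 h2 => hf i h1 (by simpa using h2),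
        fun i h1 h2 => ?_⟩
      simp at h1
      omega
    refine (Tri.while I (fun s' => 20 * s'.reg 5 + 10) (fun s' hI hb => ?_)
      (fun s' hI hb => ?_) _ hs).mono (by simp) fun _ h => h
    · obtain ⟨h1, h2, h3, h4⟩ := hI
      simp only [holds_lt, eval_ofNat, eval_reg] at hb
      obtain ⟨k, hk⟩ : ∃ k, s'.reg 5 = k + 1 := ⟨s'.reg 5 - 1, by omega⟩
      have hF : frHat f (k + 1) ≤ n := by
        have := frHat_succ f ⟨k, by omega⟩
        simp only at this
        omega
      refine ⟨13, Tri.wp ?_ (by decide)⟩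
      have hcost : (RamTest.lt 0 (R 5)).cost = 3 := rfl
      simp only [RamProg.wp, eval_add, eval_sub, eval_reg, eval_load, eval_ofNat, hk,
        h3 (k + 1) (by omega) (by omega), setArr_reg, Nat.add_sub_cancel]
      refine ⟨⟨by omega, by omega⟩, by omega, ⟨by simpa using h1, by simp; omega, ?_, ?_⟩, ?_⟩
      · intro i h5 h6
        simp only [setReg_reg, if_true] at h6
        simp only [setReg_arr, setArr_arr, true_and]
        rw [if_neg (by omega)]
        exact h3 i h5 (by omega)
      · intro i h5 h6
        simp only [setReg_reg, if_true] at h5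
        simp only [setReg_arr, setArr_arr, true_and]
        split_ifs with h7
        · obtain rfl : i = k + 1 := by omega
          rfl
        · exact h4 i (by omega) h6
      · simp [hcost]
        omega
    · have hcost : (RamTest.lt 0 (R 5)).cost = 3 := rfl
      simp only [holds_lt, eval_ofNat, eval_reg] at hb
      exact ⟨by omega, hI, by omega⟩
  · rintro s' ⟨⟨h1, -, -, h4⟩, h5⟩
    refine Tri.wp ?_ (le_trans (by decide : _ ≤ 70) (by omega))
    simp only [RamProg.wp, eval_add, eval_reg, eval_ofNat, setArr_reg, h1]
    refine ⟨⟨by omega, by omega⟩, ⟨by omega, by omega⟩, ⟨by omega, by omega⟩,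
      ⟨by omega, by omega⟩, ⟨by omega, by omega⟩, ⟨by omega, by omega⟩, ⟨by omega, by omega⟩,
      ⟨by omega, by omega⟩, by omega, by simp, fun i hi => ?_⟩
    simp only [setReg_arr, setArr_arr, true_and]
    unfold padFr
    split_ifs <;> first | rfl | omega | skip
    have := h4 (i - 3) (by omega) (by omega)
    rwa [Nat.sub_add_cancel (by omega)] at this

/-! ### Widths -/

/-- Compute the widths, from the last vertex to the first one. -/
def widthProg : RamProg :=
  .assign 5 (R 0) ;;
  .while (.lt 0 (R 5)) (
    .assign 6 (A 0 (R 5)) ;;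
    .assign 7 (A 0 (R 6) - R 6) ;;
    .ite (.eq (R 7) 0)
      (.store 1 (R 5) (R 0 + 1) ;; .store 2 (R 5) (R 5))
      (.ite (.eq (R 7) 1)
        (.ite (.eq (A 1 (R 6)) (R 0 + 1))
          (.store 1 (R 5) (R 0 + 1) ;; .store 2 (R 5) (R 5))
          (.store 1 (R 5) (A 1 (R 6) + 1) ;; .store 2 (R 5) (A 2 (R 6))))
        (.store 1 (R 5) 1 ;; .store 2 (R 5) (R 6))) ;;
    .assign 5 (R 5 - 1))

/-- Arrays `1` and `2` hold the width of `i`. -/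
def WidthAt (N : ℕ) (F : ℕ → ℕ) (s : RamState) (i : ℕ) : Prop :=
  (∀ κ, IsWidth F i κ → s.arr 1 i = κ ∧ s.arr 2 i = F^[κ] i) ∧
    ((¬ ∃ κ, IsWidth F i κ) → s.arr 1 i = N + 1 ∧ s.arr 2 i = i)

theorem IsWidth.unique {F : ℕ → ℕ} {v κ κ' : ℕ} (h : IsWidth F v κ) (h' : IsWidth F v κ') :
    κ = κ' := by
  rcases lt_trichotomy κ κ' with hlt | rfl | hlt
  · have := h'.2.2 κ h.1 hlt
    have := h.2.1
    omega
  · rfl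
  · have := h.2.2 κ' h'.1 hlt
    have := h'.2.1
    omega

theorem isWidth_one {F : ℕ → ℕ} {i : ℕ} (h : 2 ≤ outDeg F (F i)) : IsWidth F i 1 :=
  ⟨le_rfl, h, fun k h1 h2 => by omega⟩

theorem isWidth_succ {F : ℕ → ℕ} {i κ : ℕ} (h : outDeg F (F i) < 2) (hκ : 1 ≤ κ) :
    IsWidth F i (κ + 1) ↔ IsWidth F (F i) κ := by
  constructor
  · rintro ⟨h1, h2, h3⟩
    exact ⟨hκ, h2, fun k h4 h5 => h3 (k + 1) (by omega) (by omega)⟩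
  · rintro ⟨h1, h2, h3⟩
    refine ⟨by omega, h2, fun k h4 h5 => ?_⟩
    obtain ⟨k, rfl⟩ : ∃ l, k = l + 1 := ⟨k - 1, by omega⟩
    rcases Nat.eq_zero_or_pos k with rfl | hk
    · exact h
    · exact h3 k hk (by omega)

theorem exists_isWidth_iff {F : ℕ → ℕ} {i : ℕ} (h : outDeg F (F i) < 2) :
    (∃ κ, IsWidth F i κ) ↔ ∃ κ, IsWidth F (F i) κ := by
  constructor
  · rintro ⟨κ, hκ⟩
    have h1 := hκ.1
    rcases h1.eq_or_lt with rfl | h1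
    · have := hκ.2.1
      simp only [Function.iterate_one] at this
      omega
    · obtain ⟨k, rfl⟩ : ∃ l, κ = l + 1 := ⟨κ - 1, by omega⟩
      exact ⟨k, (isWidth_succ h (by omega)).1 hκ⟩
  · rintro ⟨κ, hκ⟩
    exact ⟨κ + 1, (isWidth_succ h hκ.1).2 hκ⟩

section

variable {N : ℕ} {F : ℕ → ℕ}

theorem PadGraph.not_isWidth (G : PadGraph N F) {i : ℕ} (h : outDeg F (F i) = 0) :
    ¬ ∃ κ, IsWidth F i κ := by
  rintro ⟨κ, h1, h2, -⟩
  have h3 : F (F i) = F i := by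
    have := G.le_map _ (G.map_le i)
    unfold outDeg at h
    omega
  obtain ⟨k, rfl⟩ : ∃ l, κ = l + 1 := ⟨κ - 1, by omega⟩
  rw [Function.iterate_succ_apply, Function.iterate_fixed h3] at h2
  omega

theorem PadGraph.width_le (G : PadGraph N F) {i κ : ℕ} (hi : i ≤ N) (h : IsWidth F i κ) :
    i + κ + 1 ≤ N ∧ F^[κ] i ≤ N := by
  have h2 := h.2.1
  have h1 := G.add_le_iterate (i := κ + 1) hi (by omega : 1 ≤ outDeg F (F^[κ] i)) le_rfl
  have h3 := G.iterate_le hi (κ + 1)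
  exact ⟨by omega, G.iterate_le hi κ⟩

theorem widthProg_spec (G : PadGraph N F) {B : ℕ} {s : RamState} (hB : N + 7 ≤ B)
    (hs : Holds N F s) :
    Tri B widthProg s (100 * (N + 1)) (fun s' => Holds N F s' ∧ HoldsWidth s' N F) := by
  refine Tri.seq (T₁ := 10) (P := fun s' => s' = s.setReg 5 N) (Tri.wp ?_ (by decide)) ?_ (by omega)
  · simp only [RamProg.wp, eval_reg, hs.1]
    exact ⟨by omega, trivial⟩
  rintro _ rfl
  let I : RamState → Prop := fun s' => Holds N F s' ∧ s'.reg 5 ≤ N ∧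
    ∀ i, s'.reg 5 < i → i ≤ N → WidthAt N F s' i
  have hs' : I (s.setReg 5 N) := by
    refine ⟨⟨by simpa using hs.1, hs.2⟩, by simp, fun i h1 h2 => ?_⟩
    simp at h1
    omega
  refine (Tri.while I (fun s' => 60 * s'.reg 5 + 10) (fun s' hI hb => ?_)
    (fun s' hI hb => ?_) _ hs').mono (by simp; omega) fun _ h => h
  · obtain ⟨⟨h1, h2⟩, h3, h4⟩ := hI
    simp only [holds_lt, eval_ofNat, eval_reg] at hb
    obtain ⟨k, hk⟩ : ∃ k, s'.reg 5 = k := ⟨_, rfl⟩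
    rw [hk] at hb h3
    have hFk := G.map_le k
    have hFk' := G.le_map k h3
    have hFF := G.le_map _ hFk
    have hFF' := G.map_le (F k)
    refine ⟨50, Tri.wp ?_ (by decide)⟩
    have hcost : (RamTest.lt 0 (R 5)).cost = 3 := rfl
    have r1 : s'.arr 0 k = F k := h2 k (by omega)
    have r2 : s'.arr 0 (F k) = F (F k) := h2 _ (by omega)
    simp only [RamProg.wp, eval_add, eval_sub, eval_reg, eval_load, eval_ofNat, hk, h1, setArr_reg,
      setReg_reg, setReg_arr, if_true, holds_eq, r1, r2, Nat.reduceEqDiff, if_false]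
    have fin : ∀ x y, (∀ κ, IsWidth F k κ → x = κ ∧ y = F^[κ] k) →
        ((¬ ∃ κ, IsWidth F k κ) → x = N + 1 ∧ y = k) →
        ∀ s'' : RamState, s''.reg 0 = N → s''.reg 5 = k - 1 → s''.arr 0 = s'.arr 0 →
        (∀ i, s''.arr 1 i = if i = k then x else s'.arr 1 i) →
        (∀ i, s''.arr 2 i = if i = k then y else s'.arr 2 i) →
        I s'' ∧ (RamTest.lt 0 (R 5)).cost + 1 + 50 + (60 * s''.reg 5 + 10) ≤ 60 * k + 10 := by
      intro x y hx hy s'' e0 e5 ea e1 e2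
      refine ⟨⟨⟨e0, fun i hi => by rw [ea]; exact h2 i hi⟩, by omega, fun i h5 h6 => ?_⟩, by omega⟩
      unfold WidthAt
      rw [e1, e2]
      by_cases hik : i = k
      · subst hik
        simp only [if_true]
        exact ⟨hx, hy⟩
      · simp only [if_neg hik]
        exact h4 i (by omega) h6
    refine ⟨by omega, by omega, fun c1 => ?_, fun c1 => ⟨fun c2 => ⟨fun c3 => ?_, fun c3 => ?_⟩,
      fun c2 => ?_⟩⟩
    · have hn := G.not_isWidth (i := k) (by unfold outDeg; omega)
      refine ⟨⟨by omega, by omega⟩, ⟨by omega, by omega⟩, by omega,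
        fin (N + 1) k (fun κ hκ => (hn ⟨κ, hκ⟩).elim) (fun _ => ⟨rfl, rfl⟩) _ ?_ ?_ ?_ ?_ ?_⟩ <;>
      simp [h1]
      funext i; simp
    · have hlt : k < F k := by
        by_contra hle
        have : F k = k := by omega
        rw [this, this] at c2
        omega
      have hw := h4 (F k) (by omega) hFk
      have hd : outDeg F (F k) < 2 := by unfold outDeg; omega
      have hn : ¬ ∃ κ, IsWidth F k κ := by
        rw [exists_isWidth_iff hd]
        rintro ⟨κ, hκ⟩
        have h7 := (hw.1 κ hκ).1
        have := (G.width_le hFk hκ).1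
        omega
      refine ⟨⟨by omega, by omega⟩, ⟨by omega, by omega⟩, by omega,
        fin (N + 1) k (fun κ hκ => (hn ⟨κ, hκ⟩).elim) (fun _ => ⟨rfl, rfl⟩) _ ?_ ?_ ?_ ?_ ?_⟩ <;>
      simp [h1]
      funext i; simp
    · have hlt : k < F k := by
        by_contra hle
        have : F k = k := by omega
        rw [this, this] at c2
        omega
      have hw := h4 (F k) (by omega) hFk
      have hd : outDeg F (F k) < 2 := by unfold outDeg; omega
      obtain ⟨κ, hκ⟩ : ∃ κ, IsWidth F (F k) κ := by
        by_contra hn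
        exact c3 (hw.2 hn).1
      obtain ⟨h7, h8⟩ := hw.1 κ hκ
      have hle := G.width_le hFk hκ
      have hκ' := (isWidth_succ hd hκ.1).2 hκ
      rw [h7]
      simp only [setArr_arr, setReg_arr, Nat.reduceEqDiff, false_and, if_false, h8]
      refine ⟨⟨by omega, by omega⟩, ⟨by omega, by omega⟩, by omega,
        fin (κ + 1) (F^[κ] (F k)) (fun κ' hκ₂ => ?_)
        (fun hn => (hn ⟨_, hκ'⟩).elim) _ ?_ ?_ ?_ ?_ ?_⟩
      · obtain rfl := hκ₂.unique hκ'
        exact ⟨rfl, rfl⟩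
      · simp [h1]
      · simp
      · funext i; simp
      · simp
      · simp
    · have hκ' := isWidth_one (F := F) (i := k) (by unfold outDeg; omega)
      refine ⟨⟨by omega, by omega⟩, ⟨by omega, by omega⟩, by omega,
        fin 1 (F k) (fun κ' hκ₂ => ?_) (fun hn => (hn ⟨_, hκ'⟩).elim) _ ?_ ?_ ?_ ?_ ?_⟩
      · obtain rfl := hκ₂.unique hκ'
        exact ⟨rfl, rfl⟩
      · simp [h1]
      · simp
      · funext i; simp
      · simp
      · simp
  · have hcost : (RamTest.lt 0 (R 5)).cost = 3 := rfl
    simp only [holds_lt, eval_ofNat, eval_reg] at hb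
    exact ⟨by omega, hI.1, fun i h1 h2 => hI.2.2 i (by omega) h2⟩

end

/-! ### Listing the vertices and the edges of `R` -/

/-- Twice the number of arcs that leave a vertex smaller than `x`; this is the index of the first
vertex of `R` that comes from an arc leaving `x`. -/
def base (F : ℕ → ℕ) (x : ℕ) : ℕ := 2 * ∑ i ∈ Finset.Ico 1 x, outDeg F i

/-- The index of a vertex of `R`: the vertices are ordered lexicographically, the lower copy of an
arc before the upper one, and the sink last. -/
def index (N : ℕ) (F : ℕ → ℕ) : RVertex → ℕ
  | .node x y b => base F x + 2 * (y - x - 1) + b.toNat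
  | .sink => base F (N + 1)

/-- What is stored of an edge: the index of its target, its weight, and its flag. -/
def code (N : ℕ) (F : ℕ → ℕ) (e : REdge) : ℕ × ℕ × ℕ :=
  (index N F e.tgt, e.weight, e.compact.toNat)

open Classical in
/-- The regular edges of weight `j` that leave a copy of `vw` because of its `j`-extension. -/
noncomputable def extOuts (F : ℕ → ℕ) (j v w : ℕ) (b : Bool) : List REdge :=
  if Ext F j v w (extPair F (penLast F j v w).1 (penLast F j v w).2).1
      (extPair F (penLast F j v w).1 (penLast F j v w).2).2 then
    [⟨.node v w b, .node (extPair F (penLast F j v w).1 (penLast F j v w).2).1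
        (extPair F (penLast F j v w).1 (penLast F j v w).2).2 false, j, false⟩,
     ⟨.node v w b, .node (extPair F (penLast F j v w).1 (penLast F j v w).2).1
        (extPair F (penLast F j v w).1 (penLast F j v w).2).2 true, j, false⟩]
  else []

open Classical in
/-- The edges of `R` that leave a vertex, in the order in which they are stored. -/
noncomputable def outs (N : ℕ) (F : ℕ → ℕ) : RVertex → List REdge
  | .node v w false => extOuts F 3 v w false ++ (extOuts F 4 v w false ++
      if v + 2 = N ∧ w + 1 = N then [⟨.node v w false, .sink, 3, false⟩] else [])
  | .node v w true =>
    if h : ∃ κ, IsWidth F v κ then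
      extOuts F (h.choose + 4) v w true ++
        if w < F v then
          [⟨.node v w true, .node (F^[h.choose] v) (F^[h.choose] v + 1) true, h.choose, true⟩]
        else []
    else []
  | .sink => []

theorem outs_true_of_isWidth {N : ℕ} {F : ℕ → ℕ} {v w κ : ℕ} (h : IsWidth F v κ) :
    outs N F (.node v w true) = extOuts F (κ + 4) v w true ++
      if w < F v then [⟨.node v w true, .node (F^[κ] v) (F^[κ] v + 1) true, κ, true⟩] else [] := by
  have hex : ∃ κ, IsWidth F v κ := ⟨κ, h⟩
  have : hex.choose = κ := hex.choose_spec.unique h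
  simp only [outs, dif_pos hex, this]

theorem outs_true_of_not {N : ℕ} {F : ℕ → ℕ} {v w : ℕ} (h : ¬ ∃ κ, IsWidth F v κ) :
    outs N F (.node v w true) = [] := by
  simp only [outs, dif_neg h]

theorem mem_extOuts {F : ℕ → ℕ} {j v w : ℕ} {b : Bool} {e : REdge} :
    e ∈ extOuts F j v w b ↔
      ∃ x y c, Ext F j v w x y ∧ e = ⟨.node v w b, .node x y c, j, false⟩ := by
  unfold extOuts
  constructor
  · split_ifs with h
    · intro he
      simp only [List.mem_cons, List.not_mem_nil, or_false] at he
      rcases he with rfl | rfl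
      · exact ⟨_, _, _, h, rfl⟩
      · exact ⟨_, _, _, h, rfl⟩
    · simp
  · rintro ⟨x, y, c, h, rfl⟩
    rw [← h.eq, if_pos h]
    cases c <;> simp

theorem nodup_extOuts (F : ℕ → ℕ) (j v w : ℕ) (b : Bool) : (extOuts F j v w b).Nodup := by
  unfold extOuts
  split_ifs <;> simp

theorem length_extOuts_le (F : ℕ → ℕ) (j v w : ℕ) (b : Bool) :
    (extOuts F j v w b).length ≤ 2 := by
  unfold extOuts
  split_ifs <;> simp

theorem nodup_outs (N : ℕ) (F : ℕ → ℕ) (a : RVertex) : (outs N F a).Nodup := by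
  rcases a with ⟨v, w, _ | _⟩ | _
  · unfold outs
    refine List.Nodup.append (nodup_extOuts _ _ _ _ _)
      (List.Nodup.append (nodup_extOuts _ _ _ _ _) (by split_ifs <;> simp) ?_) ?_
    · intro e h1 h2
      obtain ⟨x, y, c, -, rfl⟩ := mem_extOuts.1 h1
      split_ifs at h2 <;> simp at h2
    · intro e h1 h2
      obtain ⟨x, y, c, -, rfl⟩ := mem_extOuts.1 h1
      rcases List.mem_append.1 h2 with h2 | h2
      · obtain ⟨x, y, c, -, h3⟩ := mem_extOuts.1 h2
        simp at h3
      · split_ifs at h2 <;> simp at h2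
  · by_cases h : ∃ κ, IsWidth F v κ
    · obtain ⟨κ, hκ⟩ := h
      rw [outs_true_of_isWidth hκ]
      refine List.Nodup.append (nodup_extOuts _ _ _ _ _) (by split_ifs <;> simp) ?_
      intro e h1 h2
      obtain ⟨x, y, c, -, rfl⟩ := mem_extOuts.1 h1
      split_ifs at h2 <;> simp at h2
    · rw [outs_true_of_not h]
      exact List.nodup_nil
  · exact List.nodup_nil

theorem length_outs_le (N : ℕ) (F : ℕ → ℕ) (a : RVertex) : (outs N F a).length ≤ 5 := by
  rcases a with ⟨v, w, _ | _⟩ | _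
  · have h1 := length_extOuts_le F 3 v w false
    have h2 := length_extOuts_le F 4 v w false
    simp only [outs]
    split_ifs <;> simp <;> omega
  · by_cases h : ∃ κ, IsWidth F v κ
    · obtain ⟨κ, hκ⟩ := h
      have h1 := length_extOuts_le F (κ + 4) v w true
      rw [outs_true_of_isWidth hκ]
      split_ifs <;> simp <;> omega
    · rw [outs_true_of_not h]
      simp
  · simp [outs]

section

variable {N : ℕ} {F : ℕ → ℕ}

theorem mem_outs (G : PadGraph N F) {a : RVertex} {e : REdge} (ha : IsRVertex N F a) :
    e ∈ outs N F a ↔ IsREdge N F e ∧ e.src = a := by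
  have h6 := G.six_le
  constructor
  · intro he
    rcases a with ⟨v, w, _ | _⟩ | _
    · simp only [outs, List.mem_append, mem_extOuts] at he
      rcases he with ⟨x, y, c, h, rfl⟩ | ⟨x, y, c, h, rfl⟩ | he
      · exact ⟨.small c (.inl rfl) ((isExtension_iff G).2 h), rfl⟩
      · exact ⟨.small c (.inr rfl) ((isExtension_iff G).2 h), rfl⟩
      · split_ifs at he with hc
        · simp only [List.mem_singleton] at he
          obtain rfl : v = N - 2 := by omega
          obtain rfl : w = N - 1 := by omega
          subst he
          exact ⟨.last, rfl⟩
        · simp at he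
    · by_cases h : ∃ κ, IsWidth F v κ
      · obtain ⟨κ, hκ⟩ := h
        simp only [outs_true_of_isWidth hκ, List.mem_append, mem_extOuts] at he
        rcases he with ⟨x, y, c, h, rfl⟩ | he
        · exact ⟨.large c hκ ((isExtension_iff G).2 h), rfl⟩
        · split_ifs at he with hc
          · simp only [List.mem_singleton] at he
            subst he
            cases ha with
            | node _ ha => exact ⟨.compact ha hc.ne' hκ, rfl⟩
          · simp at he
      · rw [outs_true_of_not h] at he
        simp at he
    · simp [outs] at he
  · rintro ⟨he, rfl⟩
    cases he with
    | small c hj h =>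
      have h := (isExtension_iff G).1 h
      rcases hj with rfl | rfl
      · exact List.mem_append_left _ (mem_extOuts.2 ⟨_, _, _, h, rfl⟩)
      · exact List.mem_append_right _ (List.mem_append_left _ (mem_extOuts.2 ⟨_, _, _, h, rfl⟩))
    | large c hκ h =>
      have h := (isExtension_iff G).1 h
      simp only [outs_true_of_isWidth hκ]
      exact List.mem_append_left _ (mem_extOuts.2 ⟨_, _, _, h, rfl⟩)
    | compact h hw hκ =>
      simp only [outs_true_of_isWidth hκ]
      have := h.2.2.2
      rw [if_pos (by omega)]
      simp
    | last =>
      refine List.mem_append_right _ (List.mem_append_right _ ?_)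
      rw [if_pos (by omega)]
      simp

theorem IsREdge.isRVertex_tgt (G : PadGraph N F) {e : REdge} (h : IsREdge N F e) :
    IsRVertex N F e.tgt := by
  cases h with
  | small c hj h =>
    have h := (isExtension_iff G).1 h
    have h1 := h.ok.add_le_last G
    have h2 := h.far
    have h3 := h.lt_map
    have h4 := h.lt
    have h5 := G.map_le
    exact .node _ ⟨by omega, h.lt, h3.le.trans (G.map_le _), h3.le⟩
  | large c hκ h =>
    have h := (isExtension_iff G).1 h
    have h1 := h.ok.add_le_last G
    have h2 := h.far
    have h3 := h.lt_map
    have h4 := h.lt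
    have h5 := G.map_le
    exact .node _ ⟨by omega, h.lt, h3.le.trans (G.map_le _), h3.le⟩
  | @compact v w κ h hw hκ =>
    have h1 := hκ.2.1
    have h2 := h.le
    have h3 := G.add_le_iterate (i := κ) (by omega : v ≤ N) (by omega : 1 ≤ outDeg F (F^[κ] v))
      (by omega)
    have h4 := G.map_le (F^[κ] v)
    unfold outDeg at h1
    exact .node _ ⟨by omega, by omega, by omega, by omega⟩
  | last => exact .sink

theorem base_succ {x : ℕ} (hx : 1 ≤ x) : base F (x + 1) = base F x + 2 * outDeg F x := by
  unfold base
  rw [Finset.sum_Ico_succ_top hx]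
  ring

theorem base_mono : Monotone (base F) := fun _ _ h =>
  Nat.mul_le_mul_left _ (Finset.sum_le_sum_of_subset (Finset.Ico_subset_Ico_right h))

theorem IsArc.index_lt {x y : ℕ} (h : IsArc N F x y) (b : Bool) :
    base F x ≤ index N F (.node x y b) ∧ index N F (.node x y b) < base F (x + 1) := by
  obtain ⟨h1, h2, h3, h4⟩ := h
  have := Bool.toNat_le b
  rw [base_succ h1]
  simp only [index, outDeg]
  omega

theorem IsArc.index_lt_sink {x y : ℕ} (h : IsArc N F x y) (b : Bool) :
    index N F (.node x y b) < base F (N + 1) :=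
  (h.index_lt b).2.trans_le (base_mono (by have := h.le; omega))

theorem IsRVertex.index_le {a : RVertex} (ha : IsRVertex N F a) :
    index N F a ≤ base F (N + 1) := by
  cases ha with
  | node b h => exact (h.index_lt_sink b).le
  | sink => exact le_rfl

theorem index_node_inj {x y x' y' : ℕ} {b b' : Bool} (h : IsArc N F x y) (h' : IsArc N F x' y')
    (he : index N F (.node x y b) = index N F (.node x' y' b')) : x = x' ∧ y = y' ∧ b = b' := by
  have h1 := h.index_lt b
  have h2 := h'.index_lt b'
  have hx : x = x' := by
    rcases lt_trichotomy x x' with hlt | rfl | hlt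
    · have := base_mono (F := F) (show x + 1 ≤ x' from hlt)
      omega
    · rfl
    · have := base_mono (F := F) (show x' + 1 ≤ x from hlt)
      omega
  subst hx
  have h3 := h.le
  have h4 := h'.le
  have h5 := Bool.toNat_le b
  have h6 := Bool.toNat_le b'
  simp only [index] at he
  refine ⟨rfl, by omega, ?_⟩
  have : b.toNat = b'.toNat := by omega
  cases b <;> cases b' <;> simp at this ⊢

/-- Along an edge of `R` the index increases. -/
theorem IsREdge.index_lt (G : PadGraph N F) {e : REdge} (h : IsREdge N F e)
    (hs : IsRVertex N F e.src) : index N F e.src < index N F e.tgt := by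
  have h1 := h.weight_le G
  have h2 := h.isRVertex_tgt G
  rcases e with ⟨src, tgt, wt, c⟩
  simp only at h1 h2 hs ⊢
  cases hs with
  | sink => cases h
  | node b hb =>
    cases h2 with
    | sink => exact hb.index_lt_sink b
    | node b' hb' =>
      simp only [rpos] at h1
      exact (hb.index_lt b).2.trans_le ((base_mono (by omega)).trans (hb'.index_lt b').1)

end

/-- The first cells of the arrays `7, 8, 9`, as many as register `8` says. -/
def elist (s : RamState) : List (ℕ × ℕ × ℕ) :=
  (List.range (s.reg 8)).map fun e => (s.arr 7 e, s.arr 8 e, s.arr 9 e)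

theorem length_elist (s : RamState) : (elist s).length = s.reg 8 := by simp [elist]

theorem elist_congr {s s' : RamState} (h8 : s'.reg 8 = s.reg 8) (h7 : s'.arr 7 = s.arr 7)
    (h8' : s'.arr 8 = s.arr 8) (h9 : s'.arr 9 = s.arr 9) : elist s' = elist s := by
  simp only [elist, h8, h7, h8', h9]

theorem bijOn_of_getElem {α : Type*} {g : ℕ → α} {m : ℕ} {l : List α} (hl : l.Nodup)
    (hg : ∀ i (h : i < l.length), g (m + i) = l[i]) :
    Set.BijOn g (Set.Ico m (m + l.length)) {x | x ∈ l} := by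
  refine ⟨fun e he => ?_, fun e he e' he' h => ?_, fun x hx => ?_⟩
  · have := hg (e - m) (by have := he.1; have := he.2; omega)
    rw [Nat.add_sub_cancel' he.1] at this
    rw [Set.mem_ofPred_eq, this]
    exact List.getElem_mem _
  · obtain ⟨h1, h2⟩ := he
    obtain ⟨h3, h4⟩ := he'
    have h5 := hg (e - m) (by omega)
    have h6 := hg (e' - m) (by omega)
    rw [Nat.add_sub_cancel' h1] at h5
    rw [Nat.add_sub_cancel' h3] at h6
    rw [h5, h6] at h
    have := (List.Nodup.getElem_inj_iff hl).1 h
    omega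
  · obtain ⟨i, hi, rfl⟩ := List.getElem_of_mem hx
    exact ⟨m + i, ⟨by omega, by omega⟩, hg i hi⟩

/-- The list of the edges that leave `a` is stored at index `k`. -/
def Stored (N : ℕ) (F : ℕ → ℕ) (s : RamState) (k : ℕ) (a : RVertex) : Prop :=
  ∃ l₁ l₂, elist s = l₁ ++ ((outs N F a).map (code N F) ++ l₂) ∧
    s.arr 6 k = l₁.length ∧ s.arr 6 (k + 1) = l₁.length + (outs N F a).length

/-- The vertex of `R` with index `k` is stored, together with the edges that leave it. -/
def VertexOK (N : ℕ) (F : ℕ → ℕ) (s : RamState) (k : ℕ) : Prop :=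
  ∃ v w b, IsArc N F v w ∧ k = index N F (.node v w b) ∧ s.arr 3 k = v ∧ s.arr 4 k = w ∧
    s.arr 5 k = b.toNat ∧ Stored N F s k (.node v w b)

/-- The whole digraph `R` is stored, every vertex at its index. -/
structure Built (N : ℕ) (F : ℕ → ℕ) (s : RamState) : Prop where
  sink : s.reg 1 = base F (N + 1)
  vertex : ∀ k, k < s.reg 1 → VertexOK N F s k
  last : s.arr 6 (s.reg 1 + 1) = s.arr 6 (s.reg 1)
  room : s.reg 8 ≤ 5 * s.reg 1

section

variable {N : ℕ} {F : ℕ → ℕ}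

theorem Stored.getElem {s : RamState} {k : ℕ} {a : RVertex} (h : Stored N F s k a) :
    s.arr 6 (k + 1) = s.arr 6 k + (outs N F a).length ∧
    ∀ i (hi : i < (outs N F a).length), s.arr 7 (s.arr 6 k + i) = index N F (outs N F a)[i].tgt ∧
      s.arr 8 (s.arr 6 k + i) = (outs N F a)[i].weight ∧
      s.arr 9 (s.arr 6 k + i) = (outs N F a)[i].compact.toNat := by
  obtain ⟨l₁, l₂, h1, h2, h3⟩ := h
  refine ⟨by omega, fun i hi => ?_⟩
  have h4 : l₁.length + i < (elist s).length := by simp [h1]; omega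
  have h5 : (elist s)[l₁.length + i] = code N F (outs N F a)[i] := by
    simp only [h1]
    rw [List.getElem_append_right (by omega), List.getElem_append_left (by simp; omega)]
    simp
  simp only [elist, List.getElem_map, List.getElem_range, code, Prod.mk.injEq] at h5
  rwa [h2]

theorem Built.vertexAt_index {s : RamState} (h : Built N F s) {a : RVertex}
    (ha : IsRVertex N F a) : vertexAt s (index N F a) = a := by
  cases ha with
  | sink => simp [vertexAt, index, h.sink]
  | @node x y b hb =>
    have h1 := hb.index_lt_sink b
    obtain ⟨v, w, b', h2, h3, h4, h5, h6, -⟩ := h.vertex (index N F (.node x y b))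
      (by rw [h.sink]; exact h1)
    obtain ⟨rfl, rfl, rfl⟩ := index_node_inj hb h2 h3
    unfold vertexAt
    rw [if_neg (by rw [h.sink]; omega), h4, h5, h6]
    cases b <;> simp

theorem Built.exists_vertex {s : RamState} (h : Built N F s) {k : ℕ} (hk : k ≤ s.reg 1) :
    ∃ a, IsRVertex N F a ∧ k = index N F a := by
  rcases hk.lt_or_eq with hk | rfl
  · obtain ⟨v, w, b, h1, h2, -⟩ := h.vertex k hk
    exact ⟨_, .node b h1, h2⟩
  · exact ⟨.sink, .sink, h.sink⟩

theorem Built.stored {s : RamState} (h : Built N F s) {a : RVertex} (ha : IsRVertex N F a) :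
    s.arr 6 (index N F a + 1) = s.arr 6 (index N F a) + (outs N F a).length ∧
    ∀ i (hi : i < (outs N F a).length),
      s.arr 7 (s.arr 6 (index N F a) + i) = index N F (outs N F a)[i].tgt ∧
      s.arr 8 (s.arr 6 (index N F a) + i) = (outs N F a)[i].weight ∧
      s.arr 9 (s.arr 6 (index N F a) + i) = (outs N F a)[i].compact.toNat := by
  cases ha with
  | sink =>
    have := h.last
    rw [h.sink] at this
    simp [outs, index, this]
  | @node x y b hb =>
    have h1 := hb.index_lt_sink b
    obtain ⟨v, w, b', h2, h3, h4, h5, h6, h7⟩ :=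
      h.vertex (index N F (.node x y b)) (by rw [h.sink]; exact h1)
    obtain ⟨rfl, rfl, rfl⟩ := index_node_inj hb h2 h3
    exact h7.getElem

theorem Built.start_le {s : RamState} (h : Built N F s) {a : RVertex} (ha : IsRVertex N F a)
    (hne : a ≠ .sink) : s.arr 6 (index N F a + 1) ≤ 5 * base F (N + 1) := by
  cases ha with
  | sink => exact (hne rfl).elim
  | @node x y b hb =>
    have h1 := hb.index_lt_sink b
    obtain ⟨v, w, b', -, -, -, -, -, l₁, l₂, h2, -, h4⟩ :=
      h.vertex (index N F (.node x y b)) (by rw [h.sink]; exact h1)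
    have h5 := congrArg List.length h2
    simp only [length_elist, List.length_append, List.length_map] at h5
    have h6 := h.room
    have h7 := h.sink
    omega

theorem Built.triple {s : RamState} (h : Built N F s) {v w : ℕ} {b : Bool} (ha : IsArc N F v w) :
    s.arr 3 (index N F (.node v w b)) = v ∧ s.arr 4 (index N F (.node v w b)) = w ∧
      s.arr 5 (index N F (.node v w b)) = b.toNat := by
  obtain ⟨v', w', b', h2, h3, h4, h5, h6, -⟩ :=
    h.vertex (index N F (.node v w b)) (by rw [h.sink]; exact ha.index_lt_sink b)
  obtain ⟨rfl, rfl, rfl⟩ := index_node_inj ha h2 h3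
  exact ⟨h4, h5, h6⟩

theorem Built.edgeAt (G : PadGraph N F) {s : RamState} (h : Built N F s) {a : RVertex}
    (ha : IsRVertex N F a) (i : ℕ) (hi : i < (outs N F a).length) :
    edgeAt s (index N F a) (s.arr 6 (index N F a) + i) = (outs N F a)[i] := by
  obtain ⟨h1, h2, h3⟩ := (h.stored ha).2 i hi
  obtain ⟨h4, h5⟩ := (mem_outs G ha).1 (List.getElem_mem hi)
  unfold StraightDom.edgeAt
  rw [h.vertexAt_index ha, h1, h.vertexAt_index (h4.isRVertex_tgt G), h2, h3]
  generalize (outs N F a)[i] = e at *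
  rcases e with ⟨src, tgt, wt, c⟩
  subst h5
  cases c <;> simp

theorem Built.holdsR (G : PadGraph N F) {s : RamState} (h : Built N F s) : HoldsR s N F := by
  refine ⟨⟨fun k hk => ?_, fun k hk k' hk' he => ?_, fun a ha => ?_⟩,
      fun k hk => ⟨fun e h1 h2 => ?_, ?_⟩⟩
  · obtain ⟨a, ha, rfl⟩ := h.exists_vertex hk
    rw [h.vertexAt_index ha]
    exact ha
  · obtain ⟨a, ha, rfl⟩ := h.exists_vertex hk
    obtain ⟨a', ha', rfl⟩ := h.exists_vertex hk'
    rw [h.vertexAt_index ha, h.vertexAt_index ha'] at he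
    rw [he]
  · exact ⟨index N F a, by rw [Set.mem_Iic, h.sink]; exact ha.index_le, h.vertexAt_index ha⟩
  · obtain ⟨a, ha, rfl⟩ := h.exists_vertex hk
    obtain ⟨h3, h4⟩ := h.stored ha
    obtain ⟨i, rfl⟩ : ∃ i, e = s.arr 6 (index N F a) + i := ⟨e - s.arr 6 (index N F a), by omega⟩
    have hi : i < (outs N F a).length := by omega
    rw [(h4 i hi).1, h.sink]
    exact (((mem_outs G ha).1 (List.getElem_mem hi)).1.isRVertex_tgt G).index_le
  · obtain ⟨a, ha, rfl⟩ := h.exists_vertex hk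
    rw [(h.stored ha).1, h.vertexAt_index ha]
    have := bijOn_of_getElem (nodup_outs N F a) (h.edgeAt G ha)
    simpa only [mem_outs G ha] using this

end

/-! ### Building `R` -/

/-- Array `17` receives the indices of the first vertices of `R` for each vertex of the graph, and
register `1` the index of the sink. -/
def baseProg : RamProg :=
  .assign 5 1 ;; .store 17 1 0 ;;
  .while (.lt (R 5) (R 0 + 1)) (
    .assign 6 (A 0 (R 5) - R 5) ;;
    .store 17 (R 5 + 1) (A 17 (R 5) + R 6 + R 6) ;;
    .assign 5 (R 5 + 1)) ;;
  .assign 1 (A 17 (R 5))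

/-- Registers `13` and `14` receive `extPair F p q`, where `p` and `q` are in the registers `10`
and `11`. -/
def extPairProg : RamProg :=
  .assign 15 (A 0 (A 0 (R 10) + 1)) ;; .assign 16 (A 0 (A 0 (R 11) + 1)) ;;
  .ite (.eq (R 15) (R 16))
    (.assign 17 (A 0 (R 15 - 1) - (R 15 - 1)) ;;
     .ite (.eq (R 17) 1) (.assign 13 (R 15 - 2) ;; .assign 14 (R 15 - 1))
      (.ite (.lt 1 (R 17)) (.assign 13 (R 15 - 1) ;; .assign 14 (R 15))
        (.assign 13 (R 15) ;; .assign 14 (R 16))))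
    (.assign 17 (A 0 (R 15) - R 15) ;;
     .ite (.eq (R 17) 1) (.assign 13 (R 15 - 1) ;; .assign 14 (R 15))
      (.ite (.eq (A 0 (R 15)) (R 16))
        (.ite (.lt 1 (R 17)) (.assign 13 (R 15) ;; .assign 14 (R 16 - 1))
          (.assign 13 (R 15) ;; .assign 14 (R 16)))
        (.assign 13 (R 15) ;; .assign 14 (R 16))))

/-- Append an edge: its target has the index in register `20`, its weight is in register `12`, and
its flag is in register `21`. -/
def emitProg : RamProg :=
  .store 7 (R 8) (R 20) ;; .store 8 (R 8) (R 12) ;; .store 9 (R 8) (R 21) ;; .assign 8 (R 8 + 1)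

/-- Append the regular edges that come from an expansive set whose last two vertices are in the
registers `10` and `11`, and whose size is in register `12`. -/
def extProg : RamProg :=
  extPairProg ;;
  .ite (.lt (A 0 (R 11)) (R 13)) (.ite (.lt (R 13) (R 14)) (.ite (.lt (R 14) (A 0 (R 13)))
    (.assign 21 0 ;;
     .assign 20 (A 17 (R 13) + (R 14 - R 13 - 1) + (R 14 - R 13 - 1)) ;; emitProg ;;
     .assign 20 (R 20 + 1) ;; emitProg) .skip) .skip) .skip

/-- Append the regular edges of weight `3` that do not lead to the sink. -/
def outThreeProg : RamProg :=
  .ite (.lt (R 6) (A 0 (R 5)))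
    (.assign 10 (R 6) ;; .assign 11 (A 0 (R 5)) ;; .assign 12 3 ;; extProg) .skip

/-- Append the regular edges of weight `4` that leave a lower vertex. -/
def outFourProg : RamProg :=
  .ite (.lt (R 6) (A 0 (R 5))) (.ite (.lt (R 6 + 1) (A 0 (R 6)))
    (.assign 11 (A 0 (R 6)) ;;
     .ite (.lt (A 0 (R 5)) (R 11 - 1)) (.assign 10 (A 0 (R 5))) (.assign 10 (R 11 - 1)) ;;
     .assign 12 4 ;; extProg) .skip) .skip

/-- Append the edge to the sink. -/
def outSinkProg : RamProg :=
  .ite (.eq (R 5 + 2) (R 0)) (.ite (.eq (R 6 + 1) (R 0))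
    (.assign 20 (R 1) ;; .assign 12 3 ;; .assign 21 0 ;; emitProg) .skip) .skip

/-- Append the edges that leave a lower vertex. -/
def outLowerProg : RamProg := outThreeProg ;; outFourProg ;; outSinkProg

/-- Append the edges that leave an upper vertex. -/
def outUpperProg : RamProg :=
  .ite (.lt (A 1 (R 5)) (R 0 + 1)) (.ite (.lt (R 6) (A 0 (R 5)))
    (.assign 9 (A 2 (R 5)) ;; .assign 11 (A 0 (R 9)) ;; .assign 10 (R 11 - 1) ;;
     .assign 12 (A 1 (R 5) + 4) ;; extProg ;;
     .assign 12 (A 1 (R 5)) ;; .assign 20 (A 17 (R 9) + 1) ;; .assign 21 1 ;; emitProg) .skip) .skip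

/-- Store the two vertices of `R` that come from the arc from register `5` to register `6`; the
first one has its index in register `7`. -/
def arcProg : RamProg :=
  .store 3 (R 7) (R 5) ;; .store 4 (R 7) (R 6) ;; .store 5 (R 7) 0 ;;
  outLowerProg ;;
  .assign 7 (R 7 + 1) ;; .store 6 (R 7) (R 8) ;;
  .store 3 (R 7) (R 5) ;; .store 4 (R 7) (R 6) ;; .store 5 (R 7) 1 ;;
  outUpperProg ;;
  .assign 7 (R 7 + 1) ;; .store 6 (R 7) (R 8)

/-- Build `R` with adjacency lists. -/
def buildProg : RamProg :=
  baseProg ;;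
  .assign 5 1 ;; .assign 6 2 ;; .assign 7 0 ;; .assign 8 0 ;; .store 6 0 0 ;;
  .while (.lt (R 5) (R 0 + 1))
    (.ite (.lt (A 0 (R 5)) (R 6))
      (.assign 5 (R 5 + 1) ;; .assign 6 (R 5 + 1))
      (arcProg ;; .assign 6 (R 6 + 1))) ;;
  .store 6 (R 7 + 1) (R 8)

/-- What the memory holds while `R` is being built. -/
structure Ctx (N : ℕ) (F : ℕ → ℕ) (s : RamState) : Prop where
  graph : Holds N F s
  width : HoldsWidth s N F
  base : ∀ x, 1 ≤ x → x ≤ N + 1 → s.arr 17 x = base F x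
  sink : s.reg 1 = StraightDom.base F (N + 1)

section

variable {N B : ℕ} {F : ℕ → ℕ}

theorem Ctx.congr {s s' : RamState} (h : Ctx N F s) (r0 : s'.reg 0 = s.reg 0)
    (r1 : s'.reg 1 = s.reg 1) (a0 : s'.arr 0 = s.arr 0) (a1 : s'.arr 1 = s.arr 1)
    (a2 : s'.arr 2 = s.arr 2) (a17 : s'.arr 17 = s.arr 17) : Ctx N F s' := by
  refine ⟨⟨by rw [r0, h.graph.1], by rw [a0]; exact h.graph.2⟩, ?_, by rw [a17]; exact h.base,
    by rw [r1, h.sink]⟩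
  have := h.width
  unfold HoldsWidth at *
  rwa [a1, a2]

theorem Ctx.frame {p : RamProg} {s s' : RamState} (h : Ctx N F s) (hf : Frame p s s')
    (r0 : p.noReg 0 = true := by rfl) (r1 : p.noReg 1 = true := by rfl)
    (a0 : p.noArr 0 = true := by rfl) (a1 : p.noArr 1 = true := by rfl)
    (a2 : p.noArr 2 = true := by rfl) (a17 : p.noArr 17 = true := by rfl) : Ctx N F s' :=
  h.congr (hf.reg 0 r0) (hf.reg 1 r1) (hf.arr 0 a0) (hf.arr 1 a1) (hf.arr 2 a2) (hf.arr 17 a17)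

theorem emitProg_spec {s : RamState} (h8 : s.reg 8 + 1 ≤ B) (h20 : s.reg 20 ≤ B)
    (h12 : s.reg 12 ≤ B) (h21 : s.reg 21 ≤ B) :
    Tri B emitProg s 20
      (fun s' => elist s' = elist s ++ [(s.reg 20, s.reg 12, s.reg 21)]) := by
  refine Tri.wp ?_ (by decide)
  simp only [emitProg, RamProg.wp, eval_reg, eval_add, eval_ofNat, setArr_reg]
  refine ⟨⟨by omega, by omega⟩, ⟨by omega, by omega⟩, ⟨by omega, by omega⟩, by omega, ?_⟩
  simp only [elist, setReg_reg, if_true, List.range_succ, List.map_append, setReg_arr, setArr_arr]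
  congr 1
  · refine List.map_congr_left fun e he => ?_
    have := List.mem_range.1 he
    simp [this.ne]
  · simp

theorem extPairProg_spec (G : PadGraph N F) {s : RamState} (hs : Holds N F s) (hB : N + 7 ≤ B)
    (h10 : s.reg 10 ≤ N) (h11 : s.reg 11 ≤ N) :
    Tri B extPairProg s 60 (fun s' => (s'.reg 13, s'.reg 14) =
      extPair F (s.reg 10) (s.reg 11) ∧ s'.reg 13 ≤ N ∧ s'.reg 14 ≤ N) := by
  refine Tri.wp ?_ (by decide)
  have hF := G.map_le
  have e : ∀ i, i ≤ N + 1 → s.arr 0 i = F i := hs.2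
  have e1 := e (s.reg 10) (by omega)
  have e2 := e (s.reg 11) (by omega)
  have e3 := e (F (s.reg 10) + 1) (by have := hF (s.reg 10); omega)
  have e4 := e (F (s.reg 11) + 1) (by have := hF (s.reg 11); omega)
  have hu := hF (F (s.reg 10) + 1)
  have hz := hF (F (s.reg 11) + 1)
  simp only [extPairProg, RamProg.wp, eval_reg, eval_add, eval_sub, eval_load, eval_ofNat,
    setReg_reg, setReg_arr, if_true, holds_eq, holds_lt, e1, e2, e3, e4, Nat.reduceEqDiff, if_false]
  unfold extPair outDeg
  generalize F (F (s.reg 10) + 1) = u at *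
  generalize F (F (s.reg 11) + 1) = z at *
  have e5 := e u (by omega)
  have e6 := e (u - 1) (by omega)
  have hu' := hF u
  have hu'' := hF (u - 1)
  rw [e5, e6]
  refine ⟨by omega, by omega, fun c1 => ⟨by omega, fun c2 => ⟨by omega, by omega, ?_⟩,
    fun c2 => ⟨fun c3 => ⟨by omega, by omega, ?_⟩, fun c3 => ⟨by omega, by omega, ?_⟩⟩⟩,
    fun c1 => ⟨by omega, fun c2 => ⟨by omega, by omega, ?_⟩, fun c2 => ⟨fun c3 =>
      ⟨fun c4 => ⟨by omega, by omega, ?_⟩, fun c4 => ⟨by omega, by omega, ?_⟩⟩,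
      fun c3 => ⟨by omega, by omega, ?_⟩⟩⟩⟩
  all_goals
    refine ⟨?_, by omega, by omega⟩
    dsimp only [Prod.mk.eta]
    split_ifs <;> first | rfl | omega

theorem extProg_spec (G : PadGraph N F) {s : RamState} (hs : Ctx N F s) {j v w : ℕ} (b : Bool)
    (hB : N + 7 ≤ B) (hB' : base F (N + 1) + 2 ≤ B)
    (h8 : s.reg 8 + 2 ≤ B) (hok : ExpOK F j v w) (h10 : s.reg 10 = (penLast F j v w).1)
    (h11 : s.reg 11 = (penLast F j v w).2) (h12 : s.reg 12 = j) (hj : j ≤ B) :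
    Tri B extProg s 160
      (fun s' => elist s' = elist s ++ (extOuts F j v w b).map (code N F)) := by
  have hF := G.map_le
  have hp : s.reg 10 ≤ N ∧ s.reg 11 ≤ N := by
    rw [h10, h11]
    refine ⟨?_, hok.last_le G⟩
    have h5 := G.iterate_le (hok.le G).1 (j - 3)
    unfold penLast
    split_ifs
    · exact (hok.le G).2
    · exact (min_le_left _ _).trans (hF v)
    · exact (Nat.sub_le _ _).trans h5
  refine Tri.seq (extPairProg_spec G hs.graph hB hp.1 hp.2).frame ?_ (by omega)
  rintro s₁ ⟨⟨h1, h2, h3⟩, hf⟩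
  have hs₁ := hs.frame hf
  have e8 := hf.reg 8
  have e11 := hf.reg 11
  have e12 := hf.reg 12
  have el : elist s₁ = elist s := elist_congr e8 (hf.arr 7) (hf.arr 8) (hf.arr 9)
  rw [h10, h11] at h1
  have hiff : Ext F j v w (s₁.reg 13) (s₁.reg 14) ↔ F (s.reg 11) < s₁.reg 13 ∧
      s₁.reg 13 < s₁.reg 14 ∧ s₁.reg 14 < F (s₁.reg 13) :=
    ⟨fun h => ⟨by rw [h11]; exact h.far, h.lt, h.lt_map⟩,
      fun h => ⟨hok, h.2.1, h.2.2, by rw [← h11]; exact h.1, h1⟩⟩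
  have hout : extOuts F j v w b = if F (s.reg 11) < s₁.reg 13 ∧
      s₁.reg 13 < s₁.reg 14 ∧ s₁.reg 14 < F (s₁.reg 13) then
      [⟨.node v w b, .node (s₁.reg 13) (s₁.reg 14) false, j, false⟩,
       ⟨.node v w b, .node (s₁.reg 13) (s₁.reg 14) true, j, false⟩] else [] := by
    unfold extOuts
    rw [← h1]
    simp only [hiff]
  rw [hout]
  have hr1 : s₁.arr 0 (s₁.reg 11) = F (s.reg 11) := by rw [e11]; exact hs₁.graph.2 _ (by omega)
  have hr2 : s₁.arr 0 (s₁.reg 13) = F (s₁.reg 13) := hs₁.graph.2 _ (by omega)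
  have hskip : ¬ (F (s.reg 11) < s₁.reg 13 ∧
      s₁.reg 13 < s₁.reg 14 ∧ s₁.reg 14 < F (s₁.reg 13)) → elist s₁ = elist s ++
      (if F (s.reg 11) < s₁.reg 13 ∧ s₁.reg 13 < s₁.reg 14 ∧ s₁.reg 14 < F (s₁.reg 13) then
      [⟨.node v w b, .node (s₁.reg 13) (s₁.reg 14) false, j, false⟩,
       ⟨.node v w b, .node (s₁.reg 13) (s₁.reg 14) true, j, false⟩] else []).map (code N F) := by
    intro h
    rw [if_neg h, el]
    simp
  refine Tri.wp ?_ (by decide)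
  simp only [RamProg.wp, holds_lt, eval_load, eval_reg, hr1, hr2]
  refine ⟨fun c1 => ⟨fun c2 => ⟨fun c3 => ?_, fun c3 => hskip (by tauto)⟩,
    fun c2 => hskip (by tauto)⟩, fun c1 => hskip (by tauto)⟩
  rw [if_pos ⟨c1, c2, c3⟩]
  have harc : IsArc N F (s₁.reg 13) (s₁.reg 14) := ⟨by omega, c2, h3, c3.le⟩
  have hb := hs₁.base (s₁.reg 13) (by omega) (by omega)
  have hi := (harc.index_lt_sink true)
  simp only [index, Bool.toNat_true] at hi
  simp only [emitProg, RamProg.wp, eval_add, eval_sub, eval_ofNat, eval_load, eval_reg, setArr_reg,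
    setReg_reg, setReg_arr, if_true, Nat.reduceEqDiff, if_false, hb, e8, e12, h12]
  refine ⟨by omega, by omega, ⟨by omega, by omega⟩, ⟨by omega, by omega⟩, ⟨by omega, by omega⟩,
    by omega, by omega, ⟨by omega, by omega⟩, ⟨by omega, by omega⟩, ⟨by omega, by omega⟩,
    by omega, ?_⟩
  rw [← el]
  simp only [elist, setReg_reg, if_true, List.range_succ, List.map_append, setReg_arr, setArr_arr,
    e8, List.append_assoc]
  congr 1
  · refine List.map_congr_left fun e he => ?_
    have := List.mem_range.1 he
    simp [this.ne, (this.trans (Nat.lt_succ_self _)).ne]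
  · simp [code, index, two_mul, add_assoc]

/-- The state while the arc `vw` is treated: the arc is in the registers `5` and `6`. -/
structure ArcCtx (N : ℕ) (F : ℕ → ℕ) (v w B : ℕ) (s : RamState) : Prop extends Ctx N F s where
  arc : IsArc N F v w
  five : s.reg 5 = v
  six : s.reg 6 = w
  room : s.reg 8 + 5 ≤ B

theorem outThreeProg_spec (G : PadGraph N F) (hB : N + 7 ≤ B) (hB' : base F (N + 1) + 2 ≤ B)
    {s : RamState} {v w : ℕ} (hs : ArcCtx N F v w B s) : Tri B outThreeProg s 200
      (fun s' => elist s' = elist s ++ (extOuts F 3 v w false).map (code N F)) := by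
  have harc := hs.arc.le
  have hv : s.arr 0 v = F v := hs.graph.2 v (by omega)
  have hF := G.map_le v
  refine Tri.ite (T := 190) (fun hb => ?_) (fun hb => Tri.skip ?_ (by omega)) (by decide)
  · simp only [holds_lt, eval_reg, eval_load, hs.five, hs.six, hv] at hb
    have hok : ExpOK F 3 v w := ⟨harc.1, harc.2.1, hb, .inl rfl⟩
    refine Tri.assign (T := 180) (by simp [hs.six]; omega) (Tri.assign (T := 172) ?_
      (Tri.assign (T := 160) (by simp; omega) ?_ (by decide)) (by decide)) (by decide)
    · simp [hs.five, hv]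
      omega
    · refine extProg_spec G ?_ false hB hB' ?_ hok ?_ ?_ ?_ (by omega)
      · exact hs.toCtx.congr rfl rfl rfl rfl rfl rfl
      · have := hs.room
        simp
        omega
      · simp [penLast, hs.six]
      · simp [penLast, hs.five, hv]
      · simp
  · simp only [holds_lt, eval_reg, eval_load, hs.five, hs.six, hv] at hb
    unfold extOuts
    rw [if_neg fun h => hb h.ok.lt_map]
    simp

theorem outFourProg_spec (G : PadGraph N F) (hB : N + 7 ≤ B) (hB' : base F (N + 1) + 2 ≤ B)
    {s : RamState} {v w : ℕ} (hs : ArcCtx N F v w B s) : Tri B outFourProg s 240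
      (fun s' => elist s' = elist s ++ (extOuts F 4 v w false).map (code N F)) := by
  have harc := hs.arc.le
  have hv : s.arr 0 v = F v := hs.graph.2 v (by omega)
  have hw : s.arr 0 w = F w := hs.graph.2 w (by omega)
  have hF := G.map_le v
  have hF' := G.map_le w
  refine Tri.ite (T := 230) (fun hb => Tri.ite (T := 220) (fun hb' => ?_)
    (fun hb' => Tri.skip ?_ (by omega)) (by decide)) (fun hb => Tri.skip ?_ (by omega)) (by decide)
  · simp only [holds_lt, eval_reg, eval_load, eval_add, eval_ofNat, hs.five, hs.six, hv,
      hw] at hb hb'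
    have hok : ExpOK F 4 v w := ⟨harc.1, harc.2.1, hb, .inr (.inl ⟨rfl, hb'⟩)⟩
    refine Tri.assign (T := 210) (by simp [hs.six, hw]; omega) ?_ (by decide)
    refine Tri.seq (T₁ := 30) (Tri.frame (Q := fun s' => s'.reg 10 = min (F v) (F w - 1))
      (Tri.wp ?_ (by decide))) ?_ (by omega)
    · simp only [RamProg.wp, holds_lt, eval_reg, eval_load, eval_sub, eval_ofNat, setReg_reg,
        setReg_arr, hs.five, hs.six, hv, hw, Nat.reduceEqDiff, if_false, if_true]
      refine ⟨fun h => ⟨by omega, by omega⟩, fun h => ⟨by omega, by omega⟩⟩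
    · rintro s₁ ⟨h1, hf⟩
      refine Tri.assign (T := 160) (by simp; omega) ?_ (by decide)
      have hc : Ctx N F (s.setReg 11 ((A 0 (R 6)).eval s)) :=
        hs.toCtx.congr rfl rfl rfl rfl rfl rfl
      have e8 := hf.reg 8
      have e11 := hf.reg 11
      have el : elist (s₁.setReg 12 4) = elist s :=
        elist_congr e8 (hf.arr 7) (hf.arr 8) (hf.arr 9)
      have hr := hs.room
      simp only [setReg_reg, Nat.reduceEqDiff, if_false, if_true, eval_load, eval_reg, hs.six,
        hw] at e8 e11
      rw [← el]
      refine extProg_spec G ?_ false hB hB' ?_ hok ?_ ?_ ?_ (by omega)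
      · exact (hc.frame hf).congr rfl rfl rfl rfl rfl rfl
      · simp
        omega
      · simp [penLast, h1]
      · simp [penLast, e11]
      · simp
  · simp only [holds_lt, eval_reg, eval_load, eval_add, eval_ofNat, hs.five, hs.six, hv,
      hw] at hb hb'
    unfold extOuts
    rw [if_neg fun h => hb' (by simpa using h.ok.size)]
    simp
  · simp only [holds_lt, eval_reg, eval_load, hs.five, hs.six, hv] at hb
    unfold extOuts
    rw [if_neg fun h => hb h.ok.lt_map]
    simp

theorem outSinkProg_spec (hB : N + 7 ≤ B) (hB' : base F (N + 1) + 2 ≤ B)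
    {s : RamState} {v w : ℕ} (hs : ArcCtx N F v w B s) : Tri B outSinkProg s 50
      (fun s' => elist s' = elist s ++ (if v + 2 = N ∧ w + 1 = N then
        [(⟨.node v w false, .sink, 3, false⟩ : REdge)] else []).map (code N F)) := by
  have hr := hs.room
  refine Tri.ite (T := 44) (fun hb => Tri.ite (T := 38) (fun hb' => ?_)
    (fun hb' => Tri.skip ?_ (by omega)) (by decide)) (fun hb => Tri.skip ?_ (by omega)) (by decide)
  all_goals
    simp only [holds_eq, eval_reg, eval_add, eval_ofNat, hs.five, hs.six, hs.graph.1] at *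
  · rw [if_pos ⟨hb, hb'⟩]
    have h1 := hs.sink
    refine Tri.assign (T := 34) (by simp; omega) (Tri.assign (T := 30) (by simp; omega)
      (Tri.assign (T := 20) (by simp) ?_ (by decide)) (by decide)) (by decide)
    refine (emitProg_spec ?_ ?_ ?_ ?_).mono le_rfl fun s' h => ?_
    · simp
      omega
    · simp
      omega
    · simp
      omega
    · simp
    · rw [h]
      congr 1
      simp [code, index, h1]
  · rw [if_neg (by tauto)]
    simp
  · rw [if_neg (by tauto)]
    simp

theorem ArcCtx.room_left {s s' : RamState} {v w : ℕ} (hs : ArcCtx N F v w B s) {p : RamProg}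
    (hf : Frame p s s') {l : List (ℕ × ℕ × ℕ)} (hl : elist s' = elist s ++ l)
    {B' : ℕ} (hB : s.reg 8 + l.length + 5 ≤ B')
    (r0 : p.noReg 0 = true := by rfl) (r1 : p.noReg 1 = true := by rfl)
    (r5 : p.noReg 5 = true := by rfl) (r6 : p.noReg 6 = true := by rfl)
    (a0 : p.noArr 0 = true := by rfl) (a1 : p.noArr 1 = true := by rfl)
    (a2 : p.noArr 2 = true := by rfl) (a17 : p.noArr 17 = true := by rfl) :
    ArcCtx N F v w B' s' := by
  have h := congrArg List.length hl
  simp only [length_elist, List.length_append] at h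
  exact ⟨hs.toCtx.frame hf r0 r1 a0 a1 a2 a17, hs.arc, (hf.reg 5 r5).trans hs.five,
    (hf.reg 6 r6).trans hs.six, by omega⟩

theorem outLowerProg_spec (G : PadGraph N F) (hB : N + 7 ≤ B) (hB' : base F (N + 1) + 2 ≤ B)
    {s : RamState} {v w : ℕ} (hs : ArcCtx N F v w B s) (hr : s.reg 8 + 9 ≤ B) :
    Tri B outLowerProg s 490
      (fun s' => elist s' = elist s ++ (outs N F (.node v w false)).map (code N F)) := by
  refine Tri.seq (outThreeProg_spec G hB hB' hs).frame ?_ (by omega)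
  rintro s₁ ⟨l₁, f₁⟩
  have b₁ := length_extOuts_le F 3 v w false
  have b₂ := length_extOuts_le F 4 v w false
  refine Tri.seq (outFourProg_spec G hB hB' (hs.room_left f₁ l₁ (by simp; omega))).frame ?_
    (by omega)
  rintro s₂ ⟨l₂, f₂⟩
  have n₁ := congrArg List.length l₁
  simp only [length_elist, List.length_append, List.length_map] at n₁
  have c₁ : ArcCtx N F v w (s₁.reg 8 + 5) s₁ := hs.room_left f₁ l₁ (by simp; omega)
  refine (outSinkProg_spec hB hB' (c₁.room_left f₂ l₂ (by simp; omega))).mono (by omega)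
    fun s₃ l₃ => ?_
  rw [l₃, l₂, l₁]
  simp [outs]

theorem outUpperProg_spec (G : PadGraph N F) (hB : N + 7 ≤ B) (hB' : base F (N + 1) + 2 ≤ B)
    {s : RamState} {v w : ℕ} (hs : ArcCtx N F v w B s) : Tri B outUpperProg s 260
      (fun s' => elist s' = elist s ++ (outs N F (.node v w true)).map (code N F)) := by
  have harc := hs.arc.le
  have hr := hs.room
  have hv : s.arr 0 v = F v := hs.graph.2 v (by omega)
  obtain ⟨hw1, hw2⟩ := hs.width v (by omega) (by omega)
  refine Tri.ite (T := 250) (fun hb => Tri.ite (T := 240) (fun hb' => ?_)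
    (fun hb' => Tri.skip ?_ (by omega)) (by decide)) (fun hb => Tri.skip ?_ (by omega)) (by decide)
  · simp only [holds_lt, eval_reg, eval_load, eval_add, eval_ofNat, hs.five, hs.six, hv,
      hs.graph.1] at hb hb'
    obtain ⟨κ, hκ⟩ : ∃ κ, IsWidth F v κ := by
      by_contra h
      have := (hw2 h).1
      omega
    obtain ⟨h1, h2⟩ := hw1 κ hκ
    have hle := G.width_le (by omega : v ≤ N) hκ
    have hFz : F (F^[κ] v) = F^[κ + 1] v := (Function.iterate_succ_apply' _ _ _).symm
    have ez : s.arr 0 (F^[κ] v) = F^[κ + 1] v := by rw [hs.graph.2 _ (by omega), hFz]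
    have hzN := G.iterate_le (by omega : v ≤ N) (κ + 1)
    have hpen : penLast F (κ + 4) v w = (F^[κ + 1] v - 1, F^[κ + 1] v) := by
      have hκ' := hκ.1
      unfold penLast
      rw [if_neg (by omega), if_neg (by omega)]
      rfl
    have hok : ExpOK F (κ + 4) v w := ⟨harc.1, harc.2.1, hb',
      .inr (.inr ⟨by have := hκ.1; omega, hκ.2.1⟩)⟩
    have hz1 := G.add_le_iterate (i := κ) (by omega : v ≤ N)
      (by have := hκ.2.1; omega : 1 ≤ outDeg F (F^[κ] v)) (Nat.le_succ κ)
    have hbz := hs.base (F^[κ] v) (by omega) (by omega)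
    have hzarc : IsArc N F (F^[κ] v) (F^[κ] v + 1) := by
      have := hκ.2.1
      unfold outDeg at this
      exact ⟨by omega, by omega, by omega, by omega⟩
    have hzi := hzarc.index_lt_sink true
    simp only [index, Bool.toNat_true] at hzi
    rw [outs_true_of_isWidth hκ, if_pos hb', List.map_append, ← List.append_assoc]
    generalize F^[κ + 1] v = z' at hFz ez hzN hpen
    refine Tri.assign (T := 235) ?_ (Tri.assign (T := 230) ?_ (Tri.assign (T := 225) ?_
      (Tri.assign (T := 215) ?_ ?_ (by decide)) (by decide)) (by decide)) (by decide)
    · simp [hs.five, h2]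
      omega
    · simp [hs.five, h2, ez]
      omega
    · simp [hs.five, h2, ez]
      omega
    · simp [hs.five, h1]
      omega
    simp only [eval_reg, eval_load, eval_add, eval_sub, eval_ofNat, setReg_reg, setReg_arr,
      if_true, Nat.reduceEqDiff, if_false, hs.five, h1, h2, ez]
    refine Tri.seq (extProg_spec (j := κ + 4) (v := v) (w := w) G ?_ true hB hB' ?_ hok ?_ ?_ ?_
        (by omega)).frame ?_
      (by omega)
    · exact hs.toCtx.congr rfl rfl rfl rfl rfl rfl
    · simp
      omega
    · simp [hpen]
    · simp [hpen]
    · simp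
    rintro s₁ ⟨g1, hf⟩
    have e5 := hf.reg 5
    have e8 : s₁.reg 8 = (elist s ++ (extOuts F (κ + 4) v w true).map (code N F)).length := by
      rw [← length_elist, g1]
      rfl
    have hlen := length_extOuts_le F (κ + 4) v w true
    have e9 := hf.reg 9
    have a1 := hf.arr 1
    have a17 := hf.arr 17
    simp only [setReg_reg, setReg_arr, if_true, Nat.reduceEqDiff, if_false, hs.five] at e5 e9 a1 a17
    simp only [List.length_append, length_elist, List.length_map] at e8
    refine Tri.assign (T := 45) ?_ (Tri.assign (T := 35) ?_ (Tri.assign (T := 20) ?_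
      ((emitProg_spec ?_ ?_ ?_ ?_).mono le_rfl fun s' h => ?_) (by decide)) (by decide)) (by decide)
    · simp [e5, a1, h1]
      omega
    · simp [e9, a17, hbz]
      omega
    · simp
      omega
    · simp
      omega
    · simp [e9, a17, hbz]
      omega
    · simp [e5, a1, h1]
      omega
    · simp
      omega
    · rw [h]
      simp only [eval_reg, eval_load, eval_add, eval_ofNat, setReg_reg, setReg_arr,
        if_true, Nat.reduceEqDiff, if_false, e5, e9, a1, a17, h1, hbz]
      refine congrArg₂ _ g1 ?_
      simp [code, index]
  · simp only [holds_lt, eval_reg, eval_load, eval_add, eval_ofNat, hs.five, hs.six, hv,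
      hs.graph.1] at hb hb'
    by_cases h : ∃ κ, IsWidth F v κ
    · obtain ⟨κ, hκ⟩ := h
      rw [outs_true_of_isWidth hκ, if_neg hb']
      unfold extOuts
      rw [if_neg fun h => hb' h.ok.lt_map]
      simp
    · rw [outs_true_of_not h]
      simp
  · simp only [holds_lt, eval_reg, eval_load, eval_add, eval_ofNat, hs.five, hs.graph.1] at hb
    rw [outs_true_of_not]
    · simp
    · rintro ⟨κ, hκ⟩
      have h1 := (hw1 κ hκ).1
      have hle := G.width_le (by omega : v ≤ N) hκ
      omega

theorem VertexOK.append {s s' : RamState} {k : ℕ} (h : VertexOK N F s k) {l : List (ℕ × ℕ × ℕ)}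
    (hl : elist s' = elist s ++ l) (h3 : s'.arr 3 k = s.arr 3 k) (h4 : s'.arr 4 k = s.arr 4 k)
    (h5 : s'.arr 5 k = s.arr 5 k) (h6 : s'.arr 6 k = s.arr 6 k)
    (h6' : s'.arr 6 (k + 1) = s.arr 6 (k + 1)) : VertexOK N F s' k := by
  obtain ⟨v, w, b, g1, g2, g3, g4, g5, l₁, l₂, g6, g7, g8⟩ := h
  exact ⟨v, w, b, g1, g2, h3.trans g3, h4.trans g4, h5.trans g5, l₁, l₂ ++ l,
    by rw [hl, g6]; simp, h6.trans g7, h6'.trans g8⟩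

theorem VertexOK.new {s s' : RamState} {k v w : ℕ} {b : Bool} (harc : IsArc N F v w)
    (hk : k = index N F (.node v w b))
    (hl : elist s' = elist s ++ (outs N F (.node v w b)).map (code N F)) (h3 : s'.arr 3 k = v)
    (h4 : s'.arr 4 k = w) (h5 : s'.arr 5 k = b.toNat) (h6 : s'.arr 6 k = s.reg 8)
    (h6' : s'.arr 6 (k + 1) = s'.reg 8) : VertexOK N F s' k := by
  refine ⟨v, w, b, harc, hk, h3, h4, h5, elist s, [], by rw [hl]; simp,
    by rw [h6, length_elist], ?_⟩
  rw [h6', ← length_elist, hl]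
  simp

theorem arcProg_spec (G : PadGraph N F) (hB : N + 7 ≤ B) (hB' : base F (N + 1) + 2 ≤ B)
    {s : RamState} {v w : ℕ} (hs : Ctx N F s) (harc : IsArc N F v w) (h5 : s.reg 5 = v)
    (h6 : s.reg 6 = w) (h7 : s.reg 7 = index N F (.node v w false)) (h8 : s.reg 8 + 10 ≤ B)
    (ha6 : s.arr 6 (s.reg 7) = s.reg 8) (hv : ∀ k, k < s.reg 7 → VertexOK N F s k) :
    Tri B arcProg s 1200 (fun s' => s'.reg 7 = s.reg 7 + 2 ∧ s'.reg 8 ≤ s.reg 8 + 10 ∧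
      s'.arr 6 (s'.reg 7) = s'.reg 8 ∧ ∀ k, k < s'.reg 7 → VertexOK N F s' k) := by
  have hle := harc.le
  have hk1 := harc.index_lt_sink true
  have hk2 : index N F (.node v w true) = index N F (.node v w false) + 1 := by simp [index]
  generalize hk : s.reg 7 = k at *
  rw [hk2, ← h7] at hk1
  obtain ⟨s₁, hs₁⟩ : ∃ s₁, s₁ = ((s.setArr 3 k v).setArr 4 k w).setArr 5 k 0 := ⟨_, rfl⟩
  have c₁ : ArcCtx N F v w B s₁ := by
    subst hs₁
    exact ⟨hs.congr rfl rfl rfl rfl rfl rfl, harc, h5, h6, by simp; omega⟩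
  refine Tri.store (T := 1190) (by simp; omega) (by simp; omega) (Tri.store (T := 1180)
    (by simp; omega) (by simp; omega) (Tri.store (T := 1170) (by simp; omega) (by simp) ?_
      (by decide)) (by decide)) (by decide)
  simp only [eval_reg, eval_ofNat, setArr_reg, hk, h5, h6]
  rw [← hs₁]
  have r₁ : s₁.reg 8 = s.reg 8 := by rw [hs₁]; rfl
  have l₁ : elist s₁ = elist s := elist_congr (by rw [hs₁]; rfl) (by rw [hs₁]; rfl)
    (by rw [hs₁]; rfl) (by rw [hs₁]; rfl)
  refine Tri.seq (outLowerProg_spec G hB hB' c₁ (by omega)).frame ?_ (by omega)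
  rintro s₂ ⟨l₂, f₂⟩
  have b₂ := length_outs_le N F (.node v w false)
  have b₃ := length_outs_le N F (.node v w true)
  have n₂ := congrArg List.length l₂
  simp only [length_elist, List.length_append, List.length_map, r₁] at n₂
  have c₂ : ArcCtx N F v w B s₂ := c₁.room_left f₂ l₂ (by simp; omega)
  have e7 := f₂.reg 7
  have a3 := f₂.arr 3
  have a4 := f₂.arr 4
  have a5 := f₂.arr 5
  have a6 := f₂.arr 6
  have hk' : s₂.reg 7 = k := by rw [e7, hs₁]; exact hk
  obtain ⟨s₃, hs₃⟩ : ∃ s₃, s₃ = (((((s₂.setReg 7 (k + 1)).setArr 6 (k + 1) (s₂.reg 8)).setArr 3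
    (k + 1) v).setArr 4 (k + 1) w).setArr 5 (k + 1) 1) := ⟨_, rfl⟩
  refine Tri.assign (T := 660) (by simp [hk']; omega) (Tri.store (T := 650) (by simp [hk']; omega)
    (by simp; omega) (Tri.store (T := 640) (by simp [hk']; omega) (by simp [c₂.five]; omega)
    (Tri.store (T := 630) (by simp [hk']; omega) (by simp [c₂.six]; omega)
    (Tri.store (T := 620) (by simp [hk']; omega) (by simp; omega) ?_
      (by decide)) (by decide)) (by decide)) (by decide)) (by decide)
  simp only [eval_reg, eval_add, eval_ofNat, setArr_reg, setReg_reg, hk', if_true, Nat.reduceEqDiff,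
    if_false, c₂.five, c₂.six]
  rw [← hs₃]
  have l₃ : elist s₃ = elist s₂ := elist_congr (by rw [hs₃]; rfl) (by rw [hs₃]; rfl)
    (by rw [hs₃]; rfl) (by rw [hs₃]; rfl)
  have c₃ : ArcCtx N F v w B s₃ := by
    subst hs₃
    exact ⟨c₂.toCtx.congr rfl rfl rfl rfl rfl rfl, harc, c₂.five, c₂.six, by simp; omega⟩
  have v₃ : ∀ i, i < k + 1 → VertexOK N F s₃ i := by
    intro i hi
    rcases (Nat.lt_succ_iff.1 hi).lt_or_eq with hi | rfl
    · refine (hv i hi).append (by rw [l₃, l₂, l₁]) ?_ ?_ ?_ ?_ ?_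
      · simp [hs₃, a3, hs₁, hi.ne, (hi.trans (Nat.lt_succ_self _)).ne]
      · simp [hs₃, a4, hs₁, hi.ne, (hi.trans (Nat.lt_succ_self _)).ne]
      · simp [hs₃, a5, hs₁, hi.ne, (hi.trans (Nat.lt_succ_self _)).ne]
      · simp [hs₃, a6, hs₁, (hi.trans (Nat.lt_succ_self _)).ne]
      · simp [hs₃, a6, hs₁, hi.ne]
    · refine VertexOK.new (s := s) harc h7 (by rw [l₃, l₂, l₁]) ?_ ?_ ?_ ?_ ?_
      · simp [hs₃, a3, hs₁]
      · simp [hs₃, a4, hs₁]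
      · simp [hs₃, a5, hs₁]
      · simp [hs₃, a6, hs₁, ha6]
      · simp [hs₃]
  refine Tri.seq (outUpperProg_spec G hB hB' c₃).frame ?_ (by omega)
  rintro s₄ ⟨l₄, f₄⟩
  have n₄ := congrArg List.length l₄
  have r₃ : s₃.reg 8 = s₂.reg 8 := by rw [hs₃]; rfl
  simp only [length_elist, List.length_append, List.length_map, r₃] at n₄
  have e7' : s₄.reg 7 = k + 1 := by rw [f₄.reg 7, hs₃]; simp
  have a3' := f₄.arr 3
  have a4' := f₄.arr 4
  have a5' := f₄.arr 5
  have a6' := f₄.arr 6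
  refine Tri.wp ?_ (le_trans (by decide : _ ≤ 20) (by omega))
  simp only [RamProg.wp, eval_reg, eval_add, eval_ofNat, setReg_reg, e7', if_true, Nat.reduceEqDiff,
    if_false, setArr_reg]
  refine ⟨by omega, ⟨by omega, by omega⟩, trivial, by omega, by simp, fun i hi => ?_⟩
  have l₅ : elist ((s₄.setReg 7 (k + 1 + 1)).setArr 6 (k + 1 + 1) (s₄.reg 8)) = elist s₄ :=
    elist_congr rfl rfl rfl rfl
  rcases (Nat.lt_succ_iff.1 hi).lt_or_eq with hi | rfl
  · refine (v₃ i hi).append (by rw [l₅, l₄]) ?_ ?_ ?_ ?_ ?_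
    · simp [a3']
    · simp [a4']
    · simp [a5']
    · simp [a6', (hi.trans (Nat.lt_succ_self _)).ne]
    · simp [a6', hi.ne]
  · refine VertexOK.new (s := s₃) harc (by rw [h7, hk2]) (by rw [l₅, l₄]) ?_ ?_ ?_ ?_ ?_
    · simp [a3', hs₃]
    · simp [a4', hs₃]
    · simp [a5', hs₃]
    · simp [a6', hs₃]
    · simp

theorem baseProg_spec (hB : N + 7 ≤ B) (hB' : base F (N + 1) + 2 ≤ B) {s : RamState}
    (hs : Holds N F s) (hw : HoldsWidth s N F) : Tri B baseProg s (50 * N + 60) (Ctx N F) := by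
  let I : RamState → Prop := fun s' => (Holds N F s' ∧ HoldsWidth s' N F) ∧ 1 ≤ s'.reg 5 ∧
    s'.reg 5 ≤ N + 1 ∧ ∀ x, 1 ≤ x → x ≤ s'.reg 5 → s'.arr 17 x = base F x
  refine Tri.assign (T := 50 * N + 50) (by simp; omega) (Tri.store (T := 50 * N + 40) 
    (by simp; omega) (by simp) (Tri.seq (T₁ := 50 * N + 10) (P := fun s' => I s' ∧ s'.reg 5 = N + 1) ?_ ?_
    (by omega)) (by simp [RamExpr.cost]; omega)) (by simp [RamExpr.cost]; omega)
  · have hI : I ((s.setReg 5 1).setArr 17 1 0) := by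
      refine ⟨⟨⟨hs.1, hs.2⟩, hw⟩, le_rfl, by simp, fun x h1 h2 => ?_⟩
      obtain rfl : x = 1 := le_antisymm h2 h1
      simp [base]
    refine (Tri.while I (fun s' => 50 * (N + 1 - s'.reg 5) + 10) (fun s' hI hb => ?_)
      (fun s' hI hb => ?_) _ hI).mono (by simp) fun _ h => h
    · obtain ⟨⟨⟨h1, h2⟩, h3⟩, h4, h5, h6⟩ := hI
      have hcost : (RamTest.lt (R 5) (R 0 + 1)).cost = 5 := rfl
      simp only [holds_lt, eval_reg, eval_add, eval_ofNat, h1] at hb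
      generalize hk : s'.reg 5 = k at *
      have e1 := h2 k (by omega)
      have e2 := h6 k h4 le_rfl
      have e3 := base_succ (F := F) h4
      have e4 := base_mono (F := F) (show k + 1 ≤ N + 1 by omega)
      unfold outDeg at e3
      refine ⟨30, Tri.wp ?_ (by decide)⟩
      simp only [RamProg.wp, eval_add, eval_sub, eval_reg, eval_load, eval_ofNat, setReg_reg,
        setReg_arr, setArr_reg, hk, e1, e2, if_true, Nat.reduceEqDiff, if_false]
      refine ⟨by omega, ⟨by omega, by omega⟩, by omega, ⟨⟨⟨h1, ?_⟩, h3⟩, by simp, by simp; omega,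
          ?_⟩, ?_⟩
      · intro i hi
        simpa using h2 i hi
      · intro x h7 h8
        simp only [setReg_reg, if_true] at h8
        simp only [setReg_arr, setArr_arr, true_and]
        split_ifs with h9
        · rw [h9, e3]
          omega
        · exact h6 x h7 (by omega)
      · simp only [hcost]
        omega
    · have hcost : (RamTest.lt (R 5) (R 0 + 1)).cost = 5 := rfl
      have h1 := hI.1.1.1
      have h2 := hI.2.2.1
      simp only [holds_lt, eval_reg, eval_add, eval_ofNat, h1] at hb
      exact ⟨by omega, hI, by omega⟩
  · rintro s' ⟨⟨⟨h1, h2⟩, h3, h4, h5⟩, h6⟩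
    refine Tri.wp ?_ (le_trans (by decide : _ ≤ 10) (by omega))
    have h7 := h5 (N + 1) (by omega) (by omega)
    simp only [RamProg.wp, eval_reg, eval_load, h6, h7]
    refine ⟨by omega, ⟨h1.1, h1.2⟩, h2, fun x h8 h9 => h5 x h8 (by omega), by simp⟩

theorem buildProg_spec (G : PadGraph N F) (hB : N + 7 ≤ B) (hB' : 6 * base F (N + 1) + 20 ≤ B)
    {s : RamState} (hs : Holds N F s) (hw : HoldsWidth s N F) :
    Tri B buildProg s (2000 * (N + base F (N + 1) + 1))
      (fun s' => Holds N F s' ∧ Built N F s') := by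
  refine Tri.seq (baseProg_spec hB (by omega) hs hw) ?_ (by omega)
  intro s hs
  let I : RamState → Prop := fun s' => Ctx N F s' ∧ 1 ≤ s'.reg 5 ∧ s'.reg 5 ≤ N + 1 ∧
    s'.reg 5 < s'.reg 6 ∧ (s'.reg 5 ≤ N → s'.reg 6 ≤ F (s'.reg 5) + 1) ∧
    (s'.reg 5 = N + 1 → s'.reg 6 = N + 2) ∧
    s'.reg 7 = base F (s'.reg 5) + 2 * (s'.reg 6 - s'.reg 5 - 1) ∧
    s'.reg 8 ≤ 5 * s'.reg 7 ∧ s'.arr 6 (s'.reg 7) = s'.reg 8 ∧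
    ∀ k, k < s'.reg 7 → VertexOK N F s' k
  have hF1 := G.first 1 (by omega)
  have h6N := G.six_le
  let T := 1900 * (N + base F (N + 1))
  have hT : 1900 * (N + base F (N + 1)) = T := rfl
  refine Tri.assign (T := T + 140) (by simp; omega) (Tri.assign (T := T + 130) (by simp; omega)
    (Tri.assign (T := T + 120) (by simp) (Tri.assign (T := T + 110) (by simp)
    (Tri.store (T := T + 100) (by simp) (by simp) (Tri.seq (T₁ := T + 10)
      (P := fun s' => I s' ∧ s'.reg 5 = N + 1) ?_ ?_ (by omega)) ?_) ?_) ?_) ?_) ?_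
  · have hI : I (((((s.setReg 5 1).setReg 6 2).setReg 7 0).setReg 8 0).setArr 6 0 0) := by
      refine ⟨hs.congr rfl rfl rfl rfl rfl rfl, by simp, by simp, by simp, ?_, ?_, ?_, by simp,
        by simp, by simp⟩
      · simp [hF1]
      · simp
      · simp [base]
    refine (Tri.while I (fun s' => 1900 * (N + 1 - s'.reg 5 + (base F (N + 1) - s'.reg 7)) + 10)
      (fun s' hI hb => ?_) (fun s' hI hb => ?_) _ hI).mono ?_ fun _ h => h
    · have hcost : (RamTest.lt (R 5) (R 0 + 1)).cost = 5 := rfl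
      obtain ⟨h1, h2, h3, h4, h5, h6, h7, h8, h9, h10⟩ := hI
      simp only [holds_lt, eval_reg, eval_add, eval_ofNat, h1.graph.1] at hb
      have e1 : s'.arr 0 (s'.reg 5) = F (s'.reg 5) := h1.graph.2 _ (by omega)
      have hF := G.map_le (s'.reg 5)
      have hF' := G.le_map (s'.reg 5) (by omega)
      have e3 := base_succ (F := F) h2
      have e4 := base_mono (F := F) (show s'.reg 5 + 1 ≤ N + 1 by omega)
      unfold outDeg at e3
      refine ⟨1300, Tri.ite (T := 1290) (fun hb' => ?_) (fun hb' => ?_) (by decide)⟩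
      · simp only [holds_lt, eval_reg, eval_load, e1] at hb'
        refine Tri.wp ?_ (by decide)
        have h5 := h5 (by omega)
        simp only [RamProg.wp, eval_reg, eval_add, eval_ofNat, setReg_reg, if_true]
        refine ⟨by omega, by omega, ⟨h1.congr rfl rfl rfl rfl rfl rfl, ?_, ?_, ?_, ?_, ?_, ?_,
          h8, h9, fun k hk => (h10 k hk).append (l := []) (by simp [elist]) rfl rfl rfl rfl rfl⟩,
          ?_⟩ <;> simp only [setReg_reg, if_true, Nat.reduceEqDiff, if_false]
        · omega
        · omega
        · omega
        · intro h
          have := G.le_map _ h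
          omega
        · omega
        · omega
        · rw [hcost]
          omega
      · simp only [holds_lt, eval_reg, eval_load, e1] at hb'
        have harc : IsArc N F (s'.reg 5) (s'.reg 6) := ⟨h2, h4, by omega, by omega⟩
        refine Tri.seq (arcProg_spec G hB (by omega) h1 harc rfl rfl (by simpa [index] using h7)
          (by have := (harc.index_lt_sink false); simp only [index,
              Bool.toNat_false] at this; omega)
          h9 h10).frame ?_ (by omega)
        rintro s₁ ⟨⟨g1, g2, g3, g4⟩, hf⟩
        have r5 := hf.reg 5
        have r6 := hf.reg 6
        refine Tri.wp ?_ (by decide)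
        simp only [RamProg.wp, eval_reg, eval_add, eval_ofNat, r6]
        refine ⟨by omega, ⟨(h1.frame hf).congr rfl rfl rfl rfl rfl rfl, ?_, ?_, ?_, ?_, ?_, ?_,
          ?_, ?_, fun k hk => (g4 k hk).append (l := []) (by simp [elist]) rfl rfl rfl rfl rfl⟩,
          ?_⟩ <;> simp only [setReg_reg, if_true, Nat.reduceEqDiff, if_false, r5, hcost,
            setReg_arr]
        · omega
        · omega
        · omega
        · omega
        · omega
        · omega
        · omega
        · exact g3
        · omega
    · have hcost : (RamTest.lt (R 5) (R 0 + 1)).cost = 5 := rfl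
      have h1 := hI.1.graph.1
      have h2 := hI.2.2.1
      simp only [holds_lt, eval_reg, eval_add, eval_ofNat, h1] at hb
      exact ⟨by omega, hI, by omega⟩
    · simp [← hT]
  · rintro s' ⟨⟨h1, h2, h3, h4, h5, h6, h7, h8, h9, h10⟩, h11⟩
    have e7 : s'.reg 7 = base F (N + 1) := by rw [h7, h6 h11, h11]; simp
    refine Tri.wp ?_ (le_trans (by decide : _ ≤ 20) (by omega))
    simp only [RamProg.wp, eval_reg, eval_add, eval_ofNat]
    refine ⟨⟨by omega, by omega⟩, ⟨h1.graph.1, h1.graph.2⟩, h1.sink, fun k hk => ?_, ?_, ?_⟩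
    · have hk : k < s'.reg 7 := by rw [e7, ← h1.sink]; exact hk
      exact (h10 k hk).append (l := []) (by simp [elist]) (by simp) (by simp) (by simp)
        (by simp; omega) (by simp; omega)
    · simp [h1.sink, e7, ← h9]
    · have := h1.sink
      simp only [setArr_reg]
      omega
  all_goals
    simp [RamExpr.cost]
    omega

end

/-! ### Loops -/

theorem Frame.refl (p : RamProg) (s : RamState) : Frame p s s := ⟨fun _ _ => rfl, fun _ _ => rfl⟩

theorem Frame.trans {p : RamProg} {s s' s'' : RamState} (h : Frame p s s') (h' : Frame p s' s'') :
    Frame p s s'' :=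
  ⟨fun r hr => (h'.1 r hr).trans (h.1 r hr), fun a ha => (h'.2 a ha).trans (h.2 a ha)⟩

/-- The rule for loops, with the frame of the body as part of the invariant. -/
theorem Tri.while_frame {B : ℕ} {b : RamTest} {p : RamProg} {Q : RamState → Prop} {s₀ : RamState}
    (I : RamState → Prop) (Φ : RamState → ℕ)
    (hbody : ∀ s, Frame p s₀ s → I s → b.Holds s →
      ∃ T, Tri B p s T (fun s' => I s' ∧ b.cost + 1 + T + Φ s' ≤ Φ s))
    (hexit : ∀ s, Frame p s₀ s → I s → ¬ b.Holds s → b.cost + 1 ≤ Φ s ∧ Q s) (hs : I s₀) :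
    Tri B (.while b p) s₀ (Φ s₀) Q := by
  refine Tri.while (fun s => Frame p s₀ s ∧ I s) Φ (fun s h hb => ?_)
    (fun s h hb => hexit s h.1 h.2 hb) s₀ ⟨.refl p s₀, hs⟩
  obtain ⟨T, hT⟩ := hbody s h.1 h.2 hb
  exact ⟨T, hT.frame.mono le_rfl fun s' h' => ⟨⟨h.1.trans h'.2, h'.1.1⟩, h'.1.2⟩⟩

/-! ### Shortest paths in `R` -/

/-- Go through the edges that leave the vertex of `R` whose index is in register `5`.  Array `18`
receives one more than the least weight of a path to the sink (or zero if there is no path), and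
array `19` the first edge of such a path. -/
def scanProg : RamProg :=
  .assign 6 (A 6 (R 5)) ;; .assign 7 (A 6 (R 5 + 1)) ;; .store 18 (R 5) 0 ;;
  .while (.lt (R 6) (R 7)) (
    .assign 22 (A 18 (A 7 (R 6))) ;;
    .ite (.eq (R 22) 0) .skip
      (.assign 22 (R 22 + A 8 (R 6)) ;;
       .ite (.eq (A 18 (R 5)) 0) (.store 18 (R 5) (R 22) ;; .store 19 (R 5) (R 6))
         (.ite (.lt (R 22) (A 18 (R 5))) (.store 18 (R 5) (R 22) ;; .store 19 (R 5) (R 6)) .skip)) ;;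
    .assign 6 (R 6 + 1))

/-- Find the distances to the sink, from the last vertex of `R` to the first one. -/
def distProg : RamProg :=
  .assign 5 (R 1) ;; .store 18 (R 5) 1 ;;
  .while (.lt 0 (R 5)) (.assign 5 (R 5 - 1) ;; scanProg)

/-- Follow the first edges of shortest paths. -/
def followProg : RamProg :=
  .assign 5 0 ;; .assign 2 0 ;;
  .while (.lt (R 5) (R 1)) (
    .assign 6 (A 19 (R 5)) ;;
    .store 10 (R 2) (A 3 (R 5)) ;; .store 11 (R 2) (A 4 (R 5)) ;; .store 12 (R 2) (A 5 (R 5)) ;;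
    .store 13 (R 2) (A 8 (R 6)) ;; .store 14 (R 2) (A 9 (R 6)) ;;
    .assign 2 (R 2 + 1) ;; .assign 5 (A 7 (R 6)))

/-- Find a path of minimum weight from the source to the sink. -/
def pathProg : RamProg := distProg ;; followProg

/-- Array `18` holds the distance of `a` to the sink plus one (zero if there is no path), and array
`19` the first edge of a shortest path. -/
structure DistOK (N : ℕ) (F : ℕ → ℕ) (s : RamState) (a : RVertex) : Prop where
  none : s.arr 18 (index N F a) = 0 → ∀ Q, ¬ IsRPath N F a .sink Q
  le : s.arr 18 (index N F a) ≠ 0 → ∀ Q, IsRPath N F a .sink Q →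
    s.arr 18 (index N F a) ≤ pathWeight Q + 1
  bound : s.arr 18 (index N F a) ≠ 0 → s.arr 18 (index N F a) + rpos N a ≤ N + 2
  next : s.arr 18 (index N F a) ≠ 0 → a = .sink ∧ s.arr 18 (index N F a) = 1 ∨
    ∃ i, ∃ h : i < (outs N F a).length, s.arr 19 (index N F a) = s.arr 6 (index N F a) + i ∧
      s.arr 18 (index N F (outs N F a)[i].tgt) ≠ 0 ∧ s.arr 18 (index N F a) =
        s.arr 18 (index N F (outs N F a)[i].tgt) + (outs N F a)[i].weight

section

variable {N B : ℕ} {F : ℕ → ℕ}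

theorem Built.congr {s s' : RamState} (h : Built N F s) (r1 : s'.reg 1 = s.reg 1)
    (h8 : s'.reg 8 = s.reg 8)
    (a3 : s'.arr 3 = s.arr 3) (a4 : s'.arr 4 = s.arr 4) (a5 : s'.arr 5 = s.arr 5)
    (a6 : s'.arr 6 = s.arr 6) (a7 : s'.arr 7 = s.arr 7) (a8 : s'.arr 8 = s.arr 8)
    (a9 : s'.arr 9 = s.arr 9) : Built N F s' := by
  refine ⟨r1.trans h.sink, fun k hk => ?_, by rw [r1, a6]; exact h.last,
    by rw [r1, h8]; exact h.room⟩
  exact (h.vertex k (by rwa [← r1])).append (l := [])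
    (by rw [elist_congr h8 a7 a8 a9]; simp) (by rw [a3]) (by rw [a4]) (by rw [a5]) (by rw [a6])
    (by rw [a6])

theorem DistOK.congr (G : PadGraph N F) {s s' : RamState} {a : RVertex} (h : DistOK N F s a)
    (ha : IsRVertex N F a)
    (h18 : ∀ c, IsRVertex N F c → index N F a ≤ index N F c →
      s'.arr 18 (index N F c) = s.arr 18 (index N F c))
    (h19 : s'.arr 19 (index N F a) = s.arr 19 (index N F a)) (h6 : s'.arr 6 = s.arr 6) :
    DistOK N F s' a := by
  have e := h18 a ha le_rfl
  refine ⟨by rw [e]; exact h.none, by rw [e]; exact h.le, by rw [e]; exact h.bound, ?_⟩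
  rw [e, h19, h6]
  intro hne
  rcases h.next hne with h1 | ⟨i, hi, h2, h3, h4⟩
  · exact .inl h1
  · obtain ⟨h5, h6⟩ := (mem_outs G ha).1 (List.getElem_mem hi)
    have h7 := h5.index_lt G (by rw [h6]; exact ha)
    rw [h6] at h7
    have e' := h18 _ (h5.isRVertex_tgt G) h7.le
    exact .inr ⟨i, hi, h2, by rw [e']; exact h3, by rw [e']; exact h4⟩

theorem isRPath_sink_iff {a : RVertex} (ha : a ≠ .sink) {Q : List REdge} :
    IsRPath N F a .sink Q ↔
      ∃ e Q', Q = e :: Q' ∧ IsREdge N F e ∧ e.src = a ∧ IsRPath N F e.tgt .sink Q' := by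
  constructor
  · intro h
    cases h with
    | nil => exact (ha rfl).elim
    | cons he hP => exact ⟨_, _, rfl, he, rfl, hP⟩
  · rintro ⟨e, Q', rfl, he, rfl, hP⟩
    exact .cons he hP

theorem scanProg_spec (G : PadGraph N F) (hB : 2 * N + 7 ≤ B) (hB' : 6 * base F (N + 1) + 20 ≤ B)
    {s : RamState} (hs : Built N F s) {a : RVertex} (ha : IsRVertex N F a) (hne : a ≠ .sink)
    (h5 : s.reg 5 = index N F a)
    (hd : ∀ c, IsRVertex N F c → index N F a < index N F c → DistOK N F s c) :
    Tri B scanProg s 490 (fun s' => ∀ c, IsRVertex N F c → index N F a ≤ index N F c →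
      DistOK N F s' c) := by
  have hi := ha.index_le
  obtain ⟨hsz, hst⟩ := hs.stored ha
  have hl5 := length_outs_le N F a
  have hroom := hs.start_le ha hne
  have hmem : ∀ i (h : i < (outs N F a).length), IsRVertex N F (outs N F a)[i].tgt ∧
      index N F a < index N F (outs N F a)[i].tgt ∧
      rpos N a + (outs N F a)[i].weight ≤ rpos N (outs N F a)[i].tgt := by
    intro i h
    obtain ⟨h1, h2⟩ := (mem_outs G ha).1 (List.getElem_mem h)
    have h3 := h1.index_lt G (by rw [h2]; exact ha)
    have h4 := (h1.weight_le G).2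
    rw [h2] at h3 h4
    exact ⟨h1.isRVertex_tgt G, h3, h4⟩
  generalize hk : index N F a = k at *
  generalize hL : outs N F a = L at *
  obtain ⟨s₀, hs₀⟩ : ∃ s₀, s₀ = ((s.setReg 6 (s.arr 6 k)).setReg 7 (s.arr 6 (k + 1))).setArr 18 k 0 :=
    ⟨_, rfl⟩
  have h180 : ∀ j, j ≠ k → s₀.arr 18 j = s.arr 18 j := by
    intro j hj
    simp [hs₀, hj]
  have h60 : s₀.arr 6 = s.arr 6 := by rw [hs₀]; funext j; simp
  have h190 : s₀.arr 19 = s.arr 19 := by rw [hs₀]; funext j; simp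
  refine Tri.assign (T := 480) (by simp [h5]; omega) (Tri.assign (T := 470) (by simp [h5]; omega)
    (Tri.store (T := 460) (by simp [h5]; omega) (by simp) ?_ (by decide)) (by decide)) (by decide)
  simp only [eval_reg, eval_load, eval_add, eval_ofNat, setReg_reg, setReg_arr,
    Nat.reduceEqDiff, if_false, h5]
  rw [← hs₀]
  let D : ℕ → ℕ := s.arr 18
  let I : RamState → Prop := fun s' => ∃ i, i ≤ L.length ∧ s'.reg 6 = s.arr 6 k + i ∧
    (∀ j, j ≠ k → s'.arr 18 j = s.arr 18 j) ∧ (∀ j, j ≠ k → s'.arr 19 j = s.arr 19 j) ∧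
    (s'.arr 18 k = 0 → ∀ e ∈ L.take i, ∀ Q, ¬ IsRPath N F e.tgt .sink Q) ∧
    (s'.arr 18 k ≠ 0 → ∀ e ∈ L.take i, ∀ Q, IsRPath N F e.tgt .sink Q →
      s'.arr 18 k ≤ e.weight + pathWeight Q + 1) ∧
    (s'.arr 18 k ≠ 0 → s'.arr 18 k + rpos N a ≤ N + 2 ∧ ∃ i, ∃ h : i < L.length,
      s'.arr 19 k = s.arr 6 k + i ∧ D (index N F L[i].tgt) ≠ 0 ∧
      s'.arr 18 k = D (index N F L[i].tgt) + L[i].weight)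
  have hI : I s₀ := by
    refine ⟨0, by simp, by rw [hs₀]; simp, h180, fun j _ => by rw [h190], by simp, by simp, ?_⟩
    intro h
    simp [hs₀] at h
  have hcost : (RamTest.lt (R 6) (R 7)).cost = 3 := rfl
  have h7 : ∀ s' : RamState, s'.reg 7 = s₀.reg 7 → s'.reg 7 = s.arr 6 k + L.length := by
    intro s' h
    rw [h, hs₀, ← hsz]
    simp
  refine (Tri.while_frame I (fun s' => 90 * (s'.reg 7 - s'.reg 6) + 10) (fun s' hf hI hb => ?_)
    (fun s' hf hI hb => ?_) hI).mono ?_ fun _ h => h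
  · obtain ⟨i, g1, g2, g3, g4, g5, g6, g7⟩ := hI
    have e7 := h7 s' (hf.reg 7)
    have e5 : s'.reg 5 = k := by rw [hf.reg 5, hs₀]; simpa using h5
    have a7 : s'.arr 7 = s.arr 7 := by rw [hf.arr 7, hs₀]; funext j; simp
    have a8 : s'.arr 8 = s.arr 8 := by rw [hf.arr 8, hs₀]; funext j; simp
    simp only [holds_lt, eval_reg, e7, g2] at hb
    have hiL : i < L.length := by omega
    obtain ⟨m1, m2, -⟩ := hst i hiL
    obtain ⟨n1, n2, n3⟩ := hmem i hiL
    have hdt := hd _ n1 n2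
    have htake : L.take (i + 1) = L.take i ++ [L[i]] := by simp
    have e18 : s'.arr 18 (index N F L[i].tgt) = D (index N F L[i].tgt) := g3 _ n2.ne'
    have hDb := hdt.bound
    have hDn := hdt.none
    have hDl := hdt.le
    change D _ ≠ 0 → D _ + _ ≤ _ at hDb
    change D _ = 0 → _ at hDn
    change D _ ≠ 0 → ∀ Q, _ → D _ ≤ _ at hDl
    generalize htt : index N F L[i].tgt = t at *
    refine ⟨70, Tri.wp ?_ (by decide)⟩
    simp only [RamProg.wp, eval_reg, eval_load, eval_add, eval_ofNat, setReg_reg, setReg_arr,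
      setArr_reg, if_true, Nat.reduceEqDiff, if_false, holds_eq, holds_lt, e5, e7, g2, a7, a8, m1,
          m2, e18]
    have fin : ∀ s'' : RamState, s''.reg 6 = s.arr 6 k + i + 1 →
        (∀ j, j ≠ k → s''.arr 18 j = s.arr 18 j) → (∀ j, j ≠ k → s''.arr 19 j = s.arr 19 j) →
        (s''.arr 18 k = s'.arr 18 k ∧ s''.arr 19 k = s'.arr 19 k ∧
          (D t = 0 ∨ s'.arr 18 k ≠ 0 ∧ s'.arr 18 k ≤ D t + L[i].weight) ∨
          s''.arr 18 k = D t + L[i].weight ∧ s''.arr 19 k = s.arr 6 k + i ∧ D t ≠ 0 ∧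
          (s'.arr 18 k = 0 ∨ D t + L[i].weight < s'.arr 18 k)) →
        I s'' ∧ (RamTest.lt (R 6) (R 7)).cost + 1 + 70 + (90 * (s.arr 6 k + L.length - (s.arr 6 k +
            i + 1)) + 10) ≤
          90 * (s.arr 6 k + L.length - (s.arr 6 k + i)) + 10 := by
      intro s'' k1 k3 k4 k5
      refine ⟨⟨i + 1, hiL, k1, k3, k4, ?_⟩, by rw [hcost]; omega⟩
      rw [htake]
      simp only [List.mem_append, List.mem_singleton, or_imp, forall_and, forall_eq]
      rcases k5 with ⟨k5, k6, k7⟩ | ⟨k5, k6, k7, k8⟩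
      · rw [k5, k6]
        refine ⟨⟨g5, fun h Q hQ => ?_⟩, ⟨g6, fun h Q hQ => ?_⟩,
          fun h => (g7 h).1, fun h => (g7 h).2⟩
        · rcases k7 with k7 | k7
          · exact hDn k7 Q hQ
          · exact k7.1 h
        · rcases k7 with k7 | k7
          · exact (hDn k7 Q hQ).elim
          · have hDt : D t ≠ 0 := fun h0 => hDn h0 Q hQ
            have := hDl hDt Q hQ
            omega
      · rw [k5, k6]
        have := hDb k7
        refine ⟨⟨fun h => by omega, fun h => by omega⟩, ⟨fun h e he Q hQ => ?_, fun h Q hQ => ?_⟩,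
          fun h => by omega, fun h => ⟨i, hiL, rfl, by rw [htt]; exact k7, by rw [htt]⟩⟩
        · rcases k8 with k8 | k8
          · exact (g5 k8 e he Q hQ).elim
          · exact k8.le.trans (g6 (by omega) e he Q hQ)
        · have := hDl k7 Q hQ
          omega
    have hDB : D t ≤ N + 2 := by
      by_cases h : D t = 0
      · omega
      · have := hDb h
        omega
    refine ⟨by omega, fun c1 => ⟨by omega, fin _ ?_ ?_ ?_ ?_⟩, fun c1 => ?_⟩
    · simp
    · simpa using g3
    · simpa using g4
    · simp [c1]
    have hDb' := hDb c1
    refine ⟨by omega, fun c2 => ⟨⟨by omega, by omega⟩, ⟨by omega, by omega⟩, by omega,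
      fin _ ?_ ?_ ?_ ?_⟩, fun c2 => ⟨fun c3 => ⟨⟨by omega, by omega⟩, ⟨by omega, by omega⟩,
        by omega, fin _ ?_ ?_ ?_ ?_⟩, fun c3 => ⟨by omega, fin _ ?_ ?_ ?_ ?_⟩⟩⟩
    · simp
    · intro j hj
      simpa [hj] using g3 j hj
    · intro j hj
      simpa [hj] using g4 j hj
    · simp [c1, c2]
    · simp
    · intro j hj
      simpa [hj] using g3 j hj
    · intro j hj
      simpa [hj] using g4 j hj
    · simp [c1, c3]
    · simp
    · simpa using g3
    · simpa using g4
    · left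
      simp [c2]
      omega
  · obtain ⟨i, g1, g2, g3, g4, g5, g6, g7⟩ := hI
    have e7 := h7 s' (hf.reg 7)
    simp only [holds_lt, eval_reg, e7, g2] at hb
    refine ⟨by omega, fun c hc hkc => ?_⟩
    have a6 : s'.arr 6 = s.arr 6 := by rw [hf.arr 6, h60]
    obtain rfl : i = L.length := by omega
    rw [List.take_length] at g5 g6
    rcases hkc.lt_or_eq with hkc | hkc
    · exact (hd c hc hkc).congr G hc (fun c' hc' hle => g3 _ (by omega)) (g4 _ (by omega)) a6
    · have hca : c = a := by
        have h1 := hs.vertexAt_index hc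
        have h2 := hs.vertexAt_index ha
        rw [← hkc, ← hk, h2] at h1
        exact h1.symm
      subst hca
      refine ⟨?_, ?_, ?_, ?_⟩ <;> rw [hk]
      · intro h Q hQ
        obtain ⟨e, Q', rfl, he, hsrc, hQ'⟩ := (isRPath_sink_iff hne).1 hQ
        exact g5 h e (by rw [← hL]; exact (mem_outs G ha).2 ⟨he, hsrc⟩) Q' hQ'
      · intro h Q hQ
        obtain ⟨e, Q', rfl, he, hsrc, hQ'⟩ := (isRPath_sink_iff hne).1 hQ
        rw [pathWeight_cons]
        exact g6 h e (by rw [← hL]; exact (mem_outs G ha).2 ⟨he, hsrc⟩) Q' hQ'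
      · exact fun h => (g7 h).1
      · intro h
        obtain ⟨-, i, hi, k1, k2, k3⟩ := g7 h
        refine .inr ⟨i, by rw [hL]; exact hi, by rw [a6]; exact k1, ?_⟩
        have k4 := g3 (index N F L[i].tgt) (hmem i hi).2.1.ne'
        simp only [hL]
        rw [k4]
        exact ⟨k2, k3⟩
  · have := h7 s₀ rfl
    have h8 : s₀.reg 6 = s.arr 6 k := by rw [hs₀]; simp
    rw [h8, this]
    omega

theorem Built.frame {p : RamProg} {s s' : RamState} (h : Built N F s) (hf : Frame p s s')
    (r1 : p.noReg 1 = true := by rfl) (r8 : p.noReg 8 = true := by rfl)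
    (a3 : p.noArr 3 = true := by rfl) (a4 : p.noArr 4 = true := by rfl)
    (a5 : p.noArr 5 = true := by rfl) (a6 : p.noArr 6 = true := by rfl)
    (a7 : p.noArr 7 = true := by rfl) (a8 : p.noArr 8 = true := by rfl)
    (a9 : p.noArr 9 = true := by rfl) : Built N F s' :=
  h.congr (hf.reg 1 r1) (hf.reg 8 r8) (hf.arr 3 a3) (hf.arr 4 a4) (hf.arr 5 a5) (hf.arr 6 a6)
    (hf.arr 7 a7) (hf.arr 8 a8) (hf.arr 9 a9)

theorem index_inj {a b : RVertex} (ha : IsRVertex N F a) (hb : IsRVertex N F b)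
    (h : index N F a = index N F b) : a = b := by
  cases ha with
  | sink =>
    cases hb with
    | sink => rfl
    | node b hb => exact absurd h (hb.index_lt_sink b).ne'
  | node b ha =>
    cases hb with
    | sink => exact absurd h (ha.index_lt_sink b).ne
    | node b hb =>
      obtain ⟨rfl, rfl, rfl⟩ := index_node_inj ha hb h
      rfl

theorem distProg_spec (G : PadGraph N F) (hB : 2 * N + 7 ≤ B) (hB' : 6 * base F (N + 1) + 20 ≤ B)
    {s : RamState} (hs : Built N F s) :
    Tri B distProg s (520 * (base F (N + 1) + 1))
      (fun s' => ∀ c, IsRVertex N F c → DistOK N F s' c) := by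
  have h1 := hs.sink
  obtain ⟨s₀, hs₀⟩ : ∃ s₀, s₀ = (s.setReg 5 (s.reg 1)).setArr 18 (s.reg 1) 1 := ⟨_, rfl⟩
  refine Tri.assign (T := 520 * base F (N + 1) + 500) (by simp; omega) (Tri.store
    (T := 520 * base F (N + 1) + 490) (by simp; omega) (by simp; omega) ?_
    (by simp [RamExpr.cost]; omega)) (by simp [RamExpr.cost]; omega)
  simp only [eval_reg, eval_ofNat, setReg_reg, if_true]
  rw [← hs₀]
  have hcost : (RamTest.lt 0 (R 5)).cost = 3 := rfl
  have hs₀B : Built N F s₀ := by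
    refine hs.congr ?_ ?_ ?_ ?_ ?_ ?_ ?_ ?_ ?_ <;> rw [hs₀] <;> rfl
  refine (Tri.while_frame (fun s' => s'.reg 5 ≤ base F (N + 1) ∧
    ∀ c, IsRVertex N F c → s'.reg 5 ≤ index N F c → DistOK N F s' c)
    (fun s' => 510 * s'.reg 5 + 10) (fun s' hf hI hb => ?_) (fun s' hf hI hb => ?_) ?_).mono ?_
    fun _ h => h
  · obtain ⟨g1, g2⟩ := hI
    simp only [holds_lt, eval_reg, eval_ofNat] at hb
    have hb' := hs₀B.frame hf
    obtain ⟨a, ha, hk⟩ := hb'.exists_vertex (k := s'.reg 5 - 1) (by rw [hb'.sink]; omega)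
    have hne : a ≠ .sink := by
      rintro rfl
      simp only [index] at hk
      omega
    refine ⟨500, Tri.assign (T := 490) (by simp only [eval_reg, eval_ofNat, eval_sub]; omega) ?_
      (by decide)⟩
    simp only [eval_reg, eval_ofNat, eval_sub]
    refine (Tri.frame (scanProg_spec G hB hB' (a := a) (s := s'.setReg 5 (s'.reg 5 - 1))
      (hb'.congr rfl rfl rfl rfl rfl rfl rfl rfl rfl) ha hne (by simpa using hk) (fun c hc hlt =>
          ?_))).mono le_rfl fun s'' h => ?_
    · exact (g2 c hc (by omega)).congr G hc (fun _ _ _ => rfl) rfl rfl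
    · have e5 := h.2.reg 5
      simp only [setReg_reg, if_true] at e5
      refine ⟨⟨by omega, fun c hc hle => h.1 c hc (by omega)⟩, ?_⟩
      rw [hcost]
      omega
  · simp only [holds_lt, eval_reg, eval_ofNat] at hb
    exact ⟨by omega, fun c hc => hI.2 c hc (by omega)⟩
  · refine ⟨by rw [hs₀]; simp [h1], fun c hc hle => ?_⟩
    have hle' := hc.index_le
    have h5 : s₀.reg 5 = base F (N + 1) := by rw [hs₀]; simp [h1]
    obtain rfl : c = .sink := index_inj hc .sink (by simp only [index] at *; omega)
    have e : s₀.arr 18 (index N F .sink) = 1 := by rw [hs₀]; simp [index, h1]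
    refine ⟨fun h => by omega, fun _ Q _ => by omega, fun _ => ?_, fun _ => .inl ⟨rfl, e⟩⟩
    rw [e]
    simp only [rpos]
    omega
  · have h5 : s₀.reg 5 = base F (N + 1) := by rw [hs₀]; simp [h1]
    rw [h5]
    omega

theorem PadGraph.index_source (G : PadGraph N F) :
    IsArc N F 1 2 ∧ index N F (.node 1 2 false) = 0 := by
  have := G.first 1 (by omega)
  have := G.six_le
  exact ⟨⟨by omega, by omega, by omega, by omega⟩, by simp [index, base]⟩

theorem followProg_spec (G : PadGraph N F) (hB : 2 * N + 7 ≤ B)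
    (hB' : 6 * base F (N + 1) + 20 ≤ B) {s : RamState} (hs : Built N F s)
    (hd : ∀ c, IsRVertex N F c → DistOK N F s c) (hne : s.arr 18 0 ≠ 0) :
    Tri B followProg s (90 * (base F (N + 1) + 1)) (fun s' => ∃ P,
      IsRPath N F (.node 1 2 false) .sink P ∧ pathWeight P + 1 = s.arr 18 0 ∧ HoldsPath s' P) := by
  have h1 := hs.sink
  obtain ⟨harc, hsrc⟩ := G.index_source
  refine Tri.assign (T := 90 * base F (N + 1) + 80) (by simp) (Tri.assign
    (T := 90 * base F (N + 1) + 70) (by simp) ?_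
    (by simp [RamExpr.cost]; omega)) (by simp [RamExpr.cost]; omega)
  simp only [eval_ofNat]
  have hcost : (RamTest.lt (R 5) (R 1)).cost = 3 := rfl
  refine (Tri.while_frame (fun s' => ∃ a P, IsRVertex N F a ∧ s'.reg 5 = index N F a ∧
    s.arr 18 (index N F a) ≠ 0 ∧ IsRPath N F (.node 1 2 false) a P ∧
    pathWeight P + s.arr 18 (index N F a) = s.arr 18 0 ∧ HoldsPath s' P)
    (fun s' => 90 * (s'.reg 1 - s'.reg 5) + 10) (fun s' hf hI hb => ?_) (fun s' hf hI hb => ?_)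
    ?_).mono ?_ fun _ h => h
  · obtain ⟨a, P, ha, g1, g2, g3, g4, g5, g6⟩ := hI
    have e1 : s'.reg 1 = base F (N + 1) := by rw [hf.reg 1]; simpa using h1
    simp only [holds_lt, eval_reg, e1, g1] at hb
    obtain ⟨v, w, b, rfl, hvw⟩ : ∃ v w b, a = .node v w b ∧ IsArc N F v w := by
      cases ha with
      | sink => simp [index] at hb
      | node b h => exact ⟨_, _, b, rfl, h⟩
    obtain ⟨t3, t4, t5⟩ := hs.triple (b := b) hvw
    rcases (hd _ ha).next g2 with h | ⟨i, hi, h2, h3, h4⟩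
    · simp at h
    obtain ⟨m1, m2, m3⟩ := (hs.stored ha).2 i hi
    obtain ⟨n1, n2⟩ := (mem_outs G ha).1 (List.getElem_mem hi)
    have n3 := n1.isRVertex_tgt G
    have n4 := n1.index_lt G (by rw [n2]; exact ha)
    have n5 := n1.weight_le G
    have n6 := n3.index_le
    have n7 := g3.weight_le G
    have hroom := hs.start_le ha (by simp)
    have hsz := (hs.stored ha).1
    rw [← h2] at m1 m2 m3
    rw [n2] at n4
    generalize (outs N F (.node v w b))[i] = e at *
    have n8 : rpos N (.node v w b) ≤ N ∧ rpos N e.tgt ≤ N + 1 := by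
      refine ⟨by have := hvw.le; simp only [rpos]; omega, ?_⟩
      have := (hd _ n3).bound h3
      omega
    rw [n2] at n5
    have n9 := hvw.le
    have nb := Bool.toNat_le b
    have nc := Bool.toNat_le e.compact
    refine ⟨70, Tri.wp ?_ (by decide)⟩
    have a3 : s'.arr 3 = s.arr 3 := hf.arr 3
    have a4 : s'.arr 4 = s.arr 4 := hf.arr 4
    have a5 : s'.arr 5 = s.arr 5 := hf.arr 5
    have a7 : s'.arr 7 = s.arr 7 := hf.arr 7
    have a8 : s'.arr 8 = s.arr 8 := hf.arr 8
    have a9 : s'.arr 9 = s.arr 9 := hf.arr 9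
    have a19 : s'.arr 19 = s.arr 19 := hf.arr 19
    simp only [RamProg.wp, eval_reg, eval_load, eval_add, eval_ofNat, setReg_reg, setReg_arr,
      setArr_reg, setArr_arr, if_true, Nat.reduceEqDiff, if_false, false_and, g1, e1, a3, a4, a5,
          a7, a8,
      a9, a19, t3, t4, t5, m1, m2, m3]
    refine ⟨by omega, ⟨by omega, by omega⟩, ⟨by omega, by omega⟩, ⟨by omega, by omega⟩,
      ⟨by omega, by omega⟩, ⟨by omega, by omega⟩, by omega, by omega,
      ⟨e.tgt, P ++ [e], n3, rfl, h3, ?_, ?_, ?_, ?_⟩, by rw [hcost]; omega⟩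
    · refine g3.append ?_
      rw [← n2]
      exact .cons n1 (.nil _)
    · rw [pathWeight_append, pathWeight_cons, pathWeight_nil]
      omega
    · simp [g5]
    · intro k hk
      simp only [List.length_append, List.length_singleton] at hk
      rcases (Nat.lt_succ_iff.1 hk).lt_or_eq with hk | rfl
      · rw [List.getElem_append_left hk]
        have := g6 k hk
        have hk' : k ≠ s'.reg 2 := by omega
        simpa [hk'] using this
      · rw [List.getElem_append_right le_rfl]
        simp only [Nat.sub_self, List.getElem_singleton, n2]
        refine ⟨?_, ?_, ?_⟩
        · cases b <;> simp [g5]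
        · simp [g5]
        · rcases hc : e.compact <;> simp [g5]
  · obtain ⟨a, P, ha, g1, g2, g3, g4, g5⟩ := hI
    have e1 : s'.reg 1 = base F (N + 1) := by rw [hf.reg 1]; simpa using h1
    simp only [holds_lt, eval_reg, e1, g1] at hb
    have := ha.index_le
    obtain rfl : a = .sink := index_inj ha .sink (by simp only [index] at *; omega)
    refine ⟨by omega, P, g3, ?_, g5⟩
    rcases (hd _ ha).next g2 with h | ⟨i, hi, h2, h3, h4⟩
    · omega
    · simp [outs] at hi
  · refine ⟨_, [], .node false harc, ?_, ?_, .nil _, ?_, ?_, ?_⟩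
    · simp [hsrc]
    · rwa [hsrc]
    · simp [hsrc]
    · simp
    · simp
  · simp [h1]

theorem pathProg_spec (G : PadGraph N F) (hB : 2 * N + 7 ≤ B)
    (hB' : 6 * base F (N + 1) + 20 ≤ B) {s : RamState} (hs : Built N F s)
    (hex : ∃ P, IsRPath N F (.node 1 2 false) .sink P) :
    Tri B pathProg s (700 * (base F (N + 1) + 1)) (fun s' => ∃ P,
      IsShortestRPath N F P ∧ HoldsPath s' P) := by
  obtain ⟨harc, hsrc⟩ := G.index_source
  refine Tri.seq (distProg_spec G hB hB' hs).frame ?_ (by omega)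
  rintro s₁ ⟨h1, hf⟩
  have hd := h1 _ (.node false harc)
  have hne : s₁.arr 18 0 ≠ 0 := by
    obtain ⟨P, hP⟩ := hex
    intro h
    exact hd.none (by rwa [hsrc]) P hP
  refine (followProg_spec G hB hB' (hs.frame hf) h1 hne).mono (by omega) fun s₂ h => ?_
  obtain ⟨P, h2, h3, h4⟩ := h
  refine ⟨P, ⟨h2, fun Q hQ => ?_⟩, h4⟩
  have := hd.le (by rwa [hsrc]) Q hQ
  rw [hsrc] at this
  omega

end

/-! ### Writing down the encoded set -/

/-- The cells of array `a`, as many as register `r` says. -/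
def cells (r a : ℕ) (s : RamState) : List ℕ := (List.range (s.reg r)).map (s.arr a)

theorem length_cells (r a : ℕ) (s : RamState) : (cells r a s).length = s.reg r := by simp [cells]

theorem cells_congr {r a : ℕ} {s s' : RamState} (hr : s'.reg r = s.reg r)
    (ha : s'.arr a = s.arr a) : cells r a s' = cells r a s := by
  simp only [cells, hr, ha]

@[simp] theorem cells_setReg {r r' : ℕ} (h : r' ≠ r) (a : ℕ) (s : RamState) (x : ℕ) :
    cells r a (s.setReg r' x) = cells r a s :=
  cells_congr (by simp [h.symm]) rfl

theorem HoldsSet.of_cells {r a : ℕ} {s : RamState} (h : (cells r a s).Nodup) :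
    HoldsSet s r a {x | x ∈ cells r a s} := by
  have := bijOn_of_getElem (g := s.arr a) (m := 0) h fun i hi => by simp [cells]
  rw [length_cells, Nat.zero_add] at this
  have h0 : Set.Ico 0 (s.reg r) = Set.Iio (s.reg r) := by ext x; simp
  rwa [h0] at this

/-- The state after a value has been appended to array `a`, whose length is in register `r`. -/
def push (r a : ℕ) (s : RamState) (x : ℕ) : RamState :=
  (s.setArr a (s.reg r) x).setReg r (s.reg r + 1)

/-- Append a value to array `a`, whose length is in register `r`. -/
def pushProg (r a : ℕ) (e : RamExpr) : RamProg := .store a (R r) e ;; .assign r (R r + 1)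

@[simp] theorem push_reg (r a : ℕ) (s : RamState) (x r' : ℕ) :
    (push r a s x).reg r' = if r' = r then s.reg r + 1 else s.reg r' := by
  simp [push]

@[simp] theorem push_arr (r a : ℕ) (s : RamState) (x : ℕ) {a' : ℕ} (h : a' ≠ a) :
    (push r a s x).arr a' = s.arr a' := by
  funext i
  simp [push, h]

@[simp] theorem cells_push (r a : ℕ) (s : RamState) (x : ℕ) :
    cells r a (push r a s x) = cells r a s ++ [x] := by
  simp only [cells, push_reg, if_true, List.range_succ, List.map_append]
  congr 1
  · refine List.map_congr_left fun i hi => ?_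
    have := List.mem_range.1 hi
    simp [push, this.ne]
  · simp [push]

theorem pushProg_spec {B r a : ℕ} {s : RamState} {e : RamExpr} (he : e.eval s ≤ B)
    (hr : s.reg r + 1 ≤ B) :
    Tri B (pushProg r a e) s (e.cost + 6) (fun s' => s' = push r a s (e.eval s)) := by
  refine Tri.wp ?_ ?_
  · simp only [pushProg, RamProg.wp, eval_reg, eval_add, eval_ofNat, setArr_reg]
    exact ⟨⟨by omega, he⟩, hr, rfl⟩
  · change 1 + e.cost + 1 + 4 ≤ _
    omega

/-- Append the vertices `F v, …, F^k v`, where `v` is in register `7` and `k` in register `12`. -/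
def iterProg : RamProg :=
  .while (.lt 0 (R 12)) (
    .assign 7 (A 0 (R 7)) ;; pushProg 3 15 (R 7) ;; .assign 12 (R 12 - 1))

/-- Append the vertices that the edge at position `R 5` of the path contributes.  Registers
`9, 10, 11` hold its first vertex and its weight, register `6` tells whether it is the first edge
of its piece. -/
def edgeProg : RamProg :=
  .ite (.eq (A 12 (R 5)) 1)
    (.ite (.eq (R 6) 1) (pushProg 3 15 (R 9) ;; pushProg 3 15 (R 10)) .skip ;;
     .assign 7 (R 9) ;;
     .ite (.eq (A 14 (R 5)) 1)
       (.assign 12 (R 11) ;; iterProg)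
       (.assign 12 (R 11 - 4) ;; iterProg ;; .assign 7 (A 0 (R 7)) ;;
        pushProg 3 15 (R 7 - 1) ;; pushProg 3 15 (R 7)))
    (.ite (.eq (R 11) 3)
      (pushProg 3 15 (R 9) ;; pushProg 3 15 (R 10) ;; pushProg 3 15 (A 0 (R 9)))
      (.assign 7 (A 0 (R 10) - 1) ;;
       .ite (.lt (A 0 (R 9)) (R 7)) (.assign 7 (A 0 (R 9))) .skip ;;
       pushProg 3 15 (R 9) ;; pushProg 3 15 (R 10) ;; pushProg 3 15 (R 7) ;;
       pushProg 3 15 (A 0 (R 10))))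

/-- Write down the set that a path encodes. -/
def decodeProg : RamProg :=
  .assign 3 0 ;; .assign 5 0 ;; .assign 6 1 ;;
  .while (.lt (R 5) (R 2)) (
    .assign 9 (A 10 (R 5)) ;; .assign 10 (A 11 (R 5)) ;; .assign 11 (A 13 (R 5)) ;;
    edgeProg ;;
    .ite (.eq (A 14 (R 5)) 1) (.assign 6 0) (.assign 6 1) ;;
    .assign 5 (R 5 + 1))

/-- Remove the two triangles from the set, and move the other vertices back by three positions. -/
def deletionProg : RamProg :=
  .assign 5 0 ;; .assign 4 0 ;;
  .while (.lt (R 5) (R 3)) (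
    .assign 6 (A 15 (R 5)) ;;
    .ite (.lt 3 (R 6)) (.ite (.lt (R 6 + 2) (R 0)) (pushProg 4 16 (R 6 - 3)) .skip) .skip ;;
    .assign 5 (R 5 + 1))

section

variable {N B : ℕ} {F : ℕ → ℕ}

theorem iterProg_spec (G : PadGraph N F) (hB : N ≤ B) {s : RamState} (hs : Holds N F s) {v k : ℕ}
    (hv : v ≤ N) (h7 : s.reg 7 = v) (h12 : s.reg 12 = k) (h3 : s.reg 3 + k ≤ B) :
    Tri B iterProg s (30 * k + 10) (fun s' =>
      cells 3 15 s' = cells 3 15 s ++ iterList F v k ∧ s'.reg 7 = F^[k] v) := by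
  have hcost : (RamTest.lt 0 (R 12)).cost = 3 := rfl
  refine (Tri.while_frame (fun s' => ∃ i, i + s'.reg 12 = k ∧ s'.reg 7 = F^[i] v ∧
    cells 3 15 s' = cells 3 15 s ++ iterList F v i) (fun s' => 30 * s'.reg 12 + 10)
    (fun s' hf hI hb => ?_) (fun s' hf hI hb => ?_) ?_).mono (by rw [h12]) fun _ h => h
  · obtain ⟨i, g1, g2, g3⟩ := hI
    simp only [holds_lt, eval_ofNat, eval_reg] at hb
    have a0 : s'.arr 0 = s.arr 0 := hf.arr 0
    have hi := G.iterate_le hv i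
    have e1 : s'.arr 0 (F^[i] v) = F^[i + 1] v := by
      rw [a0, hs.2 _ (by omega), Function.iterate_succ_apply']
    have hi' := G.iterate_le hv (i + 1)
    have e3 : s'.reg 3 = s.reg 3 + i := by
      rw [← length_cells 3 15, g3]
      simp [length_cells]
    refine ⟨22, Tri.assign (T := 18) (by simp only [eval_load, eval_reg, g2, e1]; omega)
      (Tri.seq (T₁ := 7) (pushProg_spec ?_ ?_) ?_ (by omega)) (by decide)⟩
    · simp only [eval_load, eval_reg, setReg_reg, if_true, g2, e1]
      omega
    · simp only [setReg_reg, Nat.reduceEqDiff, if_false]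
      omega
    · rintro _ rfl
      refine Tri.wp ?_ (by decide)
      simp only [RamProg.wp, eval_load, eval_reg, eval_sub, eval_ofNat, setReg_reg, if_true,
        Nat.reduceEqDiff, if_false, g2, e1, push_reg]
      refine ⟨by omega, ⟨i + 1, by omega, rfl, ?_⟩, by rw [hcost]; omega⟩
      rw [iterList_add]
      simp only [ne_eq, Nat.reduceEqDiff, not_false_eq_true, cells_setReg, cells_push, g3,
          iterList, List.append_assoc, List.range_one, List.map_singleton]
      rw [Function.iterate_one, Function.iterate_succ_apply']
  · obtain ⟨i, g1, g2, g3⟩ := hI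
    simp only [holds_lt, eval_ofNat, eval_reg] at hb
    obtain rfl : i = k := by omega
    exact ⟨by omega, g3, g2⟩
  · exact ⟨0, by omega, by simpa using h7, by simp [iterList]⟩

theorem edgeProg_spec (G : PadGraph N F) {s : RamState} (hs : Holds N F s) {e : REdge}
    (he : IsREdge N F e) {v w : ℕ} {b : Bool} (hsrc : e.src = .node v w b) (hvw : v ≤ N ∧ w ≤ N)
    (hB : N ≤ B) (hB' : e.weight ≤ B)
    (fresh : Bool) (h3 : s.reg 3 + (edgeOut F fresh e).length ≤ B) (h9 : s.reg 9 = v)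
    (h10 : s.reg 10 = w) (h11 : s.reg 11 = e.weight)
    (h6 : s.reg 6 = fresh.toNat) (h12 : b = decide (s.arr 12 (s.reg 5) = 1))
    (h14 : e.compact = decide (s.arr 14 (s.reg 5) = 1)) :
    Tri B edgeProg s (30 * e.weight + 150) (fun s' =>
      cells 3 15 s' = cells 3 15 s ++ edgeOut F fresh e) := by
  have hF := G.map_le
  have ev := hs.2 v (by omega)
  have ew := hs.2 w (by omega)
  refine Tri.ite (T := 30 * e.weight + 140) (fun hb => ?_) (fun hb => ?_)
    (by simp [RamTest.cost, RamExpr.cost]; omega)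
  · obtain rfl : b = true := by
      rw [h12]
      exact decide_eq_true hb
    have hout : edgeOut F fresh e = (if fresh then [v, w] else []) ++
        (if e.compact then iterList F v e.weight else tailList F v e.weight) := by
      simp only [edgeOut, hsrc]
    refine Tri.seq (T₁ := 30) (Tri.frame (Q := fun s' => cells 3 15 s' = cells 3 15 s ++
      if fresh then [v, w] else []) (Tri.ite (T := 20) (fun hb => ?_)
        (fun hb => Tri.skip ?_ (by omega)) (by decide))) ?_ (by omega)
    · simp only [holds_eq, eval_reg, eval_ofNat, h6] at hb
      obtain rfl : fresh = true := by cases fresh <;> simp at hb ⊢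
      rw [hout] at h3
      simp only [if_true, List.length_append, List.length_cons, List.length_nil] at h3
      refine Tri.seq (T₁ := 7) (pushProg_spec ?_ ?_) ?_ (by omega)
      · simp only [eval_reg]
        omega
      · omega
      rintro _ rfl
      refine (pushProg_spec ?_ ?_).mono (by decide) ?_
      · simp [h10]
        omega
      · simp
        omega
      rintro _ rfl
      simp [h9, h10]
    · simp only [holds_eq, eval_reg, eval_ofNat, h6] at hb
      obtain rfl : fresh = false := by cases fresh <;> simp at hb ⊢
      simp
    rintro s₁ ⟨g1, hf⟩
    have r9 := hf.reg 9
    have r5 := hf.reg 5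
    have r0 := hf.reg 0
    have r11 := hf.reg 11
    have a14 := hf.arr 14
    have a0 := hf.arr 0
    have hs₁ : Holds N F (s₁.setReg 7 v) := ⟨by simp [r0, hs.1], by simpa [a0] using hs.2⟩
    have n1 : s₁.reg 3 = s.reg 3 + (if fresh then [v, w] else []).length := by
      rw [← length_cells 3 15, g1]
      simp [length_cells]
    rw [hout, List.length_append] at h3
    refine Tri.assign (T := 30 * e.weight + 100) (by simp [r9]; omega) (Tri.ite
      (T := 30 * e.weight + 85) (fun hc => ?_) (fun hc => ?_)
      (by simp [RamTest.cost, RamExpr.cost]; omega)) (by simp [RamExpr.cost]; omega)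
    · simp only [holds_eq, eval_reg, eval_ofNat, eval_load, setReg_reg, setReg_arr, a14,
        Nat.reduceEqDiff, if_false, r5] at hc
      have hc : e.compact = true := by rw [h14]; exact decide_eq_true hc
      rw [if_pos hc, length_iterList] at h3
      refine Tri.assign (T := 30 * e.weight + 20) (by simp; omega) ?_
        (by simp [RamExpr.cost]; omega)
      refine (iterProg_spec G hB (v := v) (k := e.weight) ?_ hvw.1 ?_ ?_ ?_).mono (by omega)
        fun s' h => ?_
      · simp only [eval_reg, r9, h9]
        exact ⟨hs₁.1, hs₁.2⟩
      · simp [r9, h9]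
      · simp [r11, h11]
      · simp
        omega
      · rw [h.1, hout, if_pos hc]
        simp [g1]
    · simp only [holds_eq, eval_reg, eval_ofNat, eval_load, setReg_reg, setReg_arr, a14,
        Nat.reduceEqDiff, if_false, r5] at hc
      have hc : e.compact ≠ true := by rw [h14]; simpa using hc
      have h4 : 5 ≤ e.weight := by
        cases he with
        | small => simp at hsrc
        | large b hκ h =>
          have := hκ.1
          simp only
          omega
        | compact => simp at hc
        | last => simp at hsrc
      rw [if_neg hc, length_tailList (by omega)] at h3
      refine Tri.assign (T := 30 * e.weight + 75) (by simp; omega) (Tri.seq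
        (T₁ := 30 * (e.weight - 4) + 10)
          (iterProg_spec G hB (v := v) (k := e.weight - 4) ?_ hvw.1 ?_ ?_ ?_).frame
        ?_ (by omega)) (by have : (R 11 - 4 : RamExpr).cost = 3 := rfl; omega)
      · exact ⟨hs₁.1, hs₁.2⟩
      · simp [r9, h9]
      · simp [r11, h11]
      · simp
        omega
      rintro s₂ ⟨⟨g2, g3⟩, hf₂⟩
      have a0' : s₂.arr 0 = s.arr 0 := by rw [hf₂.arr 0]; exact a0
      have hi := G.iterate_le hvw.1 (e.weight - 4)
      have hi' := G.iterate_le hvw.1 (e.weight - 3)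
      have e1 : s₂.arr 0 (F^[e.weight - 4] v) = F^[e.weight - 3] v := by
        rw [a0', hs.2 _ (by omega), show e.weight - 3 = e.weight - 4 + 1 by omega,
          Function.iterate_succ_apply']
      have n2 : s₂.reg 3 = s₁.reg 3 + (e.weight - 4) := by
        rw [← length_cells 3 15, g2]
        simp [length_cells]
      refine Tri.assign (T := 30) (by simp only [eval_load, eval_reg, g3, e1]; omega) (Tri.seq
        (T₁ := 9) (pushProg_spec ?_ ?_) ?_ (by omega)) (by simp [RamExpr.cost]; omega)
      · simp [g3, e1]
        omega
      · simp
        omega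
      rintro _ rfl
      refine (pushProg_spec ?_ ?_).mono (by decide) ?_
      · simp [g3, e1]
        omega
      · simp
        omega
      rintro _ rfl
      rw [hout, if_neg hc]
      simp [g1, g2, g3, e1, tailList]
  · obtain rfl : b = false := by
      rw [h12]
      exact decide_eq_false hb
    have hout : edgeOut F fresh e = expList F v w e.weight := by simp only [edgeOut, hsrc]
    rw [hout] at h3 ⊢
    have hw : e.weight = 3 ∨ e.weight = 4 := by
      cases he with
      | small b hj h => exact hj
      | large => simp at hsrc
      | compact => simp at hsrc
      | last => exact .inl rfl
    refine Tri.ite (T := 130) (fun hc => ?_) (fun hc => ?_) (by simp [RamTest.cost, RamExpr.cost])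
    · simp only [holds_eq, eval_reg, eval_ofNat, h11] at hc
      have hl : expList F v w e.weight = [v, w, F v] := by rw [hc]; rfl
      rw [hl] at h3 ⊢
      simp only [List.length_cons, List.length_nil] at h3
      refine Tri.seq (T₁ := 7) (pushProg_spec ?_ ?_) ?_ (by omega)
      · simp [h9]; omega
      · omega
      rintro _ rfl
      refine Tri.seq (T₁ := 7) (pushProg_spec ?_ ?_) ?_ (by omega)
      · simp [h10]; omega
      · simp; omega
      rintro _ rfl
      refine (pushProg_spec ?_ ?_).mono (by decide) ?_
      · have := hF v
        simp [h9, ev]; omega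
      · simp; omega
      rintro _ rfl
      simp [h9, h10, ev]
    · simp only [holds_eq, eval_reg, eval_ofNat, h11] at hc
      have hl : expList F v w e.weight = [v, w, min (F v) (F w - 1), F w] := by
        rw [hw.resolve_left hc]
        rfl
      rw [hl] at h3 ⊢
      simp only [List.length_cons, List.length_nil] at h3
      have h1 := hF v
      have h2 := hF w
      refine Tri.assign (T := 110) (by simp [h10, ew]; omega) (Tri.seq (T₁ := 20) (Tri.frame
        (Q := fun s' => s'.reg 7 = min (F v) (F w - 1) ∧ cells 3 15 s' = cells 3 15 s)
        (Tri.wp ?_ (by decide))) ?_ (by omega)) (by decide)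
      · simp only [RamProg.wp, holds_lt, eval_load, eval_reg, eval_sub, eval_ofNat, setReg_reg,
          setReg_arr, if_true, Nat.reduceEqDiff, if_false, h9, h10, ev, ew]
        refine ⟨fun h => ⟨by omega, by omega, ?_⟩, fun h => ⟨by omega, ?_⟩⟩ <;> simp
      rintro s₁ ⟨⟨g1, g2⟩, hf⟩
      have r3 : s₁.reg 3 = s.reg 3 := hf.reg 3
      have r9 : s₁.reg 9 = v := (hf.reg 9).trans h9
      have r10 : s₁.reg 10 = w := (hf.reg 10).trans h10
      have a0 : s₁.arr 0 = s.arr 0 := hf.arr 0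
      refine Tri.seq (T₁ := 7) (pushProg_spec ?_ ?_) ?_ (by omega)
      · simp [r9]; omega
      · omega
      rintro _ rfl
      refine Tri.seq (T₁ := 7) (pushProg_spec ?_ ?_) ?_ (by omega)
      · simp [r10]; omega
      · simp; omega
      rintro _ rfl
      refine Tri.seq (T₁ := 7) (pushProg_spec ?_ ?_) ?_ (by omega)
      · simp [g1]; omega
      · simp; omega
      rintro _ rfl
      refine (pushProg_spec ?_ ?_).mono (by decide) ?_
      · simp [r10, a0, ew]; omega
      · simp; omega
      rintro _ rfl
      simp [g1, g2, r9, r10, a0, ew]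

theorem IsRPath.isREdge {a b : RVertex} {P : List REdge} (h : IsRPath N F a b P) :
    ∀ e ∈ P, IsREdge N F e := by
  induction h with
  | nil => simp
  | cons he _ ih =>
    intro e he'
    rcases List.mem_cons.1 he' with rfl | he'
    · exact he
    · exact ih e he'

theorem IsREdge.src_le (G : PadGraph N F) {e : REdge} (h : IsREdge N F e) {v w : ℕ} {b : Bool}
    (hs : e.src = .node v w b) : v ≤ N ∧ w ≤ N := by
  cases h with
  | small b hj h =>
    simp only [RVertex.node.injEq] at hs
    obtain ⟨rfl, rfl, -⟩ := hs
    exact ((isExtension_iff G).1 h).ok.le G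
  | large b hκ h =>
    simp only [RVertex.node.injEq] at hs
    obtain ⟨rfl, rfl, -⟩ := hs
    exact ((isExtension_iff G).1 h).ok.le G
  | compact h =>
    simp only [RVertex.node.injEq] at hs
    obtain ⟨rfl, rfl, -⟩ := hs
    have := h.le
    omega
  | last =>
    simp only [RVertex.node.injEq] at hs
    omega

theorem IsRPath.length_pathOut (G : PadGraph N F) {P : List REdge}
    (hP : IsRPath N F (.node 1 2 false) .sink P) :
    (pathOut F true P).length = pathWeight P ∧ pathWeight P ≤ N := by
  obtain ⟨-, h1, h2, -⟩ := hP.dom G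
  rw [List.toFinset_card_of_nodup (h2.imp fun h => h.ne)] at h1
  have := (hP.weight_le G).2
  simp only [rpos] at this
  omega

theorem decodeProg_spec (G : PadGraph N F) (hB : 2 * N + 7 ≤ B) {s : RamState} (hs : Holds N F s)
    {P : List REdge} (hP : IsRPath N F (.node 1 2 false) .sink P) (hst : HoldsPath s P) :
    Tri B decodeProg s (300 * (N + 1)) (fun s' => cells 3 15 s' = pathOut F true P) := by
  obtain ⟨hl, hw⟩ := hP.length_pathOut G
  have hPl := (hP.weight_le G).1
  obtain ⟨h2, hst⟩ := hst
  refine Tri.assign (T := 300 * N + 290) (by simp) (Tri.assign (T := 300 * N + 280) (by simp)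
    (Tri.assign (T := 300 * N + 270) (by simp; omega) ?_ (by simp [RamExpr.cost]; omega))
    (by simp [RamExpr.cost]; omega)) (by simp [RamExpr.cost]; omega)
  simp only [eval_ofNat]
  have hcost : (RamTest.lt (R 5) (R 2)).cost = 3 := rfl
  refine (Tri.while_frame (fun s' => ∃ Q Q' fresh, P = Q ++ Q' ∧ s'.reg 5 = Q.length ∧
    s'.reg 6 = fresh.toNat ∧ cells 3 15 s' ++ pathOut F fresh Q' = pathOut F true P)
    (fun s' => 230 * (P.length - s'.reg 5) + 30 * pathWeight (P.drop (s'.reg 5)) + 10)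
    (fun s' hf hI hb => ?_) (fun s' hf hI hb => ?_) ?_).mono ?_ fun _ h => h
  · obtain ⟨Q, Q', fresh, rfl, g2, g3, g4⟩ := hI
    have e2 : s'.reg 2 = (Q ++ Q').length := by rw [hf.reg 2, ← h2]; rfl
    simp only [holds_lt, eval_reg, e2, g2] at hb
    cases Q' with
    | nil => simp at hb
    | cons e Q' =>
      have he : IsREdge N F e := hP.isREdge e (by simp)
      obtain ⟨k1, k2, k3⟩ := hst Q.length (by simp)
      simp only [List.getElem_append_right le_rfl, Nat.sub_self, List.getElem_cons_zero] at k1 k2 k3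
      have hle := he.src_le G k1
      have a10 : s'.arr 10 = s.arr 10 := hf.arr 10
      have a11 : s'.arr 11 = s.arr 11 := hf.arr 11
      have a12 : s'.arr 12 = s.arr 12 := hf.arr 12
      have a13 : s'.arr 13 = s.arr 13 := hf.arr 13
      have a14 : s'.arr 14 = s.arr 14 := hf.arr 14
      have a0 : s'.arr 0 = s.arr 0 := hf.arr 0
      have e0 : s'.reg 0 = s.reg 0 := hf.reg 0
      have hwt : pathWeight (Q ++ e :: Q') = pathWeight Q + (e.weight + pathWeight Q') := by
        simp
      have hlen := congrArg List.length g4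
      rw [hl] at hlen
      simp only [pathOut, List.length_append, length_cells] at hlen
      simp only [List.length_append, List.length_cons] at hPl hb
      obtain ⟨s₀, hs₀⟩ : ∃ s₀, s₀ = ((s'.setReg 9 (s.arr 10 Q.length)).setReg 10
        (s.arr 11 Q.length)).setReg 11 e.weight := ⟨_, rfl⟩
      refine ⟨30 * e.weight + 210, Tri.assign (T := 30 * e.weight + 200) ?_ (Tri.assign
        (T := 30 * e.weight + 190) ?_ (Tri.assign (T := 30 * e.weight + 180) ?_ ?_
        (by simp [RamExpr.cost]; omega)) (by simp [RamExpr.cost]; omega))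
        (by simp [RamExpr.cost]; omega)⟩
      · simp [a10, g2]
        omega
      · simp [a11, g2]
        omega
      · simp [a13, g2, ← k2]
        omega
      simp only [eval_load, eval_reg, a10, a11, a13, g2, setReg_arr, setReg_reg, Nat.reduceEqDiff,
        if_false, ← k2]
      rw [← hs₀]
      have e5 : s₀.reg 5 = Q.length := by simp [hs₀, g2]
      refine Tri.seq (edgeProg_spec G (s := s₀) (e := e) (fresh := fresh) (B := B) ?_ he k1 hle
        (by omega) (by omega) ?_ ?_ ?_ ?_ ?_ ?_ ?_).frame ?_ (by omega)
      · refine ⟨by simp [hs₀, e0, hs.1], ?_⟩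
        simpa [hs₀, a0] using hs.2
      · simp [hs₀]
        omega
      · simp [hs₀]
      · simp [hs₀]
      · simp [hs₀]
      · simp [hs₀, g3]
      · rw [e5]
        simp [hs₀, a12]
      · rw [e5, k3]
        simp [hs₀, a14]
      rintro s₁ ⟨n1, hf₁⟩
      have e5' : s₁.reg 5 = Q.length := (hf₁.reg 5).trans e5
      have a14' : s₁.arr 14 = s.arr 14 := by rw [hf₁.arr 14, hs₀]; exact a14
      have hc0 : cells 3 15 s₀ = cells 3 15 s' := by simp [hs₀]
      refine Tri.wp ?_ (le_trans (by decide : _ ≤ 20) (by omega))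
      simp only [RamProg.wp, holds_eq, eval_load, eval_reg, eval_add, eval_ofNat, setReg_reg,
          if_true,
        Nat.reduceEqDiff, if_false, e5', a14']
      have fin : ∀ (s₂ : RamState) (c : ℕ), c = (!e.compact).toNat →
          cells 3 15 s₂ = cells 3 15 s₁ →
          (∃ R R' fresh, Q ++ e :: Q' = R ++ R' ∧ Q.length + 1 = R.length ∧ c = fresh.toNat ∧
            cells 3 15 s₂ ++ pathOut F fresh R' = pathOut F true (Q ++ e :: Q')) ∧
          (RamTest.lt (R 5) (R 2)).cost + 1 + (30 * e.weight + 210) +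
            (230 * ((Q ++ e :: Q').length - (Q.length + 1)) +
              30 * pathWeight ((Q ++ e :: Q').drop (Q.length + 1)) + 10) ≤
            230 * ((Q ++ e :: Q').length - Q.length) +
              30 * pathWeight ((Q ++ e :: Q').drop Q.length) + 10 := by
        intro s₂ c m1 m3
        refine ⟨⟨Q ++ [e], Q', !e.compact, by simp, by simp, m1, ?_⟩, ?_⟩
        · rw [m3, n1, hc0, List.append_assoc, ← g4]
          rfl
        · rw [hcost, ← List.drop_drop, List.drop_left]
          simp only [List.drop_succ_cons, List.drop_zero, pathWeight_cons, List.length_append,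
            List.length_cons]
          omega
      refine ⟨fun hc => ⟨by omega, by omega, fin _ _ ?_ ?_⟩,
        fun hc => ⟨by omega, by omega, fin _ _ ?_ ?_⟩⟩
      · simp [k3, hc]
      · simp
      · simp [k3, hc]
      · simp
  · obtain ⟨Q, Q', fresh, rfl, g2, g3, g4⟩ := hI
    have e2 : s'.reg 2 = (Q ++ Q').length := by rw [hf.reg 2, ← h2]; rfl
    simp only [holds_lt, eval_reg, e2, g2, List.length_append] at hb
    obtain rfl : Q' = [] := List.length_eq_zero_iff.1 (by omega)
    refine ⟨by omega, ?_⟩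
    simpa [pathOut] using g4
  · exact ⟨[], P, true, rfl, by simp, by simp, by simp [cells]⟩
  · simp
    omega

theorem deletionProg_spec (hB : 2 * N + 7 ≤ B) {s : RamState} (h0 : s.reg 0 = N)
    {L : List ℕ} (hL : cells 3 15 s = L) (hlen : L.length ≤ N) (hLN : ∀ x ∈ L, x ≤ N) :
    Tri B deletionProg s (100 * (N + 1)) (fun s' => cells 4 16 s' =
      (L.filter fun x => 3 < x ∧ x + 2 < N).map fun x => x - 3) := by
  refine Tri.assign (T := 100 * N + 90) (by simp) (Tri.assign (T := 100 * N + 80) (by simp)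
    ?_ (by simp [RamExpr.cost]; omega)) (by simp [RamExpr.cost]; omega)
  simp only [eval_ofNat]
  have hcost : (RamTest.lt (R 5) (R 3)).cost = 3 := rfl
  have h3 : s.reg 3 = L.length := by rw [← length_cells 3 15, hL]
  refine (Tri.while_frame (fun s' => s'.reg 5 ≤ L.length ∧ cells 4 16 s' =
      ((L.take (s'.reg 5)).filter fun x => 3 < x ∧ x + 2 < N).map fun x => x - 3)
    (fun s' => 80 * (L.length - s'.reg 5) + 10)
    (fun s' hf hI hb => ?_) (fun s' hf hI hb => ?_) ?_).mono ?_ fun _ h => h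
  · obtain ⟨g1, g2⟩ := hI
    have e3 : s'.reg 3 = L.length := by rw [hf.reg 3]; simpa using h3
    have e0 : s'.reg 0 = N := by rw [hf.reg 0]; simpa using h0
    have a15 : s'.arr 15 = s.arr 15 := hf.arr 15
    simp only [holds_lt, eval_reg, e3] at hb
    generalize hi : s'.reg 5 = i at *
    have ex : s.arr 15 i = L[i] := by
      simp only [← hL, cells, List.getElem_map, List.getElem_range]
    have hx := hLN _ (List.getElem_mem hb)
    have ht : L.take (i + 1) = L.take i ++ [L[i]] := by simp
    have e4 : s'.reg 4 ≤ i := by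
      rw [← length_cells 4 16, g2, List.length_map]
      exact (List.length_filter_le _ _).trans (by simp)
    refine ⟨50, Tri.wp ?_ (by decide)⟩
    simp only [RamProg.wp, pushProg, holds_lt, eval_load, eval_reg, eval_add, eval_sub, eval_ofNat,
      setReg_reg, setArr_reg, if_true, Nat.reduceEqDiff, if_false, e0, hi, a15, ex]
    refine ⟨by omega, fun c1 => ⟨fun c2 => ⟨⟨by omega, by omega⟩, by omega, by omega,
      ⟨by omega, ?_⟩, by rw [hcost]; omega⟩, fun c2 => ⟨by omega, ⟨by omega, ?_⟩,
      by rw [hcost]; omega⟩⟩, fun c2 => ⟨by omega, ⟨by omega, ?_⟩, by rw [hcost]; omega⟩⟩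
    · have := cells_push 4 16 (s'.setReg 6 L[i]) (L[i] - 3)
      simp only [push, setReg_reg, Nat.reduceEqDiff, if_false] at this
      rw [cells_setReg (by decide), this, cells_setReg (by decide), g2, ht,
        List.filter_append, List.map_append]
      simp [c1, c2]
    · rw [cells_setReg (by decide), cells_setReg (by decide), g2, ht, List.filter_append,
        List.map_append]
      simp [c2]
    · rw [cells_setReg (by decide), cells_setReg (by decide), g2, ht, List.filter_append,
        List.map_append]
      simp [c2]
  · obtain ⟨g1, g2⟩ := hI
    have e3 : s'.reg 3 = L.length := by rw [hf.reg 3]; simpa using h3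
    simp only [holds_lt, eval_reg, e3] at hb
    refine ⟨by omega, ?_⟩
    rw [g2, List.take_of_length_le (by omega)]
  · simp [cells]
  · simp
    omega

end

/-! ### The algorithm on a straight graph -/

theorem IsStraightOrder.base_padFr {V : Type*} {G : Digraph V} {n : ℕ} {v : Fin n ≃ V}
    {f : Fin n → Fin n} (h : IsStraightOrder G v f) :
    base (padFr n (frHat f)) (n + 6 + 1) = 2 * (numArcs G + 6) := by
  have h1 : ∑ i ∈ Finset.Ico 4 (n + 4), outDeg (padFr n (frHat f)) i = numArcs G := by
    rw [h.numArcs_eq, Finset.sum_Ico_eq_sum_range, Nat.add_sub_cancel, ← Fin.sum_univ_eq_sum_range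
      (fun k => outDeg (padFr n (frHat f)) (4 + k))]
    refine Finset.sum_congr rfl fun i _ => ?_
    rw [add_comm 4, outDeg, padFr_add_four]
    omega
  have h2 : base (padFr n (frHat f)) 4 = 6 := by
    simp [base, Finset.sum_Ico_succ_top, outDeg, padFr]
  have h3 : base (padFr n (frHat f)) (n + 4) = 6 + 2 * numArcs G := by
    rw [← h1, ← h2]
    unfold base
    rw [← Finset.sum_Ico_consecutive _ (by omega : 1 ≤ 4) (by omega : 4 ≤ n + 4)]
    ring
  have h4 : ∀ i, n + 4 ≤ i → outDeg (padFr n (frHat f)) i = n + 6 - i := by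
    intro i hi
    rw [outDeg, padFr, if_neg (by omega), if_neg (by omega)]
  rw [show n + 6 + 1 = n + 4 + 1 + 1 + 1 by omega, base_succ (by omega), base_succ (by omega),
    base_succ (by omega), h3, h4 _ le_rfl, h4 _ (by omega), h4 _ (by omega)]
  omega

/-- The six programs, run on any memory that holds a straight graph. -/
theorem IsStraightOrder.run {V : Type*} {G : Digraph V} {n : ℕ} {v : Fin n ≃ V}
    {f : Fin n → Fin n} (h : IsStraightOrder G v f)
    (hdeg : ∀ x, 2 ≤ (G.toSimpleGraphInclusive.neighborSet x).encard) {B : ℕ}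
    (hB : 100 * (n + numArcs G + 1) ≤ B) {s : RamState} (h0 : s.reg 0 = n)
    (hf : ∀ i, 1 ≤ i → i ≤ n → s.arr 0 i = frHat f i) :
    ∃ (σ₁ σ₂ σ₃ σ₄ σ₅ σ₆ : RamState) (t₁ t₂ t₃ t₄ t₅ t₆ : ℕ) (P : List REdge) (W' : Set ℕ)
      (W : Set V),
      (Exec B insertionProg s t₁ σ₁ ∧ t₁ ≤ 100 * (n + 1) ∧
        HoldsGraph σ₁ (n + 6) (padFr n (frHat f))) ∧
      (Exec B widthProg σ₁ t₂ σ₂ ∧ t₂ ≤ 700 * (n + 1) ∧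
        HoldsWidth σ₂ (n + 6) (padFr n (frHat f))) ∧
      (Exec B buildProg σ₂ t₃ σ₃ ∧ t₃ ≤ 40000 * (numArcs G + 1) ∧
        HoldsR σ₃ (n + 6) (padFr n (frHat f))) ∧
      (Exec B pathProg σ₃ t₄ σ₄ ∧ t₄ ≤ 10000 * (numArcs G + 1) ∧
        IsShortestRPath (n + 6) (padFr n (frHat f)) P ∧ HoldsPath σ₄ P) ∧
      (Exec B decodeProg σ₄ t₅ σ₅ ∧ t₅ ≤ 3000 * (n + 1) ∧
        Encodes (n + 6) (padFr n (frHat f)) P W' ∧ HoldsSet σ₅ 3 15 W') ∧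
      (Exec B deletionProg σ₅ t₆ σ₆ ∧ t₆ ≤ 1000 * (n + 1) ∧
        W' = {1, 2, 3} ∪ {k | ∃ i : Fin n, v i ∈ W ∧ k = (i : ℕ) + 4} ∪ {n + 4, n + 5, n + 6} ∧
        HoldsSet σ₆ 4 16 {k | ∃ i : Fin n, v i ∈ W ∧ k = (i : ℕ) + 1}) ∧
      IsMinTotalDominating 2 G.toSimpleGraphInclusive W := by
  have hpad := h.padGraph
  have hbase := h.base_padFr
  have hnm := h.le_numArcs hdeg
  have huniv := (h.dom_iff Set.univ (padSet v Set.univ) (coe_padSet v _)).2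
    (fun x => by rw [Set.inter_univ]; exact hdeg x)
  obtain ⟨t₁, σ₁, x₁, b₁, q₁⟩ := insertionProg_spec (B := B) (by omega) h0 hf
  have hmin := fun W' => h.min (W' := W')
  generalize padFr n (frHat f) = F at *
  obtain ⟨t₂, σ₂, x₂, b₂, q₂, q₂'⟩ := widthProg_spec hpad (B := B) (by omega) q₁
  obtain ⟨t₃, σ₃, x₃, b₃, q₃, q₃'⟩ := buildProg_spec hpad (B := B) (by omega) (by omega) q₂ q₂'
  obtain ⟨t₄, σ₄, x₄, b₄, P, hP, q₄⟩ := pathProg_spec hpad (B := B) (by omega) (by omega) q₃'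
    (huniv.exists_path hpad)
  have k₄ : Holds (n + 6) F σ₄ :=
    ⟨(x₄.reg_eq (r := 0) rfl).trans q₃.1, by rw [x₄.arr_eq (a := 0) rfl]; exact q₃.2⟩
  obtain ⟨t₅, σ₅, x₅, b₅, q₅⟩ := decodeProg_spec hpad (B := B) (by omega) k₄ hP.1 q₄
  have k₅ : σ₅.reg 0 = n + 6 := (x₅.reg_eq (r := 0) rfl).trans k₄.1
  obtain ⟨hd, hcard, hlt, henc⟩ := hP.1.dom hpad
  obtain ⟨hlen, hw⟩ := hP.1.length_pathOut hpad
  obtain ⟨heq, hopt⟩ := hmin _ hd (fun W'' hW'' => by rw [hcard]; exact hP.min hpad hW'')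
  have hsub : ∀ x ∈ pathOut F true P, 1 ≤ x ∧ x ≤ n + 6 := fun x hx =>
    hd.sub x (List.mem_toFinset.2 hx)
  obtain ⟨t₆, σ₆, x₆, b₆, q₆⟩ := deletionProg_spec (B := B) (by omega) k₅ q₅ (by omega)
    (fun x hx => (hsub x hx).2)
  refine ⟨σ₁, σ₂, σ₃, σ₄, σ₅, σ₆, t₁, t₂, t₃, t₄, t₅, t₆, P, {x | x ∈ pathOut F true P},
    {x | (v.symm x : ℕ) + 4 ∈ (pathOut F true P).toFinset}, ⟨x₁, b₁, q₁.1, fun i h1 h2 =>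
      q₁.2 i (by omega)⟩, ⟨x₂, by omega, q₂'⟩, ⟨x₃, by omega, q₃'.holdsR hpad⟩,
    ⟨x₄, by omega, hP, q₄⟩, ⟨x₅, by omega, henc, ?_⟩, ⟨x₆, by omega, ?_, ?_⟩, hopt⟩
  · rw [← q₅]
    refine HoldsSet.of_cells ?_
    rw [q₅]
    exact hlt.imp fun h => h.ne
  · rw [← heq, List.coe_toFinset]
  · have hnd : (cells 4 16 σ₆).Nodup := by
      rw [q₆]
      refine List.Nodup.map_on ?_ ((hlt.imp fun h => h.ne).filter _)
      intro x hx y hy hxy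
      simp only [List.mem_filter, decide_eq_true_eq] at hx hy
      omega
    convert HoldsSet.of_cells hnd using 1
    ext k
    rw [q₆]
    simp only [Set.mem_ofPred_eq, List.mem_map, List.mem_filter, decide_eq_true_eq,
      Equiv.symm_apply_apply, List.mem_toFinset]
    constructor
    · rintro ⟨i, hi, rfl⟩
      exact ⟨_, ⟨hi, by omega, by omega⟩, by omega⟩
    · rintro ⟨x, ⟨h1, h2, h3⟩, rfl⟩
      refine ⟨⟨x - 4, by omega⟩, ?_, by simp only; omega⟩
      rwa [show x - 4 + 4 = x by omega]

/-! ### Orders of proper interval graphs -/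

/-- The vertices of `K` are among `0, …, n - 1`, and in the order given by `ρ` every vertex between
two adjacent vertices is adjacent to both. -/
structure Umbrella (K : SimpleGraph ℕ) (n : ℕ) (ρ : ℕ → ℤ) : Prop where
  lt : ∀ {x y}, K.Adj x y → x < n
  inj : ∀ {x y}, x < n → y < n → ρ x = ρ y → x = y
  left : ∀ {x y z}, y < n → ρ x < ρ y → ρ y < ρ z → K.Adj x z → K.Adj x y
  right : ∀ {x y z}, y < n → ρ x < ρ y → ρ y < ρ z → K.Adj x z → K.Adj y z

/-- `D` is one more than the distance from `r` in the component `S` of `r`, as characterized by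
local properties. -/
structure Layered (K : SimpleGraph ℕ) (S : Finset ℕ) (r : ℕ) (D : ℕ → ℕ) : Prop where
  mem : r ∈ S
  root : D r = 1
  closed : ∀ x ∈ S, ∀ y, K.Adj x y → y ∈ S
  step : ∀ x ∈ S, ∀ y, K.Adj x y → D y ≤ D x + 1
  parent : ∀ x ∈ S, x ≠ r → ∃ z ∈ S, K.Adj z x ∧ D x = D z + 1

/-- In the order given by `ρ`, the vertex `e` has the same closed neighbourhood as the first vertex
of the component `S`. -/
structure LeftEnd (K : SimpleGraph ℕ) (S : Finset ℕ) (ρ : ℕ → ℤ) (e : ℕ) : Prop where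
  mem : e ∈ S
  adj : ∀ y ∈ S, ρ y < ρ e → K.Adj y e
  least : ∀ y ∈ S, ∀ z, K.Adj e z → ρ y < ρ z → K.Adj y z

open Classical in
/-- The number of vertices of `S` up to the last neighbour of `x`, in the order given by `ρ`. -/
noncomputable def upTo (K : SimpleGraph ℕ) (S : Finset ℕ) (ρ : ℕ → ℤ) (x : ℕ) : ℕ :=
  (S.filter fun y => ρ y ≤ ρ x ∨ K.Adj x y).card

section

variable {K : SimpleGraph ℕ} {n : ℕ} {ρ : ℕ → ℤ} {S T : Finset ℕ} {r e : ℕ} {D : ℕ → ℕ}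

theorem Umbrella.neg (h : Umbrella K n ρ) : Umbrella K n fun x => -ρ x where
  lt := h.lt
  inj hx hy he := h.inj hx hy (neg_injective he)
  left hy h1 h2 ha := (h.right hy (neg_lt_neg_iff.1 h2) (neg_lt_neg_iff.1 h1) ha.symm).symm
  right hy h1 h2 ha := (h.left hy (neg_lt_neg_iff.1 h2) (neg_lt_neg_iff.1 h1) ha.symm).symm

/-- To the left of the root, the distance from it decreases. -/
theorem Layered.antitone (h : Umbrella K n ρ) (L : Layered K S r D) (hS : ∀ x ∈ S, x < n) :
    ∀ x ∈ S, ∀ y ∈ S, ρ x ≤ ρ y → ρ y ≤ ρ r → D y ≤ D x := by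
  suffices H : ∀ k, ∀ x ∈ S, D x = k → ∀ y ∈ S, ρ x ≤ ρ y → ρ y ≤ ρ r → D y ≤ D x from
    fun x hx => H _ x hx rfl
  intro k
  induction k with
  | zero =>
    intro x hx hD
    by_cases hxr : x = r
    · have := L.root
      rw [← hxr] at this
      omega
    · obtain ⟨z, -, -, h1⟩ := L.parent x hx hxr
      omega
  | succ k ih =>
    intro x hx hD y hy hxy hyr
    rcases hxy.lt_or_eq with hxy | hxy
    · obtain ⟨z, hz, hzx, hDz⟩ := L.parent x hx (by rintro rfl; omega)
      rcases lt_trichotomy (ρ y) (ρ z) with hyz | hyz | hyz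
      · have := L.step z hz y (h.right (hS y hy) hxy hyz hzx.symm).symm
        omega
      · rw [h.inj (hS y hy) (hS z hz) hyz]
        omega
      · have := ih z hz (by omega) y hy hyz.le hyr
        omega
    · rw [h.inj (hS x hx) (hS y hy) hxy]

/-- A vertex of least degree among those farthest from the root, if it lies to the left of the
root, has the same closed neighbourhood as the first vertex of the component. -/
theorem Layered.leftEnd (h : Umbrella K n ρ) (L : Layered K S r D) (hS : ∀ x ∈ S, x < n)
    (he : e ∈ S) (hmax : ∀ x ∈ S, D x ≤ D e)
    (hdeg : ∀ x ∈ S, D x = D e → (K.neighborSet e).ncard ≤ (K.neighborSet x).ncard)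
    (her : ρ e ≤ ρ r) : LeftEnd K S ρ e := by
  obtain ⟨a, ha, hmin⟩ := S.exists_min_image ρ ⟨e, he⟩
  have hanti := L.antitone h hS
  have hk : ∀ x ∈ S, ρ x ≤ ρ e → D x = D e := fun x hx hxe =>
    le_antisymm (hmax x hx) (hanti x hx e he hxe her)
  have hfin : (K.neighborSet e).Finite := (Set.finite_Iio n).subset fun y hy => h.lt hy.symm
  have key : ∀ y ∈ S, ρ y ≤ ρ e → y ≠ e → K.Adj a e := by
    intro y hy hye hne
    by_cases har : a = r
    · have h1 : ρ e = ρ a := le_antisymm (har ▸ her) (hmin e he)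
      have h2 : ρ y = ρ e := le_antisymm hye (h1 ▸ hmin y hy)
      exact (hne (h.inj (hS y hy) (hS e he) h2)).elim
    · obtain ⟨z, hz, hza, hDz⟩ := L.parent a ha har
      have h1 := hk a ha (hmin e he)
      have hez : ρ e < ρ z := by
        by_contra hle
        have := hk z hz (not_lt.1 hle)
        omega
      rcases (hmin e he).lt_or_eq with hlt | heq
      · exact h.left (hS e he) hlt hez hza.symm
      · have h2 : ρ y = ρ e := le_antisymm hye (heq ▸ hmin y hy)
        exact (hne (h.inj (hS y hy) (hS e he) h2)).elim
  have hadj : ∀ y ∈ S, ρ y < ρ e → K.Adj y e := by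
    intro y hy hye
    have h1 := key y hy hye.le (by rintro rfl; exact lt_irrefl _ hye)
    rcases (hmin y hy).lt_or_eq with hlt | heq
    · exact h.right (hS y hy) hlt hye h1
    · rwa [← h.inj (hS a ha) (hS y hy) heq]
  refine ⟨he, hadj, fun y hy z hez hyz => ?_⟩
  have hz := L.closed e he z hez
  by_cases hae : a = e
  · subst hae
    rcases (hmin y hy).lt_or_eq with hlt | heq
    · exact h.right (hS y hy) hlt hyz hez
    · rwa [← h.inj (hS a ha) (hS y hy) heq]
  -- the closed neighbourhood of the first vertex is contained in that of `e`, hence equal to it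
  · have hale : ρ a < ρ e := (hmin e he).lt_of_ne fun h1 => hae (h.inj (hS a ha) (hS e he) h1)
    have hAe := hadj a ha hale
    have hsub : insert a (K.neighborSet a) ⊆ insert e (K.neighborSet e) := by
      rintro w (rfl | hw)
      · exact .inr hAe.symm
      · have hwS := L.closed a ha w hw
        by_cases hwe : w = e
        · exact .inl hwe
        rcases lt_trichotomy (ρ w) (ρ e) with h1 | h1 | h1
        · exact .inr (hadj w hwS h1).symm
        · exact (hwe (h.inj (hS w hwS) (hS e he) h1)).elim
        · exact .inr (h.right (hS e he) hale h1 hw)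
    have hfa : (K.neighborSet a).Finite := (Set.finite_Iio n).subset fun y hy => h.lt hy.symm
    have heq := Set.eq_of_subset_of_ncard_le hsub (by
      rw [Set.ncard_insert_of_notMem (by simp) hfa, Set.ncard_insert_of_notMem (by simp) hfin]
      exact Nat.add_le_add_right (hdeg a ha (hk a ha hale.le)) 1) (hfin.insert e)
    have hza : K.Adj a z := by
      have : z ∈ insert a (K.neighborSet a) := heq ▸ Set.mem_insert_of_mem _ hez
      rcases this with rfl | h1
      · exact absurd (hmin y hy) (not_le.2 hyz)
      · exact h1
    rcases (hmin y hy).lt_or_eq with hlt | heq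
    · exact h.right (hS y hy) hlt hyz hza
    · rwa [← h.inj (hS a ha) (hS y hy) heq]

/-- From the first vertex on, the distance from it increases. -/
theorem LeftEnd.monotone (h : Umbrella K n ρ) (E : LeftEnd K S ρ e) (L : Layered K S e D)
    (hS : ∀ x ∈ S, x < n) : ∀ y ∈ S, ∀ x ∈ S, y ≠ e → x ≠ e → ρ x ≤ ρ y → D x ≤ D y := by
  suffices H : ∀ k, ∀ y ∈ S, D y = k → ∀ x ∈ S, y ≠ e → x ≠ e → ρ x ≤ ρ y → D x ≤ D y from
    fun y hy => H _ y hy rfl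
  intro k
  induction k using Nat.strong_induction_on with
  | _ k ih =>
    intro y hy hD x hx hye hxe hxy
    rcases hxy.lt_or_eq with hxy | hxy
    · obtain ⟨z, hz, hzy, hDz⟩ := L.parent y hy hye
      by_cases hze : z = e
      · subst hze
        have : K.Adj z x := by
          rcases lt_trichotomy (ρ x) (ρ z) with h1 | h1 | h1
          · exact (E.adj x hx h1).symm
          · exact (hxe (h.inj (hS x hx) (hS z hz) h1)).elim
          · exact h.left (hS x hx) h1 hxy hzy
        have := L.step z hz x this
        omega
      rcases lt_trichotomy (ρ z) (ρ x) with h1 | h1 | h1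
      · have := L.step z hz x (h.left (hS x hx) h1 hxy hzy)
        omega
      · rw [← h.inj (hS z hz) (hS x hx) h1]
        omega
      · have := ih (D z) (by omega) z hz rfl x hx hze hxe h1.le
        omega
    · rw [h.inj (hS x hx) (hS y hy) hxy]

/-- The distances from an end determine the last neighbour of each vertex. -/
theorem LeftEnd.dist_le_or_adj_iff (h : Umbrella K n ρ) (E : LeftEnd K S ρ e)
    (L : Layered K S e D) (hS : ∀ x ∈ S, x < n) {x y : ℕ} (hx : x ∈ S) (hy : y ∈ S) :
    D y ≤ D x ∨ K.Adj x y ↔ ρ y ≤ ρ x ∨ K.Adj x y := by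
  have hmono := E.monotone h L hS
  have hpos : ∀ x ∈ S, x ≠ e → 2 ≤ D x := by
    intro x hx hxe
    obtain ⟨z, hz, hzx, hDz⟩ := L.parent x hx hxe
    have : 1 ≤ D z := by
      by_cases hze : z = e
      · rw [hze, L.root]
      · obtain ⟨z', -, -, h1⟩ := L.parent z hz hze
        omega
    omega
  have he := L.root
  constructor
  · rintro (hD | hadj)
    · by_contra hcon
      obtain ⟨h1, h2⟩ := not_or.1 hcon
      rw [not_le] at h1
      by_cases hye : y = e
      · subst hye
        exact h2 (E.adj x hx h1)
      by_cases hxe : x = e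
      · subst hxe
        have := hpos y hy hye
        omega
      · have h3 := hmono y hy x hx hye hxe h1.le
        obtain ⟨z, hz, hzy, hDz⟩ := L.parent y hy hye
        by_cases hze : z = e
        · subst hze
          exact h2 (E.least x hx y hzy h1)
        rcases lt_trichotomy (ρ z) (ρ x) with h4 | h4 | h4
        · exact h2 (h.right (hS x hx) h4 h1 hzy)
        · exact h2 (h.inj (hS z hz) (hS x hx) h4 ▸ hzy)
        · have := hmono z hz x hx hze hxe h4.le
          omega
    · exact .inr hadj
  · rintro (hle | hadj)
    · by_cases hye : y = e
      · subst hye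
        by_cases hxe : x = y
        · exact .inl (by rw [hxe])
        · have := hpos x hx hxe
          exact .inl (by omega)
      by_cases hxe : x = e
      · subst hxe
        exact .inr (E.adj y hy (hle.lt_of_ne fun h1 => hye (h.inj (hS y hy) (hS x hx) h1))).symm
      · exact .inl (hmono x hx y hy hxe hye hle)
    · exact .inr hadj

/-- The vertices of `T` are ordered, before all other vertices, and `g` counts the vertices up to
the last neighbour. -/
def Sorted (K : SimpleGraph ℕ) (n : ℕ) (T : Finset ℕ) (g : ℕ → ℕ) : Prop :=
  ∃ ρ, Umbrella K n ρ ∧ (∀ x ∈ T, ∀ y < n, y ∉ T → ρ x < ρ y) ∧ ∀ x ∈ T, g x = upTo K T ρ x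

open Classical in
/-- A component can be put behind the components that are ordered already. -/
theorem Sorted.union_of_umbrella {g g' : ℕ → ℕ} {ρ' : ℕ → ℤ} (hT : ∀ x ∈ T, x < n)
    (hS : ∀ x ∈ S, x < n) (hTc : ∀ x ∈ T, ∀ y, K.Adj x y → y ∈ T)
    (hSc : ∀ x ∈ S, ∀ y, K.Adj x y → y ∈ S) (hdisj : ∀ x ∈ T, x ∉ S) (h : Sorted K n T g)
    (h' : Umbrella K n ρ') (hgT : ∀ x ∈ T, g' x = g x)
    (hgS : ∀ x ∈ S, g' x = T.card + upTo K S ρ' x) : Sorted K n (T ∪ S) g' := by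
  obtain ⟨ρ, h, hbefore, hg⟩ := h
  obtain ⟨M, hM⟩ : ∃ M : ℤ, ∀ y < n, |ρ y| < M ∧ |ρ' y| < M := by
    refine ⟨∑ y ∈ Finset.range n, (|ρ y| + |ρ' y|) + 1, fun y hy => ?_⟩
    have := Finset.single_le_sum (f := fun y => |ρ y| + |ρ' y|) (fun i _ => by positivity)
      (Finset.mem_range.2 hy)
    have h1 := abs_nonneg (ρ y)
    have h2 := abs_nonneg (ρ' y)
    constructor <;> omega
  -- the blocks are moved apart by multiples of `2 * M`
  let q : ℕ → ℤ := fun y => if y ∈ T then ρ y else if y ∈ S then 2 * M + ρ' y else 4 * M + ρ y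
  have qT : ∀ y ∈ T, q y = ρ y := fun y hy => if_pos hy
  have qS : ∀ y ∈ S, q y = 2 * M + ρ' y := fun y hy => by
    simp only [q]
    rw [if_neg fun h => hdisj y h hy, if_pos hy]
  have qO : ∀ y, y ∉ T → y ∉ S → q y = 4 * M + ρ y := fun y h1 h2 => by
    simp only [q]
    rw [if_neg h1, if_neg h2]
  have hb : ∀ y < n, -M < ρ y ∧ ρ y < M ∧ -M < ρ' y ∧ ρ' y < M := fun y hy =>
    ⟨(abs_lt.1 (hM y hy).1).1, (abs_lt.1 (hM y hy).1).2, (abs_lt.1 (hM y hy).2).1,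
      (abs_lt.1 (hM y hy).2).2⟩
  have hcase : ∀ y, y ∈ T ∨ y ∈ S ∨ (y ∉ T ∧ y ∉ S) := fun y => by tauto
  have hcl : ∀ {x z}, K.Adj x z → (x ∈ T ∧ z ∈ T) ∨ (x ∈ S ∧ z ∈ S) ∨
      ((x ∉ T ∧ x ∉ S) ∧ z ∉ T ∧ z ∉ S) := fun {x z} hxz => by
    rcases hcase x with hx | hx | hx
    · exact .inl ⟨hx, hTc x hx z hxz⟩
    · exact .inr (.inl ⟨hx, hSc x hx z hxz⟩)
    · exact .inr (.inr ⟨hx, fun hz => hx.1 (hTc z hz x hxz.symm),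
        fun hz => hx.2 (hSc z hz x hxz.symm)⟩)
  -- a vertex between two adjacent ones is in the same block, where the order is as before
  have hmid : ∀ {x y z}, y < n → q x < q y → q y < q z → K.Adj x z →
      (ρ x < ρ y ∧ ρ y < ρ z) ∨ (ρ' x < ρ' y ∧ ρ' y < ρ' z) := fun {x y z} hy h1 h2 hxz => by
    have b1 := hb x (h.lt hxz)
    have b2 := hb y hy
    have b3 := hb z (h.lt hxz.symm)
    rcases hcl hxz with ⟨c1, c2⟩ | ⟨c1, c2⟩ | ⟨c1, c2⟩
    · rw [qT x c1] at h1
      rw [qT z c2] at h2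
      rcases hcase y with c3 | c3 | c3
      · rw [qT y c3] at h1 h2
        exact .inl ⟨h1, h2⟩
      · rw [qS y c3] at h1 h2
        omega
      · rw [qO y c3.1 c3.2] at h1 h2
        omega
    · rw [qS x c1] at h1
      rw [qS z c2] at h2
      rcases hcase y with c3 | c3 | c3
      · rw [qT y c3] at h1 h2
        omega
      · rw [qS y c3] at h1 h2
        exact .inr ⟨by omega, by omega⟩
      · rw [qO y c3.1 c3.2] at h1 h2
        omega
    · rw [qO x c1.1 c1.2] at h1
      rw [qO z c2.1 c2.2] at h2
      rcases hcase y with c3 | c3 | c3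
      · rw [qT y c3] at h1 h2
        omega
      · rw [qS y c3] at h1 h2
        omega
      · rw [qO y c3.1 c3.2] at h1 h2
        exact .inl ⟨by omega, by omega⟩
  refine ⟨q, ⟨h.lt, fun {x y} hx hy hxy => ?_, fun hy h1 h2 ha => ?_, fun hy h1 h2 ha => ?_⟩,
    fun x hx y hy hyn => ?_, fun x hx => ?_⟩
  · have b1 := hb x hx
    have b2 := hb y hy
    rcases hcase x with c1 | c1 | c1 <;> rcases hcase y with c2 | c2 | c2 <;>
      simp only [qT, qS, qO, c1, c2, not_false_eq_true] at hxy
    · exact h.inj hx hy hxy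
    · omega
    · omega
    · omega
    · exact h'.inj hx hy (by omega)
    · omega
    · omega
    · omega
    · exact h.inj hx hy (by omega)
  · rcases hmid hy h1 h2 ha with ⟨h3, h4⟩ | ⟨h3, h4⟩
    · exact h.left hy h3 h4 ha
    · exact h'.left hy h3 h4 ha
  · rcases hmid hy h1 h2 ha with ⟨h3, h4⟩ | ⟨h3, h4⟩
    · exact h.right hy h3 h4 ha
    · exact h'.right hy h3 h4 ha
  · rw [Finset.mem_union, not_or] at hyn
    rw [qO y hyn.1 hyn.2]
    have b2 := hb y hy
    rcases Finset.mem_union.1 hx with c1 | c1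
    · have b1 := hb x (hT x c1)
      rw [qT x c1]
      omega
    · have b1 := hb x (hS x c1)
      rw [qS x c1]
      omega
  · have hd : Disjoint T S := Finset.disjoint_left.2 hdisj
    rw [upTo, Finset.filter_union, Finset.card_union_of_disjoint
      (Finset.disjoint_filter_filter hd)]
    rcases Finset.mem_union.1 hx with c1 | c1
    · rw [hgT x c1, hg x c1, upTo, Finset.filter_false_of_mem (s := S), Finset.card_empty,
        Nat.add_zero]
      · congr 1
        refine Finset.filter_congr fun y hy => ?_
        rw [qT x c1, qT y hy]
      · intro y hy
        have b1 := hb x (hT x c1)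
        have b2 := hb y (hS y hy)
        rw [qT x c1, qS y hy, not_or]
        exact ⟨by omega, fun ha => hdisj y (hTc x c1 y ha) hy⟩
    · rw [hgS x c1, upTo, Finset.filter_true_of_mem (s := T)]
      · congr 2
        refine Finset.filter_congr fun y hy => ?_
        rw [qS x c1, qS y hy]
        simp
      · intro y hy
        have b1 := hb x (hS x c1)
        have b2 := hb y (hT y hy)
        rw [qS x c1, qT y hy]
        exact .inl (by omega)

open Classical in
/-- Sorting the vertices by `2 * g x` minus the degree of `x`, with ties broken in any way, gives a
straight order, because this key is one more than the sum of two monotone quantities: `g x`, and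
the number of vertices before `x` that are not adjacent to it.  Two vertices with the same key are
therefore related in the same way to all others. -/
theorem Sorted.straight {g key σ : ℕ → ℕ} (h : Sorted K n (Finset.range n) g)
    (hkey : ∀ x < n, key x + (K.neighborSet x).ncard = 2 * g x)
    (hσ : Set.BijOn σ (Set.Iio n) (Set.Iio n))
    (hmono : ∀ i j, i ≤ j → j < n → key (σ i) ≤ key (σ j)) :
    (∀ i < n, i < g (σ i) ∧ g (σ i) ≤ n) ∧ (∀ i j, i ≤ j → j < n → g (σ i) ≤ g (σ j)) ∧
      ∀ i j, i < j → j < n → (K.Adj (σ i) (σ j) ↔ j < g (σ i)) := by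
  obtain ⟨ρ, h, -, hg⟩ := h
  let U : ℕ → Finset ℕ := fun x => (Finset.range n).filter fun y => ρ y ≤ ρ x ∨ K.Adj x y
  let L : ℕ → Finset ℕ := fun x => (Finset.range n).filter fun y => ρ y < ρ x ∧ ¬ K.Adj y x
  have hU : ∀ x < n, (U x).card = g x := fun x hx => (hg x (Finset.mem_range.2 hx)).symm
  have memU : ∀ {x y}, y ∈ U x ↔ y < n ∧ (ρ y ≤ ρ x ∨ K.Adj x y) := by simp [U]
  have memL : ∀ {x y}, y ∈ L x ↔ y < n ∧ ρ y < ρ x ∧ ¬ K.Adj y x := by simp [L]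
  have hsum : ∀ x < n, key x = (U x).card + (L x).card + 1 := by
    intro x hx
    have h1 : U x = insert x (L x ∪ (Finset.range n).filter fun y => K.Adj x y) := by
      ext y
      simp only [memU, Finset.mem_insert, Finset.mem_union, memL, Finset.mem_filter,
        Finset.mem_range, K.adj_comm y x]
      constructor
      · rintro ⟨h1, h2 | h2⟩
        · rcases h2.lt_or_eq with h3 | h3
          · tauto
          · exact .inl (h.inj h1 hx h3)
        · tauto
      · rintro (rfl | ⟨h1, h2, -⟩ | ⟨h1, h2⟩)
        · exact ⟨hx, .inl le_rfl⟩
        · exact ⟨h1, .inl h2.le⟩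
        · exact ⟨h1, .inr h2⟩
    have h2 : (U x).card = (L x).card + ((Finset.range n).filter fun y => K.Adj x y).card + 1 := by
      rw [h1, Finset.card_insert_of_notMem (by simp [memL]), Finset.card_union_of_disjoint]
      rw [Finset.disjoint_left]
      intro y hy hy'
      exact (memL.1 hy).2.2 (Finset.mem_filter.1 hy').2.symm
    have h3 : (K.neighborSet x).ncard = ((Finset.range n).filter fun y => K.Adj x y).card := by
      rw [← Set.ncard_coe_finset]
      congr 1
      ext y
      simpa using fun h1 : K.Adj x y => h.lt h1.symm
    have := hkey x hx
    have := hU x hx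
    omega
  have subU : ∀ {x y}, x < n → y < n → ρ x ≤ ρ y → U x ⊆ U y := by
    intro x y hx hy hxy z hz
    obtain ⟨h1, h2⟩ := memU.1 hz
    refine memU.2 ⟨h1, ?_⟩
    rcases le_or_gt (ρ z) (ρ y) with h3 | h3
    · exact .inl h3
    · rcases hxy.lt_or_eq with h4 | h4
      · exact .inr (h.right hy h4 h3 (h2.resolve_left (by omega)))
      · rw [h.inj hx hy h4] at h2
        exact h2
  have subL : ∀ {x y}, x < n → y < n → ρ x ≤ ρ y → L x ⊆ L y := by
    intro x y hx hy hxy z hz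
    obtain ⟨h1, h2, h3⟩ := memL.1 hz
    refine memL.2 ⟨h1, by omega, fun h4 => h3 ?_⟩
    rcases hxy.lt_or_eq with h5 | h5
    · exact h.left hx h2 h5 h4
    · rwa [h.inj hx hy h5]
  have keq : ∀ {x y}, x < n → y < n → key y ≤ key x → ρ x ≤ ρ y →
      U x = U y ∧ L x = L y := by
    intro x y hx hy h1 h2
    have h3 := subU hx hy h2
    have h4 := subL hx hy h2
    have h5 := Finset.card_le_card h3
    have h6 := Finset.card_le_card h4
    have h7 := hsum x hx
    have h8 := hsum y hy
    exact ⟨Finset.eq_of_subset_of_card_le h3 (by omega),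
      Finset.eq_of_subset_of_card_le h4 (by omega)⟩
  have down : ∀ {x z z'}, x < n → z < n → key z ≤ key z' → z' ∈ U x → z ∈ U x := by
    intro x z z' hx hz hk hz'
    obtain ⟨h1, h2⟩ := memU.1 hz'
    by_contra hcon
    rw [memU, not_and, not_or] at hcon
    obtain ⟨h3, h4⟩ := hcon hz
    rcases le_or_gt (ρ z) (ρ z') with h5 | h5
    · rcases h5.lt_or_eq with h6 | h6
      · exact h4 (h.left hz (by omega) h6 (h2.resolve_left (by omega)))
      · rw [← h.inj hz h1 h6] at h2
        exact h2.elim h3 h4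
    · have h6 : x ∈ L z' := (keq h1 hz hk h5.le).2 ▸ memL.2 ⟨hx, by omega, h4⟩
      obtain ⟨-, h7, h8⟩ := memL.1 h6
      exact h2.elim (by omega) h8
  have hlt : ∀ {i}, i < n → σ i < n := fun hi => hσ.mapsTo hi
  -- in the new order, the vertices up to the last neighbour come first
  have init : ∀ {x}, x < n → ∀ {j}, j < n → (σ j ∈ U x ↔ j < g x) := by
    intro x hx
    let I := (Finset.range n).filter fun j => σ j ∈ U x
    have h1 : I.card = g x := by
      rw [← hU x hx]
      refine Finset.card_bij (fun j _ => σ j) (fun j hj => (Finset.mem_filter.1 hj).2)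
        (fun i hi j hj hij => ?_) fun y hy => ?_
      · exact hσ.injOn (Finset.mem_range.1 (Finset.mem_filter.1 hi).1)
          (Finset.mem_range.1 (Finset.mem_filter.1 hj).1) hij
      · obtain ⟨j, hj, rfl⟩ := hσ.surjOn (show y ∈ Set.Iio n from (memU.1 hy).1)
        exact ⟨j, Finset.mem_filter.2 ⟨Finset.mem_range.2 hj, hy⟩, rfl⟩
    intro j hj
    constructor
    · intro h2
      have h3 : Finset.range (j + 1) ⊆ I := by
        intro i hi
        rw [Finset.mem_range] at hi
        exact Finset.mem_filter.2 ⟨Finset.mem_range.2 (by omega),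
          down hx (hlt (by omega)) (hmono i j (by omega) hj) h2⟩
      have := Finset.card_le_card h3
      rw [Finset.card_range] at this
      omega
    · intro h2
      by_contra h3
      have h4 : I ⊆ Finset.range j := by
        intro i hi
        obtain ⟨h5, h6⟩ := Finset.mem_filter.1 hi
        rw [Finset.mem_range] at h5 ⊢
        by_contra h7
        exact h3 (down hx (hlt hj) (hmono j i (by omega) h5) h6)
      have := Finset.card_le_card h4
      rw [Finset.card_range] at this
      omega
  refine ⟨fun i hi => ⟨(init (hlt hi) hi).1 (memU.2 ⟨hlt hi, .inl le_rfl⟩), ?_⟩,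
    fun i j hij hj => ?_, fun i j hij hj => ?_⟩
  · rw [← hU _ (hlt hi)]
    exact (Finset.card_filter_le _ _).trans (Finset.card_range n).le
  · have hi : i < n := by omega
    rw [← hU _ (hlt hi), ← hU _ (hlt hj)]
    rcases le_total (ρ (σ i)) (ρ (σ j)) with h1 | h1
    · exact Finset.card_le_card (subU (hlt hi) (hlt hj) h1)
    · exact (keq (hlt hj) (hlt hi) (hmono i j hij hj) h1).1 ▸ le_rfl
  · have hi : i < n := by omega
    rw [← init (hlt hi) hj, memU]
    refine ⟨fun h1 => ⟨hlt hj, .inr h1⟩, fun h1 => h1.2.elim (fun h2 => ?_) id⟩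
    have h3 := (keq (hlt hj) (hlt hi) (hmono i j hij.le hj) h2).1
    have h4 : σ i ∈ U (σ j) := h3 ▸ memU.2 ⟨hlt hi, .inl le_rfl⟩
    rcases (memU.1 h4).2 with h5 | h5
    · have := hσ.injOn (show j ∈ Set.Iio n from hj) (show i ∈ Set.Iio n from hi)
        (h.inj (hlt hj) (hlt hi) (le_antisymm h2 h5))
      omega
    · exact h5.symm

theorem map_val_adj {n : ℕ} {H : SimpleGraph (Fin n)} {x y : ℕ} :
    (H.map Fin.val).Adj x y ↔ ∃ a b : Fin n, H.Adj a b ∧ (a : ℕ) = x ∧ (b : ℕ) = y :=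
  SimpleGraph.map_adj Fin.valEmbedding H x y

/-- A straight order of a proper interval graph, as a numbering. -/
theorem IsProperInterval.umbrella {n : ℕ} {H : SimpleGraph (Fin n)} (h : IsProperInterval H) :
    ∃ ρ, Umbrella (H.map Fin.val) n ρ := by
  obtain ⟨G, rfl, -, m, v, f, hv⟩ := h
  let q : ℕ → ℤ := fun x => if h : x < n then ((v.symm ⟨x, h⟩ : Fin m) : ℕ) else 0
  have hq : ∀ x : Fin n, q x = (v.symm x : ℕ) := fun x => dif_pos x.2
  have hadj : ∀ {x y : Fin n}, q x < q y →
      (G.toSimpleGraphInclusive.Adj x y ↔ v.symm y ≤ f (v.symm x)) := by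
    intro x y hlt
    rw [hq, hq, Int.ofNat_lt] at hlt
    have h1 := hv.adj_iff (v.symm x) (v.symm y)
    have h2 := hv.adj_iff (v.symm y) (v.symm x)
    rw [v.apply_symm_apply, v.apply_symm_apply] at h1 h2
    rw [Digraph.toSimpleGraphInclusive, SimpleGraph.fromRel_adj, h1, h2]
    constructor
    · rintro ⟨-, h3 | h3⟩
      · exact h3.2
      · exact absurd h3.1 (not_lt.2 hlt.le)
    · exact fun h3 => ⟨by rintro rfl; exact lt_irrefl _ hlt, .inl ⟨hlt, h3⟩⟩
  refine ⟨q, fun {x y} hxy => ?_, fun {x y} hx hy hxy => ?_, fun {x y z} hy h1 h2 hxz => ?_,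
    fun {x y z} hy h1 h2 hxz => ?_⟩
  · obtain ⟨a, b, -, rfl, rfl⟩ := map_val_adj.1 hxy
    exact a.2
  · have := hq ⟨x, hx⟩
    have := hq ⟨y, hy⟩
    have : v.symm ⟨x, hx⟩ = v.symm ⟨y, hy⟩ := Fin.ext (by simp only at *; omega)
    exact congrArg Fin.val (v.symm.injective this)
  all_goals
    obtain ⟨a, b, hab, rfl, rfl⟩ := map_val_adj.1 hxz
    have h3 := (hadj (h1.trans h2)).1 hab
    have h4 := hq a
    have h5 := hq b
    have h6 := hq ⟨y, hy⟩
    simp only at h6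
  · refine map_val_adj.2 ⟨a, ⟨y, hy⟩, (hadj h1).2 (le_trans ?_ h3), rfl, rfl⟩
    rw [Fin.le_def]
    omega
  · refine map_val_adj.2 ⟨⟨y, hy⟩, b, (hadj h2).2 (h3.trans (hv.mono ?_)), rfl, rfl⟩
    rw [Fin.le_def]
    omega

end

/-! ### Breadth-first search -/

/-- `S` is the connected component of `r`. -/
def IsComponent (K : SimpleGraph ℕ) (S : Finset ℕ) (r : ℕ) : Prop := ∀ x, x ∈ S ↔ K.Reachable r x

/-- The state of a breadth-first search of the component `S` from `r`: the cells `t₀, …, t - 1` of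
`Q` hold the vertices that have been found, those before `h` have been processed, and `D` holds
their distances from `r`, plus one; it is zero at the vertices that have not been found. -/
structure Bfs (K : SimpleGraph ℕ) (S : Finset ℕ) (r t₀ : ℕ) (D₀ Q D : ℕ → ℕ) (h t : ℕ) : Prop where
  start_le : t₀ ≤ h
  le : h ≤ t
  start_lt : t₀ < t
  mem : ∀ i, t₀ ≤ i → i < t → Q i ∈ S
  inj : ∀ i j, t₀ ≤ i → i < t → t₀ ≤ j → j < t → Q i = Q j → i = j
  pos : ∀ i, t₀ ≤ i → i < t → D (Q i) ≠ 0
  found : ∀ x ∈ S, D x ≠ 0 → ∃ i, t₀ ≤ i ∧ i < t ∧ Q i = x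
  off : ∀ x, x ∉ S → D x = D₀ x
  root : Q t₀ = r
  root_dist : D r = 1
  parent : ∀ i, t₀ < i → i < t → ∃ j, t₀ ≤ j ∧ j < t ∧ K.Adj (Q j) (Q i) ∧ D (Q i) = D (Q j) + 1
  sorted : ∀ i j, t₀ ≤ i → i ≤ j → j < t → D (Q i) ≤ D (Q j)
  window : ∀ i j, h ≤ i → i < t → t₀ ≤ j → j < t → D (Q j) ≤ D (Q i) + 1
  bound : ∀ i, t₀ ≤ i → i < t → D (Q i) + t₀ ≤ i + 1
  done : ∀ i, t₀ ≤ i → i < h → ∀ y, K.Adj (Q i) y → D y ≠ 0 ∧ D y ≤ D (Q i) + 1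

section

variable {K : SimpleGraph ℕ} {S : Finset ℕ} {r t₀ h t : ℕ} {D₀ Q D : ℕ → ℕ}

theorem IsComponent.self (hS : IsComponent K S r) : r ∈ S := (hS r).2 .rfl

theorem IsComponent.closed (hS : IsComponent K S r) : ∀ x ∈ S, ∀ y, K.Adj x y → y ∈ S :=
  fun x hx y hxy => (hS y).2 (((hS x).1 hx).trans hxy.reachable)

theorem IsComponent.of_mem (hS : IsComponent K S r) {e : ℕ} (he : e ∈ S) : IsComponent K S e :=
  fun x => (hS x).trans ⟨fun h => ((hS e).1 he).symm.trans h, fun h => ((hS e).1 he).trans h⟩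

theorem IsComponent.subset (hS : IsComponent K S r) {A : Set ℕ} (hr : r ∈ A)
    (hA : ∀ x ∈ A, ∀ y, K.Adj x y → y ∈ A) {x : ℕ} (hx : x ∈ S) : x ∈ A := by
  obtain ⟨w⟩ := (hS x).1 hx
  induction w with
  | nil => exact hr
  | cons hadj w ih =>
    rename_i u v z
    have hv : v ∈ S := hS.closed _ hS.self _ hadj
    exact ih (hS.of_mem hv) (hA _ hr _ hadj) hx

/-- The search starts with the root. -/
theorem Bfs.start (hS : IsComponent K S r) (hD : ∀ x ∈ S, D x = 0) (t₀ : ℕ) (Q : ℕ → ℕ) :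
    Bfs K S r t₀ D (Function.update Q t₀ r) (Function.update D r 1) t₀ (t₀ + 1) where
  start_le := le_rfl
  le := by omega
  start_lt := by omega
  mem i h1 h2 := by
    obtain rfl : i = t₀ := by omega
    simpa using hS.self
  inj i j h1 h2 h3 h4 _ := by omega
  pos i h1 h2 := by
    obtain rfl : i = t₀ := by omega
    simp
  found x hx hD' := by
    refine ⟨t₀, le_rfl, by omega, ?_⟩
    by_contra hne
    rw [Function.update_self] at hne
    rw [Function.update_of_ne (Ne.symm hne)] at hD'
    exact hD' (hD x hx)
  off x hx := Function.update_of_ne (by rintro rfl; exact hx hS.self) ..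
  root := by simp
  root_dist := by simp
  parent i h1 h2 := by omega
  sorted i j h1 h2 h3 := by
    obtain rfl : i = j := by omega
    rfl
  window i j h1 h2 h3 h4 := by
    obtain rfl : i = j := by omega
    omega
  bound i h1 h2 := by
    obtain rfl : i = t₀ := by omega
    simp
    omega
  done i h1 h2 := by omega

/-- A neighbour of the vertex that is being processed is found. -/
theorem Bfs.push (b : Bfs K S r t₀ D₀ Q D h t) (hht : h < t) {y : ℕ} (hy : y ∈ S) (hDy : D y = 0)
    (hadj : K.Adj (Q h) y) :
    Bfs K S r t₀ D₀ (Function.update Q t y) (Function.update D y (D (Q h) + 1)) h (t + 1) := by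
  have hQ : ∀ i, i < t → Function.update Q t y i = Q i := fun i hi =>
    Function.update_of_ne (by omega) ..
  have hne : ∀ i, t₀ ≤ i → i < t → Q i ≠ y := fun i h1 h2 h3 => b.pos i h1 h2 (h3 ▸ hDy)
  have hD : ∀ i, t₀ ≤ i → i < t → Function.update D y (D (Q h) + 1) (Q i) = D (Q i) :=
    fun i h1 h2 => Function.update_of_ne (hne i h1 h2) ..
  have h0 := b.start_le
  have h1 := b.start_lt
  have split : ∀ {i}, i < t + 1 → i < t ∨ i = t := fun hi => by omega
  constructor
  · exact b.start_le
  · omega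
  · omega
  · intro i h2 h3
    rcases split h3 with h4 | rfl
    · rw [hQ i h4]
      exact b.mem i h2 h4
    · rwa [Function.update_self]
  · intro i j h2 h3 h4 h5 h6
    rcases split h3 with h7 | rfl <;> rcases split h5 with h8 | rfl
    · rw [hQ i h7, hQ j h8] at h6
      exact b.inj i j h2 h7 h4 h8 h6
    · rw [hQ i h7, Function.update_self] at h6
      exact (hne i h2 h7 h6).elim
    · rw [hQ j h8, Function.update_self] at h6
      exact (hne j h4 h8 h6.symm).elim
    · rfl
  · intro i h2 h3
    rcases split h3 with h4 | rfl
    · rw [hQ i h4, hD i h2 h4]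
      exact b.pos i h2 h4
    · simp
  · intro x hx hDx
    by_cases hxy : x = y
    · exact ⟨t, h1.le, by omega, by rw [Function.update_self, hxy]⟩
    · rw [Function.update_of_ne hxy] at hDx
      obtain ⟨i, h2, h3, h4⟩ := b.found x hx hDx
      exact ⟨i, h2, by omega, by rw [hQ i h3, h4]⟩
  · intro x hx
    rw [Function.update_of_ne (by rintro rfl; exact hx hy), b.off x hx]
  · rw [hQ _ h1, b.root]
  · have := hD t₀ le_rfl h1
    rw [b.root] at this
    rw [this, b.root_dist]
  · intro i h2 h3
    rcases split h3 with h4 | rfl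
    · obtain ⟨j, h5, h6, h7, h8⟩ := b.parent i h2 h4
      exact ⟨j, h5, by omega, by rwa [hQ i h4, hQ j h6],
        by rw [hQ i h4, hQ j h6, hD i h2.le h4, hD j h5 h6, h8]⟩
    · refine ⟨h, h0, by omega, by rwa [hQ h hht, Function.update_self], ?_⟩
      rw [Function.update_self, Function.update_self, hQ h hht, hD h h0 hht]
  · intro i j h2 h3 h4
    rcases split h4 with h5 | rfl
    · rw [hQ i (by omega), hQ j h5, hD i h2 (by omega), hD j (by omega) h5]
      exact b.sorted i j h2 h3 h5
    · rw [Function.update_self, Function.update_self]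
      rcases h3.lt_or_eq with h5 | rfl
      · rw [hQ i h5, hD i h2 h5]
        exact b.window h i le_rfl hht h2 h5
      · rw [Function.update_self, Function.update_self]
  · intro i j h2 h3 h4 h5
    have h6 : D (Q h) ≤ Function.update D y (D (Q h) + 1) (Function.update Q t y i) := by
      rcases split h3 with h7 | rfl
      · rw [hQ i h7, hD i (by omega) h7]
        exact b.sorted h i h0 h2 h7
      · rw [Function.update_self, Function.update_self]
        omega
    rcases split h5 with h7 | rfl
    · rw [hQ j h7, hD j h4 h7]
      rcases split h3 with h8 | rfl
      · rw [hQ i h8, hD i (by omega) h8]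
        exact b.window i j h2 h8 h4 h7
      · rw [Function.update_self, Function.update_self]
        have := b.window h j le_rfl hht h4 h7
        omega
    · rw [Function.update_self, Function.update_self]
      omega
  · intro i h2 h3
    rcases split h3 with h4 | rfl
    · rw [hQ i h4, hD i h2 h4]
      exact b.bound i h2 h4
    · rw [Function.update_self, Function.update_self]
      have := b.bound h h0 hht
      omega
  · intro i h2 h3 z hz
    rw [hQ i (by omega)] at hz ⊢
    rw [hD i h2 (by omega)]
    have h4 := b.done i h2 h3 z hz
    have h5 : z ≠ y := by
      rintro rfl
      exact h4.1 hDy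
    rwa [Function.update_of_ne h5]

/-- All neighbours of the vertex that is being processed have been found. -/
theorem Bfs.advance (b : Bfs K S r t₀ D₀ Q D h t) (hht : h < t)
    (hadj : ∀ y, K.Adj (Q h) y → D y ≠ 0 ∧ D y ≤ D (Q h) + 1) :
    Bfs K S r t₀ D₀ Q D (h + 1) t where
  start_le := b.start_le.trans (Nat.le_succ h)
  le := hht
  start_lt := b.start_lt
  mem := b.mem
  inj := b.inj
  pos := b.pos
  found := b.found
  off := b.off
  root := b.root
  root_dist := b.root_dist
  parent := b.parent
  sorted := b.sorted
  window i j h1 := b.window i j (by omega)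
  bound := b.bound
  done i h1 h2 := by
    by_cases h3 : i = h
    · subst h3
      exact hadj
    · exact b.done i h1 (by omega)

theorem Bfs.sum_le (b : Bfs K S r t₀ D₀ Q D h t) (w : ℕ → ℕ) :
    ∑ i ∈ Finset.Ico t₀ t, w (Q i) ≤ ∑ x ∈ S, w x := by
  rw [← Finset.sum_image (s := Finset.Ico t₀ t) (g := Q) (f := w) fun i hi j hj hij => by
    rw [Finset.coe_Ico] at hi hj
    exact b.inj i j hi.1 hi.2 hj.1 hj.2 hij]
  refine Finset.sum_le_sum_of_subset fun x hx => ?_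
  obtain ⟨i, hi, rfl⟩ := Finset.mem_image.1 hx
  rw [Finset.mem_Ico] at hi
  exact b.mem i hi.1 hi.2

theorem Bfs.le_card (b : Bfs K S r t₀ D₀ Q D h t) : t ≤ t₀ + S.card := by
  have := b.sum_le fun _ => 1
  simp only [Finset.sum_const, Nat.card_Ico, smul_eq_mul, mul_one] at this
  omega

theorem Bfs.mem_iff (b : Bfs K S r t₀ D₀ Q D t t) (hS : IsComponent K S r) {x : ℕ} :
    x ∈ S ↔ ∃ i, t₀ ≤ i ∧ i < t ∧ Q i = x := by
  refine ⟨fun hx => ?_, ?_⟩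
  · refine hS.subset (A := {x | ∃ i, t₀ ≤ i ∧ i < t ∧ Q i = x}) ⟨t₀, le_rfl, b.start_lt, b.root⟩
      ?_ hx
    rintro x ⟨i, h1, h2, rfl⟩ y hy
    exact b.found y (hS.closed _ (b.mem i h1 h2) y hy) (b.done i h1 h2 y hy).1
  · rintro ⟨i, h1, h2, rfl⟩
    exact b.mem i h1 h2

/-- When all vertices have been processed, `D` holds the distances. -/
theorem Bfs.layered (b : Bfs K S r t₀ D₀ Q D t t) (hS : IsComponent K S r) : Layered K S r D where
  mem := hS.self
  root := b.root_dist
  closed := hS.closed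
  step x hx y hxy := by
    obtain ⟨i, h1, h2, rfl⟩ := (b.mem_iff hS).1 hx
    exact (b.done i h1 h2 y hxy).2
  parent x hx hxr := by
    obtain ⟨i, h1, h2, rfl⟩ := (b.mem_iff hS).1 hx
    obtain ⟨j, h3, h4, h5, h6⟩ := b.parent i (h1.lt_of_ne (by rintro rfl; exact hxr b.root)) h2
    exact ⟨Q j, b.mem j h3 h4, h5, h6⟩

theorem Bfs.bijOn (b : Bfs K S r t₀ D₀ Q D t t) (hS : IsComponent K S r) :
    Set.BijOn Q (Set.Ico t₀ t) S :=
  ⟨fun i hi => b.mem i hi.1 hi.2, fun i hi j hj => b.inj i j hi.1 hi.2 hj.1 hj.2, fun x hx => by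
    obtain ⟨i, h1, h2, h3⟩ := (b.mem_iff hS).1 hx
    exact ⟨i, ⟨h1, h2⟩, h3⟩⟩

theorem Bfs.card (b : Bfs K S r t₀ D₀ Q D t t) (hS : IsComponent K S r) : t = t₀ + S.card := by
  have h1 := (b.bijOn hS).ncard_eq
  have h2 := b.start_lt
  rw [Set.ncard_coe_finset, ← Finset.coe_Ico, Set.ncard_coe_finset, Nat.card_Ico] at h1
  omega

end

/-- The graph `K` on `0, …, n - 1` is given by adjacency lists in array `1`, that of `x` beginning
in cell `L x`. -/
structure Adjacency (K : SimpleGraph ℕ) (n : ℕ) (L E : ℕ → ℕ) : Prop where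
  lt : ∀ {x y}, K.Adj x y → x < n
  le : ∀ x < n, L x ≤ L (x + 1)
  list : ∀ x < n, Set.BijOn E (Set.Ico (L x) (L (x + 1))) (K.neighborSet x)

/-- Put the vertex in register `36`, a neighbour of the vertex in register `34`, into the queue,
unless it has been found before. -/
def visitProg (q d : ℕ) : RamProg :=
  .ite (.eq (A d (R 36)) 0)
    (.store d (R 36) (A d (R 34) + 1) ;; .store q (R 32) (R 36) ;; .assign 32 (R 32 + 1))
    .skip

/-- Process the vertex in cell `R 33` of the queue. -/
def processProg (q d : ℕ) : RamProg :=
  .assign 34 (A q (R 33)) ;; .assign 35 (A 0 (R 34)) ;;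
  .while (.lt (R 35) (A 0 (R 34 + 1))) (
    .assign 36 (A 1 (R 35)) ;; visitProg q d ;; .assign 35 (R 35 + 1))

/-- Search the component of the vertex in register `36`.  Array `q` holds the queue, from the cell
in register `31` up to the cell before the one in register `32`, and array `d` the distances. -/
def bfsProg (q d : ℕ) : RamProg :=
  .store d (R 36) 1 ;; .store q (R 31) (R 36) ;; .assign 33 (R 31) ;; .assign 32 (R 31 + 1) ;;
  .while (.lt (R 33) (R 32)) (processProg q d ;; .assign 33 (R 33 + 1))

section

theorem setArr_arr_self (s : RamState) (a i x : ℕ) :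
    (s.setArr a i x).arr a = Function.update (s.arr a) i x := by
  simp [RamState.setArr]

theorem setArr_arr_of_ne (s : RamState) {a a' : ℕ} (i x : ℕ) (h : a' ≠ a) :
    (s.setArr a i x).arr a' = s.arr a' := by
  simp [RamState.setArr, h]

variable {K : SimpleGraph ℕ} {n B : ℕ} {L E : ℕ → ℕ} {S : Finset ℕ} {r t₀ h q d : ℕ} {D₀ : ℕ → ℕ}

theorem Adjacency.le_last (hA : Adjacency K n L E) {x : ℕ} (hx : x ≤ n) : L x ≤ L n := by
  obtain ⟨k, rfl⟩ := Nat.exists_eq_add_of_le hx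
  have : ∀ i, i ≤ k → L x ≤ L (x + i) := by
    intro i
    induction i with
    | zero => simp
    | succ i ih => exact fun hi => (ih (by omega)).trans (hA.le (x + i) (by omega))
  exact this k le_rfl

theorem Adjacency.ncard_neighborSet (hA : Adjacency K n L E) {x : ℕ} (hx : x < n) :
    (K.neighborSet x).ncard = L (x + 1) - L x := by
  rw [← (hA.list x hx).ncard_eq, ← Finset.coe_Ico, Set.ncard_coe_finset, Nat.card_Ico]

theorem visitProg_spec (hqd : q ≠ d) (hSn : ∀ x ∈ S, x < n) (ht : t₀ + S.card ≤ n) (hB : n + 2 ≤ B)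
    {s : RamState} (b : Bfs K S r t₀ D₀ (s.arr q) (s.arr d) h (s.reg 32)) (hh : h < s.reg 32)
    (h34 : s.reg 34 = s.arr q h) (hadj : K.Adj (s.arr q h) (s.reg 36)) (hS : s.reg 36 ∈ S) :
    Tri B (visitProg q d) s 20 (fun s' =>
      Bfs K S r t₀ D₀ (s'.arr q) (s'.arr d) h (s'.reg 32) ∧ h < s'.reg 32 ∧
      (∀ i ≤ h, s'.arr q i = s.arr q i) ∧ (∀ z, s.arr d z ≠ 0 → s'.arr d z = s.arr d z) ∧
      s'.arr d (s.reg 36) ≠ 0 ∧ s'.arr d (s.reg 36) ≤ s'.arr d (s.arr q h) + 1) := by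
  have h1 := hSn _ hS
  have h2 := b.le_card
  have h3 := b.bound h b.start_le hh
  have h6 := b.pos h b.start_le hh
  refine Tri.ite (T := 15) (fun hb => Tri.wp ?_ (Nat.le_of_ble_eq_true rfl))
    (fun hb => Tri.skip ?_ (by omega)) (Nat.le_of_ble_eq_true rfl)
  · simp only [holds_eq, eval_load, eval_reg, eval_ofNat] at hb
    have hne : s.arr q h ≠ s.reg 36 := fun h4 => h6 (h4 ▸ hb)
    have b' := b.push hh hS hb hadj
    have h5 := b'.le_card
    simp only [RamProg.wp, eval_reg, eval_add, eval_load, eval_ofNat, setReg_reg, setReg_arr,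
      setArr_reg, if_true, setArr_arr_self,
      setArr_arr_of_ne _ _ _ hqd, setArr_arr_of_ne _ _ _ hqd.symm, h34]
    refine ⟨⟨by omega, by omega⟩, ⟨by omega, by omega⟩, by omega, b', by omega,
      fun i hi => Function.update_of_ne (by omega) .., fun z hz => Function.update_of_ne ?_ .., ?_,
          ?_⟩
    · rintro rfl
      exact hz hb
    · simp
    · rw [Function.update_self, Function.update_of_ne hne]
  · simp only [holds_eq, eval_load, eval_reg, eval_ofNat] at hb
    obtain ⟨i, h4, h5, h7⟩ := b.found _ hS hb
    exact ⟨b, hh, fun i _ => rfl, fun z _ => rfl, hb, h7 ▸ b.window h i le_rfl hh h4 h5⟩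

theorem processProg_spec (hq : 2 ≤ q) (hd : 2 ≤ d) (hqd : q ≠ d) (hA : Adjacency K n L E)
    (hS : IsComponent K S r) (hSn : ∀ x ∈ S, x < n) (ht : t₀ + S.card ≤ n)
    (hB : L n + n + 2 ≤ B) {s : RamState} (h0 : s.arr 0 = L) (h1 : s.arr 1 = E)
    (b : Bfs K S r t₀ D₀ (s.arr q) (s.arr d) h (s.reg 32)) (hh : h < s.reg 32)
    (h33 : s.reg 33 = h) :
    Tri B (processProg q d) s (50 * (L (s.arr q h + 1) - L (s.arr q h)) + 30) (fun s' =>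
      Bfs K S r t₀ D₀ (s'.arr q) (s'.arr d) (h + 1) (s'.reg 32) ∧
        ∀ i ≤ h, s'.arr q i = s.arr q i) := by
  have hxS := b.mem h b.start_le hh
  have hx := hSn _ hxS
  generalize hxe : s.arr q h = x at *
  have hLx := hA.le_last (x := x) (by omega)
  have hLx' := hA.le_last (x := x + 1) (by omega)
  have hL := hA.le x hx
  have hlist := hA.list x hx
  refine Tri.assign (T := 50 * (L (x + 1) - L x) + 20) (by simp [h33]; omega) (Tri.assign
    (T := 50 * (L (x + 1) - L x) + 15) (by simp [h33, hxe, h0]; omega) ?_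
    (by simp [RamExpr.cost]; omega)) (by simp [RamExpr.cost]; omega)
  have hcost : (RamTest.lt (R 35) (A 0 (R 34 + 1))).cost = 6 := rfl
  refine (Tri.while_frame (fun s' => Bfs K S r t₀ D₀ (s'.arr q) (s'.arr d) h (s'.reg 32) ∧
    h < s'.reg 32 ∧ (∀ i ≤ h, s'.arr q i = s.arr q i) ∧ L x ≤ s'.reg 35 ∧ s'.reg 35 ≤ L (x + 1) ∧
    ∀ k, L x ≤ k → k < s'.reg 35 → s'.arr d (E k) ≠ 0 ∧ s'.arr d (E k) ≤ s'.arr d x + 1)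
    (fun s' => 50 * (L (x + 1) - s'.reg 35) + 15)
    (fun s' hf hI hb => ?_) (fun s' hf hI hb => ?_) ?_).mono ?_ fun _ h => h
  · obtain ⟨g1, g2, g3', g4, g5, g6⟩ := hI
    have g3 := (g3' h le_rfl).trans hxe
    have e0 : s'.arr 0 = L := by
      rw [← h0, hf.arr 0 (by simp [visitProg, RamProg.noArr]; omega)]
      rfl
    have e1 : s'.arr 1 = E := by
      rw [← h1, hf.arr 1 (by simp [visitProg, RamProg.noArr]; omega)]
      rfl
    have e34 : s'.reg 34 = x := by
      rw [hf.reg 34]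
      simp [h33, hxe]
    simp only [holds_lt, eval_reg, eval_load, eval_add, eval_ofNat, e0, e34] at hb
    have hy : K.Adj x (E (s'.reg 35)) := hlist.mapsTo ⟨g4, hb⟩
    have hyS := hS.closed x hxS _ hy
    have hyn := hSn _ hyS
    refine ⟨35, Tri.assign (T := 30) (by simp only [eval_load, eval_reg, e1]; omega)
      (Tri.seq (T₁ := 20) (visitProg_spec (K := K)
        (r := r) (D₀ := D₀) hqd hSn ht (by omega) (h := h) ?_ ?_ ?_ ?_ ?_).frame ?_ (by omega))
      (Nat.le_of_ble_eq_true rfl)⟩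
    · simpa using g1
    · simpa using g2
    · simp [e34, g3]
    · simpa [g3, e1] using hy
    · simpa [e1] using hyS
    rintro s₂ ⟨⟨k1, k2, k3, k4, k5, k6⟩, hf₂⟩
    simp only [setReg_arr, setReg_reg, if_true, eval_load, eval_reg, e1, g3] at k3 k4 k5 k6
    have k3 : ∀ i ≤ h, s₂.arr q i = s.arr q i := fun i hi => (k3 i hi).trans (g3' i hi)
    have e35 : s₂.reg 35 = s'.reg 35 := by simp [hf₂.reg 35]
    refine Tri.wp ?_ (by decide)
    simp only [RamProg.wp, eval_reg, eval_add, eval_ofNat, setReg_reg, setReg_arr, if_true,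
      Nat.reduceEqDiff, if_false, e35]
    refine ⟨by omega, ⟨k1, k2, k3, by omega, by omega, fun k l1 l2 => ?_⟩, by omega⟩
    by_cases hk : k = s'.reg 35
    · subst hk
      exact ⟨k5, k6⟩
    · have l3 := g6 k l1 (by omega)
      have l4 := g1.pos h g1.start_le g2
      rw [g3] at l4
      rwa [k4 _ l3.1, k4 _ l4]
  · obtain ⟨g1, g2, g3', g4, g5, g6⟩ := hI
    have g3 := (g3' h le_rfl).trans hxe
    have e0 : s'.arr 0 = L := by
      rw [← h0, hf.arr 0 (by simp [visitProg, RamProg.noArr]; omega)]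
      rfl
    have e34 : s'.reg 34 = x := by
      rw [hf.reg 34]
      simp [h33, hxe]
    simp only [holds_lt, eval_reg, eval_load, eval_add, eval_ofNat, e0, e34] at hb
    refine ⟨by omega, g1.advance g2 fun y hy => ?_, g3'⟩
    rw [g3] at hy ⊢
    obtain ⟨k, hk, rfl⟩ := hlist.surjOn hy
    exact g6 k hk.1 (by have := hk.2; omega)
  · simp only [setReg_arr, setReg_reg, Nat.reduceEqDiff, if_true, if_false, eval_load, eval_reg,
      h0, h33, hxe]
    exact ⟨b, hh, fun i _ => trivial, le_rfl, hL, fun k h2 h3 => by omega⟩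
  · simp [h0, h33, hxe]

theorem bfsProg_spec (hq : 2 ≤ q) (hd : 2 ≤ d) (hqd : q ≠ d) (hA : Adjacency K n L E)
    (hS : IsComponent K S r) (hSn : ∀ x ∈ S, x < n) (ht : t₀ + S.card ≤ n)
    (hB : L n + n + 2 ≤ B) {s : RamState} (h0 : s.arr 0 = L) (h1 : s.arr 1 = E)
    (h31 : s.reg 31 = t₀) (h36 : s.reg 36 = r) (hD : ∀ x ∈ S, s.arr d x = 0) :
    Tri B (bfsProg q d) s (∑ x ∈ S, (50 * (L (x + 1) - L x) + 50) + 30) (fun s' =>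
      Bfs K S r t₀ (s.arr d) (s'.arr q) (s'.arr d) (s'.reg 32) (s'.reg 32)) := by
  set w : ℕ → ℕ := fun x => 50 * (L (x + 1) - L x) + 50 with hw
  have hr := hSn r hS.self
  have hbr := Bfs.start hS hD t₀ (s.arr q)
  have hcard := hbr.le_card
  refine Tri.store (T := ∑ x ∈ S, w x + 25) (by simp; omega) (by simp; omega) (Tri.store
    (T := ∑ x ∈ S, w x + 20) (by simp; omega) (by simp; omega) (Tri.assign
    (T := ∑ x ∈ S, w x + 15) (by simp; omega) (Tri.assign (T := ∑ x ∈ S, w x + 10)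
    (by simp; omega) ?_ ?_) (by simp [RamExpr.cost]; omega)) (by simp [RamExpr.cost]; omega))
    (show 3 + (S.sum w + 25) ≤ S.sum w + 30 by omega)
  swap
  · have : (R 31 + 1 : RamExpr).cost = 3 := rfl
    omega
  have hcost : (RamTest.lt (R 33) (R 32)).cost = 3 := rfl
  refine (Tri.while_frame (fun s' =>
    Bfs K S r t₀ (s.arr d) (s'.arr q) (s'.arr d) (s'.reg 33) (s'.reg 32))
    (fun s' => ∑ x ∈ S, w x - ∑ i ∈ Finset.Ico t₀ (s'.reg 33), w (s'.arr q i) + 10)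
    (fun s' hf b hb => ?_) (fun s' hf b hb => ?_) ?_).mono ?_ fun _ h => h
  · have e0 : s'.arr 0 = L := by
      rw [← h0, hf.arr 0 (by simp [processProg, visitProg, RamProg.noArr]; omega)]
      simp only [setReg_arr]
      rw [setArr_arr_of_ne _ _ _ (by omega), setArr_arr_of_ne _ _ _ (by omega)]
    have e1 : s'.arr 1 = E := by
      rw [← h1, hf.arr 1 (by simp [processProg, visitProg, RamProg.noArr]; omega)]
      simp only [setReg_arr]
      rw [setArr_arr_of_ne _ _ _ (by omega), setArr_arr_of_ne _ _ _ (by omega)]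
    simp only [holds_lt, eval_reg] at hb
    refine ⟨_, Tri.seq (T₁ := _) (processProg_spec hq hd hqd hA hS hSn ht hB e0 e1 b hb rfl).frame
      ?_ (Nat.le_add_right _ 5)⟩
    rintro s₂ ⟨⟨k1, k2⟩, hf₂⟩
    have e33 : s₂.reg 33 = s'.reg 33 := hf₂.reg 33
    have hlt := b.sum_le w
    have hlt' : ∑ i ∈ Finset.Ico t₀ (s'.reg 33 + 1), w (s'.arr q i) ≤
        ∑ i ∈ Finset.Ico t₀ (s'.reg 32), w (s'.arr q i) :=
      Finset.sum_le_sum_of_subset (Finset.Ico_subset_Ico_right hb)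
    have hst := b.start_le
    have hsum : ∑ i ∈ Finset.Ico t₀ (s'.reg 33 + 1), w (s₂.arr q i) =
        ∑ i ∈ Finset.Ico t₀ (s'.reg 33 + 1), w (s'.arr q i) :=
      Finset.sum_congr rfl fun i hi => by rw [k2 i (by have := (Finset.mem_Ico.1 hi).2; omega)]
    simp only [Finset.sum_Ico_succ_top hst] at hsum hlt'
    have hbc := b.le_card
    refine Tri.wp ?_ (by rw [Nat.add_sub_cancel_left]; decide)
    simp only [RamProg.wp, eval_reg, eval_add, eval_ofNat, setReg_reg, setReg_arr, if_true,
      e33]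
    refine ⟨by omega, k1, ?_⟩
    rw [Finset.sum_Ico_succ_top hst, hsum]
    simp only [hw] at *
    omega
  · simp only [holds_lt, eval_reg, not_lt] at hb
    have := b.le
    rw [show s'.reg 33 = s'.reg 32 by omega] at b
    exact ⟨by omega, b⟩
  · simp only [setReg_arr, setReg_reg, setArr_reg, Nat.reduceEqDiff, if_true, if_false, eval_reg,
      setArr_arr_self, setArr_arr_of_ne _ _ _ hqd, setArr_arr_of_ne _ _ _ hqd.symm, h31, h36,
      eval_add, eval_ofNat]
    exact hbr
  · simp [h31]

end

/-! ### Ordering one component -/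

/-- Among the vertices in the cells `R 31, …, R 32 - 1` of array `20` that are farthest from the
vertex in register `30`, find one of least degree, and put it into register `37`. -/
def endProg : RamProg :=
  .assign 37 (R 30) ;; .assign 33 (R 31) ;;
  .while (.lt (R 33) (R 32)) (
    .assign 34 (A 20 (R 33)) ;;
    .ite (.lt (A 21 (R 37)) (A 21 (R 34))) (.assign 37 (R 34))
      (.ite (.eq (A 21 (R 37)) (A 21 (R 34)))
        (.ite (.lt (A 0 (R 34 + 1) - A 0 (R 34)) (A 0 (R 37 + 1) - A 0 (R 37)))
          (.assign 37 (R 34)) .skip) .skip) ;;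
    .assign 33 (R 33 + 1))

/-- Add to register `40` the number of neighbours of the vertex in register `34` that are farther
from the end than this vertex. -/
def fartherProg : RamProg :=
  .assign 35 (A 0 (R 34)) ;;
  .while (.lt (R 35) (A 0 (R 34 + 1))) (
    .ite (.lt (A 23 (R 34)) (A 23 (A 1 (R 35)))) (.assign 40 (R 40 + 1)) .skip ;;
    .assign 35 (R 35 + 1))

/-- For the vertices in the cells `R 31, …, R 32 - 1` of array `22`, write to array `24` the number
of vertices up to their last neighbour.  Register `39` holds the number of vertices up to the last
one in the same layer, register `38` the number of this layer. -/
def countProg : RamProg :=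
  .assign 33 (R 32) ;; .assign 38 0 ;; .assign 39 0 ;;
  .while (.lt (R 31) (R 33)) (
    .assign 33 (R 33 - 1) ;; .assign 34 (A 22 (R 33)) ;;
    .ite (.eq (A 23 (R 34)) (R 38)) .skip (.assign 38 (A 23 (R 34)) ;; .assign 39 (R 33 + 1)) ;;
    .assign 40 (R 39) ;; fartherProg ;; .store 24 (R 34) (R 40))

/-- Put the component of the vertex in register `30` behind the components that have been ordered
already. -/
def componentProg : RamProg :=
  .assign 31 (R 32) ;; .assign 36 (R 30) ;; bfsProg 20 21 ;; endProg ;;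
  .assign 36 (R 37) ;; bfsProg 22 23 ;; countProg

/-- Order all components. -/
def componentsProg : RamProg :=
  .assign 30 0 ;; .assign 32 0 ;;
  .while (.lt (R 30) (R 0)) (
    .ite (.eq (A 21 (R 30)) 0) componentProg .skip ;;
    .assign 30 (R 30 + 1))

section

variable {K : SimpleGraph ℕ} {n B : ℕ} {L E : ℕ → ℕ} {S T : Finset ℕ} {r e t₀ t : ℕ}
  {D₀ Q D : ℕ → ℕ}

theorem endProg_spec (hA : Adjacency K n L E) (hS : IsComponent K S r) (hSn : ∀ x ∈ S, x < n)
    (hB : n ≤ B) {s : RamState} (h0 : s.arr 0 = L) (h30 : s.reg 30 = r) (h31 : s.reg 31 = t₀)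
    (hs : t₀ + S.card ≤ n)
    (b : Bfs K S r t₀ D₀ (s.arr 20) (s.arr 21) (s.reg 32) (s.reg 32)) :
    Tri B endProg s (60 * S.card + 20) (fun s' => s'.reg 37 ∈ S ∧
      (∀ x ∈ S, s.arr 21 x ≤ s.arr 21 (s'.reg 37)) ∧
      ∀ x ∈ S, s.arr 21 x = s.arr 21 (s'.reg 37) →
        (K.neighborSet (s'.reg 37)).ncard ≤ (K.neighborSet x).ncard) := by
  have hr := hSn r hS.self
  have hcard := b.card hS
  refine Tri.assign (T := 60 * S.card + 15) (by simp; omega) (Tri.assign (T := 60 * S.card + 10)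
    (by simp; omega) ?_ (by simp [RamExpr.cost]; omega)) (by simp [RamExpr.cost]; omega)
  have hcost : (RamTest.lt (R 33) (R 32)).cost = 3 := rfl
  refine (Tri.while_frame (fun s' => s'.reg 37 ∈ S ∧ t₀ ≤ s'.reg 33 ∧
    ∀ i, t₀ ≤ i → i < s'.reg 33 → s.arr 21 (s.arr 20 i) < s.arr 21 (s'.reg 37) ∨
      s.arr 21 (s.arr 20 i) = s.arr 21 (s'.reg 37) ∧
        L (s'.reg 37 + 1) - L (s'.reg 37) ≤ L (s.arr 20 i + 1) - L (s.arr 20 i))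
    (fun s' => 60 * (s.reg 32 - s'.reg 33) + 10)
    (fun s' hf hI hb => ?_) (fun s' hf hI hb => ?_) ?_).mono ?_ fun _ h => h
  · obtain ⟨g1, g2, g3⟩ := hI
    have e0 : s'.arr 0 = L := (hf.arr 0).trans h0
    have e20 : s'.arr 20 = s.arr 20 := hf.arr 20
    have e21 : s'.arr 21 = s.arr 21 := hf.arr 21
    have e32 : s'.reg 32 = s.reg 32 := (hf.reg 32).trans (by simp)
    simp only [holds_lt, eval_reg, e32] at hb
    have hx := b.mem _ g2 hb
    have hxn := hSn _ hx
    have step : ∀ {c}, c ∈ S → (∀ i, t₀ ≤ i → i < s'.reg 33 + 1 →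
        s.arr 21 (s.arr 20 i) < s.arr 21 c ∨ s.arr 21 (s.arr 20 i) = s.arr 21 c ∧
          L (c + 1) - L c ≤ L (s.arr 20 i + 1) - L (s.arr 20 i)) → c ∈ S ∧ t₀ ≤ s'.reg 33 + 1 ∧
        ∀ i, t₀ ≤ i → i < s'.reg 33 + 1 →
          s.arr 21 (s.arr 20 i) < s.arr 21 c ∨ s.arr 21 (s.arr 20 i) = s.arr 21 c ∧
            L (c + 1) - L c ≤ L (s.arr 20 i + 1) - L (s.arr 20 i) :=
      fun h1 h2 => ⟨h1, by omega, h2⟩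
    have hsplit : ∀ {i}, i < s'.reg 33 + 1 → i < s'.reg 33 ∨ i = s'.reg 33 := fun h => by omega
    refine ⟨50, Tri.wp ?_ (by decide)⟩
    simp only [RamProg.wp, eval_reg, eval_add, eval_sub, eval_load, eval_ofNat, setReg_reg,
      setReg_arr, if_true, Nat.reduceEqDiff, if_false, holds_eq, holds_lt, e0, e20, e21]
    refine ⟨by omega, fun c1 => ⟨by omega, by omega, step hx fun i h1 h2 => ?_, by omega⟩,
      fun c1 => ⟨fun c2 => ⟨fun c3 => ⟨by omega, by omega, step hx fun i h1 h2 => ?_, by omega⟩,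
        fun c3 => ⟨by omega, step g1 fun i h1 h2 => ?_, by omega⟩⟩,
        fun c2 => ⟨by omega, step g1 fun i h1 h2 => ?_, by omega⟩⟩⟩ <;>
    · rcases hsplit h2 with h3 | rfl
      · have := g3 i h1 h3
        omega
      · omega
  · obtain ⟨g1, g2, g3⟩ := hI
    have e32 : s'.reg 32 = s.reg 32 := (hf.reg 32).trans (by simp)
    simp only [holds_lt, eval_reg, e32] at hb
    refine ⟨by omega, g1, fun x hx => ?_, fun x hx hxe => ?_⟩
    · obtain ⟨i, h1, h2, rfl⟩ := (b.mem_iff hS).1 hx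
      have := g3 i h1 (by omega)
      omega
    · obtain ⟨i, h1, h2, rfl⟩ := (b.mem_iff hS).1 hx
      have := g3 i h1 (by omega)
      rw [hA.ncard_neighborSet (hSn _ g1), hA.ncard_neighborSet (hSn _ hx)]
      omega
  · simp only [setReg_reg, Nat.reduceEqDiff, if_true, if_false, eval_reg, h30, h31]
    exact ⟨hS.self, le_rfl, fun i h1 h2 => by omega⟩
  · simp [h31, hcard]

theorem fartherProg_spec (hA : Adjacency K n L E) (hB : L n + n + 2 ≤ B) {s : RamState}
    (h0 : s.arr 0 = L) (h1 : s.arr 1 = E) {x : ℕ} (hx : x < n) (h34 : s.reg 34 = x)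
    (h40 : s.reg 40 ≤ n) :
    Tri B fartherProg s (50 * (L (x + 1) - L x) + 15) (fun s' =>
      s'.reg 40 = s.reg 40 + ((Finset.Ico (L x) (L (x + 1))).filter
        fun k => s.arr 23 x < s.arr 23 (E k)).card) := by
  have hL := hA.le x hx
  have hL' := hA.le_last (x := x + 1) (by omega)
  refine Tri.assign (T := 50 * (L (x + 1) - L x) + 12) (by simp [h34, h0]; omega) ?_
    (by simp [RamExpr.cost]; omega)
  have hcost : (RamTest.lt (R 35) (A 0 (R 34 + 1))).cost = 6 := rfl
  refine (Tri.while_frame (fun s' => L x ≤ s'.reg 35 ∧ s'.reg 35 ≤ L (x + 1) ∧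
    s'.reg 40 = s.reg 40 + ((Finset.Ico (L x) (s'.reg 35)).filter
      fun k => s.arr 23 x < s.arr 23 (E k)).card)
    (fun s' => 50 * (L (x + 1) - s'.reg 35) + 12)
    (fun s' hf hI hb => ?_) (fun s' hf hI hb => ?_) ?_).mono ?_ fun _ h => h
  · obtain ⟨g1, g2, g3⟩ := hI
    have e0 : s'.arr 0 = L := (hf.arr 0).trans h0
    have e1 : s'.arr 1 = E := (hf.arr 1).trans h1
    have e23 : s'.arr 23 = s.arr 23 := hf.arr 23
    have e34 : s'.reg 34 = x := (hf.reg 34).trans h34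
    simp only [holds_lt, eval_reg, eval_load, eval_add, eval_ofNat, e0, e34] at hb
    have hle := Finset.card_filter_le (Finset.Ico (L x) (s'.reg 35))
      fun k => s.arr 23 x < s.arr 23 (E k)
    rw [Nat.card_Ico] at hle
    refine ⟨25, Tri.wp ?_ (by decide)⟩
    simp only [RamProg.wp, eval_reg, eval_add, eval_load, eval_ofNat, setReg_reg,
      if_true, Nat.reduceEqDiff, if_false, holds_lt, e1, e23, e34]
    rw [← Nat.succ_eq_add_one, Nat.Ico_succ_right_eq_insert_Ico g1, Finset.filter_insert]
    refine ⟨fun c1 => ⟨by omega, by omega, ⟨by omega, by omega, ?_⟩, by omega⟩,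
      fun c1 => ⟨by omega, ⟨by omega, by omega, ?_⟩, by omega⟩⟩
    · rw [if_pos c1, Finset.card_insert_of_notMem (by simp), g3]
      rfl
    · rw [if_neg c1, g3]
  · obtain ⟨g1, g2, g3⟩ := hI
    have e0 : s'.arr 0 = L := (hf.arr 0).trans h0
    have e34 : s'.reg 34 = x := (hf.reg 34).trans h34
    simp only [holds_lt, eval_reg, eval_load, eval_add, eval_ofNat, e0, e34] at hb
    rw [show s'.reg 35 = L (x + 1) by omega] at g3
    exact ⟨by omega, g3⟩
  · simp [h0, h34, hL]
  · simp [h0, h34]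

open Classical in
/-- The two parts in which the vertices up to the last neighbour are counted: those that are not
farther from the end, and the neighbours that are farther. -/
theorem Bfs.count (b : Bfs K S r t₀ D₀ Q D t t) (hS : IsComponent K S r) (hA : Adjacency K n L E)
    (hSn : ∀ x ∈ S, x < n) {x l : ℕ} (hx : x ∈ S) (hl : t₀ ≤ l ∧ l ≤ t)
    (hlt : ∀ j, t₀ ≤ j → j < t → (D (Q j) ≤ D x ↔ j < l)) :
    l + ((Finset.Ico (L x) (L (x + 1))).filter fun k => D x < D (E k)).card =
      t₀ + (S.filter fun y => D y ≤ D x ∨ K.Adj x y).card := by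
  have h1 : (S.filter fun y => D y ≤ D x ∨ K.Adj x y).card =
      (S.filter fun y => D y ≤ D x).card + (S.filter fun y => D x < D y ∧ K.Adj x y).card := by
    rw [← Finset.card_union_of_disjoint]
    · congr 1
      ext y
      simp only [Finset.mem_filter, Finset.mem_union]
      have := lt_or_ge (D x) (D y)
      tauto
    · rw [Finset.disjoint_filter]
      omega
  have h2 : (Finset.Ico t₀ l).card = (S.filter fun y => D y ≤ D x).card := by
    refine Finset.card_bij (fun j _ => Q j) (fun j hj => ?_) (fun i hi j hj hij => ?_)
      fun y hy => ?_
    · rw [Finset.mem_Ico] at hj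
      exact Finset.mem_filter.2 ⟨b.mem j hj.1 (by omega), (hlt j hj.1 (by omega)).2 hj.2⟩
    · rw [Finset.mem_Ico] at hi hj
      exact b.inj i j hi.1 (by omega) hj.1 (by omega) hij
    · obtain ⟨hy, hy'⟩ := Finset.mem_filter.1 hy
      obtain ⟨j, h3, h4, rfl⟩ := (b.mem_iff hS).1 hy
      exact ⟨j, Finset.mem_Ico.2 ⟨h3, (hlt j h3 h4).1 hy'⟩, rfl⟩
  have h3 : ((Finset.Ico (L x) (L (x + 1))).filter fun k => D x < D (E k)).card =
      (S.filter fun y => D x < D y ∧ K.Adj x y).card := by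
    have hlist := hA.list x (hSn x hx)
    refine Finset.card_bij (fun k _ => E k) (fun k hk => ?_) (fun i hi j hj hij => ?_)
      fun y hy => ?_
    · obtain ⟨hk, hk'⟩ := Finset.mem_filter.1 hk
      have h4 : K.Adj x (E k) := hlist.mapsTo (Finset.mem_Ico.1 hk)
      exact Finset.mem_filter.2 ⟨hS.closed x hx _ h4, hk', h4⟩
    · exact hlist.injOn (Finset.mem_Ico.1 (Finset.mem_filter.1 hi).1)
        (Finset.mem_Ico.1 (Finset.mem_filter.1 hj).1) hij
    · obtain ⟨-, hy, hy'⟩ := Finset.mem_filter.1 hy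
      obtain ⟨k, hk, rfl⟩ := hlist.surjOn hy'
      exact ⟨k, Finset.mem_filter.2 ⟨Finset.mem_Ico.2 hk, hy⟩, rfl⟩
  rw [Nat.card_Ico] at h2
  omega

open Classical in
theorem countProg_spec (hA : Adjacency K n L E) (hS : IsComponent K S r) (hSn : ∀ x ∈ S, x < n)
    (hB : L n + n + 2 ≤ B) (ht : t₀ + S.card ≤ n) {s : RamState} (h0 : s.arr 0 = L)
    (h1 : s.arr 1 = E) (h31 : s.reg 31 = t₀)
    (b : Bfs K S r t₀ D₀ (s.arr 22) (s.arr 23) (s.reg 32) (s.reg 32)) :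
    Tri B countProg s (∑ x ∈ S, (50 * (L (x + 1) - L x) + 80) + 20) (fun s' =>
      (∀ x ∈ S, s'.arr 24 x =
        t₀ + (S.filter fun y => s.arr 23 y ≤ s.arr 23 x ∨ K.Adj x y).card) ∧
      ∀ x, x ∉ S → s'.arr 24 x = s.arr 24 x) := by
  have hcard := b.card hS
  set w : ℕ → ℕ := fun x => 50 * (L (x + 1) - L x) + 80 with hw
  refine Tri.assign (T := ∑ x ∈ S, w x + 18) (by simp; omega) (Tri.assign (T := ∑ x ∈ S, w x + 15)
    (by simp) (Tri.assign (T := ∑ x ∈ S, w x + 10) (by simp) ?_ ?_)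
    ?_) (show 2 + (S.sum w + 18) ≤ S.sum w + 20 by omega)
  rotate_left
  · show 2 + (S.sum w + 10) ≤ S.sum w + 15
    omega
  · show 2 + (S.sum w + 15) ≤ S.sum w + 18
    omega
  have hcost : (RamTest.lt (R 31) (R 33)).cost = 3 := rfl
  refine (Tri.while_frame (fun s' => t₀ ≤ s'.reg 33 ∧ s'.reg 33 ≤ s.reg 32 ∧
    (∀ i, s'.reg 33 ≤ i → i < s.reg 32 → s'.arr 24 (s.arr 22 i) =
      t₀ + (S.filter fun y => s.arr 23 y ≤ s.arr 23 (s.arr 22 i) ∨ K.Adj (s.arr 22 i) y).card) ∧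
    (∀ x, x ∉ S → s'.arr 24 x = s.arr 24 x) ∧
    (s'.reg 33 = s.reg 32 → s'.reg 38 = 0) ∧
    (s'.reg 33 < s.reg 32 → s'.reg 38 = s.arr 23 (s.arr 22 (s'.reg 33)) ∧ t₀ ≤ s'.reg 39 ∧
      s'.reg 39 ≤ s.reg 32 ∧ ∀ j, t₀ ≤ j → j < s.reg 32 →
        (s.arr 23 (s.arr 22 j) ≤ s'.reg 38 ↔ j < s'.reg 39)))
    (fun s' => ∑ i ∈ Finset.Ico t₀ (s'.reg 33), w (s.arr 22 i) + 10)
    (fun s' hf hI hb => ?_) (fun s' hf hI hb => ?_) ?_).mono ?_ fun _ h => h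
  · obtain ⟨g1, g2, g3, g4, g5, g6⟩ := hI
    have e0 : s'.arr 0 = L := (hf.arr 0).trans h0
    have e1 : s'.arr 1 = E := (hf.arr 1).trans h1
    have e22 : s'.arr 22 = s.arr 22 := hf.arr 22
    have e23 : s'.arr 23 = s.arr 23 := hf.arr 23
    have e31 : s'.reg 31 = t₀ := (hf.reg 31).trans h31
    simp only [holds_lt, eval_reg, e31] at hb
    obtain ⟨i, hi⟩ : ∃ i, s'.reg 33 = i + 1 := ⟨s'.reg 33 - 1, by omega⟩
    have hx := b.mem i (by omega) (by omega)
    have hpos := b.pos i (by omega) (by omega)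
    have hbound := b.bound i (by omega) (by omega)
    set x := s.arr 22 i with hxe
    have hxn := hSn x hx
    refine ⟨50 * (L (x + 1) - L x) + 70, Tri.assign (T := 50 * (L (x + 1) - L x) + 66)
      (by simp; omega) (Tri.assign (T := 50 * (L (x + 1) - L x) + 63) ?_
        (Tri.seq (T₁ := 20) (Tri.frame (Q := fun s₂ => s₂.reg 38 = s.arr 23 x ∧ t₀ ≤ s₂.reg 39 ∧
          s₂.reg 39 ≤ s.reg 32 ∧ ∀ j, t₀ ≤ j → j < s.reg 32 →
            (s.arr 23 (s.arr 22 j) ≤ s₂.reg 38 ↔ j < s₂.reg 39)) (Tri.wp ?_ (by decide))) ?_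
          (by omega)) (by simp [RamExpr.cost]; omega))
        (by have : (R 33 - 1 : RamExpr).cost = 3 := rfl; omega)⟩
    · simp only [eval_load, eval_sub, eval_reg, eval_ofNat, setReg_reg, setReg_arr, if_true, hi,
        e22, Nat.add_sub_cancel]
      omega
    · simp only [RamProg.wp, eval_load, eval_sub, eval_reg, eval_ofNat, eval_add, setReg_reg,
        setReg_arr, if_true, hi, e22, e23, Nat.add_sub_cancel, holds_eq, Nat.reduceEqDiff, if_false]
      rw [← hxe]
      refine ⟨fun c1 => ?_, fun c1 => ⟨by omega, by omega, rfl, by omega, by omega,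
        fun j h2 h3 => ⟨fun h4 => ?_, fun h4 => ?_⟩⟩⟩
      · have h2 : s'.reg 33 < s.reg 32 := by
          by_contra h3
          have := g5 (by omega)
          omega
        obtain ⟨-, k2, k3, k4⟩ := g6 h2
        exact ⟨c1.symm, k2, k3, k4⟩
      · by_contra h5
        have h6 : s'.reg 33 < s.reg 32 := by omega
        have k1 := (g6 h6).1
        have h7 := b.sorted i (s'.reg 33) (by omega) (by omega) h6
        have h8 := b.sorted (s'.reg 33) j (by omega) (by omega) h3
        rw [← hxe] at h7
        omega
      · exact b.sorted j i h2 (by omega) (by omega)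
    rintro s₂ ⟨⟨k1, k2, k3, k4⟩, hf₂⟩
    have f0 : s₂.arr 0 = L := (hf₂.arr 0).trans e0
    have f1 : s₂.arr 1 = E := (hf₂.arr 1).trans e1
    have f23 : s₂.arr 23 = s.arr 23 := (hf₂.arr 23).trans e23
    have f24 : s₂.arr 24 = s'.arr 24 := hf₂.arr 24
    have f33 : s₂.reg 33 = i := (hf₂.reg 33).trans (by simp [hi])
    have f34 : s₂.reg 34 = x := (hf₂.reg 34).trans (by simp [hi, e22, hxe])
    have hcnt := b.count hS hA hSn hx ⟨k2, k3⟩ (by rw [← k1]; exact k4)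
    have hcl := Finset.card_filter_le S fun y => s.arr 23 y ≤ s.arr 23 x ∨ K.Adj x y
    refine Tri.assign (T := 50 * (L (x + 1) - L x) + 35) (by simp; omega) (Tri.seq
      (T₁ := 50 * (L (x + 1) - L x) + 15) (fartherProg_spec hA hB ?_ ?_ hxn ?_ ?_).frame ?_
      (by omega)) (by simp [RamExpr.cost]; omega)
    · exact f0
    · exact f1
    · exact f34
    · simp
      omega
    rintro s₃ ⟨l1, hf₃⟩
    simp only [setReg_reg, if_true, eval_reg, setReg_arr, f23, hcnt] at l1
    have m33 : s₃.reg 33 = i := (hf₃.reg 33).trans f33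
    have m34 : s₃.reg 34 = x := (hf₃.reg 34).trans f34
    have m38 : s₃.reg 38 = s₂.reg 38 := hf₃.reg 38
    have m39 : s₃.reg 39 = s₂.reg 39 := hf₃.reg 39
    have m24 : s₃.arr 24 = s'.arr 24 := (hf₃.arr 24).trans f24
    refine Tri.wp ?_ (le_trans (b := 20) (by decide) (by omega))
    simp only [RamProg.wp, eval_reg, setArr_reg, m33, m34, m38, m39, l1, setArr_arr_self, m24]
    refine ⟨⟨by omega, by omega⟩, ⟨by omega, by omega, fun j h2 h3 => ?_, fun y hy => ?_,
      fun h2 => by omega, fun _ => ⟨k1, k2, k3, k4⟩⟩, ?_⟩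
    · by_cases hj : j = i
      · rw [hj, ← hxe, Function.update_self]
      · rw [Function.update_of_ne, g3 j (by omega) h3]
        exact fun h4 => hj (b.inj j i (by omega) h3 (by omega) (by omega) h4)
    · rw [Function.update_of_ne (by rintro rfl; exact hy hx), g4 y hy]
    · rw [hi, Finset.sum_Ico_succ_top (by omega)]
      simp only [hw, ← hxe]
      omega
  · obtain ⟨g1, g2, g3, g4, g5, g6⟩ := hI
    have e31 : s'.reg 31 = t₀ := (hf.reg 31).trans h31
    simp only [holds_lt, eval_reg, e31] at hb
    refine ⟨by omega, fun x hx => ?_, g4⟩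
    obtain ⟨i, h2, h3, rfl⟩ := (b.mem_iff hS).1 hx
    exact g3 i (by omega) h3
  · simp only [setReg_reg, setReg_arr, Nat.reduceEqDiff, if_true, if_false, eval_reg, eval_ofNat]
    exact ⟨by omega, le_rfl, fun i h2 h3 => by omega, fun x _ => trivial, fun _ => trivial,
      fun h2 => by omega⟩
  · simp only [setReg_reg, Nat.reduceEqDiff, if_true, if_false, eval_reg]
    exact Nat.add_le_add_right (b.sum_le w) 10

open Classical in
theorem componentProg_spec (hA : Adjacency K n L E) (hS : IsComponent K S r)
    (hSn : ∀ x ∈ S, x < n) (hT : ∀ x ∈ T, x < n) (hTc : ∀ x ∈ T, ∀ y, K.Adj x y → y ∈ T)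
    (hdisj : ∀ x ∈ T, x ∉ S) (hB : L n + n + 2 ≤ B) {s : RamState} (h0 : s.arr 0 = L)
    (h1 : s.arr 1 = E) (h30 : s.reg 30 = r) (h32 : s.reg 32 = T.card)
    (h21 : ∀ x ∈ S, s.arr 21 x = 0) (h23 : ∀ x ∈ S, s.arr 23 x = 0)
    (hs : Sorted K n T (s.arr 24)) :
    Tri B componentProg s (∑ x ∈ S, (150 * (L (x + 1) - L x) + 390)) (fun s' =>
      s'.reg 32 = (T ∪ S).card ∧ Sorted K n (T ∪ S) (s'.arr 24) ∧ (∀ x ∈ S, s'.arr 21 x ≠ 0) ∧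
      ∀ x, x ∉ S → s'.arr 21 x = s.arr 21 x ∧ s'.arr 23 x = s.arr 23 x) := by
  have hcard : (T ∪ S).card = T.card + S.card :=
    Finset.card_union_of_disjoint (Finset.disjoint_left.2 hdisj)
  have hle : T.card + S.card ≤ n := by
    rw [← hcard, ← Finset.card_range n]
    refine Finset.card_le_card fun x hx => Finset.mem_range.2 ?_
    exact (Finset.mem_union.1 hx).elim (hT x) (hSn x)
  have hr := hSn r hS.self
  have hpos : 1 ≤ S.card := Finset.card_pos.2 ⟨r, hS.self⟩
  have hsum : ∀ c k, ∑ x ∈ S, (c * (L (x + 1) - L x) + k) =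
      c * ∑ x ∈ S, (L (x + 1) - L x) + k * S.card := fun c k => by
    rw [Finset.sum_add_distrib, ← Finset.mul_sum, Finset.sum_const, smul_eq_mul, mul_comm k]
  have hbfs := hsum 50 50
  have hcount := hsum 50 80
  rw [hsum]
  generalize ∑ x ∈ S, (L (x + 1) - L x) = M at *
  refine Tri.assign (T := 150 * M + 390 * S.card - 2) (by simp; omega) (Tri.assign
    (T := 150 * M + 390 * S.card - 4) (by simp; omega) (Tri.seq (T₁ := _)
      (bfsProg_spec (t₀ := T.card) (q := 20) (d := 21) (by omega) (by omega) (by omega) hA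
        hS hSn hle hB ?_ ?_ ?_ ?_ ?_).frame ?_ (by omega)) (by simp [RamExpr.cost]; omega))
    (by simp [RamExpr.cost]; omega)
  · exact h0
  · exact h1
  · simp [h32]
  · simp [h30]
  · exact h21
  rintro s₁ ⟨b, hf₁⟩
  have a0 : s₁.arr 0 = L := (hf₁.arr 0).trans h0
  have a1 : s₁.arr 1 = E := (hf₁.arr 1).trans h1
  have a23 : s₁.arr 23 = s.arr 23 := hf₁.arr 23
  have a24 : s₁.arr 24 = s.arr 24 := hf₁.arr 24
  have a30 : s₁.reg 30 = r := (hf₁.reg 30).trans (by simp [h30])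
  have a31 : s₁.reg 31 = T.card := (hf₁.reg 31).trans (by simp [h32])
  refine Tri.seq (T₁ := 60 * S.card + 20)
    (endProg_spec hA hS hSn (by omega) a0 a30 a31 hle b).frame ?_ (by omega)
  rintro s₂ ⟨⟨he, hmax, hdeg⟩, hf₂⟩
  have b0 : s₂.arr 0 = L := (hf₂.arr 0).trans a0
  have b1 : s₂.arr 1 = E := (hf₂.arr 1).trans a1
  have b23 : s₂.arr 23 = s.arr 23 := (hf₂.arr 23).trans a23
  have b24 : s₂.arr 24 = s.arr 24 := (hf₂.arr 24).trans a24
  have b31 : s₂.reg 31 = T.card := (hf₂.reg 31).trans a31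
  have b21 : s₂.arr 21 = s₁.arr 21 := hf₂.arr 21
  have hSe := hS.of_mem he
  have hen := hSn _ he
  refine Tri.assign (T := 100 * M + 170 * S.card + 50) (by simp; omega) (Tri.seq
    (T₁ := _) (bfsProg_spec (t₀ := T.card) (q := 22) (d := 23)
      (by omega) (by omega) (by omega) hA hSe hSn hle hB ?_ ?_ ?_ ?_ ?_).frame ?_
      (by omega)) (by simp [RamExpr.cost]; omega)
  · exact b0
  · exact b1
  · simp [b31]
  · simp
  · intro x hx
    rw [setReg_arr, b23]
    exact h23 x hx
  rintro s₃ ⟨b', hf₃⟩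
  have c0 : s₃.arr 0 = L := (hf₃.arr 0).trans b0
  have c1 : s₃.arr 1 = E := (hf₃.arr 1).trans b1
  have c21 : s₃.arr 21 = s₁.arr 21 := (hf₃.arr 21).trans b21
  have c24 : s₃.arr 24 = s.arr 24 := (hf₃.arr 24).trans b24
  have c31 : s₃.reg 31 = T.card := (hf₃.reg 31).trans b31
  refine (countProg_spec hA hSe hSn hB hle c0 c1 c31 b').frame.mono (by omega) ?_
  rintro s₄ ⟨⟨k1, k2⟩, hf₄⟩
  have d21 : s₄.arr 21 = s₁.arr 21 := (hf₄.arr 21).trans c21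
  have d23 : s₄.arr 23 = s₃.arr 23 := hf₄.arr 23
  have d32 : s₄.reg 32 = s₃.reg 32 := hf₄.reg 32
  have hlay := b.layered hS
  have hlay' := b'.layered hSe
  refine ⟨by rw [d32, b'.card hSe, hcard], ?_, fun x hx => ?_, fun x hx => ⟨?_, ?_⟩⟩
  · obtain ⟨ρ, h, -⟩ := id hs
    -- one of the two directions has the end that was found in front
    obtain ⟨ρ', h', her⟩ : ∃ ρ', Umbrella K n ρ' ∧ ρ' (s₂.reg 37) ≤ ρ' r := by
      rcases le_total (ρ (s₂.reg 37)) (ρ r) with h2 | h2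
      · exact ⟨ρ, h, h2⟩
      · exact ⟨_, h.neg, neg_le_neg h2⟩
    have hend := hlay.leftEnd h' hSn he hmax hdeg her
    refine hs.union_of_umbrella hT hSn hTc hS.closed hdisj h' (fun x hx => ?_) fun x hx => ?_
    · rw [k2 x (hdisj x hx), c24]
    · rw [k1 x hx, upTo]
      congr 2
      exact Finset.filter_congr fun y hy => hend.dist_le_or_adj_iff h' hlay' hSn hx hy
  · obtain ⟨i, h2, h3, rfl⟩ := (b.mem_iff hS).1 hx
    rw [d21]
    exact b.pos i h2 h3
  · rw [d21, b.off x hx]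
    rfl
  · rw [d23, b'.off x hx, setReg_arr, b23]

theorem Adjacency.exists_component (hA : Adjacency K n L E) (hr : r < n) :
    ∃ S, IsComponent K S r ∧ ∀ x ∈ S, x < n := by
  classical
  have hlt : ∀ {x}, K.Reachable r x → x < n := fun {x} => by
    rintro ⟨w⟩
    induction w with
    | nil => exact hr
    | cons hadj w ih => exact ih (hA.lt hadj.symm)
  exact ⟨(Finset.range n).filter (K.Reachable r), fun x => by
    simpa using hlt, fun x hx => Finset.mem_range.1 (Finset.mem_filter.1 hx).1⟩

theorem Adjacency.sum_add (hA : Adjacency K n L E) :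
    ∑ x ∈ Finset.range n, (L (x + 1) - L x) + L 0 = L n := by
  have : ∀ k ≤ n, ∑ x ∈ Finset.range k, (L (x + 1) - L x) + L 0 = L k := by
    intro k
    induction k with
    | zero => simp
    | succ k ih =>
      intro hk
      have := ih (by omega)
      have := hA.le k (by omega)
      rw [Finset.sum_range_succ]
      omega
  exact this n le_rfl

theorem componentsProg_spec (hA : Adjacency K n L E) (hK : ∃ ρ, Umbrella K n ρ)
    (hB : L n + n + 2 ≤ B) {s : RamState} (hs : s.reg 0 = n) (h0 : s.arr 0 = L)
    (h1 : s.arr 1 = E) (h21 : ∀ x, s.arr 21 x = 0) (h23 : ∀ x, s.arr 23 x = 0) :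
    Tri B componentsProg s (150 * L n + 410 * n + 20) (fun s' =>
      Sorted K n (Finset.range n) (s'.arr 24)) := by
  classical
  set w : ℕ → ℕ := fun x => 150 * (L (x + 1) - L x) + 390 with hw
  refine Tri.assign (T := 150 * L n + 410 * n + 18) (by simp) (Tri.assign
    (T := 150 * L n + 410 * n + 10) (by simp) ?_
    (show 2 + (150 * L n + 410 * n + 10) ≤ _ by omega))
    (show 2 + (150 * L n + 410 * n + 18) ≤ _ by omega)
  have hcost : (RamTest.lt (R 30) (R 0)).cost = 3 := rfl
  refine (Tri.while_frame (fun s' => s'.reg 30 ≤ n ∧ ∃ T : Finset ℕ, (∀ x ∈ T, x < n) ∧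
    (∀ x ∈ T, ∀ y, K.Adj x y → y ∈ T) ∧ (∀ x < s'.reg 30, x ∈ T) ∧ s'.reg 32 = T.card ∧
    Sorted K n T (s'.arr 24) ∧ (∀ x, s'.arr 21 x = 0 ↔ x ∉ T) ∧ ∀ x, x ∉ T → s'.arr 23 x = 0)
    (fun s' => 20 * (n - s'.reg 30) +
      ∑ x ∈ (Finset.range n).filter fun x => s'.arr 21 x = 0, w x + 10)
    (fun s' hf hI hb => ?_) (fun s' hf hI hb => ?_) ?_).mono ?_ fun _ h => h
  · obtain ⟨g0, T, hT, hTc, g1, g2, g3, g4, g5⟩ := hI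
    have e0 : s'.arr 0 = L := (hf.arr 0).trans h0
    have e1 : s'.arr 1 = E := (hf.arr 1).trans h1
    have e00 : s'.reg 0 = n := (hf.reg 0).trans (by simp [hs])
    simp only [holds_lt, eval_reg, e00] at hb
    have hcost' : (RamTest.eq (A 21 (R 30)) 0).cost = 4 := rfl
    have hlt : ∀ {x}, x < s'.reg 30 + 1 → x < s'.reg 30 ∨ x = s'.reg 30 := fun h => by omega
    by_cases hr : s'.reg 30 ∈ T
    · have hc : s'.arr 21 (s'.reg 30) ≠ 0 := fun h => (g4 _).1 h hr
      refine ⟨10, Tri.seq (T₁ := 6) (Tri.ite (b := .eq (A 21 (R 30)) 0) (T := 1)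
        (Q := fun s₁ => s₁ = s') (fun h => (hc h).elim) (fun _ => Tri.skip rfl le_rfl) (by omega))
        ?_ (by omega)⟩
      rintro s₁ rfl
      refine Tri.wp ?_ (by decide)
      simp only [RamProg.wp, eval_reg, eval_add, eval_ofNat, setReg_reg, setReg_arr, if_true,
        Nat.reduceEqDiff, if_false]
      refine ⟨by omega, ⟨by omega, T, hT, hTc, fun x hx => ?_, g2, g3, g4, g5⟩, ?_⟩
      · rcases hlt hx with h | rfl
        · exact g1 x h
        · exact hr
      · show _ + (_ + ∑ x ∈ (Finset.range n).filter (fun x => s₁.arr 21 x = 0), w x + 10) ≤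
          _ + ∑ x ∈ (Finset.range n).filter (fun x => s₁.arr 21 x = 0), w x + 10
        omega
    · have hc : s'.arr 21 (s'.reg 30) = 0 := (g4 _).2 hr
      obtain ⟨S, hS, hSn⟩ := hA.exists_component hb
      have hdisj : ∀ x ∈ T, x ∉ S := fun x hx hxS => hr
        ((hS.of_mem hxS).subset (A := T) hx hTc hS.self)
      refine ⟨∑ x ∈ S, w x + 10, Tri.seq (T₁ := ∑ x ∈ S, w x + 5) (Tri.ite
        (b := .eq (A 21 (R 30)) 0) (T := ∑ x ∈ S, w x) (fun _ => componentProg_spec hA hS hSn hT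
            hTc hdisj hB e0 e1 rfl g2
          (fun x hx => (g4 x).2 fun h => hdisj x h hx) (fun x hx => g5 x fun h => hdisj x h hx) g3)
        (fun h => (h hc).elim) (by omega)).frame ?_ (by omega)⟩
      rintro s₁ ⟨⟨k1, k2, k3, k4⟩, hf₁⟩
      have e30 : s₁.reg 30 = s'.reg 30 := hf₁.reg 30
      refine Tri.wp ?_ (le_trans (b := 4) (by decide) (by omega))
      simp only [RamProg.wp, eval_reg, eval_add, eval_ofNat, setReg_reg, setReg_arr, if_true,
        Nat.reduceEqDiff, if_false, e30]
      have hfilter : ∑ x ∈ (Finset.range n).filter (fun x => s'.arr 21 x = 0), w x =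
          ∑ x ∈ (Finset.range n).filter (fun x => s₁.arr 21 x = 0), w x + ∑ x ∈ S, w x := by
        rw [← Finset.sum_union]
        · refine Finset.sum_congr ?_ fun _ _ => rfl
          ext x
          simp only [Finset.mem_filter, Finset.mem_union, Finset.mem_range]
          by_cases hx : x ∈ S
          · have := (g4 x).2 fun h => hdisj x h hx
            have := hSn x hx
            tauto
          · rw [(k4 x hx).1]
            tauto
        · exact Finset.disjoint_left.2 fun x hx hxS => k3 x hxS (Finset.mem_filter.1 hx).2
      refine ⟨by omega, ⟨by omega, T ∪ S, fun x hx => ?_, fun x hx y hxy => ?_, fun x hx => ?_, k1,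
        k2, fun x => ?_, fun x hx => ?_⟩, by omega⟩
      · exact (Finset.mem_union.1 hx).elim (hT x) (hSn x)
      · exact (Finset.mem_union.1 hx).elim (fun h => Finset.mem_union_left _ (hTc x h y hxy))
          fun h => Finset.mem_union_right _ (hS.closed x h y hxy)
      · rcases hlt hx with h | rfl
        · exact Finset.mem_union_left _ (g1 x h)
        · exact Finset.mem_union_right _ hS.self
      · by_cases hx : x ∈ S
        · simp [k3 x hx, hx]
        · rw [(k4 x hx).1, g4, Finset.mem_union, or_iff_left hx]
      · rw [Finset.mem_union, not_or] at hx
        rw [(k4 x hx.2).2, g5 x hx.1]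
  · obtain ⟨g0, T, hT, hTc, g1, g2, g3, g4, g5⟩ := hI
    have e00 : s'.reg 0 = n := (hf.reg 0).trans (by simp [hs])
    simp only [holds_lt, eval_reg, e00] at hb
    have : T = Finset.range n := by
      ext x
      exact ⟨fun hx => Finset.mem_range.2 (hT x hx), fun hx =>
        g1 x (by have := Finset.mem_range.1 hx; omega)⟩
    exact ⟨by omega, this ▸ g3⟩
  · obtain ⟨ρ, h⟩ := hK
    refine ⟨by simp, ∅, by simp, by simp, by simp, by simp, ⟨ρ, h, by simp, by simp⟩, ?_, ?_⟩
    · simpa using h21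
    · simpa using h23
  · have := hA.sum_add
    rw [Finset.filter_true_of_mem fun x _ => by simpa using h21 x]
    simp only [hw, Finset.sum_add_distrib, ← Finset.mul_sum, Finset.sum_const, Finset.card_range,
      smul_eq_mul, setReg_reg, Nat.reduceEqDiff, if_true, if_false, eval_ofNat]
    omega

end

/-! ### Sorting the vertices -/

/-- Write the sort keys to array `28`, and count them in array `25`, shifted by one. -/
def keyProg : RamProg :=
  .assign 33 0 ;;
  .while (.lt (R 33) (R 0)) (
    .store 28 (R 33) (A 24 (R 33) + A 24 (R 33) - (A 0 (R 33 + 1) - A 0 (R 33))) ;;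
    .store 25 (A 28 (R 33) + 1) (A 25 (A 28 (R 33) + 1) + 1) ;;
    .assign 33 (R 33 + 1))

/-- Replace the numbers in array `25` by their partial sums. -/
def prefixProg : RamProg :=
  .assign 33 0 ;;
  .while (.lt (R 33) (R 0 + R 0)) (
    .store 25 (R 33 + 1) (A 25 (R 33 + 1) + A 25 (R 33)) ;; .assign 33 (R 33 + 1))

/-- Put the vertices into array `27`, in the order of their keys, and the numbers of vertices up to
their last neighbours into array `0`. -/
def placeProg : RamProg :=
  .assign 33 0 ;;
  .while (.lt (R 33) (R 0)) (
    .assign 34 (A 25 (A 28 (R 33))) ;; .store 25 (A 28 (R 33)) (R 34 + 1) ;;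
    .store 27 (R 34) (R 33) ;; .store 0 (R 34 + 1) (A 24 (R 33)) ;; .assign 33 (R 33 + 1))

/-- Sort the vertices by their keys. -/
def sortProg : RamProg := keyProg ;; prefixProg ;; placeProg

/-- The position of `x` among `0, …, n - 1` in the order of the keys, where ties are broken by the
order of the numbers. -/
def place (n : ℕ) (key : ℕ → ℕ) (x : ℕ) : ℕ :=
  ((Finset.range n).filter fun y => key y < key x ∨ key y = key x ∧ y < x).card

section

variable {n B : ℕ} {key g : ℕ → ℕ}

theorem place_lt_place {x y : ℕ} (hx : x < n) (h : key x < key y ∨ key x = key y ∧ x < y) :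
    place n key x < place n key y := by
  refine Finset.card_lt_card ⟨fun z hz => ?_, fun hsub => ?_⟩
  · simp only [Finset.mem_filter, Finset.mem_range] at hz ⊢
    omega
  · have := hsub (Finset.mem_filter.2 ⟨Finset.mem_range.2 hx, h⟩)
    simp at this

theorem place_lt {x : ℕ} (hx : x < n) : place n key x < n := by
  have : place n key x < (Finset.range n).card :=
    Finset.card_lt_card (Finset.filter_ssubset.2 ⟨x, Finset.mem_range.2 hx, by simp⟩)
  simpa using this

theorem place_inj {x y : ℕ} (hx : x < n) (hy : y < n) (h : place n key x = place n key y) :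
    x = y := by
  by_contra hne
  rcases (by omega : (key x < key y ∨ key x = key y ∧ x < y) ∨
      (key y < key x ∨ key y = key x ∧ y < x)) with h1 | h1
  · exact absurd h (place_lt_place hx h1).ne
  · exact absurd h (place_lt_place hy h1).ne'

theorem place_eq {x : ℕ} (hx : x < n) : place n key x =
    ((Finset.range n).filter fun y => key y < key x).card +
      ((Finset.range x).filter fun y => key y = key x).card := by
  rw [place, Finset.filter_or, Finset.card_union_of_disjoint
    (Finset.disjoint_filter.2 fun y _ h1 h2 => h1.ne h2.1)]
  congr 2
  ext y
  simp only [Finset.mem_filter, Finset.mem_range]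
  omega

theorem card_filter_succ (p : ℕ → Prop) [DecidablePred p] (x : ℕ) :
    ((Finset.range (x + 1)).filter p).card =
      ((Finset.range x).filter p).card + if p x then 1 else 0 := by
  rw [Finset.range_add_one, Finset.filter_insert]
  split_ifs with h
  · rw [Finset.card_insert_of_notMem (by simp)]
  · rfl

theorem card_filter_range_le (p : ℕ → Prop) [DecidablePred p] (x : ℕ) :
    ((Finset.range x).filter p).card ≤ x :=
  (Finset.card_filter_le _ _).trans (Finset.card_range x).le

theorem keyProg_spec (hB : 2 * n + 2 ≤ B) {s : RamState} (h0 : s.reg 0 = n)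
    (hkey : ∀ x < n, s.arr 24 x + s.arr 24 x - (s.arr 0 (x + 1) - s.arr 0 x) = key x)
    (hle : ∀ x < n, key x ≤ 2 * n) (h25 : ∀ k, s.arr 25 k = 0) :
    Tri B keyProg s (60 * n + 20) (fun s' => (∀ x < n, s'.arr 28 x = key x) ∧
      s'.arr 25 0 = 0 ∧
      ∀ k, s'.arr 25 (k + 1) = ((Finset.range n).filter fun y => key y = k).card) := by
  refine Tri.assign (T := 60 * n + 10) (by simp) ?_ (show 2 + (60 * n + 10) ≤ _ by omega)
  have hcost : (RamTest.lt (R 33) (R 0)).cost = 3 := rfl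
  refine (Tri.while_frame (fun s' => s'.reg 33 ≤ n ∧ (∀ x < s'.reg 33, s'.arr 28 x = key x) ∧
    s'.arr 25 0 = 0 ∧
    ∀ k, s'.arr 25 (k + 1) = ((Finset.range (s'.reg 33)).filter fun y => key y = k).card)
    (fun s' => 60 * (n - s'.reg 33) + 10)
    (fun s' hf hI hb => ?_) (fun s' hf hI hb => ?_) ?_).mono ?_ fun _ h => h
  · obtain ⟨g0, g1, g2, g3⟩ := hI
    have e00 : s'.reg 0 = n := (hf.reg 0).trans (by simp [h0])
    have e0 : s'.arr 0 = s.arr 0 := hf.arr 0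
    have e24 : s'.arr 24 = s.arr 24 := hf.arr 24
    simp only [holds_lt, eval_reg, e00] at hb
    have hk := hle _ hb
    have hc := g3 (key (s'.reg 33))
    have hc' := card_filter_range_le (fun y => key y = key (s'.reg 33)) (s'.reg 33)
    refine ⟨50, Tri.wp ?_ (by decide)⟩
    simp only [RamProg.wp, eval_reg, eval_add, eval_sub, eval_load, eval_ofNat, setReg_reg,
      setReg_arr, setArr_reg, if_true, Nat.reduceEqDiff, if_false, setArr_arr, e0, e24, hkey _ hb,
      and_self, false_and, hc]
    refine ⟨⟨by omega, by omega⟩, ⟨by omega, by omega⟩, by omega, ⟨by omega, fun x hx => ?_, ?_,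
      fun k => ?_⟩, by omega⟩
    · by_cases hxe : x = s'.reg 33
      · simp [hxe]
      · simpa [hxe] using g1 x (by omega)
    · simpa using g2
    · rw [card_filter_succ]
      by_cases hke : k = key (s'.reg 33)
      · simp [hke]
      · simp [hke, Ne.symm hke, g3]
  · obtain ⟨g0, g1, g2, g3⟩ := hI
    have e00 : s'.reg 0 = n := (hf.reg 0).trans (by simp [h0])
    simp only [holds_lt, eval_reg, e00] at hb
    obtain rfl : s'.reg 33 = n := by omega
    exact ⟨by omega, g1, g2, g3⟩
  · simp [h25]
  · simp

theorem prefixProg_spec (hB : 2 * n + 2 ≤ B) {s : RamState} (h0 : s.reg 0 = n)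
    (h1 : s.arr 25 0 = 0)
    (h2 : ∀ k, s.arr 25 (k + 1) = ((Finset.range n).filter fun y => key y = k).card) :
    Tri B prefixProg s (60 * n + 20) (fun s' => ∀ k ≤ 2 * n,
      s'.arr 25 k = ((Finset.range n).filter fun y => key y < k).card) := by
  refine Tri.assign (T := 60 * n + 10) (by simp) ?_ (show 2 + (60 * n + 10) ≤ _ by omega)
  have hcost : (RamTest.lt (R 33) (R 0 + R 0)).cost = 5 := rfl
  refine (Tri.while_frame (fun s' => s'.reg 33 ≤ 2 * n ∧ (∀ k ≤ s'.reg 33,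
    s'.arr 25 k = ((Finset.range n).filter fun y => key y < k).card) ∧
    ∀ k, s'.reg 33 < k → s'.arr 25 k = s.arr 25 k)
    (fun s' => 30 * (2 * n - s'.reg 33) + 10)
    (fun s' hf hI hb => ?_) (fun s' hf hI hb => ?_) ?_).mono ?_ fun _ h => h
  · obtain ⟨g0, g1, g2⟩ := hI
    have e00 : s'.reg 0 = n := (hf.reg 0).trans (by simp [h0])
    simp only [holds_lt, eval_reg, eval_add, e00] at hb
    have hc : s'.arr 25 (s'.reg 33 + 1) + s'.arr 25 (s'.reg 33) =
        ((Finset.range n).filter fun y => key y < s'.reg 33 + 1).card := by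
      rw [g2 _ (by omega), h2, g1 _ le_rfl, ← Finset.card_union_of_disjoint
        (Finset.disjoint_filter.2 fun y _ h1 h2 => h2.ne h1), ← Finset.filter_or]
      congr 2
      ext y
      omega
    have hc' := card_filter_range_le (fun y => key y < s'.reg 33 + 1) n
    refine ⟨20, Tri.wp ?_ (by decide)⟩
    simp only [RamProg.wp, eval_reg, eval_add, eval_load, eval_ofNat, setReg_reg,
      setReg_arr, setArr_reg, if_true, setArr_arr, true_and, hc]
    refine ⟨⟨by omega, by omega⟩, by omega, ⟨by omega, fun k hk => ?_, fun k hk => ?_⟩, by omega⟩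
    · split_ifs with h
      · rw [h]
      · exact g1 k (by omega)
    · rw [if_neg (by omega), g2 k (by omega)]
  · obtain ⟨g0, g1, g2⟩ := hI
    have e00 : s'.reg 0 = n := (hf.reg 0).trans (by simp [h0])
    simp only [holds_lt, eval_reg, eval_add, e00] at hb
    exact ⟨by omega, fun k hk => g1 k (by omega)⟩
  · simp [h1]
  · simp
    omega

theorem placeProg_spec (hB : 2 * n + 2 ≤ B) {s : RamState} (h0 : s.reg 0 = n)
    (hle : ∀ x < n, key x ≤ 2 * n) (hg : ∀ x < n, s.arr 24 x ≤ n)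
    (h28 : ∀ x < n, s.arr 28 x = key x)
    (h25 : ∀ k ≤ 2 * n, s.arr 25 k = ((Finset.range n).filter fun y => key y < k).card) :
    Tri B placeProg s (60 * n + 20) (fun s' => ∀ x < n, s'.arr 27 (place n key x) = x ∧
      s'.arr 0 (place n key x + 1) = s.arr 24 x) := by
  refine Tri.assign (T := 60 * n + 10) (by simp) ?_ (show 2 + (60 * n + 10) ≤ _ by omega)
  have hcost : (RamTest.lt (R 33) (R 0)).cost = 3 := rfl
  refine (Tri.while_frame (fun s' => s'.reg 33 ≤ n ∧ (∀ k ≤ 2 * n, s'.arr 25 k =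
      ((Finset.range n).filter fun y => key y < k).card +
        ((Finset.range (s'.reg 33)).filter fun y => key y = k).card) ∧
      ∀ x < s'.reg 33, s'.arr 27 (place n key x) = x ∧
        s'.arr 0 (place n key x + 1) = s.arr 24 x)
    (fun s' => 60 * (n - s'.reg 33) + 10)
    (fun s' hf hI hb => ?_) (fun s' hf hI hb => ?_) ?_).mono ?_ fun _ h => h
  · obtain ⟨g0, g1, g2⟩ := hI
    have e00 : s'.reg 0 = n := (hf.reg 0).trans (by simp [h0])
    have e24 : s'.arr 24 = s.arr 24 := hf.arr 24
    have e28 : s'.arr 28 = s.arr 28 := hf.arr 28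
    simp only [holds_lt, eval_reg, e00] at hb
    have hk := hle _ hb
    have hgx := hg _ hb
    have hc : s'.arr 25 (key (s'.reg 33)) = place n key (s'.reg 33) := by
      rw [g1 _ hk, place_eq hb]
    have hp := place_lt (key := key) hb
    refine ⟨50, Tri.wp ?_ (by decide)⟩
    simp only [RamProg.wp, eval_reg, eval_add, eval_load, eval_ofNat, setReg_reg,
      setReg_arr, setArr_reg, if_true, Nat.reduceEqDiff, if_false, setArr_arr, e24, e28,
      h28 _ hb, true_and, false_and, hc]
    refine ⟨by omega, ⟨by omega, by omega⟩, ⟨by omega, by omega⟩, ⟨by omega, by omega⟩, by omega,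
      ⟨by omega, fun k hk' => ?_, fun x hx => ?_⟩, by omega⟩
    · rw [card_filter_succ]
      split_ifs with h3 h4 h4
      · rw [h3, ← hc, g1 _ hk]
        omega
      · exact (h4 h3.symm).elim
      · exact (h3 h4.symm).elim
      · exact g1 k hk'
    · by_cases hxe : x = s'.reg 33
      · simp [hxe]
      · have hne : place n key x ≠ place n key (s'.reg 33) := fun h =>
          hxe (place_inj (by omega) hb h)
        rw [if_neg hne, if_neg (by omega)]
        exact g2 x (by omega)
  · obtain ⟨g0, g1, g2⟩ := hI
    have e00 : s'.reg 0 = n := (hf.reg 0).trans (by simp [h0])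
    simp only [holds_lt, eval_reg, e00] at hb
    exact ⟨by omega, fun x hx => g2 x (by omega)⟩
  · simpa using h25
  · simp

theorem sortProg_spec (hB : 2 * n + 2 ≤ B) {s : RamState} (h0 : s.reg 0 = n)
    (hkey : ∀ x < n, s.arr 24 x + s.arr 24 x - (s.arr 0 (x + 1) - s.arr 0 x) = key x)
    (hg : ∀ x < n, s.arr 24 x ≤ n) (h25 : ∀ k, s.arr 25 k = 0) :
    Tri B sortProg s (180 * n + 60) (fun s' => Set.BijOn (s'.arr 27) (Set.Iio n) (Set.Iio n) ∧
      (∀ i j, i ≤ j → j < n → key (s'.arr 27 i) ≤ key (s'.arr 27 j)) ∧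
      ∀ i < n, s'.arr 0 (i + 1) = s.arr 24 (s'.arr 27 i)) := by
  have hle : ∀ x < n, key x ≤ 2 * n := fun x hx => by
    have := hkey x hx
    have := hg x hx
    omega
  refine Tri.seq (T₁ := 60 * n + 20) (keyProg_spec hB h0 hkey hle h25).frame ?_ (by omega)
  rintro s₁ ⟨⟨g1, g2, g3⟩, hf₁⟩
  have e0 : s₁.reg 0 = n := (hf₁.reg 0).trans h0
  have e24 : s₁.arr 24 = s.arr 24 := hf₁.arr 24
  refine Tri.seq (T₁ := 60 * n + 20) (prefixProg_spec hB e0 g2 g3).frame ?_ (by omega)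
  rintro s₂ ⟨g4, hf₂⟩
  have f24 : s₂.arr 24 = s.arr 24 := (hf₂.arr 24).trans e24
  have f28 : s₂.arr 28 = s₁.arr 28 := hf₂.arr 28
  refine (placeProg_spec hB ((hf₂.reg 0).trans e0) hle (by rwa [f24]) (by rwa [f28]) g4).mono
    (by omega) fun s' h => ?_
  rw [f24] at h
  have hsurj : ∀ i < n, ∃ x < n, place n key x = i := by
    intro i hi
    have : Set.SurjOn (place n key) (Finset.range n) (Finset.range n) := by
      refine Finset.surjOn_of_injOn_of_card_le _ (fun x hx => ?_) (fun x hx y hy => ?_) le_rfl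
      · exact Finset.mem_coe.2 (Finset.mem_range.2 (place_lt (Finset.mem_range.1 hx)))
      · exact place_inj (Finset.mem_range.1 hx) (Finset.mem_range.1 hy)
    obtain ⟨x, hx, hxi⟩ := this (Finset.mem_coe.2 (Finset.mem_range.2 hi))
    exact ⟨x, Finset.mem_range.1 hx, hxi⟩
  refine ⟨⟨fun i hi => ?_, fun i hi j hj hij => ?_, fun x hx => ?_⟩, fun i j hij hj => ?_,
    fun i hi => ?_⟩
  · obtain ⟨x, hx, rfl⟩ := hsurj i hi
    rwa [Set.mem_Iio, (h x hx).1]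
  · obtain ⟨x, hx, rfl⟩ := hsurj i hi
    obtain ⟨y, hy, rfl⟩ := hsurj j hj
    rw [(h x hx).1, (h y hy).1] at hij
    rw [hij]
  · exact ⟨_, place_lt hx, (h x hx).1⟩
  · obtain ⟨x, hx, rfl⟩ := hsurj i (by omega)
    obtain ⟨y, hy, rfl⟩ := hsurj j hj
    rw [(h x hx).1, (h y hy).1]
    by_contra hcon
    have := place_lt_place (key := key) hy (.inl (not_le.1 hcon))
    omega
  · obtain ⟨x, hx, rfl⟩ := hsurj i hi
    rw [(h x hx).1, (h x hx).2]

end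

/-! ### The algorithm on a proper interval graph -/

/-- Translate the positions in array `16` back to vertices. -/
def backProg : RamProg :=
  .assign 5 0 ;;
  .while (.lt (R 5) (R 4)) (.store 0 (R 5) (A 27 (A 16 (R 5) - 1)) ;; .assign 5 (R 5 + 1)) ;;
  .assign 0 (R 4)

/-- Find a minimum total 2-dominating set of a proper interval graph. -/
def intervalProg : RamProg :=
  componentsProg ;; sortProg ;; insertionProg ;; widthProg ;; buildProg ;; pathProg ;;
  decodeProg ;; deletionProg ;; backProg

section

variable {n B : ℕ} {H : SimpleGraph (Fin n)}

theorem backProg_spec {s : RamState} (hr : s.reg 4 ≤ B)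
    (hv : ∀ i < s.reg 4, s.arr 27 (s.arr 16 i - 1) ≤ B) :
    Tri B backProg s (30 * s.reg 4 + 20) (fun s' => s'.reg 0 = s.reg 4 ∧
      ∀ i < s.reg 4, s'.arr 0 i = s.arr 27 (s.arr 16 i - 1)) := by
  have hcost : (RamTest.lt (R 5) (R 4)).cost = 3 := rfl
  refine Tri.assign (T := 30 * s.reg 4 + 15) (by simp) (Tri.seq (T₁ := 30 * s.reg 4 + 10)
    ((Tri.while_frame (fun s' => s'.reg 5 ≤ s.reg 4 ∧
      ∀ i < s'.reg 5, s'.arr 0 i = s.arr 27 (s.arr 16 i - 1))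
    (fun s' => 30 * (s.reg 4 - s'.reg 5) + 10)
    (Q := fun s' => s'.reg 4 = s.reg 4 ∧ ∀ i < s.reg 4, s'.arr 0 i = s.arr 27 (s.arr 16 i - 1))
    (fun s' hf hI hb => ?_) (fun s' hf hI hb => ?_) ?_).mono ?_ fun _ h => h) ?_ (by omega))
    (show 2 + (30 * s.reg 4 + 15) ≤ _ by omega)
  · obtain ⟨g1, g2⟩ := hI
    have e4 : s'.reg 4 = s.reg 4 := (hf.reg 4).trans (by simp)
    have e16 : s'.arr 16 = s.arr 16 := hf.arr 16
    have e27 : s'.arr 27 = s.arr 27 := hf.arr 27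
    simp only [holds_lt, eval_reg, e4] at hb
    have h1 := hv _ hb
    refine ⟨15, Tri.wp ?_ (by decide)⟩
    simp only [RamProg.wp, eval_reg, eval_add, eval_sub, eval_load, eval_ofNat, setReg_reg,
      setReg_arr, setArr_reg, if_true, setArr_arr, e16, e27, true_and]
    refine ⟨⟨by omega, by omega⟩, by omega, ⟨by omega, fun i hi => ?_⟩, by omega⟩
    split_ifs with h2
    · rw [h2]
    · exact g2 i (by omega)
  · obtain ⟨g1, g2⟩ := hI
    have e4 : s'.reg 4 = s.reg 4 := (hf.reg 4).trans (by simp)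
    simp only [holds_lt, eval_reg, e4] at hb
    exact ⟨by omega, e4, fun i hi => g2 i (by omega)⟩
  · simp
  · simp
  · rintro s₁ ⟨g1, g2⟩
    refine Tri.wp ⟨by simp [g1, hr], by simp [g1], g2⟩ ?_
    show 2 ≤ _
    omega

theorem HoldsAdjacencyLists.adjacency {σ : RamState} (h : HoldsAdjacencyLists σ H) :
    Adjacency (H.map Fin.val) n (σ.arr 0) (σ.arr 1) where
  lt hxy := by
    obtain ⟨a, b, -, rfl, rfl⟩ := map_val_adj.1 hxy
    exact a.2
  le x hx := h.start_le ⟨x, hx⟩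
  list x hx := by
    have : (H.map Fin.val).neighborSet x = {k | ∃ y : Fin n, H.Adj ⟨x, hx⟩ y ∧ k = (y : ℕ)} := by
      ext k
      rw [SimpleGraph.mem_neighborSet, map_val_adj]
      constructor
      · rintro ⟨a, b, hab, rfl, rfl⟩
        exact ⟨b, hab, rfl⟩
      · rintro ⟨y, hy, rfl⟩
        exact ⟨⟨x, hx⟩, y, hy, rfl, rfl⟩
    rw [this]
    exact h.list ⟨x, hx⟩

theorem HoldsAdjacencyLists.arr_last {σ : RamState} (h : HoldsAdjacencyLists σ H) :
    σ.arr 0 n = 2 * H.edgeSet.ncard := by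
  rw [← h.adjacency.sum_add, h.start_zero, ← sum_ncard_neighborSet, Nat.add_zero,
    ← Fin.sum_univ_eq_sum_range fun x => σ.arr 0 (x + 1) - σ.arr 0 x]
  refine Finset.sum_congr rfl fun x _ => ?_
  have h1 := (h.list x).ncard_eq
  rw [← Finset.coe_Ico, Set.ncard_coe_finset, Nat.card_Ico] at h1
  rw [h1, ← Set.ncard_image_of_injective (H.neighborSet x) Fin.val_injective]
  congr 1
  ext k
  simp [eq_comm]

/-- A numbering in which adjacency is described by a map, as a straight order. -/
theorem exists_isStraightOrder {g σ : ℕ → ℕ} (hσ : Set.BijOn σ (Set.Iio n) (Set.Iio n))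
    (hg : ∀ i < n, i < g (σ i) ∧ g (σ i) ≤ n) (hmono : ∀ i j, i ≤ j → j < n → g (σ i) ≤ g (σ j))
    (hadj : ∀ i j, i < j → j < n → ((H.map Fin.val).Adj (σ i) (σ j) ↔ j < g (σ i))) :
    ∃ (G : Digraph (Fin n)) (v : Fin n ≃ Fin n) (f : Fin n → Fin n),
      G.toSimpleGraphInclusive = H ∧ IsStraightOrder G v f ∧ (∀ i, (v i : ℕ) = σ i) ∧
        ∀ i, 1 ≤ i → i ≤ n → frHat f i = g (σ (i - 1)) := by
  let v : Fin n ≃ Fin n := Equiv.ofBijective (fun i => ⟨σ i, hσ.mapsTo i.2⟩)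
    (Finite.injective_iff_bijective.1 fun i j hij =>
      Fin.ext (hσ.injOn i.2 j.2 (congrArg Fin.val hij)))
  have hv : ∀ i, (v i : ℕ) = σ i := fun i => rfl
  have hH : ∀ i j : Fin n, i < j → (H.Adj (v i) (v j) ↔ (j : ℕ) < g (σ i)) := by
    intro i j hij
    rw [← hadj i j hij j.2, map_val_adj]
    constructor
    · exact fun h => ⟨v i, v j, h, rfl, rfl⟩
    · rintro ⟨a, b, hab, h1, h2⟩
      rw [← hv] at h1 h2
      rwa [← Fin.ext h1, ← Fin.ext h2]
  refine ⟨⟨fun x y => v.symm x < v.symm y ∧ H.Adj x y⟩, v,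
    fun i => ⟨g (σ i) - 1, by have := hg i i.2; omega⟩, ?_, ⟨fun i => ?_, fun i j hij => ?_,
      fun i j => ?_⟩, hv, fun i h1 h2 => ?_⟩
  · ext x y
    rw [Digraph.toSimpleGraphInclusive, SimpleGraph.fromRel_adj]
    constructor
    · rintro ⟨-, h | h⟩
      · exact h.2
      · exact h.2.symm
    · intro h
      refine ⟨h.ne, ?_⟩
      rcases lt_or_gt_of_ne (v.symm.injective.ne h.ne) with h1 | h1
      · exact .inl ⟨h1, h⟩
      · exact .inr ⟨h1, h.symm⟩
  · have := hg i i.2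
    rw [Fin.le_def]
    simp only
    omega
  · have := hmono i j hij j.2
    rw [Fin.le_def]
    simp only
    omega
  · simp only [Equiv.symm_apply_apply]
    refine and_congr_right fun hij => ?_
    have := hg i i.2
    rw [hH i j hij, Fin.le_def]
    simp only
    omega
  · have := hg (i - 1) (by omega)
    rw [frHat, dif_pos ⟨h1, h2⟩]
    simp only
    omega

theorem Sorted.degree_le {K : SimpleGraph ℕ} {g : ℕ → ℕ} (h : Sorted K n (Finset.range n) g)
    {x : ℕ} (hx : x < n) : (K.neighborSet x).ncard ≤ g x ∧ g x ≤ n := by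
  classical
  obtain ⟨ρ, h, -, hg⟩ := h
  rw [hg x (Finset.mem_range.2 hx), upTo, ← Set.ncard_coe_finset]
  refine ⟨Set.ncard_le_ncard (fun y hy => ?_) (Finset.finite_toSet _), ?_⟩
  · exact Finset.mem_coe.2
      (Finset.mem_filter.2 ⟨Finset.mem_range.2 (h.lt (SimpleGraph.Adj.symm hy)), .inr hy⟩)
  · rw [Set.ncard_coe_finset]
    exact (Finset.card_filter_le _ _).trans (Finset.card_range n).le

/-- The vertices are ordered by their keys, the algorithm for straight graphs is run on the graph that
is renumbered in this way, and the resulting positions are translated back to vertices. -/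
theorem intervalProg_spec (hH : IsProperInterval H) (hdeg : ∀ x, 2 ≤ (H.neighborSet x).encard)
    {σ : RamState} (hσ : HoldsAdjacencyLists σ H) (hB : 100 * (n + H.edgeSet.ncard + 1) ≤ B) :
    ∃ (σ' : RamState) (t : ℕ) (W : Set (Fin n)), Exec B intervalProg σ t σ' ∧
      t ≤ 100000 * (n + H.edgeSet.ncard + 1) ∧
      HoldsSet σ' 0 0 {k | ∃ x : Fin n, x ∈ W ∧ k = (x : ℕ)} ∧ IsMinTotalDominating 2 H W := by
  have hA := hσ.adjacency
  have hlast := hσ.arr_last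
  obtain ⟨t₁, s₁, x₁, b₁, q₁⟩ := componentsProg_spec (B := B) hA hH.umbrella (by omega)
    hσ.reg_zero rfl rfl (fun x => hσ.arr_ge 21 x (by omega)) fun x => hσ.arr_ge 23 x (by omega)
  have d₁ := fun x (hx : x < n) => q₁.degree_le hx
  have e₁ : s₁.arr 0 = σ.arr 0 := x₁.arr_eq rfl
  let key : ℕ → ℕ := fun x => s₁.arr 24 x + s₁.arr 24 x - (s₁.arr 0 (x + 1) - s₁.arr 0 x)
  have hkey : ∀ x < n, key x + ((H.map Fin.val).neighborSet x).ncard = 2 * s₁.arr 24 x := by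
    intro x hx
    have := d₁ x hx
    have h1 := hA.ncard_neighborSet hx
    simp only [key, e₁]
    omega
  obtain ⟨t₂, s₂, x₂, b₂, q₂, q₂', q₂''⟩ := sortProg_spec (B := B) (n := n) (key := key) (by omega)
    ((x₁.reg_eq rfl).trans hσ.reg_zero) (fun x _ => rfl) (fun x hx => (d₁ x hx).2)
    (fun k => by rw [x₁.arr_eq rfl]; exact hσ.arr_ge 25 k (by omega))
  obtain ⟨o₁, o₂, o₃⟩ := q₁.straight hkey q₂ q₂'
  obtain ⟨G, v, f, rfl, hv, hvs, hf⟩ := exists_isStraightOrder q₂ o₁ o₂ o₃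
  have hm := hv.ncard_edgeSet
  obtain ⟨σ₁, σ₂, σ₃, σ₄, σ₅, σ₆, t₃, t₄, t₅, t₆, t₇, t₈, P, W', W, ⟨y₁, c₁, -⟩, ⟨y₂, c₂, -⟩,
    ⟨y₃, c₃, -⟩, ⟨y₄, c₄, -⟩, ⟨y₅, c₅, -⟩, ⟨y₆, c₆, -, hset⟩, hW⟩ := hv.run hdeg (B := B)
      (by omega) (s := s₂) ((x₂.reg_eq rfl).trans ((x₁.reg_eq rfl).trans hσ.reg_zero))
      (fun i h1 h2 => by
        rw [hf i h1 h2, ← q₂'' (i - 1) (by omega), Nat.sub_add_cancel h1])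
  have e27 : σ₆.arr 27 = s₂.arr 27 := by
    rw [y₆.arr_eq rfl, y₅.arr_eq rfl, y₄.arr_eq rfl, y₃.arr_eq rfl, y₂.arr_eq rfl, y₁.arr_eq rfl]
  -- the vertex at the position in cell `i` of array `16`
  have hcell : ∀ i < σ₆.reg 4, ∃ j : Fin n, v j ∈ W ∧ σ₆.arr 16 i = j + 1 ∧
      σ₆.arr 27 (σ₆.arr 16 i - 1) = v j := by
    intro i hi
    obtain ⟨j, h1, h2⟩ := hset.mapsTo hi
    exact ⟨j, h1, h2, by rw [h2, e27, Nat.add_sub_cancel, hvs]⟩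
  have hr : σ₆.reg 4 ≤ n := by
    have h1 := hset.ncard_eq
    have h2 : {k | ∃ i : Fin n, v i ∈ W ∧ k = (i : ℕ) + 1} ⊆ Set.Icc 1 n := by
      rintro _ ⟨i, -, rfl⟩
      exact ⟨by omega, i.2⟩
    have h3 := Set.ncard_le_ncard h2 (Set.finite_Icc 1 n)
    rw [← h1, ← Finset.coe_Icc, Set.ncard_coe_finset, ← Finset.coe_Iio, Set.ncard_coe_finset,
      Nat.card_Iio, Nat.card_Icc] at h3
    omega
  obtain ⟨t₉, s₉, x₉, b₉, q₉, q₉'⟩ := backProg_spec (B := B) (s := σ₆) (by omega) fun i hi => by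
    obtain ⟨j, -, -, h⟩ := hcell i hi
    have := (v j).2
    omega
  refine ⟨s₉, _, W, .seq x₁ (.seq x₂ (.seq y₁ (.seq y₂ (.seq y₃ (.seq y₄ (.seq y₅ (.seq y₆
    x₉))))))), by omega, ?_, hW⟩
  refine ⟨fun i hi => ?_, fun i hi j hj hij => ?_, ?_⟩
  · rw [Set.mem_Iio, q₉] at hi
    obtain ⟨j, h1, -, h2⟩ := hcell i hi
    exact ⟨v j, h1, by rw [q₉' i hi, h2]⟩
  · rw [Set.mem_Iio, q₉] at hi hj
    rw [q₉' i hi, q₉' j hj] at hij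
    obtain ⟨a, -, h1, h2⟩ := hcell i hi
    obtain ⟨b, -, h3, h4⟩ := hcell j hj
    rw [h2, h4] at hij
    have := v.injective (Fin.ext hij)
    exact hset.injOn hi hj (by rw [h1, h3, this])
  · rintro _ ⟨x, hx, rfl⟩
    obtain ⟨i, hi, h1⟩ := hset.surjOn ⟨v.symm x, by simpa using hx, rfl⟩
    obtain ⟨j, -, h2, h3⟩ := hcell i hi
    refine ⟨i, by rw [Set.mem_Iio, q₉]; exact hi, ?_⟩
    have : j = v.symm x := Fin.ext (by omega)
    rw [q₉' i hi, h3, this, v.apply_symm_apply]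

end

end StraightDom

theorem mainTheorem6 :
    -- the algorithm on a straight orientation, step by step
    (∃ (insertion step0 step1 step2 step3 deletion : StraightDom.RamProg) (c : ℕ),
      ∀ (V : Type*) (G : Digraph V) (n : ℕ) (v : Fin n ≃ V) (f : Fin n → Fin n),
        StraightDom.IsStraightOrder G v f →
        (∀ x, 2 ≤ (G.toSimpleGraphInclusive.neighborSet x).encard) →
        ∀ (m N B : ℕ) (F : ℕ → ℕ), m = StraightDom.numArcs G → N = n + 6 →
          F = StraightDom.padFr n (StraightDom.frHat f) → B = c * (n + m + 1) ^ 2 →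
        StraightDom.RAcyclic N F ∧
        ∃ (σ₁ σ₂ σ₃ σ₄ σ₅ σ₆ : StraightDom.RamState) (t₁ t₂ t₃ t₄ t₅ t₆ : ℕ)
          (P : List StraightDom.REdge) (W' : Set ℕ) (W : Set V),
          (StraightDom.Exec B insertion
              (StraightDom.inputState n (StraightDom.frHat f)) t₁ σ₁ ∧
            t₁ ≤ c * (n + 1) ∧ StraightDom.HoldsGraph σ₁ N F) ∧
          (StraightDom.Exec B step0 σ₁ t₂ σ₂ ∧
            t₂ ≤ c * (n + 1) ∧ StraightDom.HoldsWidth σ₂ N F) ∧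
          (StraightDom.Exec B step1 σ₂ t₃ σ₃ ∧
            t₃ ≤ c * (m + 1) ∧ StraightDom.HoldsR σ₃ N F) ∧
          (StraightDom.Exec B step2 σ₃ t₄ σ₄ ∧
            t₄ ≤ c * (m + 1) ∧ StraightDom.IsShortestRPath N F P ∧
            StraightDom.HoldsPath σ₄ P) ∧
          (StraightDom.Exec B step3 σ₄ t₅ σ₅ ∧
            t₅ ≤ c * (n + 1) ∧ StraightDom.Encodes N F P W' ∧
            StraightDom.HoldsSet σ₅ 3 15 W') ∧
          (StraightDom.Exec B deletion σ₅ t₆ σ₆ ∧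
            t₆ ≤ c * (n + 1) ∧
            W' = {1, 2, 3} ∪ {k | ∃ i : Fin n, v i ∈ W ∧ k = (i : ℕ) + 4} ∪ {n + 4, n + 5, n + 6} ∧
            StraightDom.HoldsSet σ₆ 4 16 {k | ∃ i : Fin n, v i ∈ W ∧ k = (i : ℕ) + 1}) ∧
          StraightDom.IsMinTotalDominating 2 G.toSimpleGraphInclusive W ∧
          t₁ + t₂ + t₃ + t₄ + t₅ + t₆ ≤ c * (m + 1)) ∧
    -- linear time on proper interval graphs given by adjacency lists
    (∃ (p : StraightDom.RamProg) (c : ℕ),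
      ∀ (n : ℕ) (H : SimpleGraph (Fin n)) (σ : StraightDom.RamState),
        StraightDom.IsProperInterval H →
        (∀ x, 2 ≤ (H.neighborSet x).encard) →
        StraightDom.HoldsAdjacencyLists σ H →
        ∃ (σ' : StraightDom.RamState) (t : ℕ) (W : Set (Fin n)),
          StraightDom.Exec (c * (n + H.edgeSet.ncard + 1) ^ 2) p σ t σ' ∧
          t ≤ c * (n + H.edgeSet.ncard + 1) ∧
          StraightDom.HoldsSet σ' 0 0 {k | ∃ x : Fin n, x ∈ W ∧ k = (x : ℕ)} ∧
          StraightDom.IsMinTotalDominating 2 H W) := by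
  refine ⟨⟨StraightDom.insertionProg, StraightDom.widthProg, StraightDom.buildProg,
    StraightDom.pathProg, StraightDom.decodeProg, StraightDom.deletionProg, 100000, ?_⟩, ?_⟩
  · intro V G n v f h hdeg m N B F hm hN hF hB
    subst hm hN hF
    have hnm := h.le_numArcs hdeg
    have hB' : 100 * (n + StraightDom.numArcs G + 1) ≤ B := by
      rw [hB, pow_two, ← mul_assoc]
      exact (Nat.mul_le_mul_right _ (by norm_num)).trans (Nat.le_mul_of_pos_right _ (by omega))
    refine ⟨h.padGraph.rAcyclic, ?_⟩
    obtain ⟨σ₁, σ₂, σ₃, σ₄, σ₅, σ₆, t₁, t₂, t₃, t₄, t₅, t₆, P, W', W, ⟨x₁, b₁, q₁⟩, ⟨x₂, b₂, q₂⟩,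
      ⟨x₃, b₃, q₃⟩, ⟨x₄, b₄, q₄⟩, ⟨x₅, b₅, q₅⟩, ⟨x₆, b₆, q₆⟩, hW⟩ :=
      h.run hdeg hB' (s := StraightDom.inputState n (StraightDom.frHat f)) rfl
        (fun i h1 h2 => if_pos ⟨rfl, h1, h2⟩)
    exact ⟨σ₁, σ₂, σ₃, σ₄, σ₅, σ₆, t₁, t₂, t₃, t₄, t₅, t₆, P, W', W, ⟨x₁, by omega, q₁⟩,
      ⟨x₂, by omega, q₂⟩, ⟨x₃, by omega, q₃⟩, ⟨x₄, by omega, q₄⟩, ⟨x₅, by omega, q₅⟩,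
      ⟨x₆, by omega, q₆⟩, hW, by omega⟩
  · refine ⟨StraightDom.intervalProg, 100000, fun n H σ hH hdeg hσ => ?_⟩
    obtain ⟨σ', t, W, h⟩ := StraightDom.intervalProg_spec hH hdeg hσ
      (B := 100000 * (n + H.edgeSet.ncard + 1) ^ 2) (by
        rw [pow_two, ← mul_assoc]
        exact (Nat.mul_le_mul_right _ (by norm_num)).trans (Nat.le_mul_of_pos_right _ (by omega)))
    exact ⟨σ', t, W, h⟩
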